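/- **Setting.** A generic subject has covariate processes $X(s)\in\mathbb R^p$, $Z(s)\in\mathbb R^q$, a response process $Y(s)\in\mathbb R$, and finitely many random observation times $T_1,\dots,T_L$ of $(X,Y)$, with counting process $N(s)=\sum_{j\le L}I(T_j\le s)$; thus $\int f\,dN=\sum_{j\le L}f(T_j)$. The processes $X,Y$ are jointly measurable in time and sample point, $X(s),Y(s)$ are square integrable and $Z(s)$ is integrable for $s\in[0,1]$. The subjects $i=1,2,\dots$ are i.i.d. copies $(X_i,Z_i,Y_i,N_i)$. For all $s\in[0,1]$, $$E\{Y(s)\mid X(s),Z(s)\}=X(s)^T\beta_0(s)+Z(s)^T\gamma_0(s),\qquad E\{Z(s)\mid X(s)\}=E\{Z(s)\}.$$ Write $m_X(s)=E X(s)$, $m_Y(s)=E Y(s)$, $\tilde X=X-m_X$, $\tilde Y=Y-m_Y$, $\sigma\{s,\tilde X(s)\}^2=\mathrm{var}\{\tilde Y(s)\mid\tilde X(s)\}$. **Assumptions.** (A5) $N$ is independent of the processes $(X,Y)$ (of a $\sigma$-algebra with respect to which they are jointly measurable in time and sample point); all observation times lie in $[0,1]$ and $E\{dN(s)\}=\lambda(s)\,ds$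 with $\lambda$ twice continuously differentiable on $[0,1]$; and the intensity of ordered pairs of distinct observations is bounded: there is $c<\infty$ with $E\,\#\{(j,k):j\ne k,\ (T_j,T_k)\in B\}\le c\,|B|$ for all Borel $B\subseteq\mathbb R^2$. (A6) On $[0,1]$ the functions $\beta_0$, $m_X$, $m_Y$ are twice continuously differentiable, and $(s,u)\mapsto E\{\tilde X(s)\tilde X(u)^T\}$ is twice continuously differentiable on $[0,1]^2$; $E\{\tilde X(s)\tilde X(s)^T\}\lambda(s)$ is positive definite for every $s\in[0,1]$; $E[\tilde X(s)\tilde X(s)^T\sigma\{s,\tilde X(s)\}^2]$ is finite and continuous in $s\in[0,1]$; $E\{Y(s)^2\}$ is bounded on $[0,1]$; and for some $\delta>0$, $\sup_{s\in[0,1]}E\|\tilde X(s)\{\tilde Y(s)-\tilde X(s)^T\beta_0(s)\}\|^{2+\delta}<\infty$. (A7) $K\ge 0$ is a symmetric probability density with bounded support, $\int zK(z)\,dz=0$, $\int z^2K(z)\,dz<\infty$ and $\int K(z)^2dz<\infty$. (A8) $h=h_n>0$, $nh\to\infty$ and $nh^5\to0$. **Estimator.** With $K_h(u)=h^{-1}K(u/h)$,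 let $$\hat m_Y(t_0)=\frac{\sum_{i\le n}\int K_h(s-t_0)Y_i(s)\,dN_i(s)}{\sum_{i\le n}\int K_h(s-t_0)\,dN_i(s)},\qquad \hat m_X(t_0)=\frac{\sum_{i\le n}\int K_h(s-t_0)X_i(s)\,dN_i(s)}{\sum_{i\le n}\int K_h(s-t_0)\,dN_i(s)},$$ $\hat Y_i=Y_i-\hat m_Y$, $\hat X_i=X_i-\hat m_X$. The centering estimator $\hat\beta_c(t)$ is the $b_0$-component of the minimizer over $b_0,b_1\in\mathbb R^p$ of $$\frac1n\sum_{i=1}^n\int K_h(s-t)\{\hat Y_i(s)-\hat X_i(s)^Tb_0-\hat X_i(s)^Tb_1(s-t)\}^2dN_i(s)$$ whenever this minimizer is unique, and it is defined in an arbitrary measurable way otherwise. **Theorem.** Under (A5)–(A8), for every fixed $t\in(0,1)$, as $n\to\infty$, $$\sqrt{nh}\,\{\hat\beta_c(t)-\beta_0(t)\}\xrightarrow{d}N\{0,A(t)^{-1}\Sigma(t)A(t)^{-1}\},$$ where $A(t)=E\{\tilde X(t)\tilde X(t)^T\}\lambda(t)$ and $\Sigma(t)=\{\int K(z)^2dz\}\,E[\tilde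 X(t)\tilde X(t)^T\sigma\{t,\tilde X(t)\}^2]\,\lambda(t)$. Moreover, under (A5)–(A7), if $h=cn^{-1/5}$ for a constant $c>0$, then $\hat\beta_c(t)-\beta_0(t)=O_p(n^{-2/5})$. -/

import Mathlib

open MeasureTheory ProbabilityTheory Filter Topology Set

/-- The random quantities attached to one generic subject, as functions on a sample space `S`:
the synchronous covariate process `X`, the asynchronous covariate process `Z`, the response
process `Y`, the number `L` of observation times of `(X, Y)`, and these times `T 0, …, T (L - 1)`.
No property is built in. -/
structure Subject (S : Type*) (p q : ℕ) where
  X : ℝ → S → EuclideanSpace ℝ (Fin p)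
  Z : ℝ → S → EuclideanSpace ℝ (Fin q)
  Y : ℝ → S → ℝ
  L : S → ℕ
  T : ℕ → S → ℝ

namespace Subject

noncomputable section

variable {S : Type*} {p q : ℕ}

/-- The observation process as a random counting measure: `N ω B = #{j < L ω : T j ω ∈ B}`. -/
def N (D : Subject S p q) (ω : S) : Measure ℝ :=
  ∑ j ∈ Finset.range (D.L ω), Measure.dirac (D.T j ω)

/-- The integral `∫ f(s) dN(s)`, a finite sum over the observation times. -/
def intN {E : Type*} [AddCommMonoid E] (D : Subject S p q) (ω : S) (f : ℝ → E) : E :=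
  ∑ j ∈ Finset.range (D.L ω), f (D.T j ω)

/-- The number of ordered pairs `(T j, T k)`, `j ≠ k`, of observation times that lie in `B`. -/
def pairCount (D : Subject S p q) (ω : S) (B : Set (ℝ × ℝ)) : ENNReal :=
  ∑ j ∈ Finset.range (D.L ω), ∑ k ∈ (Finset.range (D.L ω)).erase j,
    B.indicator 1 (D.T j ω, D.T k ω)

variable [mS : MeasurableSpace S]

/-- `m_X(s) = E X(s)`. -/
def meanX (D : Subject S p q) (P : Measure S) (s : ℝ) : EuclideanSpace ℝ (Fin p) :=
  ∫ ω, D.X s ω ∂P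

/-- `m_Y(s) = E Y(s)`. -/
def meanY (D : Subject S p q) (P : Measure S) (s : ℝ) : ℝ := ∫ ω, D.Y s ω ∂P

/-- `X̃(s) = X(s) - E X(s)`. -/
def Xc (D : Subject S p q) (P : Measure S) (s : ℝ) (ω : S) : EuclideanSpace ℝ (Fin p) :=
  D.X s ω - D.meanX P s

/-- `Ỹ(s) = Y(s) - E Y(s)`. -/
def Yc (D : Subject S p q) (P : Measure S) (s : ℝ) (ω : S) : ℝ := D.Y s ω - D.meanY P s

/-- `E{X̃(s) X̃(u)ᵀ}`. -/
def covX (D : Subject S p q) (P : Measure S) (s u : ℝ) : Matrix (Fin p) (Fin p) ℝ :=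
  Matrix.of fun a b => ∫ ω, D.Xc P s ω a * D.Xc P u ω b ∂P

/-- The conditional variance `σ{s, X̃(s)}² = var{Ỹ(s) | X̃(s)}`. -/
def sigmaSq (D : Subject S p q) (P : Measure S) (s : ℝ) : S → ℝ :=
  condVar (MeasurableSpace.comap (D.Xc P s) inferInstance) (D.Yc P s) P

/-- `E[X̃(s) X̃(s)ᵀ σ{s, X̃(s)}²]`. -/
def covXSigma (D : Subject S p q) (P : Measure S) (s : ℝ) : Matrix (Fin p) (Fin p) ℝ :=
  Matrix.of fun a b => ∫ ω, D.Xc P s ω a * D.Xc P s ω b * D.sigmaSq P s ω ∂P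

/-- Standing measurability and second-moment conditions on `(X, Y, Z, L, T)`. -/
structure Regular (D : Subject S p q) (P : Measure S) : Prop where
  measurable_X : Measurable fun x : ℝ × S => D.X x.1 x.2
  measurable_Y : Measurable fun x : ℝ × S => D.Y x.1 x.2
  measurable_Z : ∀ s, Measurable (D.Z s)
  measurable_L : Measurable D.L
  measurable_T : ∀ j, Measurable (D.T j)
  memLp_X : ∀ s ∈ Icc (0 : ℝ) 1, MemLp (D.X s) 2 P
  memLp_Y : ∀ s ∈ Icc (0 : ℝ) 1, MemLp (D.Y s) 2 P
  integrable_Z : ∀ s ∈ Icc (0 : ℝ) 1, Integrable (D.Z s) P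

/-- The varying-coefficient model `E{Y(s) | X(s), Z(s)} = X(s)ᵀ β(s) + Z(s)ᵀ γ(s)`. -/
def VaryingCoefficient (D : Subject S p q) (P : Measure S)
    (β : ℝ → EuclideanSpace ℝ (Fin p)) (γ : ℝ → EuclideanSpace ℝ (Fin q)) : Prop :=
  ∀ s ∈ Icc (0 : ℝ) 1,
    P[D.Y s | MeasurableSpace.comap (fun ω => (D.X s ω, D.Z s ω)) inferInstance]
      =ᵐ[P] fun ω => inner ℝ (D.X s ω) (β s) + inner ℝ (D.Z s ω) (γ s)

/-- `E{Z(s) | X(s)} = E{Z(s)}`. -/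
def Orthogonal (D : Subject S p q) (P : Measure S) : Prop :=
  ∀ s ∈ Icc (0 : ℝ) 1,
    P[D.Z s | MeasurableSpace.comap (D.X s) inferInstance] =ᵐ[P] fun _ => ∫ ω, D.Z s ω ∂P

/-- The observation process `N` is independent of the processes `X` and `Y`. Independence refers
to a σ-algebra `𝒢` that carries the paths of `(X, Y)`, i.e. for which both processes are jointly
measurable in time and sample point, so that evaluating them at the observation times makes
sense; the pointwise generated σ-algebra may be too small for this. -/
def IndepPaths (D : Subject S p q) (P : Measure S) : Prop :=
  ∃ 𝒢 : MeasurableSpace S,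
    @Measurable (ℝ × S) _ (@Prod.instMeasurableSpace ℝ S _ 𝒢) _ (fun x => D.X x.1 x.2) ∧
    @Measurable (ℝ × S) _ (@Prod.instMeasurableSpace ℝ S _ 𝒢) _ (fun x => D.Y x.1 x.2) ∧
    𝒢 ≤ mS ∧
    Indep 𝒢 (MeasurableSpace.comap D.N inferInstance) P

/-- Conditions on the observation process: it is independent of the processes `X` and `Y`, it has
a `C²` intensity `lam` on `[0, 1]` (and no points elsewhere), and the intensity of ordered pairs
of distinct observations is bounded, i.e. the second factorial moment measure has a bounded
density. -/
structure ObservationCond (D : Subject S p q) (P : Measure S) (lam : ℝ → ℝ) : Prop where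
  indep : D.IndepPaths P
  intensity : ∀ B : Set ℝ, MeasurableSet B →
    ∫⁻ ω, D.N ω B ∂P = ∫⁻ s in B ∩ Icc 0 1, ENNReal.ofReal (lam s)
  contDiff_lam : ContDiffOn ℝ 2 lam (Icc 0 1)
  pair_intensity : ∃ c : NNReal, ∀ B : Set (ℝ × ℝ), MeasurableSet B →
    ∫⁻ ω, D.pairCount ω B ∂P ≤ c * volume B

/-- Smoothness, identifiability and moment conditions on the processes and on `β`. -/
structure SmoothnessCond (D : Subject S p q) (P : Measure S)
    (β : ℝ → EuclideanSpace ℝ (Fin p)) (lam : ℝ → ℝ) : Prop where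
  contDiff_β : ContDiffOn ℝ 2 β (Icc 0 1)
  contDiff_meanX : ContDiffOn ℝ 2 (D.meanX P) (Icc 0 1)
  contDiff_meanY : ContDiffOn ℝ 2 (D.meanY P) (Icc 0 1)
  contDiff_covX : ∀ a b, ContDiffOn ℝ 2 (fun x : ℝ × ℝ => D.covX P x.1 x.2 a b)
    (Icc 0 1 ×ˢ Icc 0 1)
  posDef : ∀ s ∈ Icc (0 : ℝ) 1, (lam s • D.covX P s s).PosDef
  integrable_sigma : ∀ s ∈ Icc (0 : ℝ) 1, ∀ a b,
    Integrable (fun ω => D.Xc P s ω a * D.Xc P s ω b * D.sigmaSq P s ω) P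
  continuous_sigma : ∀ a b, ContinuousOn (fun s => D.covXSigma P s a b) (Icc 0 1)
  second_moment_Y : ∃ C : ℝ, ∀ s ∈ Icc (0 : ℝ) 1, ∫ ω, D.Y s ω ^ 2 ∂P ≤ C
  /-- Lyapunov-type moment bound, of some order larger than two, for the regression scores
  `X̃(s) {Ỹ(s) - X̃(s)ᵀ β(s)}`. -/
  lyapunov : ∃ δ : ℝ, 0 < δ ∧ ∃ C : NNReal, ∀ s ∈ Icc (0 : ℝ) 1,
    ∫⁻ ω, ‖(D.Yc P s ω - inner ℝ (D.Xc P s ω) (β s)) • D.Xc P s ω‖ₑ ^ (2 + δ) ∂P ≤ C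

end

end Subject

/-- A symmetric, square-integrable probability density with bounded support. -/
structure IsKernel (K : ℝ → ℝ) : Prop where
  measurable : Measurable K
  nonneg : ∀ z, 0 ≤ K z
  integral_eq_one : ∫ z, K z = 1
  symm : ∀ z, K (-z) = K z
  bounded_support : ∃ R : ℝ, ∀ z, R < |z| → K z = 0
  integral_mul : ∫ z, z * K z = 0
  integrable_sq_mul : Integrable (fun z => z ^ 2 * K z)
  integrable_sq : Integrable (fun z => K z ^ 2)

noncomputable section

/-- `K_h(u) = h⁻¹ K(u / h)`. -/
def scaledKernel (K : ℝ → ℝ) (h u : ℝ) : ℝ := h⁻¹ * K (u / h)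

section Estimator

variable {S : Type*} {p q : ℕ}

/-- Nadaraya–Watson estimate of `E Y(t₀)` from the subjects `ω 0, …, ω (n - 1)`. -/
def mhatY (D : Subject S p q) (K : ℝ → ℝ) (h : ℝ) (n : ℕ) (ω : ℕ → S) (t₀ : ℝ) : ℝ :=
  (∑ i ∈ Finset.range n, D.intN (ω i) fun s => scaledKernel K h (s - t₀))⁻¹ *
    ∑ i ∈ Finset.range n, D.intN (ω i) fun s => scaledKernel K h (s - t₀) * D.Y s (ω i)

/-- Nadaraya–Watson estimate of `E X(t₀)` from the subjects `ω 0, …, ω (n - 1)`. -/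
def mhatX (D : Subject S p q) (K : ℝ → ℝ) (h : ℝ) (n : ℕ) (ω : ℕ → S) (t₀ : ℝ) :
    EuclideanSpace ℝ (Fin p) :=
  (∑ i ∈ Finset.range n, D.intN (ω i) fun s => scaledKernel K h (s - t₀))⁻¹ •
    ∑ i ∈ Finset.range n, D.intN (ω i) fun s => scaledKernel K h (s - t₀) • D.X s (ω i)

/-- The local linear least-squares criterion at `t` for the centered synchronous data
`Ŷ_i = Y_i - m̂_Y`, `X̂_i = X_i - m̂_X`, as a function of `(b₀, b₁)`. -/
def centeredCriterion (D : Subject S p q) (K : ℝ → ℝ) (h : ℝ) (n : ℕ) (ω : ℕ → S) (t : ℝ)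
    (b : EuclideanSpace ℝ (Fin p) × EuclideanSpace ℝ (Fin p)) : ℝ :=
  (n : ℝ)⁻¹ * ∑ i ∈ Finset.range n, D.intN (ω i) fun s =>
    scaledKernel K h (s - t) *
      ((D.Y s (ω i) - mhatY D K h n ω s)
        - inner ℝ (D.X s (ω i) - mhatX D K h n ω s) b.1
        - inner ℝ (D.X s (ω i) - mhatX D K h n ω s) b.2 * (s - t)) ^ 2

/-- `bhat` is a value of the centering estimator of `β(t)`: it is the first component of the
minimizer of the criterion whenever that minimizer is unique. Nothing is required of `bhat` for
samples without a unique minimizer, so that every convention for such samples is allowed. -/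
def IsCenteringEstimate (D : Subject S p q) (K : ℝ → ℝ) (h : ℝ) (n : ℕ) (ω : ℕ → S) (t : ℝ)
    (bhat : EuclideanSpace ℝ (Fin p)) : Prop :=
  ∀ b, (∀ b', b' ≠ b →
      centeredCriterion D K h n ω t b < centeredCriterion D K h n ω t b') → bhat = b.1

/-- `A(t) = E{X̃(t) X̃(t)ᵀ} λ(t)`. -/
def asympA [MeasurableSpace S] (D : Subject S p q) (P : Measure S) (lam : ℝ → ℝ) (t : ℝ) :
    Matrix (Fin p) (Fin p) ℝ :=
  lam t • D.covX P t t

/-- `Σ(t) = {∫ K(z)² dz} E[X̃(t) X̃(t)ᵀ σ{t, X̃(t)}²] λ(t)`. -/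
def asympSigma [MeasurableSpace S] (D : Subject S p q) (P : Measure S) (lam : ℝ → ℝ)
    (K : ℝ → ℝ) (t : ℝ) : Matrix (Fin p) (Fin p) ℝ :=
  ((∫ z, K z ^ 2) * lam t) • D.covXSigma P t

end Estimator

end

set_option linter.unusedSectionVars false

/-! Let `resid(s) = Ỹ(s) - X̃(s)ᵀβ₀(s)`. The model together with `E{Z|X} = E{Z}` gives `E{Ỹ|X̃} =
X̃ᵀβ₀` (`condExp_Yc`), so the score `X̃ resid` has mean zero and covariance `E[X̃X̃ᵀσ²]`
(`covXSigma_eq`). In the coordinates `d = (b₀ - β₀(t), h (b₁ - β₀'(t)))` the criterion is a weighted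
least-squares problem with normal equations `gram · d = score`. The Gram matrix tends in probability
to `A ⊗ diag(1, ∫z²K)`, which is positive definite. Hence, with probability tending to one, the
minimizer is unique, and its first block is `A⁻¹` times the leading part of the score, up to the
errors bounded in `exists_leastSquares_bound`. The leading part is a kernel average of `X̃ resid`
over all observations: an i.i.d. sum over subjects with variance of order `1/(nh)`. A central limit
theorem for it gives the claim once the rest of the score is `o_p((nh)^{-1/2})`.

The rest comes from centering by `m̂` instead of the true means. The error `m̂ - m` has order
`(nh)^{-1/2} + h`, which is not negligible by itself, but it enters only squared or multiplied by a
centered process. Its squares average to `O(1/(nh) + h²)` (`exists_lintegral_sqAvg_le`). Its product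
with a centered process `U` is, given the observation times, a quadratic form in independent paths
plus a linear one. Terms that pair two different subjects are uncorrelated except under a swap of
the subjects, and their sum has second moment `O((nh)^{-2})`. Terms within one subject have mean
size `O(1/(nh))`. The bias of `m̂` depends on the times only and multiplies a centered sum. All of
this is `O(rate n h)` with `rate n h = 1/(nh) + h²` (`exists_lintegral_crossAvg_le`), and the Taylor
remainder of `β₀` adds another `h²`. Since `√(nh) · rate = (nh)^{-1/2} + √(nh⁵)`, these errors
vanish under the bandwidth conditions of the first claim and stay bounded for `h = c n^{-1/5}`.

The weights in `m̂` have a random denominator. No uniform lower bound for it is required: at a point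
of subject `i`, the squared weights are bounded by `looBound`, a function of the other subjects that
covers both a denominator near its mean and a large deviation of it. It is independent of the points
at which it is evaluated, and its expectation is `O(1/(nh))` (`lintegral_looBound_le`).

The limit theorems use characteristic functions. For one subject, `exp(i Σ v(T_j)) - 1` equals `Σ
(exp(i v(T_j)) - 1)` up to products over distinct pairs of points (`norm_prod_sub_one_sub_sum_le`).
Campbell's formula evaluates the sum, and the bounded pair intensity makes the pairs negligible, so
dependence within a subject does not affect the limit. Then `n (φ_n - 1)` converges and `(1 +
ζ_n/n)^n → e^ζ`. The law of large numbers for the Gram matrix follows the same route with first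
moments only.

These steps are carried out for a `LocalModel` on a product of a path space and a mark space, where
conditioning on the times is Fubini's theorem. `Subject.Carrier` connects this model with the
subjects of the statement. -/

/-! ### Point measures on the line -/

/-- A finite sum of Dirac measures on the line. -/
def IsPointMeasure (ρ : Measure ℝ) : Prop :=
  ∃ (L : ℕ) (T : ℕ → ℝ), ρ = ∑ j ∈ Finset.range L, Measure.dirac (T j)

/-- Singletons are measurable, so a Dirac mass integrates every function. Hence, for a fixed sample
point, integrands along the observation times need no measurability. -/
theorem integrable_range_dirac {F : Type*} [NormedAddCommGroup F] (L : ℕ) (T : ℕ → ℝ) (f : ℝ → F) :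
    Integrable f (∑ j ∈ Finset.range L, Measure.dirac (T j)) := by
  rw [integrable_finsetSum_measure]
  intro j _
  exact integrable_dirac (by simp)

theorem integral_range_dirac {F : Type*} [NormedAddCommGroup F] [NormedSpace ℝ F] [CompleteSpace F]
    (L : ℕ) (T : ℕ → ℝ) (f : ℝ → F) :
    ∫ s, f s ∂(∑ j ∈ Finset.range L, Measure.dirac (T j)) = ∑ j ∈ Finset.range L, f (T j) := by
  rw [integral_finsetSum_measure]
  · simp
  · intro j _
    exact integrable_dirac (by simp)

namespace IsPointMeasure

variable {ρ : Measure ℝ}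

theorem isFiniteMeasure (h : IsPointMeasure ρ) : IsFiniteMeasure ρ := by
  obtain ⟨L, T, rfl⟩ := h
  infer_instance

theorem integrable {F : Type*} [NormedAddCommGroup F] (h : IsPointMeasure ρ) (f : ℝ → F) :
    Integrable f ρ := by
  obtain ⟨L, T, rfl⟩ := h
  exact integrable_range_dirac L T f

/-- Cauchy–Schwarz with the weight `|c|` divided evenly between the two factors. -/
theorem sq_integral_mul_le (h : IsPointMeasure ρ) (c f : ℝ → ℝ) :
    (∫ s, c s * f s ∂ρ) ^ 2 ≤ (∫ s, |c s| ∂ρ) * ∫ s, |c s| * f s ^ 2 ∂ρ := by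
  obtain ⟨L, T, rfl⟩ := h
  simp only [integral_range_dirac]
  refine Finset.sum_sq_le_sum_mul_sum_of_sq_le_mul _ (fun _ _ => abs_nonneg _)
    (fun _ _ => by positivity) fun j _ => ?_
  exact (by rw [mul_pow, ← mul_assoc, ← sq, sq_abs] : _ = _).le

end IsPointMeasure

/-! ### Second moments of linear functionals of centered processes -/

section PathMoments

variable {E : Type*} [MeasurableSpace E] {P : Measure E}

theorem memLp_sum_mul {ι : Type*} (s : Finset ι) (c : ι → ℝ) (f : ι → E → ℝ)
    (hf : ∀ i ∈ s, MemLp (f i) 2 P) : MemLp (fun x => ∑ i ∈ s, c i * f i x) 2 P :=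
  memLp_finsetSum s fun i hi => (hf i hi).const_mul (c i)

/-- The second moment of a linear combination of variables with second moment at most `C`. -/
theorem integral_sq_sum_mul_le {ι : Type*} (s : Finset ι) (c : ι → ℝ) (f : ι → E → ℝ) {C : ℝ}
    (hf : ∀ i ∈ s, MemLp (f i) 2 P) (hC : ∀ i ∈ s, ∫ x, f i x ^ 2 ∂P ≤ C) :
    ∫ x, (∑ i ∈ s, c i * f i x) ^ 2 ∂P ≤ C * (∑ i ∈ s, |c i|) ^ 2 := by
  have hint : ∀ i ∈ s, Integrable (fun x => |c i| * f i x ^ 2) P := fun i hi =>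
    ((hf i hi).integrable_sq).const_mul _
  calc ∫ x, (∑ i ∈ s, c i * f i x) ^ 2 ∂P
      ≤ ∫ x, (∑ i ∈ s, |c i|) * ∑ i ∈ s, |c i| * f i x ^ 2 ∂P := by
        refine integral_mono ((memLp_sum_mul s c f hf).integrable_sq)
          ((integrable_finsetSum s hint).const_mul _) fun x => ?_
        refine Finset.sum_sq_le_sum_mul_sum_of_sq_le_mul _ (fun _ _ => abs_nonneg _)
          (fun _ _ => by positivity) fun j _ => ?_
        exact (by rw [mul_pow, ← mul_assoc, ← sq, sq_abs] : _ = _).le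
    _ = (∑ i ∈ s, |c i|) * ∑ i ∈ s, |c i| * ∫ x, f i x ^ 2 ∂P := by
        rw [integral_const_mul, integral_finsetSum s hint]
        simp only [integral_const_mul]
    _ ≤ (∑ i ∈ s, |c i|) * ∑ i ∈ s, |c i| * C := by
        refine mul_le_mul_of_nonneg_left (Finset.sum_le_sum fun i hi => ?_)
          (Finset.sum_nonneg fun _ _ => abs_nonneg _)
        exact mul_le_mul_of_nonneg_left (hC i hi) (abs_nonneg _)
    _ = C * (∑ i ∈ s, |c i|) ^ 2 := by rw [← Finset.sum_mul]; ring

/-- A centered square-integrable process with second moments bounded by `C`. -/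
structure IsCentered (P : Measure E) (W : ℝ → E → ℝ) (C : ℝ) : Prop where
  measurable : Measurable fun z : ℝ × E => W z.1 z.2
  memLp : ∀ s, MemLp (W s) 2 P
  mean : ∀ s, ∫ x, W s x ∂P = 0
  sq_le : ∀ s, ∫ x, W s x ^ 2 ∂P ≤ C

variable {W U : ℝ → E → ℝ} {C C' : ℝ}

theorem IsCentered.nonneg (hW : IsCentered P W C) : 0 ≤ C :=
  (integral_nonneg fun _ => sq_nonneg _).trans (hW.sq_le 0)

theorem IsCentered.memLp_integral (hW : IsCentered P W C) {ρ : Measure ℝ} (hρ : IsPointMeasure ρ)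
    (c : ℝ → ℝ) : MemLp (fun x => ∫ s, c s * W s x ∂ρ) 2 P := by
  obtain ⟨L, T, rfl⟩ := hρ
  simp only [integral_range_dirac]
  exact memLp_sum_mul _ _ _ fun j _ => hW.memLp _

theorem IsCentered.mean_integral (hW : IsCentered P W C) [IsFiniteMeasure P] {ρ : Measure ℝ}
    (hρ : IsPointMeasure ρ) (c : ℝ → ℝ) : ∫ x, ∫ s, c s * W s x ∂ρ ∂P = 0 := by
  obtain ⟨L, T, rfl⟩ := hρ
  simp only [integral_range_dirac]
  rw [integral_finsetSum]
  · simp [integral_const_mul, hW.mean]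
  · exact fun j _ => ((hW.memLp _).integrable (by norm_num)).const_mul _

theorem IsCentered.integral_sq_integral_le (hW : IsCentered P W C) {ρ : Measure ℝ}
    (hρ : IsPointMeasure ρ) (c : ℝ → ℝ) :
    ∫ x, (∫ s, c s * W s x ∂ρ) ^ 2 ∂P ≤ C * (∫ s, |c s| ∂ρ) ^ 2 := by
  obtain ⟨L, T, rfl⟩ := hρ
  simp only [integral_range_dirac]
  exact integral_sq_sum_mul_le _ _ _ (fun j _ => hW.memLp _) fun j _ => hW.sq_le _

end PathMoments

/-! ### Integration over one coordinate of an i.i.d. vector -/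

section ProductSpace

variable {E : Type*} [MeasurableSpace E] {P : Measure E} [IsProbabilityMeasure P] {n : ℕ}

/-- Replacing one coordinate of an i.i.d. vector by an independent copy preserves its law. -/
theorem measurePreserving_update (i : Fin n) :
    MeasurePreserving (fun z : E × (Fin n → E) => Function.update z.2 i z.1)
      (P.prod (Measure.pi fun _ : Fin n => P)) (Measure.pi fun _ : Fin n => P) := by
  have hm : Measurable fun z : E × (Fin n → E) => Function.update z.2 i z.1 := by
    refine measurable_pi_lambda _ fun j => ?_
    by_cases hj : j = i
    · subst hj; simpa using measurable_fst
    · simp only [Function.update_of_ne hj]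
      exact (measurable_pi_apply j).comp measurable_snd
  refine ⟨hm, ?_⟩
  refine (Measure.pi_eq fun B hB => ?_).symm
  rw [Measure.map_apply hm (MeasurableSet.univ_pi hB)]
  have hpre : (fun z : E × (Fin n → E) => Function.update z.2 i z.1) ⁻¹' (Set.univ.pi B)
      = B i ×ˢ Set.univ.pi (Function.update B i Set.univ) := by
    ext z
    simp only [mem_preimage, Set.mem_pi, mem_univ, true_imp_iff, mem_prod]
    constructor
    · intro h
      refine ⟨by simpa using h i, fun j => ?_⟩
      by_cases hj : j = i
      · subst hj; simp
      · have := h j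
        simpa [Function.update_of_ne hj] using this
    · rintro ⟨h1, h2⟩ j
      by_cases hj : j = i
      · subst hj; simpa using h1
      · have := h2 j
        simpa [Function.update_of_ne hj] using this
  rw [hpre, Measure.prod_prod, Measure.pi_pi]
  rw [← Finset.mul_prod_erase Finset.univ (fun j => P (B j)) (Finset.mem_univ i),
    ← Finset.mul_prod_erase Finset.univ (fun j => P (Function.update B i univ j))
      (Finset.mem_univ i)]
  simp only [Function.update_self, measure_univ, one_mul]
  congr 1
  refine Finset.prod_congr rfl fun j hj => ?_
  rw [Function.update_of_ne (Finset.ne_of_mem_erase hj)]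

/-- Since resampling coordinate `i` preserves the law, Fubini allows that coordinate to be
integrated first with the others frozen. This replaces conditioning on the other coordinates. -/
theorem integral_pi_eq_zero_of_update (i : Fin n) (G : (Fin n → E) → ℝ)
    (hG : Integrable G (Measure.pi fun _ : Fin n => P))
    (h0 : ∀ x, ∫ y, G (Function.update x i y) ∂P = 0) :
    ∫ x, G x ∂(Measure.pi fun _ : Fin n => P) = 0 := by
  have hmp := measurePreserving_update (P := P) i
  rw [← hmp.map_eq, integral_map hmp.measurable.aemeasurable
    (by rw [hmp.map_eq]; exact hG.aestronglyMeasurable),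
    integral_prod_symm (fun z : E × (Fin n → E) => G (Function.update z.2 i z.1))
      (hmp.integrable_comp_of_integrable hG)]
  simp [h0]

/-- The fresh coordinate is the outer variable, so that inside the points of subject `i` are fixed
while the other subjects are averaged. -/
theorem lintegral_pi_update (i : Fin n) (G : (Fin n → E) → ENNReal) (hG : Measurable G) :
    ∫⁻ x, G x ∂(Measure.pi fun _ : Fin n => P)
      = ∫⁻ y, ∫⁻ x, G (Function.update x i y) ∂(Measure.pi fun _ : Fin n => P) ∂P := by
  have hmp := measurePreserving_update (P := P) i
  conv_lhs => rw [← hmp.map_eq]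
  rw [lintegral_map hG hmp.measurable, lintegral_prod
    (fun z : E × (Fin n → E) => G (Function.update z.2 i z.1))
    (hG.comp hmp.measurable).aemeasurable]

theorem memLp_eval {p : ENNReal} {f : E → ℝ} (hf : MemLp f p P) (i : Fin n) :
    MemLp (fun x : Fin n → E => f (x i)) p (Measure.pi fun _ : Fin n => P) :=
  hf.comp_measurePreserving (measurePreserving_eval (fun _ : Fin n => P) i)

theorem integral_eval {F : Type*} [NormedAddCommGroup F] [NormedSpace ℝ F] {f : E → F}
    (hf : AEStronglyMeasurable f P) (i : Fin n) :
    ∫ x : Fin n → E, f (x i) ∂(Measure.pi fun _ : Fin n => P) = ∫ y, f y ∂P := by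
  have h := measurePreserving_eval (fun _ : Fin n => P) i
  conv_rhs => rw [← h.map_eq]
  rw [integral_map h.measurable.aemeasurable (by rwa [h.map_eq])]

/-- The second moment of a sum of independent centered variables. -/
theorem integral_sq_sum_eval (g : Fin n → E → ℝ) (hg : ∀ j, MemLp (g j) 2 P)
    (h0 : ∀ j, ∫ x, g j x ∂P = 0) :
    ∫ x, (∑ j, g j (x j)) ^ 2 ∂(Measure.pi fun _ : Fin n => P) = ∑ j, ∫ x, g j x ^ 2 ∂P := by
  have hv := variance_sum_pi (μ := fun _ : Fin n => P) (X := g) hg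
  have hz : ∫ x, (∑ j, fun ω : Fin n → E => g j (ω j)) x ∂(Measure.pi fun _ : Fin n => P) = 0 := by
    simp only [Finset.sum_apply]
    rw [integral_finsetSum _ fun j _ =>
      (memLp_eval (hg j) j).integrable (by norm_num)]
    refine Finset.sum_eq_zero fun j _ => ?_
    rw [integral_eval (hg j).aestronglyMeasurable, h0]
  rw [variance_of_integral_eq_zero _ hz] at hv
  · simp only [Finset.sum_apply] at hv
    rw [hv]
    refine Finset.sum_congr rfl fun j _ => ?_
    rw [variance_of_integral_eq_zero (hg j).aestronglyMeasurable.aemeasurable (h0 j)]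
  · exact (memLp_finsetSum' _ fun j _ => memLp_eval (hg j) j).aestronglyMeasurable.aemeasurable

end ProductSpace

/-! ### Degenerate bilinear forms in independent paths -/

section DegenerateUStatistic

variable {E : Type*} [MeasurableSpace E] {P : Measure E} [IsProbabilityMeasure P] {n : ℕ}
  {W U : ℝ → E → ℝ} {C C' : ℝ}

/-- The squares at distinct coordinates are independent, so two second moments suffice. For `i = j`
a fourth moment would be required, which is why diagonal terms are later controlled only in mean. -/
theorem memLp_mul_eval {f g : E → ℝ} (hf : MemLp f 2 P) (hg : MemLp g 2 P) {i j : Fin n}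
    (hij : i ≠ j) :
    MemLp (fun x : Fin n → E => f (x i) * g (x j)) 2 (Measure.pi fun _ : Fin n => P) := by
  have hfi := memLp_eval (n := n) hf i
  have hgj := memLp_eval (n := n) hg j
  refine (memLp_two_iff_integrable_sq (hfi.1.mul hgj.1)).2 ?_
  have hind : IndepFun (fun x : Fin n → E => f (x i) ^ 2) (fun x => g (x j) ^ 2)
      (Measure.pi fun _ : Fin n => P) := by
    have := (iIndepFun_pi (μ := fun _ : Fin n => P) (X := fun k y => (f y ^ 2, g y ^ 2))
      fun k => (hf.1.aemeasurable.pow_const 2).prodMk (hg.1.aemeasurable.pow_const 2)).indepFun hij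
    exact this.comp measurable_fst measurable_snd
  have := hind.integrable_mul hfi.integrable_sq hgj.integrable_sq
  refine this.congr (ae_of_all _ fun x => ?_)
  simp only [Pi.mul_apply, mul_pow]

theorem integral_sq_mul_eval {f g : E → ℝ} (hf : MemLp f 2 P) (hg : MemLp g 2 P) {i j : Fin n}
    (hij : i ≠ j) :
    ∫ x : Fin n → E, (f (x i) * g (x j)) ^ 2 ∂(Measure.pi fun _ : Fin n => P)
      = (∫ y, f y ^ 2 ∂P) * ∫ y, g y ^ 2 ∂P := by
  have hfi := memLp_eval (n := n) hf i
  have hgj := memLp_eval (n := n) hg j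
  have hind : IndepFun (fun x : Fin n → E => f (x i) ^ 2) (fun x => g (x j) ^ 2)
      (Measure.pi fun _ : Fin n => P) := by
    have := (iIndepFun_pi (μ := fun _ : Fin n => P) (X := fun k y => (f y ^ 2, g y ^ 2))
      fun k => (hf.1.aemeasurable.pow_const 2).prodMk (hg.1.aemeasurable.pow_const 2)).indepFun hij
    exact this.comp measurable_fst measurable_snd
  simp only [mul_pow]
  rw [hind.integral_fun_mul_eq_mul_integral hfi.integrable_sq.1 hgj.integrable_sq.1,
    integral_eval (f := fun y => f y ^ 2) hf.integrable_sq.1,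
    integral_eval (f := fun y => g y ^ 2) hg.integrable_sq.1]

/-- If `F α` is orthogonal to every `F β` except `β = α` and `β = τ α`, the second moment of the
sum is at most twice the sum of the second moments. -/
theorem integral_sq_sum_le_two_mul {Ω ι : Type*} [MeasurableSpace Ω] {μ : Measure Ω}
    [DecidableEq ι] (A : Finset ι) (τ : ι → ι) (hτA : ∀ α ∈ A, τ α ∈ A)
    (hττ : ∀ α, τ (τ α) = α) (F : ι → Ω → ℝ)
    (hF : ∀ α ∈ A, MemLp (F α) 2 μ)
    (h0 : ∀ α ∈ A, ∀ β ∈ A, β ≠ α → β ≠ τ α → ∫ ω, F α ω * F β ω ∂μ = 0) :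
    ∫ ω, (∑ α ∈ A, F α ω) ^ 2 ∂μ ≤ 2 * ∑ α ∈ A, ∫ ω, F α ω ^ 2 ∂μ := by
  have hint : ∀ α ∈ A, ∀ β ∈ A, Integrable (fun ω => F α ω * F β ω) μ := fun α hα β hβ =>
    (hF α hα).integrable_mul (hF β hβ)
  have hexp : ∫ ω, (∑ α ∈ A, F α ω) ^ 2 ∂μ = ∑ α ∈ A, ∑ β ∈ A, ∫ ω, F α ω * F β ω ∂μ := by
    simp only [sq, Finset.sum_mul_sum]
    rw [integral_finsetSum _ fun α hα => integrable_finsetSum _ fun β hβ => hint α hα β hβ]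
    exact Finset.sum_congr rfl fun α hα => integral_finsetSum _ fun β hβ => hint α hα β hβ
  have hcs : ∀ α ∈ A, ∀ β ∈ A, ∫ ω, F α ω * F β ω ∂μ
      ≤ (∫ ω, F α ω ^ 2 ∂μ + ∫ ω, F β ω ^ 2 ∂μ) / 2 := by
    intro α hα β hβ
    rw [← integral_add (hF α hα).integrable_sq (hF β hβ).integrable_sq, ← integral_div]
    refine integral_mono (hint α hα β hβ)
      (((hF α hα).integrable_sq.add (hF β hβ).integrable_sq).div_const 2) fun ω => ?_
    change F α ω * F β ω ≤ (F α ω ^ 2 + F β ω ^ 2) / 2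
    nlinarith [sq_nonneg (F α ω - F β ω)]
  have hnn : ∀ α, 0 ≤ ∫ ω, F α ω ^ 2 ∂μ := fun α => integral_nonneg fun _ => sq_nonneg _
  -- In row `α` only `α` and `τ α` survive, and the second entry is bounded by the arithmetic mean
  -- of the two second moments. If `τ α = α`, the extra term is merely nonnegative.
  have hrow : ∀ α ∈ A, ∑ β ∈ A, ∫ ω, F α ω * F β ω ∂μ
      ≤ ∫ ω, F α ω ^ 2 ∂μ + (∫ ω, F α ω ^ 2 ∂μ + ∫ ω, F (τ α) ω ^ 2 ∂μ) / 2 := by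
    intro α hα
    have hle : ∀ β ∈ A, ∫ ω, F α ω * F β ω ∂μ
        ≤ (if β = α then ∫ ω, F α ω ^ 2 ∂μ else 0)
          + (if β = τ α then (∫ ω, F α ω ^ 2 ∂μ + ∫ ω, F (τ α) ω ^ 2 ∂μ) / 2 else 0) := by
      intro β hβ
      by_cases h1 : β = α
      · subst h1
        have h3 : 0 ≤ (if β = τ β then (∫ ω, F β ω ^ 2 ∂μ + ∫ ω, F (τ β) ω ^ 2 ∂μ) / 2 else 0) := by
          split_ifs
          · linarith [hnn β, hnn (τ β)]
          · exact le_rfl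
        have h4 : ∫ ω, F β ω * F β ω ∂μ = ∫ ω, F β ω ^ 2 ∂μ := by simp only [sq]
        simp only [if_true]
        linarith
      · by_cases h2 : β = τ α
        · simp only [h2, if_true]
          have h5 := hcs α hα (τ α) (hτA α hα)
          have h6 : τ α ≠ α := h2 ▸ h1
          simp only [h6, if_false]
          linarith
        · simp [h1, h2, h0 α hα β hβ h1 h2]
    refine (Finset.sum_le_sum hle).trans ?_
    rw [Finset.sum_add_distrib, Finset.sum_ite_eq' A, Finset.sum_ite_eq' A]
    simp [hα, hτA α hα]
  -- `τ` permutes `A`, so the rows add up to the factor `1 + 1/2 + 1/2 = 2`.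
  have hperm : ∑ α ∈ A, ∫ ω, F (τ α) ω ^ 2 ∂μ = ∑ α ∈ A, ∫ ω, F α ω ^ 2 ∂μ :=
    Finset.sum_nbij' τ τ hτA hτA (fun a _ => hττ a) (fun a _ => hττ a) fun _ _ => rfl
  rw [hexp]
  refine (Finset.sum_le_sum hrow).trans ?_
  rw [Finset.sum_add_distrib, ← Finset.sum_div, Finset.sum_add_distrib, hperm]
  linarith

/-- The bilinear form `∬ c(s, u) U(s, x) W(u, y)` in the paths `x`, `y`. -/
noncomputable def pairForm {E : Type*} (U W : ℝ → E → ℝ) (ρ ρ' : Measure ℝ) (c : ℝ → ℝ → ℝ) (x y : E) : ℝ :=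
  ∫ s, ∫ u, c s u * (U s x * W u y) ∂ρ' ∂ρ

theorem pairForm_range_dirac {E : Type*} {U W : ℝ → E → ℝ} (L L' : ℕ) (T T' : ℕ → ℝ) (c : ℝ → ℝ → ℝ) (x y : E) :
    pairForm U W (∑ j ∈ Finset.range L, Measure.dirac (T j))
      (∑ j ∈ Finset.range L', Measure.dirac (T' j)) c x y
      = ∑ z ∈ Finset.range L ×ˢ Finset.range L',
        c (T z.1) (T' z.2) * (U (T z.1) x * W (T' z.2) y) := by
  rw [pairForm, integral_range_dirac, Finset.sum_product]
  simp only [integral_range_dirac]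

theorem pairForm_memLp (hU : IsCentered P U C) (hW : IsCentered P W C') {ρ ρ' : Measure ℝ}
    (hρ : IsPointMeasure ρ) (hρ' : IsPointMeasure ρ') (c : ℝ → ℝ → ℝ) {i j : Fin n} (hij : i ≠ j) :
    MemLp (fun x : Fin n → E => pairForm U W ρ ρ' c (x i) (x j)) 2
      (Measure.pi fun _ : Fin n => P) := by
  obtain ⟨L, T, rfl⟩ := hρ
  obtain ⟨L', T', rfl⟩ := hρ'
  simp only [pairForm_range_dirac]
  exact memLp_sum_mul _ _ (fun (z : ℕ × ℕ) (x : Fin n → E) => U (T z.1) (x i) * W (T' z.2) (x j))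
    fun z _ => memLp_mul_eval (hU.memLp _) (hW.memLp _) hij

theorem integral_sq_pairForm_le (hU : IsCentered P U C) (hW : IsCentered P W C') {ρ ρ' : Measure ℝ}
    (hρ : IsPointMeasure ρ) (hρ' : IsPointMeasure ρ') (c : ℝ → ℝ → ℝ) {i j : Fin n} (hij : i ≠ j) :
    ∫ x : Fin n → E, pairForm U W ρ ρ' c (x i) (x j) ^ 2 ∂(Measure.pi fun _ : Fin n => P)
      ≤ C * C' * (∫ s, ∫ u, |c s u| ∂ρ' ∂ρ) ^ 2 := by
  obtain ⟨L, T, rfl⟩ := hρ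
  obtain ⟨L', T', rfl⟩ := hρ'
  simp only [pairForm_range_dirac, integral_range_dirac, ← Finset.sum_product']
  refine integral_sq_sum_mul_le _ _ (fun (z : ℕ × ℕ) (x : Fin n → E) => U (T z.1) (x i) * W (T' z.2) (x j))
    (fun z _ => memLp_mul_eval (hU.memLp _) (hW.memLp _) hij) fun z _ => ?_
  rw [integral_sq_mul_eval (hU.memLp _) (hW.memLp _) hij]
  exact mul_le_mul (hU.sq_le _) (hW.sq_le _) (integral_nonneg fun _ => sq_nonneg _) hU.nonneg

theorem integral_pairForm_left (hU : IsCentered P U C) {ρ ρ' : Measure ℝ}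
    (hρ : IsPointMeasure ρ) (hρ' : IsPointMeasure ρ') (c : ℝ → ℝ → ℝ) (y : E) :
    ∫ x, pairForm U W ρ ρ' c x y ∂P = 0 := by
  obtain ⟨L, T, rfl⟩ := hρ
  obtain ⟨L', T', rfl⟩ := hρ'
  simp only [pairForm_range_dirac]
  rw [integral_finsetSum _ fun z _ =>
    ((((hU.memLp _).integrable (by norm_num)).mul_const _).const_mul _)]
  simp [integral_const_mul, integral_mul_const, hU.mean]

theorem integral_pairForm_right (hW : IsCentered P W C) {ρ ρ' : Measure ℝ}
    (hρ : IsPointMeasure ρ) (hρ' : IsPointMeasure ρ') (c : ℝ → ℝ → ℝ) (x : E) :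
    ∫ y, pairForm U W ρ ρ' c x y ∂P = 0 := by
  obtain ⟨L, T, rfl⟩ := hρ
  obtain ⟨L', T', rfl⟩ := hρ'
  simp only [pairForm_range_dirac]
  rw [integral_finsetSum _ fun z _ =>
    ((((hW.memLp _).integrable (by norm_num)).const_mul _).const_mul _)]
  simp [integral_const_mul, hW.mean]

/-- One of `i`, `j` is missing from `{k, l}`. Integrating out that coordinate annihilates the
product, because the form is centered in each of its two arguments. -/
theorem integral_pairForm_mul_eq_zero (hU : IsCentered P U C) (hW : IsCentered P W C')
    {ρ : Fin n → Measure ℝ} (hρ : ∀ i, IsPointMeasure (ρ i)) (c : Fin n → Fin n → ℝ → ℝ → ℝ)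
    {i j k l : Fin n} (hij : i ≠ j) (hkl : k ≠ l) (h : ¬ ((i = k ∨ i = l) ∧ (j = k ∨ j = l))) :
    ∫ x : Fin n → E, pairForm U W (ρ i) (ρ j) (c i j) (x i) (x j)
      * pairForm U W (ρ k) (ρ l) (c k l) (x k) (x l) ∂(Measure.pi fun _ : Fin n => P) = 0 := by
  have hint := (pairForm_memLp (n := n) hU hW (hρ i) (hρ j) (c i j) hij).integrable_mul
    (pairForm_memLp hU hW (hρ k) (hρ l) (c k l) hkl)
  by_cases hi : i = k ∨ i = l
  · have hj : ¬ (j = k ∨ j = l) := fun hj => h ⟨hi, hj⟩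
    push Not at hj
    refine integral_pi_eq_zero_of_update j _ hint fun x => ?_
    simp only [Function.update_self, Function.update_of_ne hj.1.symm,
      Function.update_of_ne hj.2.symm, Function.update_of_ne hij]
    rw [integral_mul_const, integral_pairForm_right hW (hρ i) (hρ j), zero_mul]
  · push Not at hi
    refine integral_pi_eq_zero_of_update i _ hint fun x => ?_
    simp only [Function.update_self, Function.update_of_ne hi.1.symm,
      Function.update_of_ne hi.2.symm, Function.update_of_ne hij.symm]
    rw [integral_mul_const, integral_pairForm_left hU (hρ i) (hρ j), zero_mul]

/-- Second moment of a degenerate bilinear form in independent paths. -/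
theorem integral_sq_sum_pairForm_le (hU : IsCentered P U C) (hW : IsCentered P W C')
    {ρ : Fin n → Measure ℝ} (hρ : ∀ i, IsPointMeasure (ρ i)) (c : Fin n → Fin n → ℝ → ℝ → ℝ) :
    ∫ x : Fin n → E, (∑ z ∈ (Finset.univ : Finset (Fin n)).offDiag,
        pairForm U W (ρ z.1) (ρ z.2) (c z.1 z.2) (x z.1) (x z.2)) ^ 2
        ∂(Measure.pi fun _ : Fin n => P)
      ≤ 2 * ∑ z ∈ (Finset.univ : Finset (Fin n)).offDiag,
        C * C' * (∫ s, ∫ u, |c z.1 z.2 s u| ∂(ρ z.2) ∂(ρ z.1)) ^ 2 := by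
  refine (integral_sq_sum_le_two_mul _ Prod.swap ?_ (fun _ => rfl)
    (fun z (x : Fin n → E) => pairForm U W (ρ z.1) (ρ z.2) (c z.1 z.2) (x z.1) (x z.2))
    ?_ ?_).trans ?_
  · intro z hz
    simp only [Finset.mem_offDiag, Finset.mem_univ, true_and, Prod.fst_swap, Prod.snd_swap] at hz ⊢
    exact hz.symm
  · intro z hz
    simp only [Finset.mem_offDiag, Finset.mem_univ, true_and] at hz
    exact pairForm_memLp hU hW (hρ _) (hρ _) _ hz
  · rintro ⟨i, j⟩ hz ⟨k, l⟩ hz' h1 h2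
    simp only [Finset.mem_offDiag, Finset.mem_univ, true_and, ne_eq, Prod.mk.injEq,
      Prod.swap_prod_mk] at hz hz' h1 h2
    refine integral_pairForm_mul_eq_zero hU hW hρ c hz hz' ?_
    -- Two distinct indices that both lie in `{k, l}` make up the pair `(k, l)` or its swap, and
    -- both are excluded.
    rintro ⟨h3, h4⟩
    dsimp only at h3 h4
    grind
  · refine mul_le_mul_of_nonneg_left (Finset.sum_le_sum fun z hz => ?_) (by norm_num)
    simp only [Finset.mem_offDiag, Finset.mem_univ, true_and] at hz
    exact integral_sq_pairForm_le hU hW (hρ _) (hρ _) _ hz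

end DegenerateUStatistic

/-! ### Integrals of the rescaled kernel -/

section KernelIntegrals

theorem lintegral_comp_affine {h : ℝ} (hh : 0 < h) (t : ℝ) {f : ℝ → ENNReal} (hf : Measurable f) :
    ∫⁻ u, f ((u - t) / h) = ENNReal.ofReal h * ∫⁻ z, f z := by
  have h1 : ∫⁻ u, f ((u - t) / h) = ∫⁻ u, f (h⁻¹ * u) := by
    rw [← lintegral_sub_right_eq_self (fun u => f (h⁻¹ * u)) t]
    simp only [div_eq_inv_mul]
  have h2 : ∫⁻ z, f z ∂(Measure.map (h⁻¹ * ·) volume) = ∫⁻ u, f (h⁻¹ * u) :=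
    lintegral_map hf (measurable_const_mul _)
  rw [h1, ← h2, Real.map_volume_mul_left (inv_ne_zero hh.ne'), inv_inv, abs_of_pos hh,
    lintegral_smul_measure, smul_eq_mul]

variable {K : ℝ → ℝ} {h : ℝ}

theorem scaledKernel_nonneg (hK : IsKernel K) (hh : 0 < h) (u : ℝ) : 0 ≤ scaledKernel K h u :=
  mul_nonneg (inv_nonneg.2 hh.le) (hK.nonneg _)

theorem measurable_scaledKernel (hK : IsKernel K) : Measurable (scaledKernel K h) :=
  (hK.measurable.comp (measurable_id.div_const h)).const_mul _

theorem measurable_ofReal_scaledKernel_sub (hK : IsKernel K) (s : ℝ) :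
    Measurable fun u => ENNReal.ofReal (scaledKernel K h (u - s)) :=
  ((measurable_scaledKernel hK).comp (measurable_id.sub_const s)).ennreal_ofReal

/-- A non-integrable function has Bochner integral zero by convention, whereas the integral of `K`
is one. -/
theorem IsKernel.integrable (hK : IsKernel K) : Integrable K := by
  by_contra hn
  simpa [integral_undef hn] using hK.integral_eq_one

theorem IsKernel.lintegral_eq_one (hK : IsKernel K) : ∫⁻ z, ENNReal.ofReal (K z) = 1 := by
  rw [← ofReal_integral_eq_lintegral_ofReal hK.integrable (ae_of_all _ hK.nonneg),
    hK.integral_eq_one, ENNReal.ofReal_one]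

theorem lintegral_scaledKernel (hK : IsKernel K) (hh : 0 < h) (t : ℝ) :
    ∫⁻ u, ENNReal.ofReal (scaledKernel K h (u - t)) = 1 := by
  have := lintegral_comp_affine hh t (f := fun z => ENNReal.ofReal (h⁻¹ * K z))
    (hK.measurable.const_mul _).ennreal_ofReal
  simp only [scaledKernel]
  rw [this]
  simp_rw [ENNReal.ofReal_mul (inv_nonneg.2 hh.le)]
  rw [lintegral_const_mul _ hK.measurable.ennreal_ofReal, hK.lintegral_eq_one, mul_one,
    ← ENNReal.ofReal_mul hh.le, mul_inv_cancel₀ hh.ne', ENNReal.ofReal_one]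

theorem lintegral_scaledKernel_sq (hK : IsKernel K) (hh : 0 < h) (t : ℝ) :
    ∫⁻ u, ENNReal.ofReal (scaledKernel K h (u - t) ^ 2) = ENNReal.ofReal ((∫ z, K z ^ 2) / h) := by
  have := lintegral_comp_affine hh t (f := fun z => ENNReal.ofReal ((h⁻¹ * K z) ^ 2))
    ((hK.measurable.const_mul _).pow_const 2).ennreal_ofReal
  simp only [scaledKernel]
  rw [this]
  simp_rw [mul_pow]
  simp_rw [ENNReal.ofReal_mul (sq_nonneg h⁻¹)]
  rw [lintegral_const_mul _ (hK.measurable.pow_const 2).ennreal_ofReal,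
    ← ofReal_integral_eq_lintegral_ofReal hK.integrable_sq (ae_of_all _ fun _ => sq_nonneg _),
    ← mul_assoc, ← ENNReal.ofReal_mul hh.le, ← ENNReal.ofReal_mul (by positivity)]
  congr 1
  field_simp

theorem IsKernel.exists_support (hK : IsKernel K) : ∃ R : ℝ, 0 < R ∧ ∀ z, R < |z| → K z = 0 := by
  obtain ⟨R, hR⟩ := hK.bounded_support
  exact ⟨max R 1, by positivity, fun z hz => hR z (lt_of_le_of_lt (le_max_left _ _) hz)⟩

theorem abs_sub_le_of_scaledKernel_ne_zero {R : ℝ} (hR : ∀ z, R < |z| → K z = 0) (hh : 0 < h)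
    {u : ℝ} (hu : scaledKernel K h u ≠ 0) : |u| ≤ R * h := by
  by_contra hlt
  push Not at hlt
  refine hu ?_
  rw [scaledKernel, hR _ _, mul_zero]
  rw [abs_div, abs_of_pos hh, lt_div_iff₀ hh]
  exact hlt

end KernelIntegrals

/-! ### Random point processes and Campbell's formula -/

section PointProcess

variable {M : Type*} [MeasurableSpace M]

/-- A random finite set of points with intensity `lam ≤ Λ` whose second factorial moment measure
has a density bounded by `c`. -/
structure IsPointProcess (N : Kernel M ℝ) (ν : Measure M) (lam : ℝ → ℝ) (Λ c : ℝ) : Prop where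
  point : ∀ m, IsPointMeasure (N m)
  measurable_lam : Measurable lam
  lam_nonneg : ∀ s, 0 ≤ lam s
  lam_le : ∀ s, lam s ≤ Λ
  c_nonneg : 0 ≤ c
  intensity : ∀ B, MeasurableSet B → ∫⁻ m, N m B ∂ν = ∫⁻ s in B, ENNReal.ofReal (lam s)
  pair : ∀ f : ℝ → ℝ → ENNReal, Measurable (Function.uncurry f) →
    ∫⁻ m, ∫⁻ s, ∫⁻ u, f s u ∂(N m) ∂(N m) ∂ν
      ≤ (∫⁻ s, f s s * ENNReal.ofReal (lam s)) + ENNReal.ofReal c * ∫⁻ s, ∫⁻ u, f s u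

/-- Each mass `N m univ` is finite but not uniformly in `m`. Cutting the mark space by the integer
part of the mass gives countably many finite kernels. -/
theorem isSFiniteKernel_of_point {N : Kernel M ℝ} (hN : ∀ m, IsPointMeasure (N m)) :
    IsSFiniteKernel N := by
  classical
  have hfin : ∀ m, N m univ < ⊤ := fun m => by
    have := (hN m).isFiniteMeasure
    exact measure_lt_top _ _
  have hmeas : ∀ k : ℕ, MeasurableSet {m | ⌊(N m univ).toReal⌋₊ = k} := fun k =>
    (Nat.measurable_floor.comp (N.measurable_coe MeasurableSet.univ).ennreal_toReal)
      (measurableSet_singleton k)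
  refine ⟨⟨fun k => Kernel.piecewise (hmeas k) N 0, fun k => ⟨⟨ENNReal.ofReal (k + 1),
    ENNReal.ofReal_lt_top, fun m => ?_⟩⟩, ?_⟩⟩
  · rw [Kernel.piecewise_apply]
    split_ifs with hm
    · rw [← ENNReal.ofReal_toReal (hfin m).ne]
      refine ENNReal.ofReal_le_ofReal ?_
      have := Nat.lt_floor_add_one (N m univ).toReal
      simp only [mem_ofPred_eq] at hm
      rw [hm] at this
      exact this.le
    · simp
  · ext m s hs
    rw [Kernel.sum_apply' _ _ hs, tsum_eq_single ⌊(N m univ).toReal⌋₊]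
    · simp [Kernel.piecewise_apply]
    · intro k hk
      rw [Kernel.piecewise_apply, if_neg]
      · simp
      · simpa using hk.symm

theorem measurable_integral_kernel {α : Type*} [MeasurableSpace α] (N : Kernel M ℝ)
    [IsSFiniteKernel N] {f : α → ℝ → ℝ} (hf : Measurable (Function.uncurry f)) {k : α → M}
    (hk : Measurable k) : Measurable fun a => ∫ s, f a s ∂(N (k a)) :=
  (StronglyMeasurable.integral_kernel_prod_right (κ := N.comap k hk)
    hf.stronglyMeasurable).measurable

theorem measurable_lintegral_kernel {α : Type*} [MeasurableSpace α] (N : Kernel M ℝ)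
    [IsSFiniteKernel N] {f : α → ℝ → ENNReal} (hf : Measurable (Function.uncurry f)) {k : α → M}
    (hk : Measurable k) : Measurable fun a => ∫⁻ s, f a s ∂(N (k a)) :=
  Measurable.lintegral_kernel_prod_right (κ := N.comap k hk) hf

variable {N : Kernel M ℝ} {ν : Measure M} {lam : ℝ → ℝ} {Λ c : ℝ}

/-- The intensity on sets identifies the mixture `ν.bind N` with the density `lam`; integrals of
functions follow. -/
theorem lintegral_lintegral_of_intensity (hlam : Measurable lam)
    (hN : ∀ B, MeasurableSet B → ∫⁻ m, N m B ∂ν = ∫⁻ s in B, ENNReal.ofReal (lam s))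
    {f : ℝ → ENNReal} (hf : Measurable f) :
    ∫⁻ m, ∫⁻ s, f s ∂(N m) ∂ν = ∫⁻ s, f s * ENNReal.ofReal (lam s) := by
  have hb : ν.bind N = volume.withDensity fun s => ENNReal.ofReal (lam s) := by
    ext B hB
    rw [Measure.bind_apply hB N.measurable.aemeasurable, hN B hB, withDensity_apply _ hB]
  rw [← Measure.lintegral_bind N.measurable.aemeasurable hf.aemeasurable, hb,
    lintegral_withDensity_eq_lintegral_mul _ hlam.ennreal_ofReal hf]
  simp [mul_comm]

theorem IsPointProcess.campbell (hN : IsPointProcess N ν lam Λ c) {f : ℝ → ENNReal}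
    (hf : Measurable f) :
    ∫⁻ m, ∫⁻ s, f s ∂(N m) ∂ν = ∫⁻ s, f s * ENNReal.ofReal (lam s) :=
  lintegral_lintegral_of_intensity hN.measurable_lam hN.intensity hf

theorem IsPointProcess.campbell_le (hN : IsPointProcess N ν lam Λ c) {f : ℝ → ENNReal}
    (hf : Measurable f) :
    ∫⁻ m, ∫⁻ s, f s ∂(N m) ∂ν ≤ ENNReal.ofReal Λ * ∫⁻ s, f s := by
  rw [hN.campbell hf, ← lintegral_const_mul _ hf]
  refine lintegral_mono fun s => ?_
  rw [mul_comm]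
  exact mul_le_mul' (ENNReal.ofReal_le_ofReal (hN.lam_le s)) le_rfl

theorem IsPointProcess.pair_le (hN : IsPointProcess N ν lam Λ c) {f : ℝ → ℝ → ENNReal}
    (hf : Measurable (Function.uncurry f)) :
    ∫⁻ m, ∫⁻ s, ∫⁻ u, f s u ∂(N m) ∂(N m) ∂ν
      ≤ ENNReal.ofReal Λ * (∫⁻ s, f s s) + ENNReal.ofReal c * ∫⁻ s, ∫⁻ u, f s u := by
  refine (hN.pair f hf).trans (add_le_add ?_ le_rfl)
  have hm : Measurable fun s => f s s := hf.comp (measurable_id.prodMk measurable_id)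
  rw [← lintegral_const_mul _ hm]
  refine lintegral_mono fun s => ?_
  rw [mul_comm]
  exact mul_le_mul' (ENNReal.ofReal_le_ofReal (hN.lam_le s)) le_rfl

theorem IsPointProcess.Λ_nonneg (hN : IsPointProcess N ν lam Λ c) : 0 ≤ Λ :=
  (hN.lam_nonneg 0).trans (hN.lam_le 0)

end PointProcess

/-! ### Moments of the number of observations in a kernel window -/

section LocalMass

variable {M : Type*} [MeasurableSpace M]

/-- `∫ K_h(u - s) dN(u)`. -/
noncomputable def localMass (N : Kernel M ℝ) (K : ℝ → ℝ) (h s : ℝ) (m : M) : ℝ :=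
  ∫ u, scaledKernel K h (u - s) ∂(N m)

variable {N : Kernel M ℝ} {ν : Measure M} {lam : ℝ → ℝ} {Λ c : ℝ} {K : ℝ → ℝ} {h : ℝ}

theorem measurable_scaledKernel_sub (hK : IsKernel K) :
    Measurable fun z : ℝ × ℝ => scaledKernel K h (z.2 - z.1) :=
  (measurable_scaledKernel hK).comp (measurable_snd.sub measurable_fst)

theorem localMass_nonneg (hK : IsKernel K) (hh : 0 < h) (s : ℝ) (m : M) :
    0 ≤ localMass N K h s m := integral_nonneg fun _ => scaledKernel_nonneg hK hh _

theorem measurable_localMass [IsSFiniteKernel N] (hK : IsKernel K) :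
    Measurable fun z : ℝ × M => localMass N K h z.1 z.2 :=
  measurable_integral_kernel N (f := fun (z : ℝ × M) u => scaledKernel K h (u - z.1))
    ((measurable_scaledKernel hK).comp (measurable_snd.sub (measurable_fst.comp measurable_fst)))
    measurable_snd

theorem ofReal_localMass (hN : ∀ m, IsPointMeasure (N m)) (hK : IsKernel K) (hh : 0 < h) (s : ℝ)
    (m : M) : ENNReal.ofReal (localMass N K h s m)
      = ∫⁻ u, ENNReal.ofReal (scaledKernel K h (u - s)) ∂(N m) :=
  ofReal_integral_eq_lintegral_ofReal ((hN m).integrable _)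
    (ae_of_all _ fun _ => scaledKernel_nonneg hK hh _)

/-- The square is a double integral over ordered pairs of points. A point paired with itself
contributes `Λ ∫K² / h`; distinct points contribute at most `c (∫K_h)² = c ≤ c / h`, as `h ≤ 1`. -/
theorem lintegral_localMass_sq_le (hN : IsPointProcess N ν lam Λ c) (hK : IsKernel K)
    (hh : 0 < h) (hh1 : h ≤ 1) (s : ℝ) :
    ∫⁻ m, ENNReal.ofReal (localMass N K h s m ^ 2) ∂ν
      ≤ ENNReal.ofReal ((Λ * (∫ z, K z ^ 2) + c) / h) := by
  have hm : Measurable fun u => ENNReal.ofReal (scaledKernel K h (u - s)) :=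
    measurable_ofReal_scaledKernel_sub hK s
  have h1 : ∀ m, ENNReal.ofReal (localMass N K h s m ^ 2)
      = ∫⁻ v, ∫⁻ u, ENNReal.ofReal (scaledKernel K h (v - s))
        * ENNReal.ofReal (scaledKernel K h (u - s)) ∂(N m) ∂(N m) := by
    intro m
    rw [ENNReal.ofReal_pow (localMass_nonneg hK hh s m), ofReal_localMass hN.point hK hh, sq,
      ← lintegral_mul_const _ hm]
    exact lintegral_congr fun v => (lintegral_const_mul _ hm).symm
  have hK2 : 0 ≤ ∫ z, K z ^ 2 := integral_nonneg fun _ => sq_nonneg _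
  simp_rw [h1]
  refine (hN.pair_le (f := fun v u => ENNReal.ofReal (scaledKernel K h (v - s))
    * ENNReal.ofReal (scaledKernel K h (u - s)))
    ((hm.comp measurable_fst).mul (hm.comp measurable_snd))).trans ?_
  have h2 : ∫⁻ v, ENNReal.ofReal (scaledKernel K h (v - s))
      * ENNReal.ofReal (scaledKernel K h (v - s)) = ENNReal.ofReal ((∫ z, K z ^ 2) / h) := by
    rw [← lintegral_scaledKernel_sq hK hh s]
    refine lintegral_congr fun v => ?_
    rw [← ENNReal.ofReal_mul (scaledKernel_nonneg hK hh _), sq]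
  have h3 : ∫⁻ v, ∫⁻ u, ENNReal.ofReal (scaledKernel K h (v - s))
      * ENNReal.ofReal (scaledKernel K h (u - s)) = 1 := by
    simp_rw [lintegral_const_mul _ hm, lintegral_scaledKernel hK hh, mul_one]
    exact lintegral_scaledKernel hK hh s
  rw [h2, h3, mul_one, ← ENNReal.ofReal_mul hN.Λ_nonneg,
    ← ENNReal.ofReal_add (mul_nonneg hN.Λ_nonneg (div_nonneg hK2 hh.le)) hN.c_nonneg]
  refine ENNReal.ofReal_le_ofReal ?_
  rw [add_div, mul_div_assoc]
  have : c ≤ c / h := by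
    rw [le_div_iff₀ hh]; nlinarith [hN.c_nonneg]
  linarith

theorem memLp_localMass [IsSFiniteKernel N] (hN : IsPointProcess N ν lam Λ c) (hK : IsKernel K)
    (hh : 0 < h) (hh1 : h ≤ 1) (s : ℝ) : MemLp (localMass N K h s) 2 ν := by
  have hm : Measurable (localMass N K h s) :=
    (measurable_localMass hK).comp (measurable_const.prodMk measurable_id)
  rw [memLp_two_iff_integrable_sq hm.aestronglyMeasurable]
  refine ⟨(hm.pow_const 2).aestronglyMeasurable, ?_⟩
  rw [hasFiniteIntegral_iff_ofReal (ae_of_all _ fun _ => sq_nonneg _)]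
  exact (lintegral_localMass_sq_le hN hK hh hh1 s).trans_lt ENNReal.ofReal_lt_top

theorem integral_localMass_sq_le [IsSFiniteKernel N] (hN : IsPointProcess N ν lam Λ c)
    (hK : IsKernel K) (hh : 0 < h) (hh1 : h ≤ 1) (s : ℝ) :
    ∫ m, localMass N K h s m ^ 2 ∂ν ≤ (Λ * (∫ z, K z ^ 2) + c) / h := by
  have hK2 : 0 ≤ ∫ z, K z ^ 2 := integral_nonneg fun _ => sq_nonneg _
  have h0 : 0 ≤ (Λ * (∫ z, K z ^ 2) + c) / h :=
    div_nonneg (add_nonneg (mul_nonneg hN.Λ_nonneg hK2) hN.c_nonneg) hh.le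
  rw [← ENNReal.ofReal_le_ofReal_iff h0, ofReal_integral_eq_lintegral_ofReal
    (memLp_localMass hN hK hh hh1 s).integrable_sq (ae_of_all _ fun _ => sq_nonneg _)]
  exact lintegral_localMass_sq_le hN hK hh hh1 s

/-- Lower bound for the expected local mass where the intensity is bounded below. -/
theorem le_integral_localMass [IsSFiniteKernel N] [IsFiniteMeasure ν]
    (hN : IsPointProcess N ν lam Λ c)
    (hK : IsKernel K) (hh : 0 < h) (hh1 : h ≤ 1) {R : ℝ} (hR : ∀ z, R < |z| → K z = 0) {κ s : ℝ}
    (hlam : ∀ u, |u - s| ≤ R * h → κ ≤ lam u) :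
    κ ≤ ∫ m, localMass N K h s m ∂ν := by
  have hm : Measurable fun u => ENNReal.ofReal (scaledKernel K h (u - s)) :=
    measurable_ofReal_scaledKernel_sub hK s
  rw [← ENNReal.ofReal_le_ofReal_iff (integral_nonneg fun m => localMass_nonneg hK hh s m),
    ofReal_integral_eq_lintegral_ofReal
      ((memLp_localMass hN hK hh hh1 s).integrable (by norm_num))
      (ae_of_all _ fun m => localMass_nonneg hK hh s m)]
  simp_rw [ofReal_localMass hN.point hK hh]
  rw [hN.campbell hm]
  calc ENNReal.ofReal κ
      = ENNReal.ofReal κ * ∫⁻ u, ENNReal.ofReal (scaledKernel K h (u - s)) := by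
        rw [lintegral_scaledKernel hK hh, mul_one]
    _ = ∫⁻ u, ENNReal.ofReal (scaledKernel K h (u - s)) * ENNReal.ofReal κ := by
        rw [lintegral_mul_const _ hm, mul_comm]
    _ ≤ _ := by
        refine lintegral_mono fun u => ?_
        by_cases hu : scaledKernel K h (u - s) = 0
        · simp [hu]
        · exact mul_le_mul' le_rfl (ENNReal.ofReal_le_ofReal
            (hlam u (abs_sub_le_of_scaledKernel_ne_zero hR hh hu)))

/-- Expected local mass seen from a point of the process itself. -/
theorem lintegral_scaledKernel_mul_localMass_le [IsSFiniteKernel N]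
    (hN : IsPointProcess N ν lam Λ c) (hK : IsKernel K) (hh : 0 < h) (hh1 : h ≤ 1) (t : ℝ) :
    ∫⁻ m, ∫⁻ s, ENNReal.ofReal (scaledKernel K h (s - t))
        * ENNReal.ofReal (localMass N K h s m) ∂(N m) ∂ν
      ≤ ENNReal.ofReal ((Λ * K 0 + c) / h) := by
  have hm : Measurable fun s => ENNReal.ofReal (scaledKernel K h (s - t)) :=
    measurable_ofReal_scaledKernel_sub hK t
  have hm2 : Measurable fun z : ℝ × ℝ => ENNReal.ofReal (scaledKernel K h (z.2 - z.1)) :=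
    (measurable_scaledKernel_sub hK).ennreal_ofReal
  have h1 : ∀ m, ∫⁻ s, ENNReal.ofReal (scaledKernel K h (s - t))
        * ENNReal.ofReal (localMass N K h s m) ∂(N m)
      = ∫⁻ s, ∫⁻ u, ENNReal.ofReal (scaledKernel K h (s - t))
        * ENNReal.ofReal (scaledKernel K h (u - s)) ∂(N m) ∂(N m) := by
    intro m
    refine lintegral_congr fun s => ?_
    rw [ofReal_localMass hN.point hK hh, lintegral_const_mul _
      (measurable_ofReal_scaledKernel_sub hK s)]
  simp_rw [h1]
  refine (hN.pair_le (f := fun s u => ENNReal.ofReal (scaledKernel K h (s - t))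
    * ENNReal.ofReal (scaledKernel K h (u - s))) ((hm.comp measurable_fst).mul hm2)).trans ?_
  -- Every point also counts itself in its local mass, with weight `K_h(0) = K(0) / h`.
  have h2 : ∫⁻ s, ENNReal.ofReal (scaledKernel K h (s - t))
      * ENNReal.ofReal (scaledKernel K h (s - s)) = ENNReal.ofReal (h⁻¹ * K 0) := by
    rw [← one_mul (ENNReal.ofReal (h⁻¹ * K 0)), ← lintegral_scaledKernel hK hh t,
      ← lintegral_mul_const _ hm]
    simp [scaledKernel]
  have h3 : ∫⁻ s, ∫⁻ u, ENNReal.ofReal (scaledKernel K h (s - t))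
      * ENNReal.ofReal (scaledKernel K h (u - s)) = 1 := by
    rw [← lintegral_scaledKernel hK hh t]
    refine lintegral_congr fun s => ?_
    rw [lintegral_const_mul _
      (measurable_ofReal_scaledKernel_sub hK s),
      lintegral_scaledKernel hK hh, mul_one]
  have hK0 := hK.nonneg 0
  rw [h2, h3, mul_one, ← ENNReal.ofReal_mul hN.Λ_nonneg,
    ← ENNReal.ofReal_add (mul_nonneg hN.Λ_nonneg (by positivity)) hN.c_nonneg]
  refine ENNReal.ofReal_le_ofReal ?_
  have : c ≤ c / h := by
    rw [le_div_iff₀ hh]; nlinarith [hN.c_nonneg]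
  calc Λ * (h⁻¹ * K 0) + c ≤ Λ * (h⁻¹ * K 0) + c / h := by linarith
    _ = (Λ * K 0 + c) / h := by ring

attribute [irreducible] localMass

end LocalMass

/-! ### Normalized weights with a random denominator -/

section LeaveOneOut

variable {n : ℕ}

/-- Normalized weights lie in `[0, 1]`, so their squares are dominated by the weights. These sum to
one, or to zero when the denominator vanishes, since division by zero returns zero. -/
theorem sum_div_sq_le_one (A : Fin n → ℝ) (hA : ∀ j, 0 ≤ A j) (s : Finset (Fin n)) :
    ∑ j ∈ s, (A j / ∑ k, A k) ^ 2 ≤ 1 := by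
  have hD : 0 ≤ ∑ k, A k := Finset.sum_nonneg fun k _ => hA k
  have hq : ∀ j, A j / ∑ k, A k ≤ 1 := fun j =>
    div_le_one_of_le₀ (Finset.single_le_sum (fun k _ => hA k) (Finset.mem_univ j)) hD
  calc ∑ j ∈ s, (A j / ∑ k, A k) ^ 2 ≤ ∑ j ∈ s, A j / ∑ k, A k := by
        refine Finset.sum_le_sum fun j _ => ?_
        have := div_nonneg (hA j) hD
        nlinarith [hq j]
    _ ≤ ∑ j, A j / ∑ k, A k :=
        Finset.sum_le_sum_of_subset_of_nonneg (Finset.subset_univ s)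
          fun j _ _ => div_nonneg (hA j) hD
    _ ≤ 1 := by rw [← Finset.sum_div]; exact div_self_le_one _

/-- Bound for squared normalized weights: either the weights are close to their mean `b ≥ θ`, and
then the denominator is at least `θ / 2`, or the deviation from the mean is large. -/
theorem sum_erase_div_sq_le (A : Fin n → ℝ) (hA : ∀ j, 0 ≤ A j) (i : Fin n) {θ b : ℝ}
    (hθ : 0 < θ) (hb : θ ≤ b) :
    ∑ j ∈ Finset.univ.erase i, (A j / ∑ k, A k) ^ 2
      ≤ 4 * (∑ j ∈ Finset.univ.erase i, A j ^ 2
        + (∑ j ∈ Finset.univ.erase i, A j - b) ^ 2) / θ ^ 2 := by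
  set D' := ∑ j ∈ Finset.univ.erase i, A j with hD'
  -- The full denominator dominates the leave-one-out one, so the final bound need not contain `A
  -- i`.
  have hDD : D' ≤ ∑ k, A k := Finset.sum_le_sum_of_subset_of_nonneg (Finset.subset_univ _)
    fun j _ _ => hA j
  have hS : 0 ≤ ∑ j ∈ Finset.univ.erase i, A j ^ 2 := Finset.sum_nonneg fun _ _ => sq_nonneg _
  rw [le_div_iff₀ (by positivity)]
  by_cases hlt : D' < θ / 2
  · have h1 := sum_div_sq_le_one A hA (Finset.univ.erase i)
    have h2 : θ ^ 2 ≤ 4 * (D' - b) ^ 2 := by nlinarith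
    nlinarith [sq_nonneg θ]
  · push Not at hlt
    have hDpos : 0 < ∑ k, A k := by linarith
    have h1 : ∑ j ∈ Finset.univ.erase i, (A j / ∑ k, A k) ^ 2
        = (∑ j ∈ Finset.univ.erase i, A j ^ 2) / (∑ k, A k) ^ 2 := by
      simp_rw [div_pow]; rw [← Finset.sum_div]
    rw [h1, div_mul_eq_mul_div, div_le_iff₀ (by positivity)]
    have h2 : θ ^ 2 ≤ 4 * (∑ k, A k) ^ 2 := by nlinarith
    nlinarith [mul_le_mul_of_nonneg_left h2 hS,
      mul_nonneg (sq_nonneg (D' - b)) (sq_nonneg (∑ k, A k))]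

/-- If all masses vanish, the deviation from the mean is `b ≥ θ` and the ratio is at least `4`. This
covers empty kernel windows, where the kernel estimate takes the default value zero. -/
theorem one_le_of_sum_eq_zero (A : Fin n → ℝ) (hA : ∀ j, 0 ≤ A j) (i : Fin n) {θ b : ℝ}
    (hθ : 0 < θ) (hb : θ ≤ b) (h0 : ∑ k, A k = 0) :
    1 ≤ 4 * (∑ j ∈ Finset.univ.erase i, A j ^ 2
        + (∑ j ∈ Finset.univ.erase i, A j - b) ^ 2) / θ ^ 2 := by
  have hz : ∀ j, A j = 0 := fun j =>
    (Finset.sum_eq_zero_iff_of_nonneg fun k _ => hA k).1 h0 j (Finset.mem_univ j)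
  rw [le_div_iff₀ (by positivity)]
  simp only [hz]
  simp
  nlinarith

/-- The weight of subject `i` itself: it is at most one when the other masses fall below `θ / 2`, an
event already paid for by the deviation term, and at most `2 A i / θ` otherwise. -/
theorem div_sum_le (A : Fin n → ℝ) (hA : ∀ j, 0 ≤ A j) (i : Fin n) {θ b : ℝ}
    (hθ : 0 < θ) (hb : θ ≤ b) :
    A i / ∑ k, A k ≤ 4 * (∑ j ∈ Finset.univ.erase i, A j ^ 2
        + (∑ j ∈ Finset.univ.erase i, A j - b) ^ 2) / θ ^ 2 + 2 * A i / θ := by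
  set D' := ∑ j ∈ Finset.univ.erase i, A j with hD'
  have hDD : D' ≤ ∑ k, A k := Finset.sum_le_sum_of_subset_of_nonneg (Finset.subset_univ _)
    fun j _ _ => hA j
  have hS : 0 ≤ ∑ j ∈ Finset.univ.erase i, A j ^ 2 := Finset.sum_nonneg fun _ _ => sq_nonneg _
  have hD : 0 ≤ ∑ k, A k := Finset.sum_nonneg fun k _ => hA k
  have hAi : 0 ≤ 2 * A i / θ := div_nonneg (mul_nonneg zero_le_two (hA i)) hθ.le
  by_cases hlt : D' < θ / 2
  · have h1 : A i / ∑ k, A k ≤ 1 :=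
      div_le_one_of_le₀ (Finset.single_le_sum (fun k _ => hA k) (Finset.mem_univ i)) hD
    have h2 : θ ^ 2 ≤ 4 * (D' - b) ^ 2 := by nlinarith
    have h3 : 1 ≤ 4 * (∑ j ∈ Finset.univ.erase i, A j ^ 2 + (D' - b) ^ 2) / θ ^ 2 := by
      rw [le_div_iff₀ (by positivity)]; linarith
    linarith
  · push Not at hlt
    have hDpos : 0 < ∑ k, A k := by linarith
    have h1 : A i / ∑ k, A k ≤ 2 * A i / θ := by
      rw [div_le_div_iff₀ hDpos hθ]
      nlinarith [hA i]
    have h2 : 0 ≤ 4 * (∑ j ∈ Finset.univ.erase i, A j ^ 2 + (D' - b) ^ 2) / θ ^ 2 := by positivity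
    linarith

end LeaveOneOut

/-! ### The leave-one-out bound and its expectation -/

section LooBound

variable {M : Type*} [MeasurableSpace M] {n : ℕ}

/-- A function of the observation processes of all subjects but `i` that bounds the squared
normalized kernel weights at `s`. -/
noncomputable def looBound (N : Kernel M ℝ) (ν : Measure M) (K : ℝ → ℝ) (h κ : ℝ) (i : Fin n)
    (s : ℝ) (m : Fin n → M) : ℝ :=
  4 * (∑ j ∈ Finset.univ.erase i, localMass N K h s (m j) ^ 2
    + (∑ j ∈ Finset.univ.erase i, localMass N K h s (m j)
      - (n - 1) * ∫ y, localMass N K h s y ∂ν) ^ 2) / ((n - 1) * κ) ^ 2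

variable {N : Kernel M ℝ} {ν : Measure M} {lam : ℝ → ℝ} {Λ c : ℝ} {K : ℝ → ℝ} {h κ : ℝ}

theorem looBound_nonneg (i : Fin n) (s : ℝ) (m : Fin n → M) :
    0 ≤ looBound N ν K h κ i s m := by
  have : 0 ≤ ∑ j ∈ Finset.univ.erase i, localMass N K h s (m j) ^ 2 :=
    Finset.sum_nonneg fun _ _ => sq_nonneg _
  unfold looBound
  positivity

/-- Coordinate `i` does not occur, so the bound is independent of the points of subject `i`, at
which it will be evaluated. -/
theorem looBound_update (i : Fin n) (s : ℝ) (m : Fin n → M) (y : M) :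
    looBound N ν K h κ i s (Function.update m i y) = looBound N ν K h κ i s m := by
  have h1 : ∀ j ∈ Finset.univ.erase i, Function.update m i y j = m j := fun j hj =>
    Function.update_of_ne (Finset.ne_of_mem_erase hj) _ _
  unfold looBound
  have h2 : ∀ f : M → ℝ, ∑ j ∈ Finset.univ.erase i, f (Function.update m i y j)
      = ∑ j ∈ Finset.univ.erase i, f (m j) := fun f =>
    Finset.sum_congr rfl fun j hj => by rw [h1 j hj]
  rw [h2 fun y => localMass N K h s y ^ 2, h2]

theorem measurable_looBound [IsSFiniteKernel N] [SFinite ν] (hK : IsKernel K) (i : Fin n) :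
    Measurable fun z : ℝ × (Fin n → M) => looBound N ν K h κ i z.1 z.2 := by
  have h1 : ∀ j, Measurable fun z : ℝ × (Fin n → M) => localMass N K h z.1 (z.2 j) := fun j =>
    (measurable_localMass hK).comp
      (measurable_fst.prodMk ((measurable_pi_apply j).comp measurable_snd))
  have h2 : Measurable fun z : ℝ × (Fin n → M) => ∫ y, localMass N K h z.1 y ∂ν :=
    (((measurable_localMass hK).stronglyMeasurable.integral_prod_right').measurable).comp
      measurable_fst
  unfold looBound
  exact (((Finset.measurable_fun_sum _ fun j _ => (h1 j).pow_const 2).add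
    (((Finset.measurable_fun_sum _ fun j _ => h1 j).sub (h2.const_mul _)).pow_const 2)).const_mul
      4).div_const _

/-- The expected sum of squares and the variance of the sum are both at most `(n - 1) C₂ / h`.
Division by `((n - 1) κ)²` leaves `8 C₂ / (κ² (n - 1) h)`, and `n - 1 ≥ n / 2` turns the `8` into
`16`. -/
theorem lintegral_looBound_le [IsSFiniteKernel N] [IsProbabilityMeasure ν]
    (hN : IsPointProcess N ν lam Λ c) (hK : IsKernel K)
    (hh : 0 < h) (hh1 : h ≤ 1) (hκ : 0 < κ) (hn : 2 ≤ n) (i : Fin n) (s : ℝ) :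
    ∫⁻ m, ENNReal.ofReal (looBound N ν K h κ i s m) ∂(Measure.pi fun _ : Fin n => ν)
      ≤ ENNReal.ofReal (16 * (Λ * (∫ z, K z ^ 2) + c) / κ ^ 2 / (n * h)) := by
  set C₂ := Λ * (∫ z, K z ^ 2) + c with hC₂
  have hC₂0 : 0 ≤ C₂ := add_nonneg
    (mul_nonneg hN.Λ_nonneg (integral_nonneg fun _ => sq_nonneg _)) hN.c_nonneg
  set b := ∫ y, localMass N K h s y ∂ν with hb
  have hn' : (1 : ℝ) ≤ n - 1 := by
    have : (2 : ℝ) ≤ n := by exact_mod_cast hn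
    linarith
  have ha := memLp_localMass hN hK hh hh1 s
  have hai : Integrable (localMass N K h s) ν := ha.integrable (by norm_num)
  have ha2 := integral_localMass_sq_le hN hK hh hh1 s
  -- Setting coordinate `i` to zero lets the variance formula for the full product measure serve the
  -- sum over the other coordinates.
  let g : Fin n → M → ℝ := fun j y => if j = i then 0 else localMass N K h s y - b
  have hg : ∀ j, MemLp (g j) 2 ν := by
    intro j
    by_cases hj : j = i
    · have : g j = fun _ => 0 := by funext y; simp [g, hj]
      rw [this]; exact memLp_const 0
    · have : g j = fun y => localMass N K h s y - b := by funext y; simp [g, hj]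
      rw [this]; exact ha.sub (memLp_const b)
  have hg0 : ∀ j, ∫ y, g j y ∂ν = 0 := by
    intro j
    by_cases hj : j = i
    · simp [g, hj]
    · simp only [g, hj, if_false]
      rw [integral_sub hai (integrable_const _)]
      simp [hb]
  have hg2 : ∀ j, ∫ y, g j y ^ 2 ∂ν ≤ if j = i then 0 else C₂ / h := by
    intro j
    by_cases hj : j = i
    · simp [g, hj]
    · simp only [g, hj, if_false]
      refine le_trans ?_ ha2
      have h1 := variance_le_expectation_sq (μ := ν) ha.1
      rw [variance_eq_integral ha.1.aemeasurable] at h1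
      exact h1
  have hsum : ∀ m : Fin n → M, ∑ j, g j (m j)
      = ∑ j ∈ Finset.univ.erase i, localMass N K h s (m j) - (n - 1) * b := by
    intro m
    rw [← Finset.add_sum_erase _ _ (Finset.mem_univ i)]
    have : ∑ j ∈ Finset.univ.erase i, g j (m j)
        = ∑ j ∈ Finset.univ.erase i, (localMass N K h s (m j) - b) :=
      Finset.sum_congr rfl fun j hj => by simp [g, Finset.ne_of_mem_erase hj]
    rw [this, Finset.sum_sub_distrib]
    simp only [g, if_true, zero_add, Finset.sum_const, Finset.card_erase_of_mem (Finset.mem_univ i),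
      Finset.card_univ, Fintype.card_fin, nsmul_eq_mul]
    rw [Nat.cast_sub (by omega)]
    simp
  have hcount : ∀ x : ℝ, ∑ j ∈ Finset.univ.erase i, x = (n - 1) * x := by
    intro x
    simp only [Finset.sum_const, Finset.card_erase_of_mem (Finset.mem_univ i),
      Finset.card_univ, Fintype.card_fin, nsmul_eq_mul]
    rw [Nat.cast_sub (by omega)]
    simp
  have hI1 : ∀ j ∈ Finset.univ.erase i, Integrable
      (fun m : Fin n → M => localMass N K h s (m j) ^ 2) (Measure.pi fun _ : Fin n => ν) :=
    fun j _ => (memLp_eval ha j).integrable_sq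
  have hI2 : Integrable (fun m : Fin n → M => (∑ j, g j (m j)) ^ 2)
      (Measure.pi fun _ : Fin n => ν) :=
    (memLp_finsetSum _ fun j _ => memLp_eval (hg j) j).integrable_sq
  have hΦ : ∀ m : Fin n → M, looBound N ν K h κ i s m
      = 4 / ((n - 1) * κ) ^ 2 * (∑ j ∈ Finset.univ.erase i, localMass N K h s (m j) ^ 2
        + (∑ j, g j (m j)) ^ 2) := by
    intro m
    rw [hsum, looBound, ← hb]
    ring
  simp_rw [hΦ]
  rw [← ofReal_integral_eq_lintegral_ofReal]
  rotate_left
  · exact ((integrable_finsetSum _ hI1).add hI2).const_mul _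
  · refine ae_of_all _ fun m => ?_
    have : 0 ≤ ∑ j ∈ Finset.univ.erase i, localMass N K h s (m j) ^ 2 :=
      Finset.sum_nonneg fun _ _ => sq_nonneg _
    show 0 ≤ 4 / ((n - 1) * κ) ^ 2 * (∑ j ∈ Finset.univ.erase i, localMass N K h s (m j) ^ 2
        + (∑ j, g j (m j)) ^ 2)
    positivity
  refine ENNReal.ofReal_le_ofReal ?_
  rw [integral_const_mul, integral_add (integrable_finsetSum _ hI1) hI2,
    integral_finsetSum _ hI1, integral_sq_sum_eval g hg hg0]
  have hA : ∑ j ∈ Finset.univ.erase i, ∫ m : Fin n → M, localMass N K h s (m j) ^ 2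
      ∂(Measure.pi fun _ : Fin n => ν) ≤ (n - 1) * (C₂ / h) := by
    rw [← hcount]
    refine Finset.sum_le_sum fun j _ => ?_
    rw [integral_eval (f := fun y => localMass N K h s y ^ 2) ha.integrable_sq.1]
    exact ha2
  have hB : ∑ j, ∫ y, g j y ^ 2 ∂ν ≤ (n - 1) * (C₂ / h) := by
    refine (Finset.sum_le_sum fun j _ => hg2 j).trans ?_
    rw [← hcount, ← Finset.add_sum_erase _ _ (Finset.mem_univ i)]
    simp only [if_true, zero_add]
    refine (Finset.sum_congr rfl fun j hj => ?_).le
    simp [Finset.ne_of_mem_erase hj]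
  calc 4 / ((n - 1) * κ) ^ 2 * (_ + _)
      ≤ 4 / (((n : ℝ) - 1) * κ) ^ 2 * ((n - 1) * (C₂ / h) + (n - 1) * (C₂ / h)) := by gcongr
    _ = 8 * C₂ / κ ^ 2 / ((n - 1) * h) := by
        have : (n : ℝ) - 1 ≠ 0 := by linarith
        field_simp
        ring
    _ ≤ 8 * C₂ / κ ^ 2 / (n / 2 * h) := by
        have hn2 : (2 : ℝ) ≤ n := by exact_mod_cast hn
        gcongr
        linarith
    _ = 16 * C₂ / κ ^ 2 / (n * h) := by
        have : (n : ℝ) ≠ 0 := by linarith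
        field_simp
        ring

/-- Averaging a function of the other subjects over the points of subject `i`. -/
theorem lintegral_points_mul_loo_le [IsSFiniteKernel N] [IsProbabilityMeasure ν] (i : Fin n)
    {g : ℝ → M → ENNReal} (hg : Measurable (Function.uncurry g))
    {Φ : ℝ → (Fin n → M) → ENNReal} (hΦ : Measurable (Function.uncurry Φ))
    (hup : ∀ s m y, Φ s (Function.update m i y) = Φ s m) {A : ENNReal}
    (hA : ∀ s y, g s y ≠ 0 → ∫⁻ m, Φ s m ∂(Measure.pi fun _ : Fin n => ν) ≤ A) :
    ∫⁻ m, ∫⁻ s, g s (m i) * Φ s m ∂(N (m i)) ∂(Measure.pi fun _ : Fin n => ν)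
      ≤ (∫⁻ y, ∫⁻ s, g s y ∂(N y) ∂ν) * A := by
  have hmeas : Measurable fun m : Fin n → M => ∫⁻ s, g s (m i) * Φ s m ∂(N (m i)) := by
    refine measurable_lintegral_kernel N (f := fun (m : Fin n → M) s => g s (m i) * Φ s m) ?_
      (measurable_pi_apply i)
    exact (hg.comp (measurable_snd.prodMk ((measurable_pi_apply i).comp measurable_fst))).mul
      (hΦ.comp measurable_swap)
  -- Once subject `i` is an outer variable, the measure `N y` no longer depends on the remaining
  -- vector, and the two inner integrals can be exchanged.
  rw [lintegral_pi_update i _ hmeas]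
  have hm1 : Measurable fun y => ∫⁻ s, g s y ∂(N y) :=
    measurable_lintegral_kernel N (f := fun y s => g s y) (hg.comp measurable_swap) measurable_id
  rw [← lintegral_mul_const _ hm1]
  refine lintegral_mono fun y => ?_
  simp only [Function.update_self, hup]
  rw [lintegral_lintegral_swap]
  · have hgy : Measurable fun s => g s y := hg.comp (measurable_id.prodMk measurable_const)
    rw [← lintegral_mul_const _ hgy]
    refine lintegral_mono fun s => ?_
    have hΦs : Measurable fun m => Φ s m := hΦ.comp (measurable_const.prodMk measurable_id)
    rw [lintegral_const_mul _ hΦs]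
    by_cases h0 : g s y = 0
    · simp [h0]
    · exact mul_le_mul' le_rfl (hA s y h0)
  · exact ((hg.comp (measurable_snd.prodMk measurable_const)).mul
      (hΦ.comp measurable_swap)).aemeasurable

attribute [irreducible] looBound

end LooBound

theorem lintegral_mul_affine {α : Type*} [MeasurableSpace α] {ρ : Measure α} {k A B : α → ENNReal}
    (hk : Measurable k) (hA : Measurable A) (hB : Measurable B) (a b c : ENNReal) :
    ∫⁻ s, k s * (a * A s + b * B s + c) ∂ρ
      = a * (∫⁻ s, k s * A s ∂ρ) + b * (∫⁻ s, k s * B s ∂ρ) + c * ∫⁻ s, k s ∂ρ := by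
  have hkA : Measurable fun s => k s * A s := hk.mul hA
  have hkB : Measurable fun s => k s * B s := hk.mul hB
  have h1 : ∀ s, k s * (a * A s + b * B s + c)
      = (a * (k s * A s) + b * (k s * B s)) + c * k s := fun s => by ring
  simp_rw [h1]
  rw [lintegral_add_right _ (hk.const_mul c), lintegral_add_right _ (hkB.const_mul b),
    lintegral_const_mul a hkA, lintegral_const_mul b hkB, lintegral_const_mul c hk]

/-! ### Averages of the leave-one-out bound over the points of one subject -/

section Design

variable {M : Type*} [MeasurableSpace M]

/-- A point process with intensity at least `κ` near `t`, a kernel supported in `[-R, R]` and a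
bandwidth `h` for which the kernel windows around `t` stay in this neighbourhood. -/
structure IsDesign (N : Kernel M ℝ) (ν : Measure M) (lam : ℝ → ℝ) (Λ c : ℝ) (K : ℝ → ℝ)
    (R κ t h : ℝ) : Prop where
  process : IsPointProcess N ν lam Λ c
  kernel : IsKernel K
  R_pos : 0 < R
  support : ∀ z, R < |z| → K z = 0
  κ_pos : 0 < κ
  h_pos : 0 < h
  h_le : h ≤ 1
  lam_ge : ∀ u, |u - t| ≤ 2 * (R * h) → κ ≤ lam u

variable {N : Kernel M ℝ} {ν : Measure M} {lam : ℝ → ℝ} {Λ c : ℝ} {K : ℝ → ℝ} {R κ t h : ℝ} {n : ℕ}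

namespace IsDesign

/-- The constant in the second moment bound of the local mass. -/
noncomputable def sqConst (Λ c : ℝ) (K : ℝ → ℝ) : ℝ := Λ * (∫ z, K z ^ 2) + c

theorem sqConst_nonneg (d : IsDesign N ν lam Λ c K R κ t h) : 0 ≤ sqConst Λ c K :=
  add_nonneg (mul_nonneg d.process.Λ_nonneg (integral_nonneg fun _ => sq_nonneg _))
    d.process.c_nonneg

theorem sfinite (d : IsDesign N ν lam Λ c K R κ t h) : IsSFiniteKernel N :=
  isSFiniteKernel_of_point d.process.point

theorem mass_nonneg (d : IsDesign N ν lam Λ c K R κ t h) (s : ℝ) (m : M) :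
    0 ≤ localMass N K h s m := localMass_nonneg d.kernel d.h_pos s m

theorem ker_nonneg (d : IsDesign N ν lam Λ c K R κ t h) (u : ℝ) : 0 ≤ scaledKernel K h u :=
  scaledKernel_nonneg d.kernel d.h_pos u

/-- Two windows add up: `u` lies within `R h` of `s`, and `s` within `R h` of `t`. This is the
reason for the radius `2 R h` in `lam_ge`. -/
theorem mean_ge [IsProbabilityMeasure ν] (d : IsDesign N ν lam Λ c K R κ t h) {s : ℝ}
    (hs : scaledKernel K h (s - t) ≠ 0) : κ ≤ ∫ m, localMass N K h s m ∂ν := by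
  have := d.sfinite
  refine le_integral_localMass d.process d.kernel d.h_pos d.h_le d.support fun u hu => ?_
  refine d.lam_ge u ?_
  have h1 := abs_sub_le_of_scaledKernel_ne_zero d.support d.h_pos hs
  calc |u - t| = |(u - s) + (s - t)| := by ring_nf
    _ ≤ |u - s| + |s - t| := abs_add_le _ _
    _ ≤ 2 * (R * h) := by linarith

theorem theta_pos (d : IsDesign N ν lam Λ c K R κ t h) (hn : 2 ≤ n) : 0 < ((n : ℝ) - 1) * κ := by
  have : (2 : ℝ) ≤ n := by exact_mod_cast hn
  exact mul_pos (by linarith) d.κ_pos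

theorem theta_le [IsProbabilityMeasure ν] (d : IsDesign N ν lam Λ c K R κ t h) (hn : 2 ≤ n) {s : ℝ}
    (hs : scaledKernel K h (s - t) ≠ 0) :
    ((n : ℝ) - 1) * κ ≤ (n - 1) * ∫ m, localMass N K h s m ∂ν := by
  have : (2 : ℝ) ≤ n := by exact_mod_cast hn
  exact mul_le_mul_of_nonneg_left (d.mean_ge hs) (by linarith)

theorem sum_erase_le [IsProbabilityMeasure ν] (d : IsDesign N ν lam Λ c K R κ t h) (hn : 2 ≤ n)
    {s : ℝ} (hs : scaledKernel K h (s - t) ≠ 0) (i : Fin n) (m : Fin n → M) :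
    ∑ j ∈ Finset.univ.erase i,
        (localMass N K h s (m j) / ∑ k, localMass N K h s (m k)) ^ 2
      ≤ looBound N ν K h κ i s m := by
  unfold looBound
  exact sum_erase_div_sq_le (fun j => localMass N K h s (m j)) (fun j => d.mass_nonneg s (m j)) i
    (d.theta_pos hn) (d.theta_le hn hs)

theorem one_le [IsProbabilityMeasure ν] (d : IsDesign N ν lam Λ c K R κ t h) (hn : 2 ≤ n)
    {s : ℝ} (hs : scaledKernel K h (s - t) ≠ 0) (i : Fin n) (m : Fin n → M)
    (h0 : ∑ k, localMass N K h s (m k) = 0) : 1 ≤ looBound N ν K h κ i s m := by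
  unfold looBound
  exact one_le_of_sum_eq_zero (fun j => localMass N K h s (m j)) (fun j => d.mass_nonneg s (m j)) i
    (d.theta_pos hn) (d.theta_le hn hs) h0

theorem div_le [IsProbabilityMeasure ν] (d : IsDesign N ν lam Λ c K R κ t h) (hn : 2 ≤ n)
    {s : ℝ} (hs : scaledKernel K h (s - t) ≠ 0) (i : Fin n) (m : Fin n → M) :
    localMass N K h s (m i) / ∑ k, localMass N K h s (m k)
      ≤ looBound N ν K h κ i s m + 4 / (n * κ) * localMass N K h s (m i) := by
  refine (div_sum_le (fun j => localMass N K h s (m j)) (fun j => d.mass_nonneg s (m j)) i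
    (d.theta_pos hn) (d.theta_le hn hs)).trans ?_
  unfold looBound
  have h2 : (2 : ℝ) ≤ n := by exact_mod_cast hn
  have hκ := d.κ_pos
  have h3 := d.theta_pos hn
  have h4 := d.mass_nonneg s (m i)
  have : 2 * localMass N K h s (m i) / (((n : ℝ) - 1) * κ)
      ≤ 4 / (n * κ) * localMass N K h s (m i) := by
    rw [div_mul_eq_mul_div, div_le_div_iff₀ h3 (by positivity)]
    nlinarith [mul_nonneg h4 hκ.le]
  linarith

/-- The weight of subject `i` is at most one, so its square is bounded by the weight itself; this is
the origin of the second copy of `looBound`. -/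
theorem sum_sq_le [IsProbabilityMeasure ν] (d : IsDesign N ν lam Λ c K R κ t h) (hn : 2 ≤ n)
    {s : ℝ} (hs : scaledKernel K h (s - t) ≠ 0) (i : Fin n) (m : Fin n → M) :
    ∑ j, (localMass N K h s (m j) / ∑ k, localMass N K h s (m k)) ^ 2
      ≤ 2 * looBound N ν K h κ i s m + 4 / (n * κ) * localMass N K h s (m i) := by
  rw [← Finset.add_sum_erase _ _ (Finset.mem_univ i)]
  have hD : 0 ≤ ∑ k, localMass N K h s (m k) := Finset.sum_nonneg fun k _ => d.mass_nonneg s (m k)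
  have h1 : localMass N K h s (m i) / ∑ k, localMass N K h s (m k) ≤ 1 :=
    div_le_one_of_le₀ (Finset.single_le_sum (f := fun k => localMass N K h s (m k))
      (fun k _ => d.mass_nonneg s (m k)) (Finset.mem_univ i)) hD
  have h2 := div_nonneg (d.mass_nonneg s (m i)) hD
  have h3 := d.div_le hn hs i m
  have h4 := d.sum_erase_le hn hs i m
  nlinarith

theorem lintegral_eval_le [IsProbabilityMeasure ν] {f : M → ENNReal} (hf : Measurable f)
    (i : Fin n) : ∫⁻ m : Fin n → M, f (m i) ∂(Measure.pi fun _ : Fin n => ν) = ∫⁻ y, f y ∂ν := by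
  have h := measurePreserving_eval (fun _ : Fin n => ν) i
  conv_rhs => rw [← h.map_eq]
  rw [lintegral_map hf h.measurable]

theorem measurable_ofReal_looBound [IsProbabilityMeasure ν] (d : IsDesign N ν lam Λ c K R κ t h)
    (i : Fin n) :
    Measurable fun z : ℝ × (Fin n → M) => ENNReal.ofReal (looBound N ν K h κ i z.1 z.2) := by
  have := d.sfinite
  exact (measurable_looBound d.kernel i).ennreal_ofReal

theorem measurable_ofReal_localMass (d : IsDesign N ν lam Λ c K R κ t h) :
    Measurable fun z : ℝ × M => ENNReal.ofReal (localMass N K h z.1 z.2) := by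
  have := d.sfinite
  exact (measurable_localMass d.kernel).ennreal_ofReal

theorem ofReal_integral_loo [IsProbabilityMeasure ν] (d : IsDesign N ν lam Λ c K R κ t h)
    (i : Fin n) {α β γ : ℝ} (hα : 0 ≤ α) (hβ : 0 ≤ β) (hγ : 0 ≤ γ) (m : Fin n → M) :
    ENNReal.ofReal (∫ s, scaledKernel K h (s - t)
        * (α * looBound N ν K h κ i s m + β * localMass N K h s (m i) + γ) ∂(N (m i)))
      = ENNReal.ofReal α * (∫⁻ s, ENNReal.ofReal (scaledKernel K h (s - t))
          * ENNReal.ofReal (looBound N ν K h κ i s m) ∂(N (m i)))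
        + ENNReal.ofReal β * (∫⁻ s, ENNReal.ofReal (scaledKernel K h (s - t))
          * ENNReal.ofReal (localMass N K h s (m i)) ∂(N (m i)))
        + ENNReal.ofReal γ * ∫⁻ s, ENNReal.ofReal (scaledKernel K h (s - t)) ∂(N (m i)) := by
  have hΦ0 := fun s => looBound_nonneg (N := N) (ν := ν) (K := K) (h := h) (κ := κ) i s m
  have ha0 := fun s => d.mass_nonneg s (m i)
  have hm1 : Measurable fun s => ENNReal.ofReal (looBound N ν K h κ i s m) :=
    (d.measurable_ofReal_looBound i).comp (measurable_prodMk_right (y := m))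
  have hm2 : Measurable fun s => ENNReal.ofReal (localMass N K h s (m i)) :=
    d.measurable_ofReal_localMass.comp (measurable_prodMk_right (y := m i))
  rw [ofReal_integral_eq_lintegral_ofReal ((d.process.point _).integrable _)
    (ae_of_all _ fun s => mul_nonneg (d.ker_nonneg _) (add_nonneg (add_nonneg
      (mul_nonneg hα (hΦ0 s)) (mul_nonneg hβ (ha0 s))) hγ))]
  rw [← lintegral_mul_affine (measurable_ofReal_scaledKernel_sub d.kernel t) hm1 hm2]
  refine lintegral_congr fun s => ?_
  rw [ENNReal.ofReal_mul (d.ker_nonneg _), ENNReal.ofReal_add (add_nonneg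
      (mul_nonneg hα (hΦ0 s)) (mul_nonneg hβ (ha0 s))) hγ,
    ENNReal.ofReal_add (mul_nonneg hα (hΦ0 s)) (mul_nonneg hβ (ha0 s)),
    ENNReal.ofReal_mul hα, ENNReal.ofReal_mul hβ]

/-- Expected kernel average, over the points of subject `i`, of the leave-one-out bound. -/
theorem lintegral_loo_le [IsProbabilityMeasure ν] (d : IsDesign N ν lam Λ c K R κ t h) (hn : 2 ≤ n)
    (i : Fin n) {α β γ : ℝ} (hα : 0 ≤ α) (hβ : 0 ≤ β) (hγ : 0 ≤ γ) :
    ∫⁻ m, ENNReal.ofReal (∫ s, scaledKernel K h (s - t) * (α * looBound N ν K h κ i s m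
        + β * localMass N K h s (m i) + γ) ∂(N (m i))) ∂(Measure.pi fun _ : Fin n => ν)
      ≤ ENNReal.ofReal (α * (Λ * (16 * sqConst Λ c K / κ ^ 2)) / (n * h)
        + β * (Λ * K 0 + c) / h + γ * Λ) := by
  have := d.sfinite
  have hK := d.kernel
  have hh := d.h_pos
  have hC := d.sqConst_nonneg
  have hΛ := d.process.Λ_nonneg
  have hκ := d.κ_pos
  have hn0 : (0 : ℝ) < n := by exact_mod_cast (by omega : 0 < n)
  have hK0 := hK.nonneg 0
  have hc := d.process.c_nonneg
  set k : ℝ → ENNReal := fun s => ENNReal.ofReal (scaledKernel K h (s - t)) with hk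
  have hkm : Measurable k := measurable_ofReal_scaledKernel_sub hK t
  have hΦm := d.measurable_ofReal_looBound (n := n) i
  have ham := d.measurable_ofReal_localMass
  have hM1 : Measurable fun m : Fin n → M =>
      ∫⁻ s, k s * ENNReal.ofReal (looBound N ν K h κ i s m) ∂(N (m i)) :=
    measurable_lintegral_kernel N
      (f := fun (m : Fin n → M) s => k s * ENNReal.ofReal (looBound N ν K h κ i s m))
      ((hkm.comp measurable_snd).mul (hΦm.comp measurable_swap)) (measurable_pi_apply i)
  have hM2' : Measurable fun y : M => ∫⁻ s, k s * ENNReal.ofReal (localMass N K h s y) ∂(N y) :=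
    measurable_lintegral_kernel N
      (f := fun (y : M) s => k s * ENNReal.ofReal (localMass N K h s y))
      ((hkm.comp measurable_snd).mul (ham.comp measurable_swap)) measurable_id
  have hM2 : Measurable fun m : Fin n → M =>
      ∫⁻ s, k s * ENNReal.ofReal (localMass N K h s (m i)) ∂(N (m i)) :=
    hM2'.comp (measurable_pi_apply i)
  have hM3' : Measurable fun y : M => ∫⁻ s, k s ∂(N y) :=
    measurable_lintegral_kernel N (f := fun (_ : M) s => k s)
      (hkm.comp measurable_snd) measurable_id
  have hM3 : Measurable fun m : Fin n → M => ∫⁻ s, k s ∂(N (m i)) :=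
    hM3'.comp (measurable_pi_apply i)
  have hmassle : ∫⁻ y, ∫⁻ s, k s ∂(N y) ∂ν ≤ ENNReal.ofReal Λ := by
    refine (d.process.campbell_le hkm).trans ?_
    rw [hk, lintegral_scaledKernel hK hh, mul_one]
  -- The bound is independent of the points of subject `i`, so the expectations multiply: a kernel
  -- mass of at most `Λ` times `O(1/(nh))`.
  have hE1 : ∫⁻ m, ∫⁻ s, k s * ENNReal.ofReal (looBound N ν K h κ i s m) ∂(N (m i))
      ∂(Measure.pi fun _ : Fin n => ν)
      ≤ ENNReal.ofReal (Λ * (16 * sqConst Λ c K / κ ^ 2 / (n * h))) := by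
    refine (lintegral_points_mul_loo_le i (g := fun s _ => k s) (hkm.comp measurable_fst)
      (Φ := fun s m => ENNReal.ofReal (looBound N ν K h κ i s m)) hΦm
      (fun s m y => by rw [looBound_update])
      (fun s _ _ => lintegral_looBound_le d.process hK hh d.h_le hκ hn i s)).trans ?_
    rw [ENNReal.ofReal_mul hΛ]
    exact mul_le_mul' hmassle le_rfl
  -- Here both factors come from the same subject. The mass seen from one of its own points has
  -- order `1/h`; it will carry a coefficient of order `1/n`.
  have hE2 : ∫⁻ m : Fin n → M, ∫⁻ s, k s * ENNReal.ofReal (localMass N K h s (m i)) ∂(N (m i))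
      ∂(Measure.pi fun _ : Fin n => ν) ≤ ENNReal.ofReal ((Λ * K 0 + c) / h) := by
    rw [lintegral_eval_le hM2' i]
    exact lintegral_scaledKernel_mul_localMass_le d.process hK hh d.h_le t
  have hE3 : ∫⁻ m : Fin n → M, ∫⁻ s, k s ∂(N (m i)) ∂(Measure.pi fun _ : Fin n => ν)
      ≤ ENNReal.ofReal Λ := by
    rw [lintegral_eval_le hM3' i]; exact hmassle
  simp_rw [d.ofReal_integral_loo i hα hβ hγ]
  rw [lintegral_add_right _ (hM3.const_mul _), lintegral_add_right _ (hM2.const_mul _),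
    lintegral_const_mul _ hM1, lintegral_const_mul _ hM2,
    lintegral_const_mul _ hM3]
  refine (add_le_add (add_le_add (mul_le_mul' le_rfl hE1) (mul_le_mul' le_rfl hE2))
    (mul_le_mul' le_rfl hE3)).trans ?_
  rw [← ENNReal.ofReal_mul hα, ← ENNReal.ofReal_mul hβ, ← ENNReal.ofReal_mul hγ,
    ← ENNReal.ofReal_add (by positivity) (by positivity),
    ← ENNReal.ofReal_add (by positivity) (by positivity)]
  refine ENNReal.ofReal_le_ofReal (le_of_eq ?_)
  ring

/-- The same average weighted by the local mass of subject `i`. -/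
theorem lintegral_mass_mul_loo_le [IsProbabilityMeasure ν] (d : IsDesign N ν lam Λ c K R κ t h)
    (hn : 2 ≤ n) (i : Fin n) {α γ : ℝ} (hα : 0 ≤ α) (hγ : 0 ≤ γ) :
    ∫⁻ m, ENNReal.ofReal (localMass N K h t (m i) * ∫ s, scaledKernel K h (s - t)
        * (α * looBound N ν K h κ i s m + γ) ∂(N (m i))) ∂(Measure.pi fun _ : Fin n => ν)
      ≤ ENNReal.ofReal (sqConst Λ c K / h
        * (α * (16 * sqConst Λ c K / κ ^ 2) / (n * h) + γ)) := by
  have := d.sfinite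
  have hK := d.kernel
  have hh := d.h_pos
  have hC := d.sqConst_nonneg
  have hκ := d.κ_pos
  have hn0 : (0 : ℝ) < n := by exact_mod_cast (by omega : 0 < n)
  set k : ℝ → ENNReal := fun s => ENNReal.ofReal (scaledKernel K h (s - t)) with hk
  have hkm : Measurable k := measurable_ofReal_scaledKernel_sub hK t
  have hΦm : Measurable fun z : ℝ × (Fin n → M) => ENNReal.ofReal
      (α * looBound N ν K h κ i z.1 z.2 + γ) :=
    (((measurable_looBound hK i).const_mul _).add_const _).ennreal_ofReal
  have hbm : Measurable fun y => ENNReal.ofReal (localMass N K h t y) :=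
    ((measurable_localMass hK).comp (measurable_const.prodMk measurable_id)).ennreal_ofReal
  have hrw : ∀ m : Fin n → M, ENNReal.ofReal (localMass N K h t (m i)
        * ∫ s, scaledKernel K h (s - t) * (α * looBound N ν K h κ i s m + γ) ∂(N (m i)))
      = ∫⁻ s, (ENNReal.ofReal (localMass N K h t (m i)) * k s)
        * ENNReal.ofReal (α * looBound N ν K h κ i s m + γ) ∂(N (m i)) := by
    intro m
    have hΦ0 := fun s => looBound_nonneg (N := N) (ν := ν) (K := K) (h := h) (κ := κ) i s m
    rw [ENNReal.ofReal_mul (d.mass_nonneg _ _), ofReal_integral_eq_lintegral_ofReal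
      ((d.process.point _).integrable _) (ae_of_all _ fun s => mul_nonneg (d.ker_nonneg _)
        (add_nonneg (mul_nonneg hα (hΦ0 s)) hγ)), ← lintegral_const_mul']
    · refine lintegral_congr fun s => ?_
      rw [ENNReal.ofReal_mul (d.ker_nonneg _), mul_assoc]
    · exact ENNReal.ofReal_ne_top
  simp_rw [hrw]
  refine (lintegral_points_mul_loo_le i
    (g := fun s y => ENNReal.ofReal (localMass N K h t y) * k s)
    ((hbm.comp measurable_snd).mul (hkm.comp measurable_fst))
    (Φ := fun s m => ENNReal.ofReal (α * looBound N ν K h κ i s m + γ)) hΦm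
    (fun s m y => by rw [looBound_update])
    (A := ENNReal.ofReal (α * (16 * sqConst Λ c K / κ ^ 2) / (n * h) + γ))
    (fun s _ _ => ?_)).trans ?_
  · have hm : Measurable fun m => ENNReal.ofReal (looBound N ν K h κ i s m) :=
      ((measurable_looBound hK i).comp (measurable_const.prodMk measurable_id)).ennreal_ofReal
    have h1 : ∀ m, ENNReal.ofReal (α * looBound N ν K h κ i s m + γ)
        = ENNReal.ofReal α * ENNReal.ofReal (looBound N ν K h κ i s m) + ENNReal.ofReal γ := by
      intro m
      rw [ENNReal.ofReal_add (mul_nonneg hα (looBound_nonneg i s m)) hγ, ENNReal.ofReal_mul hα]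
    simp_rw [h1]
    rw [lintegral_add_right _ measurable_const, lintegral_const_mul _ hm]
    refine (add_le_add (mul_le_mul' le_rfl
      (lintegral_looBound_le d.process hK hh d.h_le hκ hn i s)) le_rfl).trans ?_
    rw [lintegral_const, measure_univ, mul_one, ← ENNReal.ofReal_mul hα]
    change ENNReal.ofReal (α * (16 * sqConst Λ c K / κ ^ 2 / (n * h))) + _ ≤ _
    rw [← ENNReal.ofReal_add (by positivity) hγ]
    exact ENNReal.ofReal_le_ofReal (le_of_eq (by ring))
  · rw [ENNReal.ofReal_mul (by positivity)]
    refine mul_le_mul' ?_ le_rfl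
    -- Integrating the kernel over the points of subject `i` reproduces its local mass at `t`, so
    -- the first factor is the second moment of that mass.
    refine le_trans (le_of_eq ?_) (lintegral_localMass_sq_le d.process hK hh d.h_le t)
    refine lintegral_congr fun y => ?_
    rw [lintegral_const_mul _ hkm, sq, ENNReal.ofReal_mul (d.mass_nonneg _ _)]
    congr 1
    exact (ofReal_localMass d.process.point hK hh t y).symm

end IsDesign

end Design

/-! ### Exchange of integrals with point measures -/

section Swap

variable {X : Type*} [MeasurableSpace X] {μ : Measure X} {ρ : Measure ℝ}

theorem IsPointMeasure.integrable_integral (hρ : IsPointMeasure ρ) {f : ℝ → X → ℝ}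
    (hf : ∀ s, Integrable (f s) μ) : Integrable (fun x => ∫ s, f s x ∂ρ) μ := by
  obtain ⟨L, T, rfl⟩ := hρ
  simp only [integral_range_dirac]
  exact integrable_finsetSum _ fun j _ => hf _

/-- Only a finite sum is exchanged with an integral, so joint measurability plays no role. -/
theorem IsPointMeasure.integral_integral_swap (hρ : IsPointMeasure ρ) {f : ℝ → X → ℝ}
    (hf : ∀ s, Integrable (f s) μ) :
    ∫ x, ∫ s, f s x ∂ρ ∂μ = ∫ s, ∫ x, f s x ∂μ ∂ρ := by
  obtain ⟨L, T, rfl⟩ := hρ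
  simp only [integral_range_dirac]
  exact integral_finsetSum _ fun j _ => hf _

theorem IsPointMeasure.integral_mono (hρ : IsPointMeasure ρ) {f g : ℝ → ℝ} (hfg : ∀ s, f s ≤ g s) :
    ∫ s, f s ∂ρ ≤ ∫ s, g s ∂ρ :=
  MeasureTheory.integral_mono (hρ.integrable f) (hρ.integrable g) hfg

theorem lintegral_ofReal_average_le {n : ℕ} (hn : 0 < n) {F : Fin n → X → ℝ}
    (hF : ∀ i x, 0 ≤ F i x) (hm : ∀ i, Measurable (F i)) {B : ℝ}
    (hB : ∀ i, ∫⁻ x, ENNReal.ofReal (F i x) ∂μ ≤ ENNReal.ofReal B) :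
    ∫⁻ x, ENNReal.ofReal ((n : ℝ)⁻¹ * ∑ i, F i x) ∂μ ≤ ENNReal.ofReal B := by
  have hn' : (0 : ℝ) < n := by exact_mod_cast hn
  have h1 : ∀ x, ENNReal.ofReal ((n : ℝ)⁻¹ * ∑ i, F i x)
      = ENNReal.ofReal (n : ℝ)⁻¹ * ∑ i, ENNReal.ofReal (F i x) := by
    intro x
    rw [ENNReal.ofReal_mul (by positivity), ENNReal.ofReal_sum_of_nonneg fun i _ => hF i x]
  simp_rw [h1]
  rw [lintegral_const_mul _ (Finset.measurable_fun_sum _ fun i _ => (hm i).ennreal_ofReal),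
    lintegral_finsetSum _ fun i _ => (hm i).ennreal_ofReal]
  refine (mul_le_mul' le_rfl (Finset.sum_le_sum fun i _ => hB i)).trans ?_
  rw [Finset.sum_const, Finset.card_univ, Fintype.card_fin, nsmul_eq_mul, ← mul_assoc,
    ← ENNReal.ofReal_natCast n, ← ENNReal.ofReal_mul (by positivity), inv_mul_cancel₀ hn'.ne',
    ENNReal.ofReal_one, one_mul]

end Swap

/-! ### Noise and bias of the kernel estimate of a mean -/

section Smoother

variable {E M : Type*} [MeasurableSpace E] [MeasurableSpace M] {n : ℕ}

/-- A bounded Lipschitz function. -/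
structure IsSmoothMean (g : ℝ → ℝ) (ℓ B : ℝ) : Prop where
  measurable : Measurable g
  abs_le : ∀ s, |g s| ≤ B
  lipschitz : ∀ u s, |g u - g s| ≤ ℓ * |u - s|

theorem IsSmoothMean.B_nonneg {g : ℝ → ℝ} {ℓ B : ℝ} (hg : IsSmoothMean g ℓ B) : 0 ≤ B :=
  (abs_nonneg _).trans (hg.abs_le 0)

theorem IsSmoothMean.ℓ_nonneg {g : ℝ → ℝ} {ℓ B : ℝ} (hg : IsSmoothMean g ℓ B) : 0 ≤ ℓ := by
  have := (abs_nonneg _).trans (hg.lipschitz 1 0)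
  simpa using this

/-- Error at `s` of the kernel estimate of the mean `g` of the process `W + g`. -/
noncomputable def nwDev (N : Kernel M ℝ) (K : ℝ → ℝ) (h : ℝ) (W : ℝ → E → ℝ) (g : ℝ → ℝ) (s : ℝ)
    (x : Fin n → E) (m : Fin n → M) : ℝ :=
  (∑ k, localMass N K h s (m k))⁻¹
    * ∑ j, ∫ u, scaledKernel K h (u - s) * (W u (x j) + g u) ∂(N (m j)) - g s

/-- The stochastic part of the error. -/
noncomputable def nwNoise (N : Kernel M ℝ) (K : ℝ → ℝ) (h : ℝ) (W : ℝ → E → ℝ) (s : ℝ)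
    (x : Fin n → E) (m : Fin n → M) : ℝ :=
  ∑ j, ∫ u, (∑ k, localMass N K h s (m k))⁻¹ * scaledKernel K h (u - s) * W u (x j) ∂(N (m j))

/-- The bias part of the error, which depends on the observation times only. -/
noncomputable def nwBias (N : Kernel M ℝ) (K : ℝ → ℝ) (h : ℝ) (g : ℝ → ℝ) (s : ℝ)
    (m : Fin n → M) : ℝ :=
  (∑ k, localMass N K h s (m k))⁻¹
    * ∑ j, ∫ u, scaledKernel K h (u - s) * g u ∂(N (m j)) - g s

variable {P : Measure E} [IsProbabilityMeasure P]
  {N : Kernel M ℝ} {ν : Measure M} {lam : ℝ → ℝ} {Λ c : ℝ} {K : ℝ → ℝ} {R κ t h : ℝ}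
  {W U : ℝ → E → ℝ} {g : ℝ → ℝ} {C C' ℓ B : ℝ}

/-- Also valid for an empty window: the inverse of zero is zero, so the noise vanishes and the bias
equals `-g s`. -/
theorem nwDev_eq {E : Type*} {W : ℝ → E → ℝ} (hN : ∀ m, IsPointMeasure (N m)) (s : ℝ) (x : Fin n → E) (m : Fin n → M) :
    nwDev N K h W g s x m = nwNoise N K h W s x m + nwBias N K h g s m := by
  unfold nwDev nwNoise nwBias
  have h1 : ∀ j, ∫ u, scaledKernel K h (u - s) * (W u (x j) + g u) ∂(N (m j))
      = ∫ u, scaledKernel K h (u - s) * W u (x j) ∂(N (m j))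
        + ∫ u, scaledKernel K h (u - s) * g u ∂(N (m j)) := by
    intro j
    rw [← integral_add ((hN _).integrable _) ((hN _).integrable _)]
    simp only [mul_add]
  simp_rw [h1, mul_assoc, integral_const_mul]
  rw [Finset.sum_add_distrib, ← Finset.mul_sum]
  ring

theorem measurable_nwDev [IsSFiniteKernel N] (hK : IsKernel K)
    (hW : Measurable fun z : ℝ × E => W z.1 z.2) (hg : Measurable g) :
    Measurable fun z : ℝ × (Fin n → E) × (Fin n → M) => nwDev N K h W g z.1 z.2.1 z.2.2 := by
  unfold nwDev
  have h1 : ∀ j, Measurable fun z : ℝ × (Fin n → E) × (Fin n → M) =>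
      localMass N K h z.1 (z.2.2 j) := fun j =>
    (measurable_localMass hK).comp (measurable_fst.prodMk
      ((measurable_pi_apply j).comp (measurable_snd.comp measurable_snd)))
  have h2 : ∀ j, Measurable fun z : ℝ × (Fin n → E) × (Fin n → M) =>
      ∫ u, scaledKernel K h (u - z.1) * (W u (z.2.1 j) + g u) ∂(N (z.2.2 j)) := by
    intro j
    refine measurable_integral_kernel N (f := fun (z : ℝ × (Fin n → E) × (Fin n → M)) u =>
      scaledKernel K h (u - z.1) * (W u (z.2.1 j) + g u)) ?_
      ((measurable_pi_apply j).comp (measurable_snd.comp measurable_snd))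
    refine Measurable.mul ?_ (Measurable.add ?_ (hg.comp measurable_snd))
    · exact (measurable_scaledKernel hK).comp
        (measurable_snd.sub (measurable_fst.comp measurable_fst))
    · exact hW.comp (measurable_snd.prodMk ((measurable_pi_apply j).comp
        (measurable_fst.comp (measurable_snd.comp measurable_fst))))
  exact ((Finset.measurable_fun_sum _ fun j _ => h1 j).inv.mul
    (Finset.measurable_fun_sum _ fun j _ => h2 j)).sub (hg.comp measurable_fst)

theorem IsDesign.integral_abs_weight (d : IsDesign N ν lam Λ c K R κ t h) (s : ℝ) (m : Fin n → M)
    (j : Fin n) :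
    ∫ u, |(∑ k, localMass N K h s (m k))⁻¹ * scaledKernel K h (u - s)| ∂(N (m j))
      = localMass N K h s (m j) / ∑ k, localMass N K h s (m k) := by
  have hD : 0 ≤ ∑ k, localMass N K h s (m k) := Finset.sum_nonneg fun k _ => d.mass_nonneg s (m k)
  have h1 : ∀ u, |(∑ k, localMass N K h s (m k))⁻¹ * scaledKernel K h (u - s)|
      = (∑ k, localMass N K h s (m k))⁻¹ * scaledKernel K h (u - s) := fun u =>
    abs_of_nonneg (mul_nonneg (inv_nonneg.2 hD) (d.ker_nonneg _))
  simp_rw [h1]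
  rw [integral_const_mul]
  conv_rhs => rw [localMass]
  rw [div_eq_inv_mul]

theorem IsDesign.memLp_nwNoise (d : IsDesign N ν lam Λ c K R κ t h) (hW : IsCentered P W C) (s : ℝ)
    (m : Fin n → M) :
    MemLp (fun x => nwNoise N K h W s x m) 2 (Measure.pi fun _ : Fin n => P) :=
  memLp_finsetSum _ fun j _ => memLp_eval (hW.memLp_integral (d.process.point (m j)) _) j

/-- Given the times, the subjects contribute independent centered terms. Dependence along a path is
arbitrary, so each subject enters through the square of its total weight. -/
theorem IsDesign.integral_nwNoise_sq_le (d : IsDesign N ν lam Λ c K R κ t h)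
    (hW : IsCentered P W C) (s : ℝ) (m : Fin n → M) :
    ∫ x, nwNoise N K h W s x m ^ 2 ∂(Measure.pi fun _ : Fin n => P)
      ≤ C * ∑ j, (localMass N K h s (m j) / ∑ k, localMass N K h s (m k)) ^ 2 := by
  unfold nwNoise
  rw [integral_sq_sum_eval (fun j y => ∫ u, (∑ k, localMass N K h s (m k))⁻¹
      * scaledKernel K h (u - s) * W u y ∂(N (m j)))
    (fun j => hW.memLp_integral (d.process.point (m j)) _)
    (fun j => hW.mean_integral (d.process.point (m j)) _), Finset.mul_sum]
  refine Finset.sum_le_sum fun j _ => ?_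
  refine (hW.integral_sq_integral_le (d.process.point (m j)) _).trans (le_of_eq ?_)
  rw [d.integral_abs_weight s m j]

/-- If the denominator is positive, the weights sum to one and the bias averages `g u - g s` over
`|u - s| ≤ R h`. If it vanishes, the bias is `-g s`, and the factor `looBound ≥ 1` accounts for it.
A Lipschitz bound is enough because the bias is only ever squared or multiplied by a centered sum.
-/
theorem IsDesign.nwBias_sq_le [IsProbabilityMeasure ν] (d : IsDesign N ν lam Λ c K R κ t h)
    (hg : IsSmoothMean g ℓ B) (hn : 2 ≤ n) {s : ℝ} (hs : scaledKernel K h (s - t) ≠ 0) (i : Fin n)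
    (m : Fin n → M) :
    nwBias N K h g s m ^ 2 ≤ (ℓ * (R * h)) ^ 2 + B ^ 2 * looBound N ν K h κ i s m := by
  have hB := hg.B_nonneg
  have hℓ := hg.ℓ_nonneg
  have hR := d.R_pos
  have hh := d.h_pos
  have hΦ := looBound_nonneg (N := N) (ν := ν) (K := K) (h := h) (κ := κ) i s m
  have hD : 0 ≤ ∑ k, localMass N K h s (m k) := Finset.sum_nonneg fun k _ => d.mass_nonneg s (m k)
  by_cases h0 : ∑ k, localMass N K h s (m k) = 0
  · have h1 := d.one_le hn hs i m h0
    have h2 : nwBias N K h g s m ^ 2 ≤ B ^ 2 := by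
      rw [nwBias, h0]
      simp only [inv_zero, zero_mul, zero_sub, even_two, Even.neg_pow]
      exact sq_le_sq' (by linarith [neg_abs_le (g s), hg.abs_le s])
        ((le_abs_self _).trans (hg.abs_le s))
    nlinarith [sq_nonneg (ℓ * (R * h)), sq_nonneg B]
  · have hDpos : 0 < ∑ k, localMass N K h s (m k) := lt_of_le_of_ne hD (Ne.symm h0)
    have hmass : ∀ y, localMass N K h s y = ∫ u, scaledKernel K h (u - s) ∂(N y) := fun y => by
      rw [localMass]
    have h1 : nwBias N K h g s m = (∑ k, localMass N K h s (m k))⁻¹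
        * ∑ j, ∫ u, scaledKernel K h (u - s) * (g u - g s) ∂(N (m j)) := by
      have h2 : ∀ j, ∫ u, scaledKernel K h (u - s) * (g u - g s) ∂(N (m j))
          = ∫ u, scaledKernel K h (u - s) * g u ∂(N (m j)) - localMass N K h s (m j) * g s := by
        intro j
        rw [hmass, ← integral_mul_const, ← integral_sub ((d.process.point _).integrable _)
          ((d.process.point _).integrable _)]
        simp only [mul_sub]
      simp_rw [h2]
      rw [Finset.sum_sub_distrib, ← Finset.sum_mul, mul_sub, ← mul_assoc, inv_mul_cancel₀ h0,
        one_mul, nwBias]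
    have h3 : |nwBias N K h g s m| ≤ ℓ * (R * h) := by
      rw [h1, abs_mul, abs_of_pos (inv_pos.2 hDpos), inv_mul_le_iff₀ hDpos]
      refine (Finset.abs_sum_le_sum_abs _ _).trans ?_
      rw [Finset.sum_mul]
      refine Finset.sum_le_sum fun j _ => ?_
      refine (abs_integral_le_integral_abs).trans ?_
      rw [hmass, ← integral_mul_const]
      refine (d.process.point _).integral_mono fun u => ?_
      rw [abs_mul, abs_of_nonneg (d.ker_nonneg _)]
      by_cases hu : scaledKernel K h (u - s) = 0
      · simp [hu]
      · refine mul_le_mul_of_nonneg_left ((hg.lipschitz u s).trans ?_) (d.ker_nonneg _)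
        exact mul_le_mul_of_nonneg_left
          (abs_sub_le_of_scaledKernel_ne_zero d.support d.h_pos hu) hℓ
    have h4 : nwBias N K h g s m ^ 2 ≤ (ℓ * (R * h)) ^ 2 := by
      rw [← sq_abs]
      exact pow_le_pow_left₀ (abs_nonneg _) h3 2
    nlinarith [mul_nonneg (sq_nonneg B) hΦ]

theorem IsDesign.memLp_nwDev (d : IsDesign N ν lam Λ c K R κ t h) (hW : IsCentered P W C) (s : ℝ)
    (m : Fin n → M) :
    MemLp (fun x => nwDev N K h W g s x m) 2 (Measure.pi fun _ : Fin n => P) := by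
  simp_rw [nwDev_eq d.process.point]
  exact (d.memLp_nwNoise hW s m).add (memLp_const _)

theorem IsDesign.integral_nwDev_sq_le [IsProbabilityMeasure ν]
    (d : IsDesign N ν lam Λ c K R κ t h) (hW : IsCentered P W C)
    (hg : IsSmoothMean g ℓ B) (hn : 2 ≤ n) {s : ℝ} (hs : scaledKernel K h (s - t) ≠ 0) (i : Fin n)
    (m : Fin n → M) :
    ∫ x, nwDev N K h W g s x m ^ 2 ∂(Measure.pi fun _ : Fin n => P)
      ≤ (4 * C + 2 * B ^ 2) * looBound N ν K h κ i s m
        + 8 * C / κ / n * localMass N K h s (m i) + 2 * (ℓ * (R * h)) ^ 2 := by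
  have hC := hW.nonneg
  have hI := (d.memLp_nwNoise (n := n) hW s m).integrable_sq
  calc ∫ x, nwDev N K h W g s x m ^ 2 ∂(Measure.pi fun _ : Fin n => P)
      ≤ ∫ x, (2 * nwNoise N K h W s x m ^ 2 + 2 * nwBias N K h g s m ^ 2)
        ∂(Measure.pi fun _ : Fin n => P) := by
        refine MeasureTheory.integral_mono (d.memLp_nwDev hW s m).integrable_sq
          ((hI.const_mul 2).add (integrable_const _)) fun x => ?_
        dsimp only
        rw [nwDev_eq d.process.point]
        nlinarith [sq_nonneg (nwNoise N K h W s x m - nwBias N K h g s m)]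
    _ = 2 * ∫ x, nwNoise N K h W s x m ^ 2 ∂(Measure.pi fun _ : Fin n => P)
        + 2 * nwBias N K h g s m ^ 2 := by
        rw [integral_add (hI.const_mul 2) (integrable_const _), integral_const_mul]
        simp
    _ ≤ 2 * (C * (2 * looBound N ν K h κ i s m + 4 / (n * κ) * localMass N K h s (m i)))
        + 2 * ((ℓ * (R * h)) ^ 2 + B ^ 2 * looBound N ν K h κ i s m) := by
        have h1 := (d.integral_nwNoise_sq_le (n := n) hW s m).trans
          (mul_le_mul_of_nonneg_left (d.sum_sq_le hn hs i m) hC)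
        have h2 := d.nwBias_sq_le hg hn hs i m
        linarith
    _ = _ := by
        have hκ := d.κ_pos.ne'
        have : (n : ℝ) ≠ 0 := by
          have : 0 < n := by omega
          exact_mod_cast this.ne'
        field_simp
        ring

end Smoother

/-! ### The average squared centering error -/

section Averages

variable {E M : Type*} [MeasurableSpace E] [MeasurableSpace M] {n : ℕ}

/-- The rate `1 / (n h) + h²`. -/
noncomputable def rate (n : ℕ) (h : ℝ) : ℝ := 1 / (n * h) + h ^ 2

theorem rate_pos {n : ℕ} {h : ℝ} (hn : 0 < n) (hh : 0 < h) : 0 < rate n h := by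
  have : (0 : ℝ) < n := by exact_mod_cast hn
  unfold rate
  positivity

variable {P : Measure E} [IsProbabilityMeasure P]
  {N : Kernel M ℝ} {ν : Measure M} [IsProbabilityMeasure ν]
  {lam : ℝ → ℝ} {Λ c : ℝ} {K : ℝ → ℝ} {R κ t h : ℝ}
  {W U : ℝ → E → ℝ} {g : ℝ → ℝ} {C C' ℓ B : ℝ}

theorem IsDesign.measurable_integral_loo (d : IsDesign N ν lam Λ c K R κ t h) (i : Fin n)
    (α β γ : ℝ) :
    Measurable fun m : Fin n → M => ∫ s, scaledKernel K h (s - t) * (α * looBound N ν K h κ i s m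
      + β * localMass N K h s (m i) + γ) ∂(N (m i)) := by
  have := d.sfinite
  refine measurable_integral_kernel N (f := fun (m : Fin n → M) s => scaledKernel K h (s - t)
    * (α * looBound N ν K h κ i s m + β * localMass N K h s (m i) + γ)) ?_ (measurable_pi_apply i)
  have h1 : Measurable fun z : (Fin n → M) × ℝ => scaledKernel K h (z.2 - t) :=
    (measurable_scaledKernel d.kernel).comp (measurable_snd.sub_const t)
  have h2 : Measurable fun z : (Fin n → M) × ℝ => looBound N ν K h κ i z.2 z.1 :=
    (measurable_looBound d.kernel i).comp measurable_swap
  have h3 : Measurable fun z : (Fin n → M) × ℝ => localMass N K h z.2 (z.1 i) :=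
    (measurable_localMass d.kernel).comp
      (measurable_snd.prodMk ((measurable_pi_apply i).comp measurable_fst))
  exact h1.mul (((h2.const_mul α).add (h3.const_mul β)).add_const γ)

theorem IsDesign.integral_loo_nonneg (d : IsDesign N ν lam Λ c K R κ t h) (i : Fin n)
    {α β γ : ℝ} (hα : 0 ≤ α) (hβ : 0 ≤ β) (hγ : 0 ≤ γ) (m : Fin n → M) :
    0 ≤ ∫ s, scaledKernel K h (s - t) * (α * looBound N ν K h κ i s m
      + β * localMass N K h s (m i) + γ) ∂(N (m i)) :=
  integral_nonneg fun s => mul_nonneg (d.ker_nonneg _) (add_nonneg (add_nonneg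
    (mul_nonneg hα (looBound_nonneg i s m)) (mul_nonneg hβ (d.mass_nonneg s _))) hγ)

/-- In its uses `y` collects the observation marks: the bound is first derived conditionally on them
and then averaged. -/
theorem lintegral_prod_le_of_cond {X Y : Type*} [MeasurableSpace X] [MeasurableSpace Y]
    {μ : Measure X} {ν' : Measure Y} [SFinite μ] [SFinite ν'] {F : X → Y → ℝ} {G : Y → ℝ}
    (hF : Measurable fun z : X × Y => F z.1 z.2) {b : ENNReal}
    (h1 : ∀ y, ∫⁻ x, ENNReal.ofReal (F x y) ∂μ ≤ ENNReal.ofReal (G y))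
    (h2 : ∫⁻ y, ENNReal.ofReal (G y) ∂ν' ≤ b) :
    ∫⁻ z, ENNReal.ofReal (F z.1 z.2) ∂(μ.prod ν') ≤ b := by
  rw [lintegral_prod_symm' _ hF.ennreal_ofReal]
  exact (lintegral_mono h1).trans h2

/-- Kernel average of the squared estimation error over all observations. -/
noncomputable def sqAvg (N : Kernel M ℝ) (K : ℝ → ℝ) (h t : ℝ) (W : ℝ → E → ℝ) (g : ℝ → ℝ)
    (x : Fin n → E) (m : Fin n → M) : ℝ :=
  (n : ℝ)⁻¹ * ∑ i, ∫ s, scaledKernel K h (s - t) * nwDev N K h W g s x m ^ 2 ∂(N (m i))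

theorem measurable_integral_nwDev [IsSFiniteKernel N] (hK : IsKernel K)
    (hW : Measurable fun z : ℝ × E => W z.1 z.2) (hg : Measurable g) (i : Fin n) (k : ℕ)
    {f : ℝ → E → ℝ} (hf : Measurable fun z : ℝ × E => f z.1 z.2) :
    Measurable fun z : (Fin n → E) × (Fin n → M) =>
      ∫ s, f s (z.1 i) * nwDev N K h W g s z.1 z.2 ^ k ∂(N (z.2 i)) := by
  refine measurable_integral_kernel N (f := fun (z : (Fin n → E) × (Fin n → M)) s =>
      f s (z.1 i) * nwDev N K h W g s z.1 z.2 ^ k) ?_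
    ((measurable_pi_apply i).comp measurable_snd)
  have h1 : Measurable fun q : ((Fin n → E) × (Fin n → M)) × ℝ =>
      nwDev N K h W g q.2 q.1.1 q.1.2 :=
    (measurable_nwDev hK hW hg).comp measurable_swap
  have h2 : Measurable fun q : ((Fin n → E) × (Fin n → M)) × ℝ => f q.2 (q.1.1 i) :=
    hf.comp (measurable_snd.prodMk ((measurable_pi_apply i).comp
      (measurable_fst.comp measurable_fst)))
  exact h2.mul (h1.pow_const k)

theorem measurable_sqAvg [IsSFiniteKernel N] (hK : IsKernel K)
    (hW : Measurable fun z : ℝ × E => W z.1 z.2) (hg : Measurable g) :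
    Measurable fun z : (Fin n → E) × (Fin n → M) => sqAvg N K h t W g z.1 z.2 := by
  unfold sqAvg
  refine (Finset.measurable_fun_sum _ fun i _ => ?_).const_mul _
  exact measurable_integral_nwDev hK hW hg i 2 (f := fun s _ => scaledKernel K h (s - t))
    ((measurable_scaledKernel hK).comp (measurable_fst.sub_const t))

/-- Conditionally on the observation times, the expected average squared error. -/
theorem IsDesign.lintegral_sqAvg_cond_le (d : IsDesign N ν lam Λ c K R κ t h)
    (hW : IsCentered P W C) (hg : IsSmoothMean g ℓ B) (hn : 2 ≤ n) (m : Fin n → M) :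
    ∫⁻ x, ENNReal.ofReal (sqAvg N K h t W g x m) ∂(Measure.pi fun _ : Fin n => P)
      ≤ ENNReal.ofReal ((n : ℝ)⁻¹ * ∑ i, ∫ s, scaledKernel K h (s - t)
        * ((4 * C + 2 * B ^ 2) * looBound N ν K h κ i s m + 8 * C / κ / n * localMass N K h s (m i)
          + 2 * (ℓ * (R * h)) ^ 2) ∂(N (m i))) := by
  have hI : ∀ s, Integrable (fun x : Fin n → E => scaledKernel K h (s - t)
      * nwDev N K h W g s x m ^ 2) (Measure.pi fun _ : Fin n => P) := fun s =>
    ((d.memLp_nwDev hW s m).integrable_sq).const_mul _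
  have hI2 := fun i => (d.process.point (m i)).integrable_integral hI
  unfold sqAvg
  rw [← ofReal_integral_eq_lintegral_ofReal]
  rotate_left
  · exact (integrable_finsetSum _ fun i _ => hI2 i).const_mul _
  · refine ae_of_all _ fun x => mul_nonneg (by positivity) (Finset.sum_nonneg fun i _ => ?_)
    exact integral_nonneg fun s => mul_nonneg (d.ker_nonneg _) (sq_nonneg _)
  refine ENNReal.ofReal_le_ofReal ?_
  rw [integral_const_mul, integral_finsetSum _ fun i _ => hI2 i]
  refine mul_le_mul_of_nonneg_left (Finset.sum_le_sum fun i _ => ?_) (by positivity)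
  rw [(d.process.point (m i)).integral_integral_swap hI]
  refine (d.process.point (m i)).integral_mono fun s => ?_
  rw [integral_const_mul]
  by_cases hs : scaledKernel K h (s - t) = 0
  · simp [hs]
  · exact mul_le_mul_of_nonneg_left (d.integral_nwDev_sq_le hW hg hn hs i m) (d.ker_nonneg _)

/-- The expected kernel average of the squared error is of the order `1 / (n h) + h²`. -/
theorem exists_lintegral_sqAvg_le (P : Measure E) [IsProbabilityMeasure P] (ν : Measure M)
    [IsProbabilityMeasure ν] (N : Kernel M ℝ) (lam : ℝ → ℝ) (Λ c : ℝ) (K : ℝ → ℝ) (R κ t : ℝ)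
    (hW : IsCentered P W C) (hg : IsSmoothMean g ℓ B) :
    ∃ A : ℝ, 0 ≤ A ∧ ∀ (n : ℕ) (h : ℝ), 2 ≤ n → IsDesign N ν lam Λ c K R κ t h →
      ∫⁻ z : (Fin n → E) × (Fin n → M), ENNReal.ofReal (sqAvg N K h t W g z.1 z.2)
        ∂((Measure.pi fun _ : Fin n => P).prod (Measure.pi fun _ : Fin n => ν))
      ≤ ENNReal.ofReal (A * rate n h) := by
  have hC := hW.nonneg
  -- The two summands are the coefficients of `1/(nh)` and `h²`. The constant is fixed before any
  -- design is given, so the signs of `Λ`, `c` and `κ` are still unknown; hence the absolute values.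
  refine ⟨|(4 * C + 2 * B ^ 2) * (Λ * (16 * IsDesign.sqConst Λ c K / κ ^ 2))
    + 8 * C / κ * (Λ * K 0 + c)| + |2 * (ℓ * R) ^ 2 * Λ|, by positivity, fun n h hn d => ?_⟩
  have := d.sfinite
  have hκ := d.κ_pos
  have hh := d.h_pos
  have hn0 : (0 : ℝ) < n := by exact_mod_cast (by omega : 0 < n)
  have hα : 0 ≤ 4 * C + 2 * B ^ 2 := by positivity
  have hβ : 0 ≤ 8 * C / κ / n := by positivity
  have hγ : 0 ≤ 2 * (ℓ * (R * h)) ^ 2 := by positivity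
  refine lintegral_prod_le_of_cond (measurable_sqAvg d.kernel hW.measurable hg.measurable)
    (d.lintegral_sqAvg_cond_le hW hg hn) ?_
  refine lintegral_ofReal_average_le (by omega) (fun i m => d.integral_loo_nonneg i hα hβ hγ m)
    (fun i => d.measurable_integral_loo i _ _ _) fun i => ?_
  refine (d.lintegral_loo_le hn i hα hβ hγ).trans (ENNReal.ofReal_le_ofReal ?_)
  set a₁ := (4 * C + 2 * B ^ 2) * (Λ * (16 * IsDesign.sqConst Λ c K / κ ^ 2))
    + 8 * C / κ * (Λ * K 0 + c) with ha₁
  set a₂ := 2 * (ℓ * R) ^ 2 * Λ with ha₂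
  calc _ = a₁ * (1 / (n * h)) + a₂ * h ^ 2 := by
        rw [ha₁, ha₂]; field_simp
    _ ≤ |a₁| * (1 / (n * h)) + |a₂| * h ^ 2 := by
        gcongr
        · exact le_abs_self _
        · exact le_abs_self _
    _ ≤ (|a₁| + |a₂|) * rate n h := by
        unfold rate
        have : 0 ≤ 1 / (n * h) := by positivity
        nlinarith [abs_nonneg a₁, abs_nonneg a₂, sq_nonneg h,
          mul_nonneg (abs_nonneg a₁) (sq_nonneg h), mul_nonneg (abs_nonneg a₂) this]

end Averages

/-! ### Products of a centered process and the centering error -/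

section Cross

variable {E M : Type*} [MeasurableSpace E] [MeasurableSpace M] {n : ℕ}

/-- Kernel average of the product of a centered process and the estimation error. -/
noncomputable def crossAvg (N : Kernel M ℝ) (K : ℝ → ℝ) (h : ℝ) (w : ℝ → ℝ) (U W : ℝ → E → ℝ)
    (g : ℝ → ℝ) (x : Fin n → E) (m : Fin n → M) : ℝ :=
  (n : ℝ)⁻¹ * ∑ i, ∫ s, w s * U s (x i) * nwDev N K h W g s x m ∂(N (m i))

/-- The coefficient of `U(s) W(u)` in `crossAvg`. -/
noncomputable def crossWeight (N : Kernel M ℝ) (K : ℝ → ℝ) (h : ℝ) (w : ℝ → ℝ) (m : Fin n → M)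
    (s u : ℝ) : ℝ :=
  (n : ℝ)⁻¹ * w s * ((∑ k, localMass N K h s (m k))⁻¹ * scaledKernel K h (u - s))

variable {P : Measure E} [IsProbabilityMeasure P]
  {N : Kernel M ℝ} {ν : Measure M} [IsProbabilityMeasure ν]
  {lam : ℝ → ℝ} {Λ c : ℝ} {K : ℝ → ℝ} {R κ t h : ℝ}
  {W U : ℝ → E → ℝ} {g w : ℝ → ℝ} {C C' ℓ B b : ℝ}

/-- The split of the error into noise and bias exhibits three parts: pairs within one subject, a
degenerate form in distinct subjects, and a part linear in `U` whose coefficients depend on the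
times only. -/
theorem crossAvg_eq (hN : ∀ m, IsPointMeasure (N m)) (x : Fin n → E) (m : Fin n → M) :
    crossAvg N K h w U W g x m
      = ∑ i, pairForm U W (N (m i)) (N (m i)) (crossWeight N K h w m) (x i) (x i)
        + ∑ z ∈ (Finset.univ : Finset (Fin n)).offDiag,
          pairForm U W (N (m z.1)) (N (m z.2)) (crossWeight N K h w m) (x z.1) (x z.2)
        + ∑ i, ∫ s, ((n : ℝ)⁻¹ * w s * nwBias N K h g s m) * U s (x i) ∂(N (m i)) := by
  have hpair : ∑ i, ∑ j, pairForm U W (N (m i)) (N (m j)) (crossWeight N K h w m) (x i) (x j)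
      = ∑ i, pairForm U W (N (m i)) (N (m i)) (crossWeight N K h w m) (x i) (x i)
        + ∑ z ∈ (Finset.univ : Finset (Fin n)).offDiag,
          pairForm U W (N (m z.1)) (N (m z.2)) (crossWeight N K h w m) (x z.1) (x z.2) := by
    rw [← Finset.sum_product', ← Finset.diag_union_offDiag,
      Finset.sum_union (Finset.disjoint_diag_offDiag _), Finset.sum_diag]
  rw [← hpair, ← Finset.sum_add_distrib, crossAvg, Finset.mul_sum]
  refine Finset.sum_congr rfl fun i _ => ?_
  simp only [pairForm]
  rw [← integral_finsetSum _ fun j _ => (hN (m i)).integrable _,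
    ← integral_add ((hN (m i)).integrable _) ((hN (m i)).integrable _), ← integral_const_mul]
  refine integral_congr_ae (ae_of_all _ fun s => ?_)
  dsimp only
  rw [nwDev_eq hN, nwNoise]
  have h1 : ∀ j, ∫ u, crossWeight N K h w m s u * (U s (x i) * W u (x j)) ∂(N (m j))
      = ((n : ℝ)⁻¹ * w s * U s (x i)) * ∫ u, (∑ k, localMass N K h s (m k))⁻¹
        * scaledKernel K h (u - s) * W u (x j) ∂(N (m j)) := by
    intro j
    rw [← integral_const_mul]
    refine integral_congr_ae (ae_of_all _ fun u => ?_)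
    simp only [crossWeight]
    ring
  simp_rw [h1]
  rw [← Finset.mul_sum]
  ring

theorem measurable_crossAvg [IsSFiniteKernel N] (hK : IsKernel K) (hw : Measurable w)
    (hU : Measurable fun z : ℝ × E => U z.1 z.2)
    (hW : Measurable fun z : ℝ × E => W z.1 z.2) (hg : Measurable g) :
    Measurable fun z : (Fin n → E) × (Fin n → M) => crossAvg N K h w U W g z.1 z.2 := by
  unfold crossAvg
  refine (Finset.measurable_fun_sum _ fun i _ => ?_).const_mul _
  have := measurable_integral_nwDev (N := N) (h := h) hK hW hg i 1 (f := fun s y => w s * U s y)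
    ((hw.comp measurable_fst).mul hU)
  simpa only [pow_one] using this

theorem integral_abs_mul_le {f f' : E → ℝ} (hf : MemLp f 2 P) (hf' : MemLp f' 2 P)
    (h1 : ∫ y, f y ^ 2 ∂P ≤ C) (h2 : ∫ y, f' y ^ 2 ∂P ≤ C') :
    ∫ y, |f y * f' y| ∂P ≤ (C + C') / 2 := by
  have hi := hf.integrable_mul hf'
  calc ∫ y, |f y * f' y| ∂P ≤ ∫ y, (f y ^ 2 + f' y ^ 2) / 2 ∂P := by
        refine integral_mono hi.abs ((hf.integrable_sq.add hf'.integrable_sq).div_const 2)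
          fun y => ?_
        change |f y * f' y| ≤ (f y ^ 2 + f' y ^ 2) / 2
        rw [abs_mul]
        nlinarith [sq_nonneg (|f y| - |f' y|), sq_abs (f y), sq_abs (f' y)]
    _ = (∫ y, f y ^ 2 ∂P + ∫ y, f' y ^ 2 ∂P) / 2 := by
        rw [integral_div, integral_add hf.integrable_sq hf'.integrable_sq]
    _ ≤ (C + C') / 2 := by linarith

theorem integrable_pairForm_self (hU : IsCentered P U C) (hW : IsCentered P W C') {ρ ρ' : Measure ℝ}
    (hρ : IsPointMeasure ρ) (hρ' : IsPointMeasure ρ') (a : ℝ → ℝ → ℝ) :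
    Integrable (fun y => pairForm U W ρ ρ' a y y) P := by
  refine hρ.integrable_integral fun s => hρ'.integrable_integral fun u => ?_
  exact ((hU.memLp s).integrable_mul (hW.memLp u)).const_mul _

/-- Both factors come from one path and may be dependent, so nothing cancels; with second moments
only, an absolute first moment is what can be bounded. -/
theorem integral_abs_pairForm_self_le (hU : IsCentered P U C) (hW : IsCentered P W C')
    {ρ ρ' : Measure ℝ} (hρ : IsPointMeasure ρ) (hρ' : IsPointMeasure ρ') (a : ℝ → ℝ → ℝ) :
    ∫ y, |pairForm U W ρ ρ' a y y| ∂P ≤ (C + C') / 2 * ∫ s, ∫ u, |a s u| ∂ρ' ∂ρ := by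
  have hi : ∀ s u, Integrable (fun y => |a s u| * |U s y * W u y|) P := fun s u =>
    ((hU.memLp s).integrable_mul (hW.memLp u)).abs.const_mul _
  have hi2 : ∀ s, Integrable (fun y => ∫ u, |a s u| * |U s y * W u y| ∂ρ') P := fun s =>
    hρ'.integrable_integral (hi s)
  calc ∫ y, |pairForm U W ρ ρ' a y y| ∂P
      ≤ ∫ y, ∫ s, ∫ u, |a s u| * |U s y * W u y| ∂ρ' ∂ρ ∂P := by
        refine MeasureTheory.integral_mono (integrable_pairForm_self hU hW hρ hρ' a).abs
          (hρ.integrable_integral hi2) fun y => ?_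
        refine abs_integral_le_integral_abs.trans (hρ.integral_mono fun s => ?_)
        refine abs_integral_le_integral_abs.trans (hρ'.integral_mono fun u => ?_)
        rw [abs_mul]
    _ = ∫ s, ∫ u, |a s u| * ∫ y, |U s y * W u y| ∂P ∂ρ' ∂ρ := by
        rw [hρ.integral_integral_swap hi2]
        refine integral_congr_ae (ae_of_all _ fun s => ?_)
        dsimp only
        rw [hρ'.integral_integral_swap (hi s)]
        simp_rw [integral_const_mul]
    _ ≤ ∫ s, ∫ u, (C + C') / 2 * |a s u| ∂ρ' ∂ρ := by
        refine hρ.integral_mono fun s => hρ'.integral_mono fun u => ?_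
        rw [mul_comm]
        exact mul_le_mul_of_nonneg_right (integral_abs_mul_le (hU.memLp s) (hW.memLp u)
          (hU.sq_le s) (hW.sq_le u)) (abs_nonneg _)
    _ = _ := by simp_rw [integral_const_mul]

theorem IsDesign.integral_abs_crossWeight (d : IsDesign N ν lam Λ c K R κ t h) (m : Fin n → M)
    (s : ℝ) (j : Fin n) :
    ∫ u, |crossWeight N K h w m s u| ∂(N (m j))
      = (n : ℝ)⁻¹ * |w s| * (localMass N K h s (m j) / ∑ k, localMass N K h s (m k)) := by
  rw [← d.integral_abs_weight s m j, ← integral_const_mul]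
  refine integral_congr_ae (ae_of_all _ fun u => ?_)
  simp only [crossWeight]
  rw [abs_mul, abs_mul, abs_of_nonneg (by positivity : (0 : ℝ) ≤ (n : ℝ)⁻¹)]

/-- On the diagonal only the weight that subject `i` receives in its own centering appears. It is
small, since one subject is a small share of the denominator. -/
theorem IsDesign.diag_le (d : IsDesign N ν lam Λ c K R κ t h) (hn : 2 ≤ n)
    (hw : ∀ s, |w s| ≤ b * scaledKernel K h (s - t)) (i : Fin n)
    (m : Fin n → M) :
    ∫ s, ∫ u, |crossWeight N K h w m s u| ∂(N (m i)) ∂(N (m i))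
      ≤ (n : ℝ)⁻¹ * (b * ∫ s, scaledKernel K h (s - t) * (1 * looBound N ν K h κ i s m
        + 4 / κ / n * localMass N K h s (m i) + 0) ∂(N (m i))) := by
  simp_rw [d.integral_abs_crossWeight]
  rw [← mul_assoc, ← integral_const_mul]
  refine (d.process.point _).integral_mono fun s => ?_
  by_cases hs : scaledKernel K h (s - t) = 0
  · have h1 : |w s| = 0 := le_antisymm (by simpa [hs] using hw s) (abs_nonneg _)
    simp [hs, h1]
  · have hD : 0 ≤ ∑ k, localMass N K h s (m k) :=
      Finset.sum_nonneg fun k _ => d.mass_nonneg s (m k)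
    have h2 := d.div_le hn hs i m
    have h3 := div_nonneg (d.mass_nonneg s (m i)) hD
    have hb : 0 ≤ b * scaledKernel K h (s - t) := (abs_nonneg _).trans (hw s)
    have h4 : (4 : ℝ) / (n * κ) = 4 / κ / n := by rw [div_div, mul_comm]
    rw [h4] at h2
    rw [mul_assoc, mul_assoc]
    refine mul_le_mul_of_nonneg_left ?_ (by positivity)
    rw [← mul_assoc]
    exact mul_le_mul (hw s) (by linarith) h3 hb

theorem IsDesign.mass_eq (s : ℝ) (y : M) :
    localMass N K h s y = ∫ u, scaledKernel K h (u - s) ∂(N y) := by rw [localMass]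

theorem IsDesign.sq_integral_weight_le (d : IsDesign N ν lam Λ c K R κ t h)
    (hw : ∀ s, |w s| ≤ b * scaledKernel K h (s - t)) (f : ℝ → ℝ) (y : M) :
    (∫ s, |w s| * f s ∂(N y)) ^ 2
      ≤ b ^ 2 * (localMass N K h t y * ∫ s, scaledKernel K h (s - t) * f s ^ 2 ∂(N y)) := by
  have hp := d.process.point y
  refine (hp.sq_integral_mul_le (fun s => |w s|) f).trans ?_
  simp only [abs_abs]
  have h1 : ∫ s, |w s| ∂(N y) ≤ b * localMass N K h t y := by
    rw [IsDesign.mass_eq, ← integral_const_mul]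
    exact hp.integral_mono hw
  have h2 : ∫ s, |w s| * f s ^ 2 ∂(N y) ≤ b * ∫ s, scaledKernel K h (s - t) * f s ^ 2 ∂(N y) := by
    rw [← integral_const_mul]
    refine hp.integral_mono fun s => ?_
    rw [← mul_assoc]
    exact mul_le_mul_of_nonneg_right (hw s) (sq_nonneg _)
  have h3 : 0 ≤ ∫ s, |w s| ∂(N y) := integral_nonneg fun _ => abs_nonneg _
  have h4 : 0 ≤ ∫ s, |w s| * f s ^ 2 ∂(N y) :=
    integral_nonneg fun _ => mul_nonneg (abs_nonneg _) (sq_nonneg _)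
  calc _ ≤ (b * localMass N K h t y) * (b * ∫ s, scaledKernel K h (s - t) * f s ^ 2 ∂(N y)) :=
        mul_le_mul h1 h2 h4 (h3.trans h1)
    _ = _ := by ring

/-- Cauchy–Schwarz along the points of subject `i` moves the square onto the normalized weights.
Summing over `j ≠ i` then produces exactly the sum that `looBound` dominates. -/
theorem IsDesign.offDiag_le (d : IsDesign N ν lam Λ c K R κ t h) (hn : 2 ≤ n)
    (hw : ∀ s, |w s| ≤ b * scaledKernel K h (s - t)) (m : Fin n → M) :
    ∑ z ∈ (Finset.univ : Finset (Fin n)).offDiag,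
        (∫ s, ∫ u, |crossWeight N K h w m s u| ∂(N (m z.2)) ∂(N (m z.1))) ^ 2
      ≤ ∑ i, ((n : ℝ)⁻¹ * b) ^ 2 * (localMass N K h t (m i)
        * ∫ s, scaledKernel K h (s - t) * looBound N ν K h κ i s m ∂(N (m i))) := by
  have hsum : ∀ f : Fin n → Fin n → ℝ, ∑ z ∈ (Finset.univ : Finset (Fin n)).offDiag, f z.1 z.2
      = ∑ i, ∑ j ∈ Finset.univ.erase i, f i j := by
    intro f
    rw [Finset.sum_sigma']
    refine Finset.sum_bij' (fun z _ => ⟨z.1, z.2⟩) (fun z _ => (z.1, z.2)) ?_ ?_ ?_ ?_ ?_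
    · rintro ⟨i, j⟩ hz
      simp only [Finset.mem_offDiag, Finset.mem_univ, true_and] at hz
      simp [Ne.symm hz]
    · rintro ⟨i, j⟩ hz
      simp only [Finset.mem_sigma, Finset.mem_univ, Finset.mem_erase, true_and, and_true] at hz
      simp [Ne.symm hz]
    · rintro ⟨i, j⟩ _; rfl
    · rintro ⟨i, j⟩ _; rfl
    · rintro ⟨i, j⟩ _; rfl
  rw [hsum fun i j => (∫ s, ∫ u, |crossWeight N K h w m s u| ∂(N (m j)) ∂(N (m i))) ^ 2]
  refine Finset.sum_le_sum fun i _ => ?_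
  have hp := d.process.point (m i)
  have hb0 := d.mass_nonneg t (m i)
  have h1 : ∀ j, (∫ s, ∫ u, |crossWeight N K h w m s u| ∂(N (m j)) ∂(N (m i))) ^ 2
      ≤ ((n : ℝ)⁻¹ * b) ^ 2 * (localMass N K h t (m i) * ∫ s, scaledKernel K h (s - t)
        * (localMass N K h s (m j) / ∑ k, localMass N K h s (m k)) ^ 2 ∂(N (m i))) := by
    intro j
    simp_rw [d.integral_abs_crossWeight, mul_assoc]
    rw [integral_const_mul, mul_pow, mul_pow, mul_assoc]
    exact mul_le_mul_of_nonneg_left (d.sq_integral_weight_le hw _ _) (sq_nonneg _)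
  refine (Finset.sum_le_sum fun j _ => h1 j).trans ?_
  rw [← Finset.mul_sum, ← Finset.mul_sum]
  refine mul_le_mul_of_nonneg_left (mul_le_mul_of_nonneg_left ?_ hb0) (sq_nonneg _)
  rw [← integral_finsetSum _ fun j _ => hp.integrable _]
  refine hp.integral_mono fun s => ?_
  rw [← Finset.mul_sum]
  by_cases hs : scaledKernel K h (s - t) = 0
  · simp [hs]
  · exact mul_le_mul_of_nonneg_left (d.sum_erase_le hn hs i m) (d.ker_nonneg _)

theorem IsDesign.bias_le (d : IsDesign N ν lam Λ c K R κ t h) (hg : IsSmoothMean g ℓ B)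
    (hn : 2 ≤ n) (hw : ∀ s, |w s| ≤ b * scaledKernel K h (s - t)) (i : Fin n) (m : Fin n → M) :
    (∫ s, |(n : ℝ)⁻¹ * w s * nwBias N K h g s m| ∂(N (m i))) ^ 2
      ≤ ((n : ℝ)⁻¹ * b) ^ 2 * (localMass N K h t (m i) * ∫ s, scaledKernel K h (s - t)
        * (B ^ 2 * looBound N ν K h κ i s m + (ℓ * (R * h)) ^ 2) ∂(N (m i))) := by
  have h1 : ∀ s, |(n : ℝ)⁻¹ * w s * nwBias N K h g s m|
      = (n : ℝ)⁻¹ * (|w s| * |nwBias N K h g s m|) := fun s => by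
    rw [abs_mul, abs_mul, abs_of_nonneg (by positivity : (0 : ℝ) ≤ (n : ℝ)⁻¹), mul_assoc]
  simp_rw [h1]
  rw [integral_const_mul, mul_pow, mul_pow, mul_assoc]
  refine mul_le_mul_of_nonneg_left ?_ (sq_nonneg _)
  refine (d.sq_integral_weight_le hw _ _).trans ?_
  refine mul_le_mul_of_nonneg_left (mul_le_mul_of_nonneg_left ?_ (d.mass_nonneg _ _)) (sq_nonneg _)
  refine (d.process.point _).integral_mono fun s => ?_
  by_cases hs : scaledKernel K h (s - t) = 0
  · simp [hs]
  · refine mul_le_mul_of_nonneg_left ?_ (d.ker_nonneg _)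
    rw [sq_abs]
    linarith [d.nwBias_sq_le hg hn hs i m]

/-- Turns a second moment bound into a first moment bound without square roots; `r` plays the role
of the expected size of `|a|`. -/
theorem abs_le_add_sq_div {a r : ℝ} (hr : 0 < r) : |a| ≤ r / 2 + r⁻¹ * a ^ 2 / 2 := by
  have h1 : r * (r / 2 + r⁻¹ * a ^ 2 / 2) = r ^ 2 / 2 + a ^ 2 / 2 := by
    field_simp
  have h2 : r * |a| ≤ r * (r / 2 + r⁻¹ * a ^ 2 / 2) := by
    rw [h1]
    nlinarith [sq_nonneg (r - |a|), sq_abs a]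
  exact le_of_mul_le_mul_left h2 hr

/-- Conditionally on the observation times, the expected absolute cross average. -/
theorem IsDesign.lintegral_crossAvg_cond_le (d : IsDesign N ν lam Λ c K R κ t h)
    (hU : IsCentered P U C) (hW : IsCentered P W C') (hg : IsSmoothMean g ℓ B) (hn : 2 ≤ n)
    (hw : ∀ s, |w s| ≤ b * scaledKernel K h (s - t)) (m : Fin n → M) {r : ℝ} (hr : 0 < r) :
    ∫⁻ x, ENNReal.ofReal |crossAvg N K h w U W g x m| ∂(Measure.pi fun _ : Fin n => P)
      ≤ ENNReal.ofReal ((n : ℝ)⁻¹ * ∑ i,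
        ((C + C') / 2 * b * (∫ s, scaledKernel K h (s - t) * (1 * looBound N ν K h κ i s m
          + 4 / κ / n * localMass N K h s (m i) + 0) ∂(N (m i)))
        + b ^ 2 / 2 * r⁻¹ * (n : ℝ)⁻¹ * (localMass N K h t (m i) * ∫ s, scaledKernel K h (s - t)
          * ((2 * C * C' + C * B ^ 2) * looBound N ν K h κ i s m + C * (ℓ * (R * h)) ^ 2)
            ∂(N (m i))) + r)) := by
  have hp := fun i => d.process.point (m i)
  have hn0 : (0 : ℝ) < n := by exact_mod_cast (by omega : 0 < n)
  have hC := hU.nonneg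
  have hC' := hW.nonneg
  set π := Measure.pi fun _ : Fin n => P with hπ
  set a := crossWeight N K h w m with ha
  let Dg : (Fin n → E) → ℝ := fun x => ∑ i, |pairForm U W (N (m i)) (N (m i)) a (x i) (x i)|
  let Of : (Fin n → E) → ℝ := fun x => ∑ z ∈ (Finset.univ : Finset (Fin n)).offDiag,
    pairForm U W (N (m z.1)) (N (m z.2)) a (x z.1) (x z.2)
  let Bi : (Fin n → E) → ℝ := fun x =>
    ∑ i, ∫ s, ((n : ℝ)⁻¹ * w s * nwBias N K h g s m) * U s (x i) ∂(N (m i))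
  have hDg : ∀ i, Integrable (fun x : Fin n → E =>
      |pairForm U W (N (m i)) (N (m i)) a (x i) (x i)|) π := fun i =>
    (measurePreserving_eval (fun _ : Fin n => P) i).integrable_comp_of_integrable
      (integrable_pairForm_self hU hW (hp i) (hp i) a).abs
  have hDgI : Integrable Dg π := integrable_finsetSum _ fun i _ => hDg i
  have hOfL : MemLp Of 2 π := memLp_finsetSum _ fun z hz => by
    simp only [Finset.mem_offDiag, Finset.mem_univ, true_and] at hz
    exact pairForm_memLp hU hW (hp _) (hp _) a hz
  have hBiL : MemLp Bi 2 π := memLp_finsetSum _ fun i _ =>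
    memLp_eval (hU.memLp_integral (hp i) _) i
  have hOf2 : ∫ x, Of x ^ 2 ∂π ≤ 2 * (C * C') * ∑ i, ((n : ℝ)⁻¹ * b) ^ 2
      * (localMass N K h t (m i)
        * ∫ s, scaledKernel K h (s - t) * looBound N ν K h κ i s m ∂(N (m i))) := by
    refine (integral_sq_sum_pairForm_le hU hW hp fun _ _ => a).trans ?_
    rw [← Finset.mul_sum, ← mul_assoc]
    exact mul_le_mul_of_nonneg_left (d.offDiag_le hn hw m) (by positivity)
  have hBi2 : ∫ x, Bi x ^ 2 ∂π ≤ C * ∑ i, ((n : ℝ)⁻¹ * b) ^ 2 * (localMass N K h t (m i)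
      * ∫ s, scaledKernel K h (s - t)
        * (B ^ 2 * looBound N ν K h κ i s m + (ℓ * (R * h)) ^ 2) ∂(N (m i))) := by
    rw [integral_sq_sum_eval (fun i y => ∫ s, ((n : ℝ)⁻¹ * w s * nwBias N K h g s m) * U s y
        ∂(N (m i))) (fun i => hU.memLp_integral (hp i) _) (fun i => hU.mean_integral (hp i) _),
      Finset.mul_sum]
    refine Finset.sum_le_sum fun i _ => (hU.integral_sq_integral_le (hp i) _).trans ?_
    exact mul_le_mul_of_nonneg_left (d.bias_le hg hn hw i m) hC
  have hDg1 : ∫ x, Dg x ∂π ≤ ∑ i, (C + C') / 2 * ((n : ℝ)⁻¹ * (b * ∫ s, scaledKernel K h (s - t)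
      * (1 * looBound N ν K h κ i s m + 4 / κ / n * localMass N K h s (m i) + 0) ∂(N (m i)))) := by
    rw [integral_finsetSum _ fun i _ => hDg i]
    refine Finset.sum_le_sum fun i _ => ?_
    rw [integral_eval (f := fun y => |pairForm U W (N (m i)) (N (m i)) a y y|)
      (integrable_pairForm_self hU hW (hp i) (hp i) a).abs.1 i]
    refine (integral_abs_pairForm_self_le hU hW (hp i) (hp i) a).trans ?_
    exact mul_le_mul_of_nonneg_left (d.diag_le hn hw i m) (by positivity)
  -- Half of `r` is spent on the off-diagonal part and half on the bias part.
  have hbound : ∀ x, |crossAvg N K h w U W g x m|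
      ≤ Dg x + (r⁻¹ / 2) * Of x ^ 2 + (r⁻¹ / 2) * Bi x ^ 2 + r := by
    intro x
    rw [crossAvg_eq d.process.point]
    have h1 : |∑ i, pairForm U W (N (m i)) (N (m i)) a (x i) (x i)| ≤ Dg x :=
      Finset.abs_sum_le_sum_abs _ _
    have h2 := abs_le_add_sq_div (a := Of x) hr
    have h3 := abs_le_add_sq_div (a := Bi x) hr
    refine (abs_add_three _ _ _).trans ?_
    calc _ ≤ Dg x + (r / 2 + r⁻¹ * Of x ^ 2 / 2) + (r / 2 + r⁻¹ * Bi x ^ 2 / 2) :=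
          add_le_add (add_le_add h1 h2) h3
      _ = _ := by ring
  have hi1 : Integrable (fun x => (r⁻¹ / 2) * Of x ^ 2) π := hOfL.integrable_sq.const_mul _
  have hi2 : Integrable (fun x => (r⁻¹ / 2) * Bi x ^ 2) π := hBiL.integrable_sq.const_mul _
  have hi3 : Integrable (fun x => Dg x + (r⁻¹ / 2) * Of x ^ 2) π := hDgI.add hi1
  have hi4 : Integrable (fun x => Dg x + (r⁻¹ / 2) * Of x ^ 2 + (r⁻¹ / 2) * Bi x ^ 2) π :=
    hi3.add hi2
  have hi5 : Integrable (fun x => Dg x + (r⁻¹ / 2) * Of x ^ 2 + (r⁻¹ / 2) * Bi x ^ 2 + r) π :=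
    hi4.add (integrable_const r)
  refine (lintegral_mono fun x => ENNReal.ofReal_le_ofReal (hbound x)).trans ?_
  rw [← ofReal_integral_eq_lintegral_ofReal hi5 (ae_of_all _ fun x =>
    (abs_nonneg _).trans (hbound x))]
  refine ENNReal.ofReal_le_ofReal ?_
  rw [integral_add hi4 (integrable_const r), integral_add hi3 hi2, integral_add hDgI hi1,
    integral_const_mul, integral_const_mul]
  have hr2 : 0 ≤ r⁻¹ / 2 := by positivity
  have hfin := add_le_add (add_le_add hDg1 (mul_le_mul_of_nonneg_left hOf2 hr2))
    (mul_le_mul_of_nonneg_left hBi2 hr2)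
  refine (add_le_add hfin (le_of_eq (by simp : ∫ _, r ∂π = r))).trans (le_of_eq ?_)
  have hcomb : ∀ i, ∫ s, scaledKernel K h (s - t)
        * ((2 * C * C' + C * B ^ 2) * looBound N ν K h κ i s m + C * (ℓ * (R * h)) ^ 2) ∂(N (m i))
      = 2 * (C * C') * ∫ s, scaledKernel K h (s - t) * looBound N ν K h κ i s m ∂(N (m i))
        + C * ∫ s, scaledKernel K h (s - t)
          * (B ^ 2 * looBound N ν K h κ i s m + (ℓ * (R * h)) ^ 2) ∂(N (m i)) := by
    intro i
    rw [← integral_const_mul, ← integral_const_mul,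
      ← integral_add ((hp i).integrable _) ((hp i).integrable _)]
    refine integral_congr_ae (ae_of_all _ fun s => ?_)
    dsimp only
    ring
  simp_rw [hcomb]
  rw [Finset.sum_add_distrib, Finset.sum_const, Finset.card_univ, Fintype.card_fin, nsmul_eq_mul,
    mul_add, ← mul_assoc (n : ℝ)⁻¹ (n : ℝ), inv_mul_cancel₀ hn0.ne', one_mul, Finset.mul_sum,
    Finset.mul_sum, Finset.mul_sum, Finset.mul_sum, Finset.mul_sum, ← Finset.sum_add_distrib,
    ← Finset.sum_add_distrib]
  congr 1
  refine Finset.sum_congr rfl fun i _ => ?_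
  ring

end Cross

/-! ### The rate of the cross average -/

section CrossRate

variable {E M : Type*} [MeasurableSpace E] [MeasurableSpace M]

theorem lintegral_ofReal_affine_le {X : Type*} [MeasurableSpace X] {μ : Measure X}
    [IsProbabilityMeasure μ] {f g : X → ℝ} (hf : Measurable f) (hg : Measurable g)
    (hf0 : ∀ x, 0 ≤ f x) (hg0 : ∀ x, 0 ≤ g x) {a b r A B : ℝ} (ha : 0 ≤ a) (hb : 0 ≤ b)
    (hr : 0 ≤ r) (hA0 : 0 ≤ A) (hB0 : 0 ≤ B)
    (hA : ∫⁻ x, ENNReal.ofReal (f x) ∂μ ≤ ENNReal.ofReal A)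
    (hB : ∫⁻ x, ENNReal.ofReal (g x) ∂μ ≤ ENNReal.ofReal B) :
    ∫⁻ x, ENNReal.ofReal (a * f x + b * g x + r) ∂μ ≤ ENNReal.ofReal (a * A + b * B + r) := by
  have h1 : ∀ x, ENNReal.ofReal (a * f x + b * g x + r) = ENNReal.ofReal a * ENNReal.ofReal (f x)
      + ENNReal.ofReal b * ENNReal.ofReal (g x) + ENNReal.ofReal r := fun x => by
    have := hf0 x
    have := hg0 x
    rw [ENNReal.ofReal_add (by positivity) hr, ENNReal.ofReal_add (by positivity) (by positivity),
      ENNReal.ofReal_mul ha, ENNReal.ofReal_mul hb]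
  simp_rw [h1]
  rw [lintegral_add_right _ measurable_const, lintegral_add_right _ (hg.ennreal_ofReal.const_mul _),
    lintegral_const_mul _ hf.ennreal_ofReal, lintegral_const_mul _ hg.ennreal_ofReal,
    lintegral_const, measure_univ, mul_one, ENNReal.ofReal_add (by positivity) hr,
    ENNReal.ofReal_add (by positivity) (by positivity), ENNReal.ofReal_mul ha,
    ENNReal.ofReal_mul hb]
  gcongr

variable {W U : ℝ → E → ℝ} {g : ℝ → ℝ} {C C' ℓ B : ℝ}

/-- The second moments of the off-diagonal and bias parts are bounded by a multiple of `rate / (n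
h)`. After division by `r = rate n h` they contribute a multiple of `1/(nh)`, and the last summand
contributes the rate itself. -/
theorem crossRate_le {n : ℕ} {h C C' b S Λ κ B R ℓ c k : ℝ} (hC : 0 ≤ C) (hC' : 0 ≤ C')
    (hS : 0 ≤ S) (hκ : 0 < κ) (hh : 0 < h) (hn : (0 : ℝ) < n) :
    (C + C') / 2 * b * (1 * (Λ * (16 * S / κ ^ 2)) / (n * h)
      + 4 / κ / n * (Λ * k + c) / h + 0 * Λ)
      + b ^ 2 / 2 * (rate n h)⁻¹ * (n : ℝ)⁻¹ * (S / h
      * ((2 * C * C' + C * B ^ 2) * (16 * S / κ ^ 2) / (n * h) + C * (ℓ * (R * h)) ^ 2)) + rate n h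
    ≤ (|(C + C') / 2 * b * (1 * (Λ * (16 * S / κ ^ 2)) + 4 / κ * (Λ * k + c))|
      + |b ^ 2 / 2 * S * ((2 * C * C' + C * B ^ 2) * (16 * S / κ ^ 2) + C * (ℓ * R) ^ 2)| + 1)
      * rate n h := by
  have hr : 0 < rate n h := by unfold rate; positivity
  have hnh : 0 < 1 / (n * h) := by positivity
  set p := (2 * C * C' + C * B ^ 2) * (16 * S / κ ^ 2) with hp
  set q := C * (ℓ * R) ^ 2 with hq
  have p1 : 0 ≤ p := by positivity
  have p2 : 0 ≤ q := by positivity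
  have e4 : 1 / (n * h) ≤ rate n h := le_add_of_nonneg_right (sq_nonneg h)
  have e5 : h ^ 2 ≤ rate n h := le_add_of_nonneg_left hnh.le
  set a₁ := (C + C') / 2 * b * (1 * (Λ * (16 * S / κ ^ 2)) + 4 / κ * (Λ * k + c)) with ha₁
  have e1 : (C + C') / 2 * b * (1 * (Λ * (16 * S / κ ^ 2)) / (n * h)
      + 4 / κ / n * (Λ * k + c) / h + 0 * Λ) = a₁ * (1 / (n * h)) := by
    rw [ha₁]; field_simp; ring
  have hsplit : p / (n * h) + C * (ℓ * (R * h)) ^ 2 ≤ (p + q) * rate n h := by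
    calc p / (n * h) + C * (ℓ * (R * h)) ^ 2 = p * (1 / (n * h)) + q * h ^ 2 := by rw [hq]; ring
      _ ≤ p * rate n h + q * rate n h := by gcongr
      _ = _ := by ring
  have e2 : b ^ 2 / 2 * (rate n h)⁻¹ * (n : ℝ)⁻¹ * (S / h * (p / (n * h) + C * (ℓ * (R * h)) ^ 2))
      ≤ b ^ 2 / 2 * S * (p + q) * (1 / (n * h)) := by
    calc _ ≤ b ^ 2 / 2 * (rate n h)⁻¹ * (n : ℝ)⁻¹ * (S / h * ((p + q) * rate n h)) := by gcongr
      _ = (b ^ 2 / 2 * S * (p + q) * (1 / (n * h))) * ((rate n h)⁻¹ * rate n h) := by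
          rw [one_div, mul_inv]; ring
      _ = _ := by rw [inv_mul_cancel₀ hr.ne', mul_one]
  rw [e1]
  have f1 : a₁ * (1 / (n * h)) ≤ |a₁| * rate n h :=
    mul_le_mul (le_abs_self _) e4 hnh.le (abs_nonneg _)
  have f2 : b ^ 2 / 2 * S * (p + q) * (1 / (n * h)) ≤ |b ^ 2 / 2 * S * (p + q)| * rate n h :=
    mul_le_mul (le_abs_self _) e4 hnh.le (abs_nonneg _)
  rw [add_mul, add_mul, one_mul]
  exact add_le_add (add_le_add f1 (e2.trans f2)) le_rfl

/-- The expected absolute cross average is of the order `1 / (n h) + h²`. -/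
theorem exists_lintegral_crossAvg_le (P : Measure E) [IsProbabilityMeasure P] (ν : Measure M)
    [IsProbabilityMeasure ν] (N : Kernel M ℝ) (lam : ℝ → ℝ) (Λ c : ℝ) (K : ℝ → ℝ) (R κ t : ℝ)
    (hU : IsCentered P U C) (hW : IsCentered P W C') (hg : IsSmoothMean g ℓ B) {b : ℝ}
    (hb : 0 ≤ b) :
    ∃ A : ℝ, 0 ≤ A ∧ ∀ (n : ℕ) (h : ℝ), 2 ≤ n → IsDesign N ν lam Λ c K R κ t h →
      ∀ w : ℝ → ℝ, Measurable w → (∀ s, |w s| ≤ b * scaledKernel K h (s - t)) →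
      ∫⁻ z : (Fin n → E) × (Fin n → M), ENNReal.ofReal |crossAvg N K h w U W g z.1 z.2|
        ∂((Measure.pi fun _ : Fin n => P).prod (Measure.pi fun _ : Fin n => ν))
      ≤ ENNReal.ofReal (A * rate n h) := by
  have hC := hU.nonneg
  have hC' := hW.nonneg
  set S := IsDesign.sqConst Λ c K with hS
  set a₁ := (C + C') / 2 * b * (1 * (Λ * (16 * S / κ ^ 2)) + 4 / κ * (Λ * K 0 + c)) with ha₁
  set a₂ := b ^ 2 / 2 * S * ((2 * C * C' + C * B ^ 2) * (16 * S / κ ^ 2) + C * (ℓ * R) ^ 2) with ha₂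
  refine ⟨|a₁| + |a₂| + 1, by positivity, fun n h hn d w hwm hw => ?_⟩
  have := d.sfinite
  have hκ := d.κ_pos
  have hh := d.h_pos
  have hR := d.R_pos
  have hS0 : 0 ≤ S := d.sqConst_nonneg
  have hΛ := d.process.Λ_nonneg
  have hc := d.process.c_nonneg
  have hK0 := d.kernel.nonneg 0
  have hn0 : (0 : ℝ) < n := by exact_mod_cast (by omega : 0 < n)
  have hr := rate_pos (by omega : 0 < n) hh
  have hβ : 0 ≤ 4 / κ / n := by positivity
  have hα2 : 0 ≤ 2 * C * C' + C * B ^ 2 := by positivity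
  have hγ2 : 0 ≤ C * (ℓ * (R * h)) ^ 2 := by positivity
  have hrn : 0 ≤ b ^ 2 / 2 * (rate n h)⁻¹ * (n : ℝ)⁻¹ := by positivity
  -- The free parameter of the conditional bound is taken to be the rate.
  refine lintegral_prod_le_of_cond
    (measurable_crossAvg d.kernel hwm hU.measurable hW.measurable hg.measurable).abs
    (fun m => d.lintegral_crossAvg_cond_le hU hW hg hn hw m hr) ?_
  have hT1 := fun i => d.measurable_integral_loo (n := n) i 1 (4 / κ / n) 0
  have hT2 : ∀ i, Measurable fun m : Fin n → M => localMass N K h t (m i)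
      * ∫ s, scaledKernel K h (s - t) * ((2 * C * C' + C * B ^ 2) * looBound N ν K h κ i s m
        + C * (ℓ * (R * h)) ^ 2) ∂(N (m i)) := fun i => by
    have h1 := d.measurable_integral_loo (n := n) i (2 * C * C' + C * B ^ 2) 0
      (C * (ℓ * (R * h)) ^ 2)
    simp only [zero_mul, add_zero] at h1
    have h2 : Measurable fun m : Fin n → M => localMass N K h t (m i) :=
      (measurable_localMass d.kernel).comp (measurable_const.prodMk (measurable_pi_apply i))
    exact h2.mul h1
  have hT10 := fun (i : Fin n) m => d.integral_loo_nonneg i (zero_le_one) hβ le_rfl m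
  have hT20 : ∀ (i : Fin n) (m : Fin n → M), 0 ≤ localMass N K h t (m i)
      * ∫ s, scaledKernel K h (s - t) * ((2 * C * C' + C * B ^ 2) * looBound N ν K h κ i s m
        + C * (ℓ * (R * h)) ^ 2) ∂(N (m i)) := fun i m =>
    mul_nonneg (d.mass_nonneg _ _) (integral_nonneg fun s => mul_nonneg (d.ker_nonneg _)
      (add_nonneg (mul_nonneg hα2 (looBound_nonneg i s m)) hγ2))
  refine lintegral_ofReal_average_le (by omega) (fun i m => ?_) (fun i => ?_) fun i => ?_
  · exact add_nonneg (add_nonneg (mul_nonneg (by positivity) (hT10 i m))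
      (mul_nonneg hrn (hT20 i m))) hr.le
  · exact (((hT1 i).const_mul _).add ((hT2 i).const_mul _)).add_const _
  refine (lintegral_ofReal_affine_le (hT1 i) (hT2 i) (hT10 i) (hT20 i) (by positivity) hrn hr.le
    (by positivity) (by positivity) (d.lintegral_loo_le hn i zero_le_one hβ le_rfl)
    (d.lintegral_mass_mul_loo_le hn i hα2 hγ2)).trans (ENNReal.ofReal_le_ofReal ?_)
  exact crossRate_le hC hC' hS0 hκ hh hn0

end CrossRate

/-! ### Kernel averages of a centered process -/

section LinearAverage

variable {E M : Type*} [MeasurableSpace E] [MeasurableSpace M] {n : ℕ}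

/-- Weighted average of a process over all observations. -/
noncomputable def linAvg (N : Kernel M ℝ) (w : ℝ → ℝ) (U : ℝ → E → ℝ) (x : Fin n → E)
    (m : Fin n → M) : ℝ :=
  (n : ℝ)⁻¹ * ∑ i, ∫ s, w s * U s (x i) ∂(N (m i))

variable {P : Measure E} [IsProbabilityMeasure P]
  {N : Kernel M ℝ} {ν : Measure M} [IsProbabilityMeasure ν]
  {lam : ℝ → ℝ} {Λ c : ℝ} {K : ℝ → ℝ} {R κ t h : ℝ}
  {U : ℝ → E → ℝ} {w : ℝ → ℝ} {C b : ℝ}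

theorem measurable_integral_marked [IsSFiniteKernel N] {f : ℝ → E → ℝ}
    (hf : Measurable fun z : ℝ × E => f z.1 z.2) :
    Measurable fun z : E × M => ∫ s, f s z.1 ∂(N z.2) := by
  refine measurable_integral_kernel N (f := fun (z : E × M) s => f s z.1) ?_ measurable_snd
  exact hf.comp (measurable_snd.prodMk (measurable_fst.comp measurable_fst))

theorem measurable_linAvg [IsSFiniteKernel N] (hw : Measurable w)
    (hU : Measurable fun z : ℝ × E => U z.1 z.2) :
    Measurable fun z : (Fin n → E) × (Fin n → M) => linAvg N w U z.1 z.2 := by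
  unfold linAvg
  refine (Finset.measurable_fun_sum _ fun i _ => ?_).const_mul _
  have h1 := measurable_integral_marked (N := N) (f := fun s y => w s * U s y)
    ((hw.comp measurable_fst).mul hU)
  have hz : Measurable fun z : (Fin n → E) × (Fin n → M) => (z.1 i, z.2 i) :=
    ((measurable_pi_apply i).comp measurable_fst).prodMk
      ((measurable_pi_apply i).comp measurable_snd)
  exact h1.comp hz

/-- Second moment of the weighted average of a centered process. -/
theorem IsDesign.lintegral_linAvg_sq_le (d : IsDesign N ν lam Λ c K R κ t h)
    (hU : IsCentered P U C) (hn : 0 < n) (hwm : Measurable w)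
    (hw : ∀ s, |w s| ≤ b * scaledKernel K h (s - t)) :
    ∫⁻ z : (Fin n → E) × (Fin n → M), ENNReal.ofReal (linAvg N w U z.1 z.2 ^ 2)
      ∂((Measure.pi fun _ : Fin n => P).prod (Measure.pi fun _ : Fin n => ν))
      ≤ ENNReal.ofReal (C * b ^ 2 * sqConst Λ c K / (n * h)) := by
  have := d.sfinite
  have hn0 : (0 : ℝ) < n := by exact_mod_cast hn
  have hC := hU.nonneg
  have hmeas : Measurable fun z : (Fin n → E) × (Fin n → M) => linAvg N w U z.1 z.2 ^ 2 :=
    (measurable_linAvg hwm hU.measurable).pow_const 2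
  refine lintegral_prod_le_of_cond (F := fun x m => linAvg N w U x m ^ 2) hmeas
    (G := fun m : Fin n → M => (n : ℝ)⁻¹ * ∑ i, (C * (n : ℝ)⁻¹ * b ^ 2) * localMass N K h t (m i) ^ 2)
    (fun m => ?_) ?_
  · have hp := fun i => d.process.point (m i)
    have e1 : ∀ x : Fin n → E, linAvg N w U x m
        = ∑ i, ∫ s, ((n : ℝ)⁻¹ * w s) * U s (x i) ∂(N (m i)) := by
      intro x
      rw [linAvg, Finset.mul_sum]
      refine Finset.sum_congr rfl fun i _ => ?_
      rw [← integral_const_mul]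
      simp only [mul_assoc]
    simp_rw [e1]
    have hL : MemLp (fun x : Fin n → E => ∑ i, ∫ s, ((n : ℝ)⁻¹ * w s) * U s (x i) ∂(N (m i))) 2
        (Measure.pi fun _ : Fin n => P) :=
      memLp_finsetSum _ fun i _ => memLp_eval (hU.memLp_integral (hp i) _) i
    rw [← ofReal_integral_eq_lintegral_ofReal hL.integrable_sq (ae_of_all _ fun _ => sq_nonneg _)]
    refine ENNReal.ofReal_le_ofReal ?_
    rw [integral_sq_sum_eval (fun i y => ∫ s, ((n : ℝ)⁻¹ * w s) * U s y ∂(N (m i)))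
      (fun i => hU.memLp_integral (hp i) _) (fun i => hU.mean_integral (hp i) _), Finset.mul_sum]
    refine Finset.sum_le_sum fun i _ => (hU.integral_sq_integral_le (hp i) _).trans ?_
    have e2 : ∫ s, |(n : ℝ)⁻¹ * w s| ∂(N (m i)) ≤ (n : ℝ)⁻¹ * b * localMass N K h t (m i) := by
      rw [IsDesign.mass_eq, ← integral_const_mul]
      refine (hp i).integral_mono fun s => ?_
      rw [abs_mul, abs_of_nonneg (by positivity : (0 : ℝ) ≤ (n : ℝ)⁻¹), mul_assoc]
      exact mul_le_mul_of_nonneg_left (hw s) (by positivity)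
    have e3 : 0 ≤ ∫ s, |(n : ℝ)⁻¹ * w s| ∂(N (m i)) := integral_nonneg fun _ => abs_nonneg _
    calc C * (∫ s, |(n : ℝ)⁻¹ * w s| ∂(N (m i))) ^ 2
        ≤ C * ((n : ℝ)⁻¹ * b * localMass N K h t (m i)) ^ 2 := by gcongr
      _ = _ := by ring
  · have hm : Measurable fun y => localMass N K h t y ^ 2 :=
      ((measurable_localMass d.kernel).comp (measurable_const.prodMk measurable_id)).pow_const 2
    refine lintegral_ofReal_average_le hn (fun i m => mul_nonneg (by positivity) (sq_nonneg _))
      (fun i => (hm.comp (measurable_pi_apply i)).const_mul _) fun i => ?_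
    have e4 : ∀ m : Fin n → M, ENNReal.ofReal ((C * (n : ℝ)⁻¹ * b ^ 2) * localMass N K h t (m i) ^ 2)
        = ENNReal.ofReal (C * (n : ℝ)⁻¹ * b ^ 2)
          * ENNReal.ofReal (localMass N K h t (m i) ^ 2) := fun m =>
      ENNReal.ofReal_mul (by positivity)
    simp_rw [e4]
    have hm' : Measurable fun m : Fin n → M => localMass N K h t (m i) ^ 2 :=
      hm.comp (measurable_pi_apply i)
    rw [lintegral_const_mul _ hm'.ennreal_ofReal,
      lintegral_eval_le (f := fun y => ENNReal.ofReal (localMass N K h t y ^ 2))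
        hm.ennreal_ofReal i]
    refine (mul_le_mul' le_rfl
      (lintegral_localMass_sq_le d.process d.kernel d.h_pos d.h_le t)).trans ?_
    rw [← ENNReal.ofReal_mul (by positivity)]
    refine ENNReal.ofReal_le_ofReal (le_of_eq ?_)
    rw [sqConst]
    field_simp

end LinearAverage

/-! ### Expansions of complex exponentials -/

section CharacteristicExpansion

theorem Complex.norm_exp_I_mul_sub_one_sub_le (x : ℝ) :
    ‖Complex.exp (Complex.I * x) - 1 - Complex.I * x‖ ≤ 2 * x ^ 2 := by
  have hx : ‖Complex.I * (x : ℂ)‖ = |x| := by simp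
  rcases le_or_gt |x| 1 with h | h
  · have := Complex.norm_exp_sub_one_sub_id_le (x := Complex.I * x) (by rwa [hx])
    rw [hx, sq_abs] at this
    nlinarith [sq_nonneg x]
  · have h1 : ‖Complex.exp (Complex.I * x) - 1‖ ≤ |x| := Real.norm_exp_I_mul_ofReal_sub_one_le
    calc _ ≤ ‖Complex.exp (Complex.I * x) - 1‖ + ‖Complex.I * (x : ℂ)‖ := norm_sub_le _ _
      _ ≤ |x| + |x| := by rw [hx]; linarith
      _ ≤ 2 * |x| ^ 2 := by nlinarith
      _ = 2 * x ^ 2 := by rw [sq_abs]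

/-- For `|x| ≤ 1` the third-order remainder suffices, as `|x|³ ≤ |x|^(2+δ)` for `δ ≤ 1`. For `|x| >
1` the cruder bound `2x² + x²/2` already lies below `3|x|^(2+δ)`. -/
theorem Complex.norm_exp_I_mul_sub_quadratic_le (x : ℝ) {δ : ℝ} (h0 : 0 < δ) (h1 : δ ≤ 1) :
    ‖Complex.exp (Complex.I * x) - 1 - Complex.I * x + (x : ℂ) ^ 2 / 2‖ ≤ 3 * |x| ^ (2 + δ) := by
  have hx : ‖Complex.I * (x : ℂ)‖ = |x| := by simp
  rcases le_or_gt |x| 1 with h | h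
  · have h3 := Complex.exp_bound (x := Complex.I * x) (by rwa [hx]) (n := 3) (by norm_num)
    have e1 : ∑ m ∈ Finset.range 3, (Complex.I * (x : ℂ)) ^ m / (m.factorial : ℂ)
        = 1 + Complex.I * x - (x : ℂ) ^ 2 / 2 := by
      simp [Finset.sum_range_succ, mul_pow, Nat.factorial]
      ring
    rw [e1, hx] at h3
    have e2 : Complex.exp (Complex.I * x) - 1 - Complex.I * x + (x : ℂ) ^ 2 / 2
        = Complex.exp (Complex.I * x) - (1 + Complex.I * x - (x : ℂ) ^ 2 / 2) := by ring
    rw [e2]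
    have h4 : |x| ^ 3 ≤ |x| ^ (2 + δ) := by
      rcases (abs_nonneg x).eq_or_lt with h5 | h5
      · rw [← h5, Real.zero_rpow (by linarith)]; norm_num
      · rw [← Real.rpow_natCast]
        exact Real.rpow_le_rpow_of_exponent_ge h5 h (by norm_num; linarith)
    have h6 : (0 : ℝ) ≤ |x| ^ (2 + δ) := by positivity
    refine h3.trans ?_
    norm_num [Nat.factorial]
    nlinarith [pow_nonneg (abs_nonneg x) 3]
  · have h2 := Complex.norm_exp_I_mul_sub_one_sub_le x
    have h3 : ‖(x : ℂ) ^ 2 / 2‖ = x ^ 2 / 2 := by simp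
    have h4 : |x| ^ 2 ≤ |x| ^ (2 + δ) := by
      rw [← Real.rpow_natCast]
      exact Real.rpow_le_rpow_of_exponent_le h.le (by norm_num; linarith)
    rw [sq_abs] at h4
    refine (norm_add_le _ _).trans ?_
    rw [h3]
    nlinarith [sq_nonneg x]

/-- The linearization error of a product of unit numbers is at most `Σ_{j≠k} |z_j - 1||z_k - 1|`.
Here the diagonal of the double sum is moved to the left-hand side. That only distinct indices occur
matters: such pairs of points are what the pair intensity controls. In the induction, the new error
is `(p - 1)(z_L - 1)`. -/
theorem norm_prod_sub_one_sub_sum_le {z : ℕ → ℂ} (hz : ∀ j, ‖z j‖ = 1) (L : ℕ) :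
    ‖∏ j ∈ Finset.range L, z j - 1 - ∑ j ∈ Finset.range L, (z j - 1)‖
      + ∑ j ∈ Finset.range L, ‖z j - 1‖ ^ 2 ≤ (∑ j ∈ Finset.range L, ‖z j - 1‖) ^ 2 := by
  have hsum : ∀ L, ‖∏ j ∈ Finset.range L, z j - 1‖ ≤ ∑ j ∈ Finset.range L, ‖z j - 1‖ := by
    intro L
    induction L with
    | zero => simp
    | succ L ih =>
      rw [Finset.prod_range_succ, Finset.sum_range_succ]
      have e : (∏ j ∈ Finset.range L, z j) * z L - 1
          = (∏ j ∈ Finset.range L, z j - 1) * z L + (z L - 1) := by ring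
      rw [e]
      refine (norm_add_le _ _).trans ?_
      rw [norm_mul, hz, mul_one]
      linarith
  induction L with
  | zero => simp
  | succ L ih =>
    rw [Finset.prod_range_succ, Finset.sum_range_succ, Finset.sum_range_succ,
      Finset.sum_range_succ]
    set p := ∏ j ∈ Finset.range L, z j
    set σ := ∑ j ∈ Finset.range L, (z j - 1)
    set a := ∑ j ∈ Finset.range L, ‖z j - 1‖
    have ha : 0 ≤ a := Finset.sum_nonneg fun _ _ => norm_nonneg _
    have e : p * z L - 1 - (σ + (z L - 1)) = (p - 1 - σ) + (p - 1) * (z L - 1) := by ring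
    have h1 : ‖p * z L - 1 - (σ + (z L - 1))‖ ≤ ‖p - 1 - σ‖ + a * ‖z L - 1‖ := by
      rw [e]
      refine (norm_add_le _ _).trans ?_
      rw [norm_mul]
      gcongr
      exact hsum L
    nlinarith [mul_nonneg ha (norm_nonneg (z L - 1))]

theorem norm_exp_I_mul_ofReal (x : ℝ) : ‖Complex.exp (Complex.I * x)‖ = 1 := by
  rw [mul_comm]; exact Complex.norm_exp_ofReal_mul_I x

theorem IsPointMeasure.norm_exp_integral_sub_le {ρ : Measure ℝ} (hρ : IsPointMeasure ρ)
    (v : ℝ → ℝ) :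
    ‖Complex.exp (Complex.I * (∫ s, v s ∂ρ : ℝ)) - 1
        - ∫ s, (Complex.exp (Complex.I * v s) - 1) ∂ρ‖
      + ∫ s, ‖Complex.exp (Complex.I * v s) - 1‖ ^ 2 ∂ρ
      ≤ (∫ s, ‖Complex.exp (Complex.I * v s) - 1‖ ∂ρ) ^ 2 := by
  obtain ⟨L, T, rfl⟩ := hρ
  simp only [integral_range_dirac]
  rw [Complex.ofReal_sum, Finset.mul_sum, Complex.exp_sum]
  exact norm_prod_sub_one_sub_sum_le (z := fun j => Complex.exp (Complex.I * v (T j)))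
    (fun j => norm_exp_I_mul_ofReal _) L

end CharacteristicExpansion

/-! ### Point processes marked by an independent path -/

section Marked

variable {E M : Type*} [MeasurableSpace E] [MeasurableSpace M] {P : Measure E}
  [IsProbabilityMeasure P] {N : Kernel M ℝ} {ν : Measure M} [IsProbabilityMeasure ν]
  {lam : ℝ → ℝ} {Λ c : ℝ}

theorem IsPointProcess.lintegral_marked (hN : IsPointProcess N ν lam Λ c) {F : ℝ → E → ENNReal}
    (hF : Measurable fun z : ℝ × E => F z.1 z.2) :
    ∫⁻ z : E × M, ∫⁻ s, F s z.1 ∂(N z.2) ∂(P.prod ν)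
      = ∫⁻ s, (∫⁻ x, F s x ∂P) * ENNReal.ofReal (lam s) := by
  have := isSFiniteKernel_of_point hN.point
  have h1 : Measurable fun z : E × M => ∫⁻ s, F s z.1 ∂(N z.2) :=
    measurable_lintegral_kernel N (f := fun (z : E × M) s => F s z.1)
      (hF.comp (measurable_snd.prodMk (measurable_fst.comp measurable_fst))) measurable_snd
  rw [lintegral_prod_symm' _ h1, ← hN.campbell hF.lintegral_prod_right']
  refine lintegral_congr fun m => ?_
  have := (hN.point m).isFiniteMeasure
  have h2 : Measurable (Function.uncurry fun x s => F s x) := hF.comp measurable_swap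
  exact lintegral_lintegral_swap (μ := P) (ν := N m) h2.aemeasurable

/-- Campbell's formula as an identity of image measures, a form that also serves complex integrands.
-/
theorem IsPointProcess.map_marked (hN : IsPointProcess N ν lam Λ c) [IsSFiniteKernel N] :
    ((P.prod ν) ⊗ₘ (Kernel.prodMkLeft E N)).map (fun y => (y.2, y.1.1))
      = (volume.withDensity fun s => ENNReal.ofReal (lam s)).prod P := by
  have hg : Measurable fun y : (E × M) × ℝ => (y.2, y.1.1) :=
    measurable_snd.prodMk (measurable_fst.comp measurable_fst)
  refine Measure.ext_of_lintegral _ fun f hf => ?_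
  have hfg : Measurable fun y : (E × M) × ℝ => f (y.2, y.1.1) := hf.comp hg
  rw [lintegral_map hf hg, Measure.lintegral_compProd hfg,
    lintegral_prod _ hf.aemeasurable,
    lintegral_withDensity_eq_lintegral_mul _ hN.measurable_lam.ennreal_ofReal
      hf.lintegral_prod_right']
  simp only [Kernel.prodMkLeft_apply]
  rw [hN.lintegral_marked (F := fun s x => f (s, x)) hf]
  simp [mul_comm]

theorem IsPointProcess.integrable_marked (hN : IsPointProcess N ν lam Λ c) {f : ℝ → E → ℂ}
    (hf : Integrable (fun z : ℝ × E => f z.1 z.2)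
      ((volume.withDensity fun s => ENNReal.ofReal (lam s)).prod P)) :
    Integrable (fun z : E × M => ∫ s, f s z.1 ∂(N z.2)) (P.prod ν) := by
  have := isSFiniteKernel_of_point hN.point
  have hg : Measurable fun y : (E × M) × ℝ => (y.2, y.1.1) :=
    measurable_snd.prodMk (measurable_fst.comp measurable_fst)
  rw [← hN.map_marked] at hf
  have h2 : Integrable (fun y : (E × M) × ℝ => f y.2 y.1.1)
    ((P.prod ν) ⊗ₘ (Kernel.prodMkLeft E N)) := (integrable_map_measure hf.1 hg.aemeasurable).1 hf
  rw [Measure.compProd] at h2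
  exact h2.integral_compProd

theorem IsPointProcess.integral_marked (hN : IsPointProcess N ν lam Λ c) {f : ℝ → E → ℂ}
    (hf : Integrable (fun z : ℝ × E => f z.1 z.2)
      ((volume.withDensity fun s => ENNReal.ofReal (lam s)).prod P)) :
    ∫ z : E × M, ∫ s, f s z.1 ∂(N z.2) ∂(P.prod ν) = ∫ s, lam s • ∫ x, f s x ∂P := by
  have := isSFiniteKernel_of_point hN.point
  have hg : Measurable fun y : (E × M) × ℝ => (y.2, y.1.1) :=
    measurable_snd.prodMk (measurable_fst.comp measurable_fst)
  have h1 := integral_prod _ hf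
  rw [integral_withDensity_eq_integral_toReal_smul hN.measurable_lam.ennreal_ofReal
    (ae_of_all _ fun _ => ENNReal.ofReal_lt_top)] at h1
  simp only [ENNReal.toReal_ofReal (hN.lam_nonneg _)] at h1
  rw [← h1]
  rw [← hN.map_marked] at hf ⊢
  have hf2 : Integrable (fun y : (E × M) × ℝ => f y.2 y.1.1)
    ((P.prod ν) ⊗ₘ (Kernel.prodMkLeft E N)) := (integrable_map_measure hf.1 hg.aemeasurable).1 hf
  rw [integral_map hg.aemeasurable hf.1, Measure.integral_compProd hf2]
  rfl

theorem IsPointMeasure.ofReal_integral {ρ : Measure ℝ} (hρ : IsPointMeasure ρ) {a : ℝ → ℝ}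
    (ha : ∀ s, 0 ≤ a s) : ENNReal.ofReal (∫ s, a s ∂ρ) = ∫⁻ s, ENNReal.ofReal (a s) ∂ρ :=
  ofReal_integral_eq_lintegral_ofReal (hρ.integrable a) (ae_of_all _ ha)

theorem IsPointMeasure.ofReal_sq_integral {ρ : Measure ℝ} (hρ : IsPointMeasure ρ) {a : ℝ → ℝ}
    (ha : ∀ s, 0 ≤ a s) :
    ENNReal.ofReal ((∫ s, a s ∂ρ) ^ 2) = ∫⁻ s, ∫⁻ u, ENNReal.ofReal (a s * a u) ∂ρ ∂ρ := by
  have h1 : (∫ s, a s ∂ρ) ^ 2 = ∫ s, ∫ u, a s * a u ∂ρ ∂ρ := by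
    simp_rw [integral_const_mul]
    rw [integral_mul_const, sq]
  rw [h1, hρ.ofReal_integral fun s => integral_nonneg fun u => mul_nonneg (ha s) (ha u)]
  exact lintegral_congr fun s => hρ.ofReal_integral fun u => mul_nonneg (ha s) (ha u)

/-- The path is independent of the times and is integrated out first; the pair bound then applies to
a deterministic function of two times. -/
theorem IsPointProcess.lintegral_pair_marked_le (hN : IsPointProcess N ν lam Λ c) {a : ℝ → E → ℝ}
    (ha : Measurable fun z : ℝ × E => a z.1 z.2) :
    ∫⁻ z : E × M, ∫⁻ s, ∫⁻ u, ENNReal.ofReal (a s z.1 * a u z.1) ∂(N z.2) ∂(N z.2) ∂(P.prod ν)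
      ≤ (∫⁻ z : E × M, ∫⁻ s, ENNReal.ofReal (a s z.1 * a s z.1) ∂(N z.2) ∂(P.prod ν))
        + ENNReal.ofReal c * ∫⁻ s, ∫⁻ u, ∫⁻ x, ENNReal.ofReal (a s x * a u x) ∂P := by
  have := isSFiniteKernel_of_point hN.point
  have hκm : Measurable fun q : (ℝ × ℝ) × E => ENNReal.ofReal (a q.1.1 q.2 * a q.1.2 q.2) := by
    have h1 : Measurable fun q : (ℝ × ℝ) × E => a q.1.1 q.2 :=
      ha.comp ((measurable_fst.comp measurable_fst).prodMk measurable_snd)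
    have h2 : Measurable fun q : (ℝ × ℝ) × E => a q.1.2 q.2 :=
      ha.comp ((measurable_snd.comp measurable_fst).prodMk measurable_snd)
    exact (h1.mul h2).ennreal_ofReal
  have hdiagm : Measurable fun z : ℝ × E => ENNReal.ofReal (a z.1 z.2 * a z.1 z.2) :=
    (ha.mul ha).ennreal_ofReal
  have hswap : ∫⁻ z : E × M, ∫⁻ s, ∫⁻ u, ENNReal.ofReal (a s z.1 * a u z.1)
      ∂(N z.2) ∂(N z.2) ∂(P.prod ν)
      = ∫⁻ m, ∫⁻ s, ∫⁻ u, ∫⁻ x, ENNReal.ofReal (a s x * a u x) ∂P ∂(N m) ∂(N m) ∂ν := by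
    rw [lintegral_prod_symm']
    · refine lintegral_congr fun m => ?_
      have := (hN.point m).isFiniteMeasure
      refine (lintegral_lintegral_swap (μ := P) (ν := N m)
        (f := fun x s => ∫⁻ u, ENNReal.ofReal (a s x * a u x) ∂(N m)) ?_).trans ?_
      swap
      · refine lintegral_congr fun s => ?_
        refine lintegral_lintegral_swap (μ := P) (ν := N m)
          (f := fun x u => ENNReal.ofReal (a s x * a u x)) ?_
        have h3 : Measurable fun q : E × ℝ => ((s, q.2), q.1) :=
          (measurable_const.prodMk measurable_snd).prodMk measurable_fst
        exact (hκm.comp h3).aemeasurable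
      · have h3 : Measurable fun q : (E × ℝ) × ℝ => ((q.1.2, q.2), q.1.1) :=
          ((measurable_snd.comp measurable_fst).prodMk measurable_snd).prodMk
            (measurable_fst.comp measurable_fst)
        exact (Measurable.lintegral_prod_right' (ν := N m) (hκm.comp h3)).aemeasurable
    · refine measurable_lintegral_kernel N (f := fun (z : E × M) s =>
        ∫⁻ u, ENNReal.ofReal (a s z.1 * a u z.1) ∂(N z.2)) ?_ measurable_snd
      refine measurable_lintegral_kernel N (f := fun (q : (E × M) × ℝ) u =>
        ENNReal.ofReal (a q.2 q.1.1 * a u q.1.1)) ?_ (measurable_snd.comp measurable_fst)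
      have h3 : Measurable fun q : ((E × M) × ℝ) × ℝ => ((q.1.2, q.2), q.1.1.1) :=
        ((measurable_snd.comp measurable_fst).prodMk measurable_snd).prodMk
          (measurable_fst.comp (measurable_fst.comp measurable_fst))
      exact hκm.comp h3
  rw [hswap, hN.lintegral_marked (F := fun s x => ENNReal.ofReal (a s x * a s x)) hdiagm]
  exact hN.pair (fun s u => ∫⁻ x, ENNReal.ofReal (a s x * a u x) ∂P) hκm.lintegral_prod_right'

/-- Expansion of the characteristic function of a marked point process. -/
theorem IsPointProcess.norm_charFun_sub_le (hN : IsPointProcess N ν lam Λ c) {v : ℝ → E → ℝ}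
    (hv : Measurable fun z : ℝ × E => v z.1 z.2)
    (hfin : ∫⁻ s, ∫⁻ x, ENNReal.ofReal |v s x| ∂P < ⊤) {B : ℝ} (hB0 : 0 ≤ B)
    (hB : ∫⁻ s, ∫⁻ u, ∫⁻ x, ENNReal.ofReal (‖Complex.exp (Complex.I * v s x) - 1‖
      * ‖Complex.exp (Complex.I * v u x) - 1‖) ∂P ≤ ENNReal.ofReal B) :
    ‖∫ z : E × M, Complex.exp (Complex.I * (∫ s, v s z.1 ∂(N z.2) : ℝ)) ∂(P.prod ν) - 1
      - ∫ s, lam s • ∫ x, (Complex.exp (Complex.I * v s x) - 1) ∂P‖ ≤ c * B := by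
  have := isSFiniteKernel_of_point hN.point
  set e : ℝ → E → ℂ := fun s x => Complex.exp (Complex.I * v s x) - 1 with he
  have hem : Measurable fun z : ℝ × E => e z.1 z.2 :=
    (Complex.measurable_exp.comp ((Complex.measurable_ofReal.comp hv).const_mul _)).sub_const _
  have hea : ∀ s x, ‖e s x‖ ≤ |v s x| := fun s x => Real.norm_exp_I_mul_ofReal_sub_one_le
  have he2 : ∀ s x, ‖e s x‖ ≤ 2 := fun s x => by
    refine (norm_sub_le _ _).trans ?_
    rw [norm_exp_I_mul_ofReal, norm_one]; norm_num
  have hvm : Measurable fun z : ℝ × E => ENNReal.ofReal |v z.1 z.2| := hv.abs.ennreal_ofReal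
  have hint : Integrable (fun z : ℝ × E => e z.1 z.2)
      ((volume.withDensity fun s => ENNReal.ofReal (lam s)).prod P) := by
    refine ⟨hem.aestronglyMeasurable, ?_⟩
    rw [hasFiniteIntegral_iff_norm, lintegral_prod _ hem.norm.ennreal_ofReal.aemeasurable,
      lintegral_withDensity_eq_lintegral_mul _ hN.measurable_lam.ennreal_ofReal
      hem.norm.ennreal_ofReal.lintegral_prod_right']
    refine lt_of_le_of_lt (b := ENNReal.ofReal Λ * ∫⁻ s, ∫⁻ x, ENNReal.ofReal |v s x| ∂P) ?_
      (ENNReal.mul_lt_top ENNReal.ofReal_lt_top hfin)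
    rw [← lintegral_const_mul _ hvm.lintegral_prod_right']
    refine lintegral_mono fun s => mul_le_mul' (ENNReal.ofReal_le_ofReal (hN.lam_le s)) ?_
    exact lintegral_mono fun x => ENNReal.ofReal_le_ofReal (hea s x)
  have hψm : Measurable fun z : E × M => ∫ s, v s z.1 ∂(N z.2) := measurable_integral_marked hv
  have hexpm : Measurable fun z : E × M =>
      Complex.exp (Complex.I * (∫ s, v s z.1 ∂(N z.2) : ℝ)) :=
    Complex.measurable_exp.comp ((Complex.measurable_ofReal.comp hψm).const_mul _)
  have hexp : Integrable (fun z : E × M =>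
      Complex.exp (Complex.I * (∫ s, v s z.1 ∂(N z.2) : ℝ))) (P.prod ν) :=
    Integrable.of_bound hexpm.aestronglyMeasurable 1
      (ae_of_all _ fun z => (norm_exp_I_mul_ofReal _).le)
  have hI := hN.integrable_marked hint
  set r : E × M → ℂ := fun z => Complex.exp (Complex.I * (∫ s, v s z.1 ∂(N z.2) : ℝ)) - 1
    - ∫ s, e s z.1 ∂(N z.2) with hr
  have hrint : Integrable r (P.prod ν) := (hexp.sub (integrable_const _)).sub hI
  have heq : ∫ z : E × M, Complex.exp (Complex.I * (∫ s, v s z.1 ∂(N z.2) : ℝ)) ∂(P.prod ν) - 1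
      - ∫ s, lam s • ∫ x, e s x ∂P = ∫ z, r z ∂(P.prod ν) := by
    have hexp1 : Integrable (fun z : E × M =>
        Complex.exp (Complex.I * (∫ s, v s z.1 ∂(N z.2) : ℝ)) - 1) (P.prod ν) :=
      hexp.sub (integrable_const _)
    rw [hr, integral_sub hexp1 hI, integral_sub hexp (integrable_const _), hN.integral_marked hint]
    simp
  rw [heq]
  refine (norm_integral_le_integral_norm _).trans ?_
  rw [integral_eq_lintegral_of_nonneg_ae (ae_of_all _ fun _ => norm_nonneg _) hrint.norm.1]
  refine ENNReal.toReal_le_of_le_ofReal (mul_nonneg hN.c_nonneg hB0) ?_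
  -- For every sample point, the remainder plus the diagonal is at most the full double integral.
  have hpt : ∀ z : E × M, ENNReal.ofReal ‖r z‖
      + ∫⁻ s, ENNReal.ofReal (‖e s z.1‖ * ‖e s z.1‖) ∂(N z.2)
      ≤ ∫⁻ s, ∫⁻ u, ENNReal.ofReal (‖e s z.1‖ * ‖e u z.1‖) ∂(N z.2) ∂(N z.2) := by
    intro z
    have h1 := (hN.point z.2).norm_exp_integral_sub_le (fun s => v s z.1)
    rw [← (hN.point z.2).ofReal_integral fun s => mul_nonneg (norm_nonneg _) (norm_nonneg _),
      ← (hN.point z.2).ofReal_sq_integral (a := fun s => ‖e s z.1‖) fun s => norm_nonneg _,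
      ← ENNReal.ofReal_add (norm_nonneg _)
        (integral_nonneg fun s => mul_nonneg (norm_nonneg _) (norm_nonneg _))]
    refine ENNReal.ofReal_le_ofReal ?_
    simp_rw [sq (‖_‖)] at h1
    exact h1
  have hB' : ∫⁻ s, ∫⁻ u, ∫⁻ x, ENNReal.ofReal (‖e s x‖ * ‖e u x‖) ∂P ≤ ENNReal.ofReal B := hB
  clear_value r e
  set D := ∫⁻ s, (∫⁻ x, ENNReal.ofReal (‖e s x‖ * ‖e s x‖) ∂P) * ENNReal.ofReal (lam s) with hD
  have hdiagm : Measurable fun z : ℝ × E => ENNReal.ofReal (‖e z.1 z.2‖ * ‖e z.1 z.2‖) :=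
    (hem.norm.mul hem.norm).ennreal_ofReal
  -- The diagonal appears on both sides and will be cancelled, which for extended nonnegative
  -- numbers requires it to be finite.
  have hDfin : D ≠ ⊤ := by
    refine (lt_of_le_of_lt (b := ENNReal.ofReal (2 * Λ) * ∫⁻ s, ∫⁻ x, ENNReal.ofReal |v s x| ∂P) ?_
      (ENNReal.mul_lt_top ENNReal.ofReal_lt_top hfin)).ne
    rw [← lintegral_const_mul _ hvm.lintegral_prod_right']
    refine lintegral_mono fun s => ?_
    rw [ENNReal.ofReal_mul zero_le_two, mul_comm (ENNReal.ofReal 2), mul_assoc, mul_comm]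
    refine mul_le_mul' (ENNReal.ofReal_le_ofReal (hN.lam_le s)) ?_
    have hvs : Measurable fun x => ENNReal.ofReal |v s x| := hvm.comp measurable_prodMk_left
    rw [← lintegral_const_mul _ hvs]
    refine lintegral_mono fun x => ?_
    rw [← ENNReal.ofReal_mul zero_le_two]
    exact ENNReal.ofReal_le_ofReal (mul_le_mul (he2 s x) (hea s x) (norm_nonneg _) zero_le_two)
  have hmain : (∫⁻ z, ENNReal.ofReal ‖r z‖ ∂(P.prod ν)) + D ≤ ENNReal.ofReal (c * B) + D := by
    rw [hD, ← hN.lintegral_marked (F := fun s x => ENNReal.ofReal (‖e s x‖ * ‖e s x‖)) hdiagm]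
    have hdm : Measurable fun z : E × M => ∫⁻ s, ENNReal.ofReal (‖e s z.1‖ * ‖e s z.1‖) ∂(N z.2) :=
      measurable_lintegral_kernel N (f := fun (z : E × M) s => ENNReal.ofReal (‖e s z.1‖ * ‖e s z.1‖))
        (hdiagm.comp (measurable_snd.prodMk (measurable_fst.comp measurable_fst))) measurable_snd
    rw [← lintegral_add_right _ hdm]
    refine (lintegral_mono hpt).trans ?_
    refine (hN.lintegral_pair_marked_le (a := fun s x => ‖e s x‖) hem.norm).trans ?_
    rw [add_comm, ENNReal.ofReal_mul hN.c_nonneg]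
    exact add_le_add (mul_le_mul' le_rfl hB') le_rfl
  exact (ENNReal.add_le_add_iff_right hDfin).1 hmain

end Marked

/-! ### Law of large numbers for local averages -/

section LocalLimits

variable {E M : Type*} [MeasurableSpace E] [MeasurableSpace M] {P : Measure E}
  [IsProbabilityMeasure P] {N : Kernel M ℝ} {ν : Measure M} [IsProbabilityMeasure ν]
  {lam : ℝ → ℝ} {Λ c : ℝ}

theorem integral_eq_smul_integral_affine {F : Type*} [NormedAddCommGroup F] [NormedSpace ℝ F]
    (f : ℝ → F) {h : ℝ} (hh : 0 < h) (t : ℝ) : ∫ s, f s = h • ∫ z, f (t + h * z) := by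
  have h1 := Measure.integral_comp_mul_left (fun y => f (t + y)) h
  rw [h1, integral_add_left_eq_self, abs_of_pos (inv_pos.2 hh), smul_smul,
    mul_inv_cancel₀ hh.ne', one_smul]

/-- Distinct points of one subject contribute at most `c B n` to its characteristic function, which
is negligible even after multiplication by `n`. Only the intensity is left in the limit. -/
theorem IsPointProcess.tendsto_charFun (hN : IsPointProcess N ν lam Λ c) {v : ℕ → ℝ → E → ℝ}
    (hv : ∀ n, Measurable fun z : ℝ × E => v n z.1 z.2)
    (hfin : ∀ᶠ n in atTop, ∫⁻ s, ∫⁻ x, ENNReal.ofReal |v n s x| ∂P < ⊤) {B : ℕ → ℝ}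
    (hB0 : ∀ᶠ n in atTop, 0 ≤ B n)
    (hB : ∀ᶠ n in atTop, ∫⁻ s, ∫⁻ u, ∫⁻ x, ENNReal.ofReal (‖Complex.exp (Complex.I * v n s x) - 1‖
      * ‖Complex.exp (Complex.I * v n u x) - 1‖) ∂P ≤ ENNReal.ofReal (B n))
    (hnB : Tendsto (fun n : ℕ => n * B n) atTop (𝓝 0)) {ζ : ℂ}
    (hζ : Tendsto (fun n : ℕ => (n : ℂ) * ∫ s, lam s • ∫ x, (Complex.exp (Complex.I * v n s x) - 1) ∂P)
      atTop (𝓝 ζ)) :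
    Tendsto (fun n : ℕ => (n : ℂ) * (∫ z : E × M,
      Complex.exp (Complex.I * (∫ s, v n s z.1 ∂(N z.2) : ℝ)) ∂(P.prod ν) - 1)) atTop (𝓝 ζ) := by
  rw [← zero_add ζ]
  have hd : Tendsto (fun n : ℕ => (n : ℂ) * (∫ z : E × M,
      Complex.exp (Complex.I * (∫ s, v n s z.1 ∂(N z.2) : ℝ)) ∂(P.prod ν) - 1
      - ∫ s, lam s • ∫ x, (Complex.exp (Complex.I * v n s x) - 1) ∂P)) atTop (𝓝 0) := by
    refine squeeze_zero_norm' (a := fun n : ℕ => c * (n * B n)) ?_ (by simpa using hnB.const_mul c)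
    filter_upwards [hfin, hB0, hB] with n h1 h2 h3
    rw [norm_mul, Complex.norm_natCast]
    refine (mul_le_mul_of_nonneg_left (hN.norm_charFun_sub_le (hv n) h1 h2 h3)
      (Nat.cast_nonneg n)).trans (le_of_eq (by ring))
  refine (hd.add hζ).congr fun n => ?_
  ring

theorem lintegral_abs_mul_le {J : ℝ → ℝ} (hJm : Measurable J) (hJi : Integrable J)
    {Γ : ℝ → E → ℝ} {C : ℝ} (hΓi : ∀ s, Integrable (Γ s) P) (hΓC : ∀ s, ∫ x, |Γ s x| ∂P ≤ C)
    (q t : ℝ) {h : ℝ} (hh : 0 < h) :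
    ∫⁻ s, ∫⁻ x, ENNReal.ofReal |q * J ((s - t) / h) * Γ s x| ∂P
      ≤ ENNReal.ofReal (|q| * C * (h * ∫ z, |J z|)) := by
  have hC : 0 ≤ C := (integral_nonneg fun _ => abs_nonneg _).trans (hΓC 0)
  calc _ ≤ ∫⁻ s, ENNReal.ofReal (|q| * C) * ENNReal.ofReal |J ((s - t) / h)| := by
        refine lintegral_mono fun s => ?_
        have h1 : ∀ x, ENNReal.ofReal |q * J ((s - t) / h) * Γ s x|
            = ENNReal.ofReal |q * J ((s - t) / h)| * ENNReal.ofReal |Γ s x| := fun x => by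
          rw [abs_mul, ENNReal.ofReal_mul (abs_nonneg _)]
        simp_rw [h1]
        rw [lintegral_const_mul' _ _ ENNReal.ofReal_ne_top,
          ← ofReal_integral_eq_lintegral_ofReal (hΓi s).abs (ae_of_all _ fun _ => abs_nonneg _),
          ← ENNReal.ofReal_mul (abs_nonneg _), ← ENNReal.ofReal_mul (by positivity), abs_mul]
        refine ENNReal.ofReal_le_ofReal ?_
        calc |q| * |J ((s - t) / h)| * ∫ x, |Γ s x| ∂P ≤ |q| * |J ((s - t) / h)| * C := by
              gcongr; exact hΓC s
          _ = _ := by ring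
    _ = _ := by
        rw [lintegral_const_mul' _ _ ENNReal.ofReal_ne_top,
          lintegral_comp_affine hh t (f := fun z => ENNReal.ofReal |J z|) hJm.abs.ennreal_ofReal,
          ← ofReal_integral_eq_lintegral_ofReal hJi.abs (ae_of_all _ fun _ => abs_nonneg _),
          ← ENNReal.ofReal_mul hh.le, ← ENNReal.ofReal_mul (by positivity)]

theorem measurable_local {J : ℝ → ℝ} (hJm : Measurable J) {Γ : ℝ → E → ℝ}
    (hΓm : Measurable fun z : ℝ × E => Γ z.1 z.2) (q t h : ℝ) :
    Measurable fun z : ℝ × E => q * J ((z.1 - t) / h) * Γ z.1 z.2 :=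
  ((hJm.comp ((measurable_fst.sub_const t).div_const h)).const_mul q).mul hΓm

/-- At the fixed time `t`, `r (e^{ijΓ/r} - 1) → ijΓ` with dominating function `|jΓ|`. Passing from
`s n` to `t` costs `|j| ∫ |Γ (s n) - Γ t|`, because the exponential is Lipschitz on the imaginary
axis. First moments suffice. -/
theorem tendsto_mul_integral_exp_sub_one {Γ : ℝ → E → ℝ}
    (hΓm : Measurable fun z : ℝ × E => Γ z.1 z.2) (hΓi : ∀ s, Integrable (Γ s) P)
    {t : ℝ} (hΓt : Tendsto (fun s => ∫ x, |Γ s x - Γ t x| ∂P) (𝓝 t) (𝓝 0))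
    {r s : ℕ → ℝ} (hr : Tendsto r atTop atTop) (hs : Tendsto s atTop (𝓝 t)) (j : ℝ) :
    Tendsto (fun n => (r n : ℂ) * ∫ x, (Complex.exp (Complex.I * ((r n)⁻¹ * j * Γ (s n) x : ℝ)) - 1) ∂P)
      atTop (𝓝 (Complex.I * (j * ∫ x, Γ t x ∂P : ℝ))) := by
  have hr0 : ∀ᶠ n in atTop, 0 < r n := hr.eventually_gt_atTop 0
  have hΓsm : ∀ s, Measurable (Γ s) := fun s => hΓm.comp measurable_prodMk_left
  have hem : ∀ q s, AEStronglyMeasurable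
      (fun x => Complex.exp (Complex.I * (q * Γ s x : ℝ)) - 1) P := fun q s =>
    ((Complex.measurable_exp.comp ((Complex.measurable_ofReal.comp
      ((hΓsm s).const_mul q)).const_mul _)).sub_const _).aestronglyMeasurable
  have hei : ∀ q s, Integrable (fun x => Complex.exp (Complex.I * (q * Γ s x : ℝ)) - 1) P :=
    fun q s => Integrable.of_bound (hem q s) 2 (ae_of_all _ fun x => by
      refine (norm_sub_le _ _).trans ?_
      rw [norm_exp_I_mul_ofReal, norm_one]; norm_num)
  have h1 : Tendsto (fun n => ∫ x, (r n : ℂ) *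
      (Complex.exp (Complex.I * ((r n)⁻¹ * j * Γ t x : ℝ)) - 1) ∂P)
      atTop (𝓝 (∫ x, Complex.I * (j * Γ t x : ℝ) ∂P)) := by
    refine tendsto_integral_filter_of_dominated_convergence (fun x => |j| * |Γ t x|) ?_ ?_ ?_ ?_
    · exact Eventually.of_forall fun n => (hem _ _).const_mul _
    · filter_upwards [hr0] with n hn
      refine ae_of_all _ fun x => ?_
      rw [norm_mul, Complex.norm_real, Real.norm_eq_abs, abs_of_pos hn]
      calc r n * ‖Complex.exp (Complex.I * ((r n)⁻¹ * j * Γ t x : ℝ)) - 1‖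
          ≤ r n * |(r n)⁻¹ * j * Γ t x| := by
            gcongr; exact Real.norm_exp_I_mul_ofReal_sub_one_le
        _ = |j| * |Γ t x| := by
            rw [abs_mul, abs_mul, abs_of_pos (inv_pos.2 hn), ← mul_assoc, ← mul_assoc,
              mul_inv_cancel₀ hn.ne', one_mul]
    · exact (hΓi t).abs.const_mul _
    · refine ae_of_all _ fun x => ?_
      rw [tendsto_iff_norm_sub_tendsto_zero]
      have h2 : Tendsto (fun n => 2 * (j * Γ t x) ^ 2 * (r n)⁻¹) atTop (𝓝 0) := by
        simpa using (tendsto_inv_atTop_zero.comp hr).const_mul (2 * (j * Γ t x) ^ 2)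
      refine squeeze_zero' (Eventually.of_forall fun _ => norm_nonneg _) ?_ h2
      filter_upwards [hr0] with n hn
      have hrc : (r n : ℂ) ≠ 0 := by exact_mod_cast hn.ne'
      have e1 : (r n : ℂ) * (Complex.exp (Complex.I * ((r n)⁻¹ * j * Γ t x : ℝ)) - 1)
          - Complex.I * (j * Γ t x : ℝ) = (r n : ℂ) *
          (Complex.exp (Complex.I * ((r n)⁻¹ * j * Γ t x : ℝ)) - 1
            - Complex.I * ((r n)⁻¹ * j * Γ t x : ℝ)) := by
        push_cast; field_simp
      rw [e1, norm_mul, Complex.norm_real, Real.norm_eq_abs, abs_of_pos hn]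
      refine (mul_le_mul_of_nonneg_left (Complex.norm_exp_I_mul_sub_one_sub_le _) hn.le).trans ?_
      apply le_of_eq; field_simp
  have h2 : ∫ x, Complex.I * (j * Γ t x : ℝ) ∂P = Complex.I * (j * ∫ x, Γ t x ∂P : ℝ) := by
    rw [integral_const_mul, integral_complex_ofReal, integral_const_mul]
  rw [h2] at h1
  have h3 : Tendsto (fun n => (r n : ℂ) * ∫ x, (Complex.exp (Complex.I * ((r n)⁻¹ * j * Γ (s n) x : ℝ)) - 1) ∂P
      - ∫ x, (r n : ℂ) * (Complex.exp (Complex.I * ((r n)⁻¹ * j * Γ t x : ℝ)) - 1) ∂P)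
      atTop (𝓝 0) := by
    refine squeeze_zero_norm' (a := fun n => |j| * ∫ x, |Γ (s n) x - Γ t x| ∂P) ?_
      (by simpa using (hΓt.comp hs).const_mul |j|)
    filter_upwards [hr0] with n hn
    rw [integral_const_mul, ← mul_sub, ← integral_sub (hei _ _) (hei _ _), norm_mul,
      Complex.norm_real, Real.norm_eq_abs, abs_of_pos hn]
    have h4 : ‖∫ x, ((Complex.exp (Complex.I * ((r n)⁻¹ * j * Γ (s n) x : ℝ)) - 1)
        - (Complex.exp (Complex.I * ((r n)⁻¹ * j * Γ t x : ℝ)) - 1)) ∂P‖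
        ≤ ∫ x, (r n)⁻¹ * |j| * |Γ (s n) x - Γ t x| ∂P := by
      refine norm_integral_le_of_norm_le (((hΓi _).sub (hΓi _)).abs.const_mul _)
        (ae_of_all _ fun x => ?_)
      have e2 : Complex.exp (Complex.I * ((r n)⁻¹ * j * Γ (s n) x : ℝ)) - 1
          - (Complex.exp (Complex.I * ((r n)⁻¹ * j * Γ t x : ℝ)) - 1)
          = Complex.exp (Complex.I * ((r n)⁻¹ * j * Γ t x : ℝ))
            * (Complex.exp (Complex.I * ((r n)⁻¹ * j * (Γ (s n) x - Γ t x) : ℝ)) - 1) := by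
        rw [mul_sub, ← Complex.exp_add, mul_one]
        push_cast
        ring_nf
      rw [e2, norm_mul, norm_exp_I_mul_ofReal, one_mul]
      refine Real.norm_exp_I_mul_ofReal_sub_one_le.trans (le_of_eq ?_)
      rw [Real.norm_eq_abs, abs_mul, abs_mul, abs_of_pos (inv_pos.2 hn)]
    refine (mul_le_mul_of_nonneg_left h4 hn.le).trans (le_of_eq ?_)
    rw [integral_const_mul]
    field_simp
  simpa using h3.add h1

/-- One factor is bounded by `2` on a window of length `2 R h` and the other by the modulus of its
exponent, so only first moments of `Γ` enter. For `q = 1/(nh)` the bound has order `h / n`. -/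
theorem lintegral_pair_exp_le_of_support {J : ℝ → ℝ} (hJm : Measurable J) (hJi : Integrable J) {R : ℝ}
    (hJR : ∀ z, R < |z| → J z = 0) {Γ : ℝ → E → ℝ} {C : ℝ}
    (hΓi : ∀ s, Integrable (Γ s) P) (hΓC : ∀ s, ∫ x, |Γ s x| ∂P ≤ C) (q t : ℝ) {h : ℝ}
    (hn : 0 < h) :
    ∫⁻ s, ∫⁻ u, ∫⁻ x, ENNReal.ofReal
      (‖Complex.exp (Complex.I * (q * J ((s - t) / h) * Γ s x : ℝ)) - 1‖
        * ‖Complex.exp (Complex.I * (q * J ((u - t) / h) * Γ u x : ℝ)) - 1‖) ∂P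
      ≤ ENNReal.ofReal (|q| * C * (h * ∫ z, |J z|) * (4 * (R * h))) := by
  have hC : 0 ≤ C := (integral_nonneg fun _ => abs_nonneg _).trans (hΓC 0)
  have hJ0 : 0 ≤ ∫ z, |J z| := integral_nonneg fun _ => abs_nonneg _
  have hb : ∀ s u x, ENNReal.ofReal (‖Complex.exp (Complex.I * (q * J ((s - t) / h) * Γ s x : ℝ)) - 1‖
      * ‖Complex.exp (Complex.I * (q * J ((u - t) / h) * Γ u x : ℝ)) - 1‖)
      ≤ (Icc (t - R * h) (t + R * h)).indicator (fun _ => (2 : ENNReal)) u *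
        ENNReal.ofReal |q * J ((s - t) / h) * Γ s x| := by
    intro s u x
    by_cases hu : u ∈ Icc (t - R * h) (t + R * h)
    · rw [indicator_of_mem hu, mul_comm, ENNReal.ofReal_mul (norm_nonneg _)]
      refine mul_le_mul' ?_ (ENNReal.ofReal_le_ofReal Real.norm_exp_I_mul_ofReal_sub_one_le)
      have h2 : ‖Complex.exp (Complex.I * (q * J ((u - t) / h) * Γ u x : ℝ)) - 1‖ ≤ 2 := by
        refine (norm_sub_le _ _).trans ?_
        rw [norm_exp_I_mul_ofReal, norm_one]; norm_num
      simpa using ENNReal.ofReal_le_ofReal h2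
    · have hJu : J ((u - t) / h) = 0 := by
        refine hJR _ ?_
        rw [abs_div, abs_of_pos hn, lt_div_iff₀ hn]
        by_contra! hcon
        rw [abs_le] at hcon
        exact hu ⟨by linarith [hcon.1], by linarith [hcon.2]⟩
      simp [hJu]
  calc _ ≤ ∫⁻ s, ∫⁻ u, (Icc (t - R * h) (t + R * h)).indicator (fun _ => (2 : ENNReal)) u *
        ∫⁻ x, ENNReal.ofReal |q * J ((s - t) / h) * Γ s x| ∂P := by
        refine lintegral_mono fun s => lintegral_mono fun u => ?_
        refine (lintegral_mono fun x => hb s u x).trans (le_of_eq ?_)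
        rw [lintegral_const_mul' _ _ (by
          by_cases hu : u ∈ Icc (t - R * h) (t + R * h) <;> simp [hu])]
    _ = ∫⁻ s, ENNReal.ofReal (4 * (R * h)) *
        ∫⁻ x, ENNReal.ofReal |q * J ((s - t) / h) * Γ s x| ∂P := by
        refine lintegral_congr fun s => ?_
        rw [lintegral_mul_const _ (measurable_const.indicator measurableSet_Icc),
          lintegral_indicator measurableSet_Icc, setLIntegral_const, Real.volume_Icc]
        congr 1
        rw [← ENNReal.ofReal_ofNat 2, ← ENNReal.ofReal_mul (by norm_num)]
        congr 1; ring
    _ ≤ _ := by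
        rw [lintegral_const_mul' _ _ ENNReal.ofReal_ne_top, mul_comm,
          ENNReal.ofReal_mul (p := |q| * C * (h * ∫ z, |J z|)) (by positivity)]
        exact mul_le_mul' (lintegral_abs_mul_le hJm hJi hΓi hΓC _ t hn) le_rfl

theorem IsPointProcess.tendsto_integral_local_average (hN : IsPointProcess N ν lam Λ c)
    {J : ℝ → ℝ} (hJm : Measurable J) (hJi : Integrable J)
    {Γ : ℝ → E → ℝ} {C t : ℝ} (hΓm : Measurable fun z : ℝ × E => Γ z.1 z.2)
    (hΓi : ∀ s, Integrable (Γ s) P) (hΓC : ∀ s, ∫ x, |Γ s x| ∂P ≤ C)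
    (hΓt : Tendsto (fun s => ∫ x, |Γ s x - Γ t x| ∂P) (𝓝 t) (𝓝 0)) (hlam : ContinuousAt lam t)
    {h : ℕ → ℝ} (hh : Tendsto h atTop (𝓝 0))
    (hnh : Tendsto (fun n : ℕ => n * h n) atTop atTop) :
    Tendsto (fun n : ℕ => ∫ z, (lam (t + h n * z) : ℂ) * (((n * h n : ℝ) : ℂ) *
      ∫ x, (Complex.exp (Complex.I * ((n * h n)⁻¹ * J z * Γ (t + h n * z) x : ℝ)) - 1) ∂P)) atTop
      (𝓝 (Complex.I * ((∫ z, J z) * (lam t * ∫ x, Γ t x ∂P) : ℝ))) := by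
  have hr0 : ∀ᶠ n : ℕ in atTop, 0 < n * h n := hnh.eventually_gt_atTop 0
  have e1 : ∫ z, (lam t : ℂ) * (Complex.I * (J z * ∫ x, Γ t x ∂P : ℝ))
      = Complex.I * ((∫ z, J z) * (lam t * ∫ x, Γ t x ∂P) : ℝ) := by
    rw [integral_const_mul, integral_const_mul, integral_complex_ofReal, integral_mul_const]
    push_cast; ring
  rw [← e1]
  have hΛ := hN.Λ_nonneg
  have hst : ∀ z, Tendsto (fun n => t + h n * z) atTop (𝓝 t) := fun z => by
    simpa using (hh.mul_const z).const_add t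
  refine tendsto_integral_filter_of_dominated_convergence (fun z => Λ * C * |J z|) ?_ ?_ ?_ ?_
  · refine Eventually.of_forall fun n => ?_
    have ha : Measurable fun z : ℝ => t + h n * z := (measurable_id.const_mul _).const_add _
    have h1 : Measurable fun z : ℝ × E =>
        Complex.exp (Complex.I * ((n * h n)⁻¹ * J z.1 * Γ (t + h n * z.1) z.2 : ℝ)) - 1 := by
      have h2 : Measurable fun z : ℝ × E => Γ (t + h n * z.1) z.2 :=
        hΓm.comp ((ha.comp measurable_fst).prodMk measurable_snd)
      exact (Complex.measurable_exp.comp ((Complex.measurable_ofReal.comp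
        (((hJm.comp measurable_fst).const_mul _).mul h2)).const_mul _)).sub_const _
    exact (((Complex.measurable_ofReal.comp (hN.measurable_lam.comp ha)).mul
      (h1.stronglyMeasurable.integral_prod_right'.measurable.const_mul _))).aestronglyMeasurable
  · filter_upwards [hr0] with n hn
    refine ae_of_all _ fun z => ?_
    rw [norm_mul, norm_mul, Complex.norm_real, Complex.norm_real, Real.norm_eq_abs,
      Real.norm_eq_abs, abs_of_pos hn, abs_of_nonneg (hN.lam_nonneg _), mul_assoc Λ]
    refine mul_le_mul (hN.lam_le _) ?_ (by positivity) hΛ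
    have h4 : ‖∫ x, (Complex.exp (Complex.I *
        ((n * h n)⁻¹ * J z * Γ (t + h n * z) x : ℝ)) - 1) ∂P‖
        ≤ ∫ x, (n * h n)⁻¹ * |J z| * |Γ (t + h n * z) x| ∂P := by
      refine norm_integral_le_of_norm_le ((hΓi _).abs.const_mul _) (ae_of_all _ fun x => ?_)
      refine Real.norm_exp_I_mul_ofReal_sub_one_le.trans (le_of_eq ?_)
      rw [Real.norm_eq_abs, abs_mul, abs_mul, abs_of_pos (inv_pos.2 hn)]
    rw [integral_const_mul] at h4
    calc n * h n * _ ≤ n * h n * ((n * h n)⁻¹ * |J z| * C) := by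
          refine mul_le_mul_of_nonneg_left (h4.trans ?_) hn.le
          have := inv_pos.2 hn
          gcongr
          exact hΓC _
      _ = C * |J z| := by
          rw [mul_assoc ((n : ℝ) * h n)⁻¹, mul_inv_cancel_left₀ hn.ne', mul_comm]
  · exact hJi.abs.const_mul _
  · refine ae_of_all _ fun z => ?_
    exact ((Complex.continuous_ofReal.tendsto _).comp (hlam.tendsto.comp (hst z))).mul
      (tendsto_mul_integral_exp_sub_one hΓm hΓi hΓt hnh (hst z) (J z))

/-- Law of large numbers for local averages, in terms of characteristic functions. -/
theorem IsPointProcess.tendsto_charFun_local_average (hN : IsPointProcess N ν lam Λ c)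
    {J : ℝ → ℝ} (hJm : Measurable J) (hJi : Integrable J) {R : ℝ} (hR : 0 < R)
    (hJR : ∀ z, R < |z| → J z = 0)
    {Γ : ℝ → E → ℝ} {C t : ℝ} (hΓm : Measurable fun z : ℝ × E => Γ z.1 z.2)
    (hΓi : ∀ s, Integrable (Γ s) P) (hΓC : ∀ s, ∫ x, |Γ s x| ∂P ≤ C)
    (hΓt : Tendsto (fun s => ∫ x, |Γ s x - Γ t x| ∂P) (𝓝 t) (𝓝 0)) (hlam : ContinuousAt lam t)
    {h : ℕ → ℝ} (h0 : ∀ᶠ n in atTop, 0 < h n) (hh : Tendsto h atTop (𝓝 0))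
    (hnh : Tendsto (fun n : ℕ => n * h n) atTop atTop) :
    Tendsto (fun n : ℕ => (n : ℂ) * (∫ z : E × M, Complex.exp (Complex.I *
      (∫ s, (n * h n)⁻¹ * J ((s - t) / h n) * Γ s z.1 ∂(N z.2) : ℝ)) ∂(P.prod ν) - 1)) atTop
      (𝓝 (Complex.I * ((∫ z, J z) * (lam t * ∫ x, Γ t x ∂P) : ℝ))) := by
  have hC : 0 ≤ C := (integral_nonneg fun _ => abs_nonneg _).trans (hΓC 0)
  have hJ0 : 0 ≤ ∫ z, |J z| := integral_nonneg fun _ => abs_nonneg _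
  have hr0 : ∀ᶠ n : ℕ in atTop, 0 < n * h n := hnh.eventually_gt_atTop 0
  refine hN.tendsto_charFun (v := fun n s x => (n * h n)⁻¹ * J ((s - t) / h n) * Γ s x)
    (B := fun n => |(n * h n)⁻¹| * C * (h n * ∫ z, |J z|) * (4 * (R * h n)))
    (fun n => measurable_local hJm hΓm _ _ _) ?_ ?_ ?_ ?_ ?_
  · filter_upwards [h0] with n hn
    exact (lintegral_abs_mul_le hJm hJi hΓi hΓC _ t hn).trans_lt ENNReal.ofReal_lt_top
  · filter_upwards [h0] with n hn
    positivity
  · filter_upwards [h0] with n hn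
    exact lintegral_pair_exp_le_of_support hJm hJi hJR hΓi hΓC _ t hn
  · have h1 : Tendsto (fun n => C * (∫ z, |J z|) * (4 * R) * h n) atTop (𝓝 0) := by
      simpa using hh.const_mul (C * (∫ z, |J z|) * (4 * R))
    refine h1.congr' ?_
    filter_upwards [h0, hr0] with n hn hrn
    rw [abs_of_pos (inv_pos.2 hrn)]
    have hn0 : (n : ℝ) ≠ 0 := fun h' => by simp [h'] at hrn
    field_simp
  have hlim := hN.tendsto_integral_local_average hJm hJi hΓm hΓi hΓC hΓt hlam hh hnh
  refine hlim.congr' ?_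
  filter_upwards [h0] with n hn
  rw [integral_eq_smul_integral_affine (fun s => lam s • ∫ x,
    (Complex.exp (Complex.I * ((n * h n)⁻¹ * J ((s - t) / h n) * Γ s x : ℝ)) - 1) ∂P) hn t,
    Complex.real_smul, ← mul_assoc, ← integral_const_mul]
  refine integral_congr_ae (ae_of_all _ fun z => ?_)
  have e2 : (t + h n * z - t) / h n = z := by field_simp; ring
  simp only [e2, Complex.real_smul]
  push_cast
  ring

end LocalLimits

/-! ### Central limit theorem for local scores -/

section LocalCentralLimit

variable {E M : Type*} [MeasurableSpace E] [MeasurableSpace M] {P : Measure E}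
  [IsProbabilityMeasure P] {N : Kernel M ℝ} {ν : Measure M} [IsProbabilityMeasure ν]
  {lam : ℝ → ℝ} {Λ c : ℝ} {g : ℝ → E → ℝ} {C t : ℝ}

theorem IsCentered.integrable_exp_sub_one (hg : IsCentered P g C) (q s : ℝ) :
    Integrable (fun x => Complex.exp (Complex.I * (q * g s x : ℝ)) - 1) P := by
  have hm : Measurable (g s) := hg.measurable.comp measurable_prodMk_left
  refine Integrable.of_bound ((Complex.measurable_exp.comp ((Complex.measurable_ofReal.comp
    (hm.const_mul q)).const_mul _)).sub_const _).aestronglyMeasurable 2 (ae_of_all _ fun x => ?_)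
  refine (norm_sub_le _ _).trans ?_
  rw [norm_exp_I_mul_ofReal, norm_one]; norm_num

theorem IsCentered.integral_exp_sub_one (hg : IsCentered P g C) (q s : ℝ) :
    ∫ x, (Complex.exp (Complex.I * (q * g s x : ℝ)) - 1) ∂P
      = ∫ x, (Complex.exp (Complex.I * (q * g s x : ℝ)) - 1 - Complex.I * (q * g s x : ℝ)) ∂P := by
  have hi : Integrable (fun x => q * g s x) P := ((hg.memLp s).integrable one_le_two).const_mul q
  have hi2 : Integrable (fun x => Complex.I * (q * g s x : ℝ)) P := hi.ofReal.const_mul _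
  rw [integral_sub (hg.integrable_exp_sub_one q s) hi2, integral_const_mul,
    integral_complex_ofReal, integral_const_mul, hg.mean]
  simp

/-- Centering removes the linear term, and a bound quadratic in `q` is left. With `q = J z / √(nh)`
it provides the dominating function in `tendsto_integral_local_score`. -/
theorem IsCentered.norm_integral_exp_sub_one_le (hg : IsCentered P g C) (q s : ℝ) :
    ‖∫ x, (Complex.exp (Complex.I * (q * g s x : ℝ)) - 1) ∂P‖ ≤ 2 * q ^ 2 * C := by
  rw [hg.integral_exp_sub_one]
  have h1 : ‖∫ x, (Complex.exp (Complex.I * (q * g s x : ℝ)) - 1 - Complex.I * (q * g s x : ℝ)) ∂P‖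
      ≤ ∫ x, 2 * q ^ 2 * g s x ^ 2 ∂P := by
    refine norm_integral_le_of_norm_le ((hg.memLp s).integrable_sq.const_mul _)
      (ae_of_all _ fun x => ?_)
    refine (Complex.norm_exp_I_mul_sub_one_sub_le _).trans (le_of_eq (by ring))
  refine h1.trans ?_
  rw [integral_const_mul]
  exact mul_le_mul_of_nonneg_left (hg.sq_le s) (by positivity)

theorem IsCentered.norm_integral_exp_sub_one_add_le (hg : IsCentered P g C) {δ Cδ : ℝ}
    (hδ0 : 0 < δ) (hδ1 : δ ≤ 1) (hgδ : ∀ s, Integrable (fun x => |g s x| ^ (2 + δ)) P)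
    (hCδ : ∀ s, ∫ x, |g s x| ^ (2 + δ) ∂P ≤ Cδ) (q s : ℝ) :
    ‖∫ x, (Complex.exp (Complex.I * (q * g s x : ℝ)) - 1) ∂P
      + ((q ^ 2 / 2 * ∫ x, g s x ^ 2 ∂P : ℝ) : ℂ)‖ ≤ 3 * |q| ^ (2 + δ) * Cδ := by
  have hi : Integrable (fun x => q * g s x) P := ((hg.memLp s).integrable one_le_two).const_mul q
  have hi2 : Integrable (fun x => Complex.I * (q * g s x : ℝ)) P := hi.ofReal.const_mul _
  have hi3 : Integrable (fun x => ((q * g s x : ℝ) : ℂ) ^ 2 / 2) P := by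
    have h2 : Integrable (fun x => ((q ^ 2 / 2 * g s x ^ 2 : ℝ) : ℂ)) P :=
      ((hg.memLp s).integrable_sq.const_mul _).ofReal
    refine h2.congr (ae_of_all _ fun x => ?_)
    push_cast; ring
  have e1 : ∫ x, ((q * g s x : ℝ) : ℂ) ^ 2 / 2 ∂P = ((q ^ 2 / 2 * ∫ x, g s x ^ 2 ∂P : ℝ) : ℂ) := by
    rw [← integral_const_mul, ← integral_complex_ofReal]
    refine integral_congr_ae (ae_of_all _ fun x => ?_)
    push_cast; ring
  have hi4 : Integrable (fun x => Complex.exp (Complex.I * (q * g s x : ℝ)) - 1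
      - Complex.I * (q * g s x : ℝ)) P := (hg.integrable_exp_sub_one q s).sub hi2
  rw [hg.integral_exp_sub_one, ← e1, ← integral_add hi4 hi3]
  have h1 : ‖∫ x, (Complex.exp (Complex.I * (q * g s x : ℝ)) - 1 - Complex.I * (q * g s x : ℝ)
      + ((q * g s x : ℝ) : ℂ) ^ 2 / 2) ∂P‖ ≤ ∫ x, 3 * |q| ^ (2 + δ) * |g s x| ^ (2 + δ) ∂P := by
    refine norm_integral_le_of_norm_le ((hgδ s).const_mul _) (ae_of_all _ fun x => ?_)
    refine (Complex.norm_exp_I_mul_sub_quadratic_le _ hδ0 hδ1).trans (le_of_eq ?_)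
    rw [abs_mul, Real.mul_rpow (abs_nonneg _) (abs_nonneg _), mul_assoc]
  refine h1.trans ?_
  rw [integral_const_mul]
  exact mul_le_mul_of_nonneg_left (hCδ s) (by positivity)

/-- The remainder beyond second order has size `r (√r)^{-(2+δ)} = (√r)^{-δ}`, which vanishes by the
Lyapunov moment. -/
theorem IsCentered.tendsto_mul_integral_exp_sub_one (hg : IsCentered P g C) {δ Cδ : ℝ}
    (hδ0 : 0 < δ) (hδ1 : δ ≤ 1) (hgδ : ∀ s, Integrable (fun x => |g s x| ^ (2 + δ)) P)
    (hCδ : ∀ s, ∫ x, |g s x| ^ (2 + δ) ∂P ≤ Cδ)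
    (hgt : ContinuousAt (fun s => ∫ x, g s x ^ 2 ∂P) t)
    {r s : ℕ → ℝ} (hr : Tendsto r atTop atTop) (hs : Tendsto s atTop (𝓝 t)) (j : ℝ) :
    Tendsto (fun n => (r n : ℂ) *
      ∫ x, (Complex.exp (Complex.I * ((√(r n))⁻¹ * j * g (s n) x : ℝ)) - 1) ∂P)
      atTop (𝓝 (-(j ^ 2 / 2 * ∫ x, g t x ^ 2 ∂P : ℝ) : ℂ)) := by
  have hr0 : ∀ᶠ n in atTop, 0 < r n := hr.eventually_gt_atTop 0
  have h1 : Tendsto (fun n => -((j ^ 2 / 2 * ∫ x, g (s n) x ^ 2 ∂P : ℝ) : ℂ)) atTop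
      (𝓝 (-(j ^ 2 / 2 * ∫ x, g t x ^ 2 ∂P : ℝ) : ℂ)) :=
    ((Complex.continuous_ofReal.tendsto _).comp ((hgt.tendsto.comp hs).const_mul _)).neg
  have hd : Tendsto (fun n => (r n : ℂ) *
      ∫ x, (Complex.exp (Complex.I * ((√(r n))⁻¹ * j * g (s n) x : ℝ)) - 1) ∂P
      + ((j ^ 2 / 2 * ∫ x, g (s n) x ^ 2 ∂P : ℝ) : ℂ)) atTop (𝓝 0) := by
    have h2 : Tendsto (fun n => 3 * |j| ^ (2 + δ) * Cδ * (√(r n)) ^ (-δ)) atTop (𝓝 0) := by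
      simpa using ((tendsto_rpow_neg_atTop hδ0).comp
        (Real.tendsto_sqrt_atTop.comp hr)).const_mul (3 * |j| ^ (2 + δ) * Cδ)
    refine squeeze_zero_norm' ?_ h2
    filter_upwards [hr0] with n hn
    have hq := Real.sqrt_pos.2 hn
    have hsq : √(r n) ^ 2 = r n := Real.sq_sqrt hn.le
    have e1 : (r n : ℂ) * ∫ x, (Complex.exp (Complex.I * ((√(r n))⁻¹ * j * g (s n) x : ℝ)) - 1) ∂P
      + ((j ^ 2 / 2 * ∫ x, g (s n) x ^ 2 ∂P : ℝ) : ℂ) = (r n : ℂ) *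
      (∫ x, (Complex.exp (Complex.I * ((√(r n))⁻¹ * j * g (s n) x : ℝ)) - 1) ∂P
        + ((((√(r n))⁻¹ * j) ^ 2 / 2 * ∫ x, g (s n) x ^ 2 ∂P : ℝ) : ℂ)) := by
      rw [mul_add, ← Complex.ofReal_mul, mul_pow, inv_pow, hsq]
      congr 2
      field_simp
    rw [e1, norm_mul, Complex.norm_real, Real.norm_eq_abs, abs_of_pos hn]
    refine (mul_le_mul_of_nonneg_left
      (hg.norm_integral_exp_sub_one_add_le hδ0 hδ1 hgδ hCδ _ _) hn.le).trans (le_of_eq ?_)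
    rw [abs_mul, abs_of_pos (inv_pos.2 hq), Real.mul_rpow (inv_pos.2 hq).le (abs_nonneg _)]
    have e2 : r n * (√(r n))⁻¹ ^ (2 + δ) = √(r n) ^ (-δ) := by
      rw [Real.inv_rpow hq.le, ← Real.rpow_neg hq.le, neg_add, Real.rpow_add hq,
        Real.rpow_neg hq.le, Real.rpow_two, hsq, ← mul_assoc, mul_inv_cancel₀ hn.ne', one_mul]
    rw [← e2]; ring
  refine ((hd.add h1).congr fun n => ?_).trans (by rw [zero_add])
  ring

theorem IsCentered.integral_abs_le (hg : IsCentered P g C) (s : ℝ) :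
    ∫ x, |g s x| ∂P ≤ 1 + C := by
  have h1 : ∫ x, |g s x| ∂P ≤ ∫ x, (1 + g s x ^ 2) ∂P := by
    refine integral_mono ((hg.memLp s).integrable one_le_two).abs
      ((integrable_const _).add (hg.memLp s).integrable_sq) fun x => ?_
    have := sq_abs (g s x)
    simp only
    nlinarith [sq_nonneg (|g s x| - 1), abs_nonneg (g s x)]
  rw [integral_add (integrable_const _) (hg.memLp s).integrable_sq] at h1
  have := hg.sq_le s
  simp at h1
  linarith

/-- With second moments available, both factors are bounded by the moduli of their exponents. For
`q² = 1/(nh)` the bound multiplied by `n` has order `h`. -/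
theorem IsCentered.lintegral_pair_exp_le (hg : IsCentered P g C) {J : ℝ → ℝ} (hJm : Measurable J)
    (hJi : Integrable J) (q t : ℝ) {h : ℝ} (hh : 0 < h) :
    ∫⁻ s, ∫⁻ u, ∫⁻ x, ENNReal.ofReal
      (‖Complex.exp (Complex.I * (q * J ((s - t) / h) * g s x : ℝ)) - 1‖
        * ‖Complex.exp (Complex.I * (q * J ((u - t) / h) * g u x : ℝ)) - 1‖) ∂P
      ≤ ENNReal.ofReal (q ^ 2 * C * (h * ∫ z, |J z|) ^ 2) := by
  have hC := hg.nonneg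
  have hJ0 : 0 ≤ ∫ z, |J z| := integral_nonneg fun _ => abs_nonneg _
  have hJl : ∫⁻ s, ENNReal.ofReal |J ((s - t) / h)| = ENNReal.ofReal (h * ∫ z, |J z|) := by
    rw [lintegral_comp_affine hh t (f := fun z => ENNReal.ofReal |J z|) hJm.abs.ennreal_ofReal,
      ← ofReal_integral_eq_lintegral_ofReal hJi.abs (ae_of_all _ fun _ => abs_nonneg _),
      ← ENNReal.ofReal_mul hh.le]
  have hb : ∀ s u, ∫⁻ x, ENNReal.ofReal
      (‖Complex.exp (Complex.I * (q * J ((s - t) / h) * g s x : ℝ)) - 1‖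
        * ‖Complex.exp (Complex.I * (q * J ((u - t) / h) * g u x : ℝ)) - 1‖) ∂P
      ≤ ENNReal.ofReal (q ^ 2 * C) * ENNReal.ofReal |J ((s - t) / h)|
        * ENNReal.ofReal |J ((u - t) / h)| := by
    intro s u
    set A := q ^ 2 * |J ((s - t) / h)| * |J ((u - t) / h)| with hA
    have hA0 : 0 ≤ A := by positivity
    have hi : Integrable (fun x => A / 2 * (g s x ^ 2 + g u x ^ 2)) P :=
      ((hg.memLp s).integrable_sq.add (hg.memLp u).integrable_sq).const_mul _
    calc _ ≤ ∫⁻ x, ENNReal.ofReal (A / 2 * (g s x ^ 2 + g u x ^ 2)) ∂P := by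
          refine lintegral_mono fun x => ENNReal.ofReal_le_ofReal ?_
          calc _ ≤ |q * J ((s - t) / h) * g s x| * |q * J ((u - t) / h) * g u x| :=
                mul_le_mul Real.norm_exp_I_mul_ofReal_sub_one_le
                  Real.norm_exp_I_mul_ofReal_sub_one_le (norm_nonneg _) (abs_nonneg _)
            _ = A * (|g s x| * |g u x|) := by
                simp only [abs_mul]
                rw [hA, ← sq_abs q]; ring
            _ ≤ _ := by
                rw [div_mul_eq_mul_div, mul_div_assoc]
                refine mul_le_mul_of_nonneg_left ?_ hA0
                rw [← sq_abs (g s x), ← sq_abs (g u x)]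
                nlinarith [sq_nonneg (|g s x| - |g u x|)]
      _ = ENNReal.ofReal (A / 2 * (∫ x, g s x ^ 2 ∂P + ∫ x, g u x ^ 2 ∂P)) := by
          rw [← ofReal_integral_eq_lintegral_ofReal hi (ae_of_all _ fun x => by positivity),
            integral_const_mul,
            integral_add (hg.memLp s).integrable_sq (hg.memLp u).integrable_sq]
      _ ≤ ENNReal.ofReal (A / 2 * (C + C)) := by
          refine ENNReal.ofReal_le_ofReal ?_
          have := hg.sq_le s
          have := hg.sq_le u
          gcongr
      _ = _ := by
          rw [← ENNReal.ofReal_mul (by positivity), ← ENNReal.ofReal_mul (by positivity)]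
          congr 1; rw [hA]; ring
  calc _ ≤ ∫⁻ s, ∫⁻ u, ENNReal.ofReal (q ^ 2 * C) * ENNReal.ofReal |J ((s - t) / h)|
        * ENNReal.ofReal |J ((u - t) / h)| := lintegral_mono fun s => lintegral_mono fun u => hb s u
    _ = ∫⁻ s, ENNReal.ofReal (q ^ 2 * C) * ENNReal.ofReal |J ((s - t) / h)|
        * ENNReal.ofReal (h * ∫ z, |J z|) := by
        refine lintegral_congr fun s => ?_
        rw [lintegral_const_mul' _ _ (ENNReal.mul_ne_top ENNReal.ofReal_ne_top
          ENNReal.ofReal_ne_top), hJl]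
    _ = _ := by
        rw [lintegral_mul_const' _ _ ENNReal.ofReal_ne_top,
          lintegral_const_mul' _ _ ENNReal.ofReal_ne_top, hJl, ← ENNReal.ofReal_mul (by positivity),
          ← ENNReal.ofReal_mul (by positivity)]
        congr 1; ring

theorem IsPointProcess.tendsto_integral_local_score (hN : IsPointProcess N ν lam Λ c)
    (hg : IsCentered P g C) {J : ℝ → ℝ} (hJm : Measurable J)
    (hJ2 : Integrable fun z => J z ^ 2) {δ Cδ : ℝ} (hδ0 : 0 < δ) (hδ1 : δ ≤ 1)
    (hgδ : ∀ s, Integrable (fun x => |g s x| ^ (2 + δ)) P)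
    (hCδ : ∀ s, ∫ x, |g s x| ^ (2 + δ) ∂P ≤ Cδ)
    (hgt : ContinuousAt (fun s => ∫ x, g s x ^ 2 ∂P) t) (hlam : ContinuousAt lam t)
    {h : ℕ → ℝ} (hh : Tendsto h atTop (𝓝 0))
    (hnh : Tendsto (fun n : ℕ => n * h n) atTop atTop) :
    Tendsto (fun n : ℕ => ∫ z, (lam (t + h n * z) : ℂ) * (((n * h n : ℝ) : ℂ) *
      ∫ x, (Complex.exp (Complex.I * ((√(n * h n))⁻¹ * J z * g (t + h n * z) x : ℝ)) - 1) ∂P)) atTop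
      (𝓝 (-((∫ z, J z ^ 2) * (lam t * ∫ x, g t x ^ 2 ∂P) / 2 : ℝ) : ℂ)) := by
  have hr0 : ∀ᶠ n : ℕ in atTop, 0 < n * h n := hnh.eventually_gt_atTop 0
  have e1 : ∫ z, (lam t : ℂ) * (-(J z ^ 2 / 2 * ∫ x, g t x ^ 2 ∂P : ℝ) : ℂ)
      = (-((∫ z, J z ^ 2) * (lam t * ∫ x, g t x ^ 2 ∂P) / 2 : ℝ) : ℂ) := by
    rw [integral_const_mul, integral_neg, integral_complex_ofReal, integral_mul_const,
      integral_div]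
    push_cast; ring
  rw [← e1]
  have hΛ := hN.Λ_nonneg
  have hst : ∀ z, Tendsto (fun n => t + h n * z) atTop (𝓝 t) := fun z => by
    simpa using (hh.mul_const z).const_add t
  refine tendsto_integral_filter_of_dominated_convergence (fun z => Λ * (2 * C) * J z ^ 2)
    ?_ ?_ ?_ ?_
  · refine Eventually.of_forall fun n => ?_
    have ha : Measurable fun z : ℝ => t + h n * z := (measurable_id.const_mul _).const_add _
    have h1 : Measurable fun z : ℝ × E =>
        Complex.exp (Complex.I * ((√(n * h n))⁻¹ * J z.1 * g (t + h n * z.1) z.2 : ℝ)) - 1 := by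
      have h2 : Measurable fun z : ℝ × E => g (t + h n * z.1) z.2 :=
        hg.measurable.comp ((ha.comp measurable_fst).prodMk measurable_snd)
      exact (Complex.measurable_exp.comp ((Complex.measurable_ofReal.comp
        (((hJm.comp measurable_fst).const_mul _).mul h2)).const_mul _)).sub_const _
    exact (((Complex.measurable_ofReal.comp (hN.measurable_lam.comp ha)).mul
      (h1.stronglyMeasurable.integral_prod_right'.measurable.const_mul _))).aestronglyMeasurable
  · filter_upwards [hr0] with n hn
    refine ae_of_all _ fun z => ?_
    rw [norm_mul, norm_mul, Complex.norm_real, Complex.norm_real, Real.norm_eq_abs,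
      Real.norm_eq_abs, abs_of_pos hn, abs_of_nonneg (hN.lam_nonneg _), mul_assoc Λ]
    refine mul_le_mul (hN.lam_le _) ?_ (by positivity) hΛ
    refine (mul_le_mul_of_nonneg_left (hg.norm_integral_exp_sub_one_le _ _) hn.le).trans
      (le_of_eq ?_)
    rw [mul_pow, inv_pow, Real.sq_sqrt hn.le]
    calc _ = (n * h n * (n * h n)⁻¹) * (2 * C * J z ^ 2) := by ring
      _ = _ := by rw [mul_inv_cancel₀ hn.ne', one_mul]
  · exact hJ2.const_mul _
  · refine ae_of_all _ fun z => ?_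
    exact ((Complex.continuous_ofReal.tendsto _).comp (hlam.tendsto.comp (hst z))).mul
      (hg.tendsto_mul_integral_exp_sub_one hδ0 hδ1 hgδ hCδ hgt hnh (hst z) (J z))

/-- Central limit theorem for local averages, in terms of characteristic functions. -/
theorem IsPointProcess.tendsto_charFun_local_score (hN : IsPointProcess N ν lam Λ c)
    (hg : IsCentered P g C) {J : ℝ → ℝ} (hJm : Measurable J) (hJi : Integrable J)
    (hJ2 : Integrable fun z => J z ^ 2) {δ Cδ : ℝ} (hδ0 : 0 < δ) (hδ1 : δ ≤ 1)
    (hgδ : ∀ s, Integrable (fun x => |g s x| ^ (2 + δ)) P)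
    (hCδ : ∀ s, ∫ x, |g s x| ^ (2 + δ) ∂P ≤ Cδ)
    (hgt : ContinuousAt (fun s => ∫ x, g s x ^ 2 ∂P) t) (hlam : ContinuousAt lam t)
    {h : ℕ → ℝ} (h0 : ∀ᶠ n in atTop, 0 < h n) (hh : Tendsto h atTop (𝓝 0))
    (hnh : Tendsto (fun n : ℕ => n * h n) atTop atTop) :
    Tendsto (fun n : ℕ => (n : ℂ) * (∫ z : E × M, Complex.exp (Complex.I *
      (∫ s, (√(n * h n))⁻¹ * J ((s - t) / h n) * g s z.1 ∂(N z.2) : ℝ)) ∂(P.prod ν) - 1)) atTop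
      (𝓝 (-((∫ z, J z ^ 2) * (lam t * ∫ x, g t x ^ 2 ∂P) / 2 : ℝ) : ℂ)) := by
  have hC := hg.nonneg
  have hJ0 : 0 ≤ ∫ z, |J z| := integral_nonneg fun _ => abs_nonneg _
  have hr0 : ∀ᶠ n : ℕ in atTop, 0 < n * h n := hnh.eventually_gt_atTop 0
  refine hN.tendsto_charFun (v := fun n s x => (√(n * h n))⁻¹ * J ((s - t) / h n) * g s x)
    (B := fun n => ((√(n * h n))⁻¹) ^ 2 * C * (h n * ∫ z, |J z|) ^ 2)
    (fun n => measurable_local hJm hg.measurable _ _ _) ?_ ?_ ?_ ?_ ?_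
  · filter_upwards [h0] with n hn
    exact (lintegral_abs_mul_le hJm hJi (fun s => (hg.memLp s).integrable one_le_two)
      hg.integral_abs_le _ t hn).trans_lt ENNReal.ofReal_lt_top
  · filter_upwards [h0] with n hn
    positivity
  · filter_upwards [h0] with n hn
    exact hg.lintegral_pair_exp_le hJm hJi _ t hn
  · have h1 : Tendsto (fun n => C * (∫ z, |J z|) ^ 2 * h n) atTop (𝓝 0) := by
      simpa using hh.const_mul (C * (∫ z, |J z|) ^ 2)
    refine h1.congr' ?_
    filter_upwards [h0, hr0] with n hn hrn
    have hn0 : (n : ℝ) ≠ 0 := fun h' => by simp [h'] at hrn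
    rw [inv_pow, Real.sq_sqrt hrn.le]
    field_simp
  have hlim := hN.tendsto_integral_local_score hg hJm hJ2 hδ0 hδ1 hgδ hCδ hgt hlam hh hnh
  refine hlim.congr' ?_
  filter_upwards [h0] with n hn
  rw [integral_eq_smul_integral_affine (fun s => lam s • ∫ x,
    (Complex.exp (Complex.I * ((√(n * h n))⁻¹ * J ((s - t) / h n) * g s x : ℝ)) - 1) ∂P) hn t,
    Complex.real_smul, ← mul_assoc, ← integral_const_mul]
  refine integral_congr_ae (ae_of_all _ fun z => ?_)
  have e2 : (t + h n * z - t) / h n = z := by field_simp; ring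
  simp only [e2, Complex.real_smul]
  push_cast
  ring

end LocalCentralLimit

/-! ### Calculus of smallness and boundedness in probability -/

section InProbability

variable {Ω : Type*} [MeasurableSpace Ω] {μ : Measure Ω}

/-- The upper tails of `f n` vanish: for nonnegative `f n`, convergence to zero in probability. -/
def SmallInProb (μ : Measure Ω) (f : ℕ → Ω → ℝ) : Prop :=
  ∀ ε : ℝ, 0 < ε → Tendsto (fun n => μ {ω | ε < f n ω}) atTop (𝓝 0)

/-- The sequence `f n` is bounded above in probability. -/
def BoundedInProb (μ : Measure Ω) (f : ℕ → Ω → ℝ) : Prop :=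
  ∀ ε : ℝ, 0 < ε → ∃ B : ℝ, ∀ᶠ n in atTop, μ {ω | B < f n ω} ≤ ENNReal.ofReal ε

variable {f g s : ℕ → Ω → ℝ}

/-- Admits a comparison that holds only on the event `s n ≤ ε₀`, whose complement has vanishing
probability. It is applied where the Gram matrix is close to its limit. -/
theorem SmallInProb.of_le_on (hs : SmallInProb μ s) (hg : SmallInProb μ g) {ε₀ : ℝ} (hε₀ : 0 < ε₀)
    (h : ∀ᶠ n in atTop, ∀ᵐ ω ∂μ, s n ω ≤ ε₀ → f n ω ≤ g n ω) : SmallInProb μ f := by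
  intro ε hε
  have h1 : Tendsto (fun n => μ {ω | ε < g n ω} + μ {ω | ε₀ < s n ω}) atTop (𝓝 0) := by
    simpa using (hg ε hε).add (hs ε₀ hε₀)
  refine tendsto_of_tendsto_of_tendsto_of_le_of_le' tendsto_const_nhds h1
    (Eventually.of_forall fun _ => zero_le) ?_
  filter_upwards [h] with n hn
  refine (measure_mono_ae (hn.mono fun ω hω hlt => ?_)).trans (measure_union_le _ _)
  by_cases hc : s n ω ≤ ε₀
  · exact Or.inl (lt_of_lt_of_le hlt (hω hc))
  · exact Or.inr (not_le.1 hc)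

theorem BoundedInProb.of_le_on (hs : SmallInProb μ s) (hg : BoundedInProb μ g) {ε₀ : ℝ}
    (hε₀ : 0 < ε₀) (h : ∀ᶠ n in atTop, ∀ᵐ ω ∂μ, s n ω ≤ ε₀ → f n ω ≤ g n ω) :
    BoundedInProb μ f := by
  intro ε hε
  obtain ⟨B, hB⟩ := hg (ε / 2) (by positivity)
  refine ⟨B, ?_⟩
  have h2 : ∀ᶠ n in atTop, μ {ω | ε₀ < s n ω} ≤ ENNReal.ofReal (ε / 2) :=
    (hs ε₀ hε₀).eventually_le_const (by simpa using hε)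
  filter_upwards [h, hB, h2] with n hn h3 h4
  calc μ {ω | B < f n ω} ≤ μ ({ω | B < g n ω} ∪ {ω | ε₀ < s n ω}) := by
        refine measure_mono_ae (hn.mono fun ω hω hlt => ?_)
        by_cases hc : s n ω ≤ ε₀
        · exact Or.inl (lt_of_lt_of_le hlt (hω hc))
        · exact Or.inr (not_le.1 hc)
    _ ≤ ENNReal.ofReal (ε / 2) + ENNReal.ofReal (ε / 2) :=
        (measure_union_le _ _).trans (add_le_add h3 h4)
    _ = ENNReal.ofReal ε := by rw [← ENNReal.ofReal_add (by positivity) (by positivity)]; ring_nf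

theorem smallInProb_zero : SmallInProb μ fun _ _ => 0 := by
  intro ε hε
  simp [hε.not_gt]

theorem SmallInProb.mono (hg : SmallInProb μ g) (h : ∀ᶠ n in atTop, ∀ᵐ ω ∂μ, f n ω ≤ g n ω) :
    SmallInProb μ f :=
  smallInProb_zero.of_le_on hg one_pos (h.mono fun _ hn => hn.mono fun _ hω _ => hω)

theorem BoundedInProb.mono (hg : BoundedInProb μ g)
    (h : ∀ᶠ n in atTop, ∀ᵐ ω ∂μ, f n ω ≤ g n ω) : BoundedInProb μ f :=
  hg.of_le_on smallInProb_zero one_pos (h.mono fun _ hn => hn.mono fun _ hω _ => hω)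

theorem SmallInProb.bounded (hf : SmallInProb μ f) : BoundedInProb μ f := fun ε hε =>
  ⟨1, (hf 1 one_pos).eventually_le_const (by simpa using hε)⟩

theorem SmallInProb.add (hf : SmallInProb μ f) (hg : SmallInProb μ g) :
    SmallInProb μ fun n ω => f n ω + g n ω := by
  intro ε hε
  have h1 : Tendsto (fun n => μ {ω | ε / 2 < f n ω} + μ {ω | ε / 2 < g n ω}) atTop (𝓝 0) := by
    simpa using (hf (ε / 2) (by positivity)).add (hg (ε / 2) (by positivity))
  refine tendsto_of_tendsto_of_tendsto_of_le_of_le tendsto_const_nhds h1 (fun _ => zero_le)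
    fun n => (measure_mono fun ω hω => ?_).trans (measure_union_le _ _)
  by_contra hc
  simp only [mem_union, mem_ofPred_eq, not_or, not_lt] at hc hω
  linarith [hc.1, hc.2]

theorem BoundedInProb.add (hf : BoundedInProb μ f) (hg : BoundedInProb μ g) :
    BoundedInProb μ fun n ω => f n ω + g n ω := by
  intro ε hε
  obtain ⟨A, hA⟩ := hf (ε / 2) (by positivity)
  obtain ⟨B, hB⟩ := hg (ε / 2) (by positivity)
  refine ⟨A + B, ?_⟩
  filter_upwards [hA, hB] with n h1 h2
  calc μ {ω | A + B < f n ω + g n ω} ≤ μ ({ω | A < f n ω} ∪ {ω | B < g n ω}) := by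
        refine measure_mono fun ω hω => ?_
        by_contra hc
        simp only [mem_union, mem_ofPred_eq, not_or, not_lt] at hc hω
        linarith [hc.1, hc.2]
    _ ≤ ENNReal.ofReal (ε / 2) + ENNReal.ofReal (ε / 2) :=
        (measure_union_le _ _).trans (add_le_add h1 h2)
    _ = ENNReal.ofReal ε := by rw [← ENNReal.ofReal_add (by positivity) (by positivity)]; ring_nf

theorem SmallInProb.const_mul (hf : SmallInProb μ f) {a : ℝ} (ha : 0 ≤ a) :
    SmallInProb μ fun n ω => a * f n ω := by
  rcases ha.eq_or_lt with rfl | ha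
  · simpa using smallInProb_zero
  intro ε hε
  refine (hf (ε / a) (by positivity)).congr fun n => ?_
  congr 1; ext ω
  simp only [mem_ofPred_eq]
  rw [div_lt_iff₀' ha]

theorem BoundedInProb.const_mul (hf : BoundedInProb μ f) {a : ℝ} (ha : 0 ≤ a) :
    BoundedInProb μ fun n ω => a * f n ω := by
  rcases ha.eq_or_lt with rfl | ha
  · simpa using smallInProb_zero.bounded
  intro ε hε
  obtain ⟨B, hB⟩ := hf ε hε
  refine ⟨a * B, hB.mono fun n hn => ?_⟩
  simpa [mul_lt_mul_iff_right₀ ha] using hn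

theorem SmallInProb.sum {ι : Type*} (s : Finset ι) {f : ι → ℕ → Ω → ℝ}
    (hf : ∀ i ∈ s, SmallInProb μ (f i)) : SmallInProb μ fun n ω => ∑ i ∈ s, f i n ω := by
  classical
  induction s using Finset.induction_on with
  | empty => simpa using smallInProb_zero
  | insert a s ha ih =>
    simp only [Finset.sum_insert ha]
    exact (hf a (Finset.mem_insert_self _ _)).add
      (ih fun i hi => hf i (Finset.mem_insert_of_mem hi))

theorem BoundedInProb.sum {ι : Type*} (s : Finset ι) {f : ι → ℕ → Ω → ℝ}
    (hf : ∀ i ∈ s, BoundedInProb μ (f i)) : BoundedInProb μ fun n ω => ∑ i ∈ s, f i n ω := by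
  classical
  induction s using Finset.induction_on with
  | empty => simpa using smallInProb_zero.bounded
  | insert a s ha ih =>
    simp only [Finset.sum_insert ha]
    exact (hf a (Finset.mem_insert_self _ _)).add
      (ih fun i hi => hf i (Finset.mem_insert_of_mem hi))

theorem SmallInProb.mul_bounded (hf : SmallInProb μ f) (hg : BoundedInProb μ g)
    (hf0 : ∀ n ω, 0 ≤ f n ω) : SmallInProb μ fun n ω => f n ω * g n ω := by
  intro ε hε
  rw [ENNReal.tendsto_nhds_zero]
  intro η hη
  obtain ⟨η', hη', hη'le⟩ : ∃ η' : ℝ, 0 < η' ∧ ENNReal.ofReal η' + ENNReal.ofReal η' ≤ η := by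
    rcases eq_or_ne η ⊤ with rfl | htop
    · exact ⟨1, one_pos, le_top⟩
    · have h0 := ENNReal.toReal_pos hη.ne' htop
      refine ⟨η.toReal / 2, by positivity, ?_⟩
      rw [← ENNReal.ofReal_add (by positivity) (by positivity), add_halves,
        ENNReal.ofReal_toReal htop]
  obtain ⟨B, hB⟩ := hg η' hη'
  set B' := max B 1
  have hB' : 0 < B' := lt_max_of_lt_right one_pos
  have h2 : ∀ᶠ n in atTop, μ {ω | ε / B' < f n ω} ≤ ENNReal.ofReal η' :=
    (hf (ε / B') (by positivity)).eventually_le_const (by simpa using hη')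
  filter_upwards [hB, h2] with n h3 h4
  refine le_trans ?_ ((add_le_add h4 h3).trans hη'le)
  refine (measure_mono fun ω hω => ?_).trans (measure_union_le _ _)
  by_contra hc
  simp only [mem_union, mem_ofPred_eq, not_or, not_lt] at hc hω
  have h5 : f n ω * g n ω ≤ ε / B' * B' := by
    calc f n ω * g n ω ≤ f n ω * B' :=
          mul_le_mul_of_nonneg_left (hc.2.trans (le_max_left _ _)) (hf0 n ω)
      _ ≤ _ := mul_le_mul_of_nonneg_right hc.1 hB'.le
  rw [div_mul_cancel₀ _ hB'.ne'] at h5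
  linarith

theorem measure_lt_le_lintegral {f : Ω → ℝ} (hf : Measurable f) {ε b : ℝ} (hε : 0 < ε)
    (h : ∫⁻ ω, ENNReal.ofReal (f ω) ∂μ ≤ ENNReal.ofReal b) :
    μ {ω | ε < f ω} ≤ ENNReal.ofReal (b / ε) := by
  have h0 : ENNReal.ofReal ε ≠ 0 := by simpa using hε
  rw [ENNReal.ofReal_div_of_pos hε, ENNReal.le_div_iff_mul_le (Or.inl h0)
    (Or.inl ENNReal.ofReal_ne_top), mul_comm]
  refine le_trans ?_ h
  refine le_trans ?_ (mul_meas_ge_le_lintegral hf.ennreal_ofReal (ENNReal.ofReal ε))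
  exact mul_le_mul' le_rfl (measure_mono fun ω hω =>
    ENNReal.ofReal_le_ofReal (show ε ≤ f ω from le_of_lt hω))

theorem smallInProb_of_lintegral (hf : ∀ n, Measurable (f n)) {a : ℕ → ℝ} (ha : Tendsto a atTop (𝓝 0))
    (h : ∀ᶠ n in atTop, ∫⁻ ω, ENNReal.ofReal (f n ω) ∂μ ≤ ENNReal.ofReal (a n)) :
    SmallInProb μ f := by
  intro ε hε
  have h1 : Tendsto (fun n => ENNReal.ofReal (a n / ε)) atTop (𝓝 0) := by
    simpa using ENNReal.tendsto_ofReal (ha.div_const ε)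
  exact tendsto_of_tendsto_of_tendsto_of_le_of_le' tendsto_const_nhds h1
    (Eventually.of_forall fun _ => zero_le) (h.mono fun n hn => measure_lt_le_lintegral (hf n) hε hn)

theorem boundedInProb_of_lintegral (hf : ∀ n, Measurable (f n)) {C : ℝ}
    (h : ∀ᶠ n in atTop, ∫⁻ ω, ENNReal.ofReal (f n ω) ∂μ ≤ ENNReal.ofReal C) :
    BoundedInProb μ f := by
  intro ε hε
  refine ⟨(|C| + 1) / ε, h.mono fun n hn => ?_⟩
  have hB : 0 < (|C| + 1) / ε := by positivity
  refine (measure_lt_le_lintegral (hf n) hB hn).trans (ENNReal.ofReal_le_ofReal ?_)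
  rw [div_div_eq_mul_div, div_le_iff₀ (by positivity), mul_comm]
  exact mul_le_mul_of_nonneg_left (by linarith [le_abs_self C]) hε.le

theorem boundedInProb_of_lintegral_sq (hf : ∀ n, Measurable (f n)) {C : ℝ}
    (h : ∀ᶠ n in atTop, ∫⁻ ω, ENNReal.ofReal (f n ω ^ 2) ∂μ ≤ ENNReal.ofReal C) :
    BoundedInProb μ fun n ω => |f n ω| := by
  intro ε hε
  obtain ⟨B, hB⟩ := boundedInProb_of_lintegral (fun n => (hf n).pow_const 2) h ε hε
  refine ⟨|B| + 1, hB.mono fun n hn => (measure_mono fun ω hω => ?_).trans hn⟩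
  simp only [mem_ofPred_eq] at hω ⊢
  have h1 := abs_nonneg B
  rw [← sq_abs]
  nlinarith [le_abs_self B]

end InProbability

/-! ### Characteristic functions of sums over subjects -/

section IndependentSums

variable {Ω S : Type*} [MeasurableSpace Ω] [MeasurableSpace S] {μ : Measure Ω}
  [IsProbabilityMeasure μ] {P : Measure S} [IsProbabilityMeasure P] {y : ℕ → Ω → S}

theorem charFun_sum_eq_pow (hy : iIndepFun y μ) (hyP : ∀ i, MeasurePreserving (y i) μ P)
    {ψ : S → ℝ} (hψ : Measurable ψ) (n : ℕ) :
    ∫ ω, Complex.exp (Complex.I * (∑ i ∈ Finset.range n, ψ (y i ω) : ℝ)) ∂μ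
      = (∫ z, Complex.exp (Complex.I * ψ z) ∂P) ^ n := by
  have hm : ∀ i, Measurable fun ω => ψ (y i ω) := fun i => hψ.comp (hyP i).measurable
  have hi : iIndepFun (fun i ω => ψ (y i ω)) μ := hy.comp (fun _ => ψ) fun _ => hψ
  have h1 := congrFun ((hi.restrict (Finset.range n)).charFun_map_fun_finsetSum_eq_prod
    fun i _ => (hm i).aemeasurable) 1
  have hS : Measurable fun ω => ∑ i ∈ Finset.range n, ψ (y i ω) :=
    Finset.measurable_fun_sum _ fun i _ => hm i
  have hexp : Continuous fun x : ℝ => Complex.exp ((1 : ℝ) * x * Complex.I) := by fun_prop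
  rw [charFun_apply_real, integral_map hS.aemeasurable
    hexp.measurable.aestronglyMeasurable] at h1
  have h2 : ∀ i, charFun (μ.map fun ω => ψ (y i ω)) 1
      = ∫ z, Complex.exp (Complex.I * ψ z) ∂P := by
    intro i
    rw [charFun_apply_real, integral_map (hm i).aemeasurable
      hexp.measurable.aestronglyMeasurable]
    have hm2 : Measurable fun z => Complex.exp (Complex.I * ψ z) :=
      Complex.measurable_exp.comp ((Complex.measurable_ofReal.comp hψ).const_mul _)
    rw [← (hyP i).map_eq, integral_map (hyP i).measurable.aemeasurable hm2.aestronglyMeasurable]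
    refine integral_congr_ae (ae_of_all _ fun ω => ?_)
    simp [mul_comm]
  rw [Finset.prod_apply] at h1
  simp only [h2, Finset.prod_const, Finset.card_range] at h1
  rw [← h1]
  refine integral_congr_ae (ae_of_all _ fun ω => ?_)
  simp [mul_comm]

/-- The characteristic function of the sum is `(1 + ζ_n / n)^n` with `ζ_n → ζ`, so no logarithm is
taken. -/
theorem tendsto_charFun_sum (hy : iIndepFun y μ) (hyP : ∀ i, MeasurePreserving (y i) μ P)
    {ψ : ℕ → S → ℝ} (hψ : ∀ n, Measurable (ψ n)) {ζ : ℂ}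
    (h : Tendsto (fun n : ℕ => (n : ℂ) * (∫ z, Complex.exp (Complex.I * ψ n z) ∂P - 1)) atTop
      (𝓝 ζ)) :
    Tendsto (fun n => ∫ ω, Complex.exp (Complex.I * (∑ i ∈ Finset.range n, ψ n (y i ω) : ℝ)) ∂μ)
      atTop (𝓝 (Complex.exp ζ)) := by
  refine (Complex.tendsto_one_add_pow_exp_of_tendsto h).congr fun n => ?_
  rw [charFun_sum_eq_pow hy hyP (hψ n)]
  ring

/-- The laws converge weakly to a Dirac mass. The portmanteau theorem for the closed set `{ε ≤ |x -
γ|}`, which that mass does not charge, gives convergence in probability. -/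
theorem smallInProb_abs_sub_of_charFun {F : ℕ → Ω → ℝ} (hF : ∀ n, Measurable (F n)) {γ : ℝ}
    (h : ∀ u : ℝ, Tendsto (fun n => ∫ ω, Complex.exp (Complex.I * (u * F n ω : ℝ)) ∂μ) atTop
      (𝓝 (Complex.exp (Complex.I * (u * γ : ℝ))))) :
    SmallInProb μ fun n ω => |F n ω - γ| := by
  have hprob : ∀ n, IsProbabilityMeasure (μ.map (F n)) := fun n =>
    Measure.isProbabilityMeasure_map (hF n).aemeasurable
  have hT : Tendsto (β := ProbabilityMeasure ℝ) (fun n => ⟨μ.map (F n), hprob n⟩) atTop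
      (𝓝 ⟨Measure.dirac γ, inferInstance⟩) := by
    refine ProbabilityMeasure.tendsto_iff_tendsto_charFun.2 fun u => ?_
    simp only [ProbabilityMeasure.coe_mk, charFun_dirac]
    have e1 : Complex.exp ((inner ℝ γ u : ℝ) * Complex.I)
        = Complex.exp (Complex.I * (u * γ : ℝ)) := by
      simp [mul_comm]
    rw [e1]
    refine (h u).congr fun n => ?_
    have hexp : Continuous fun x : ℝ => Complex.exp (u * x * Complex.I) := by fun_prop
    rw [charFun_apply_real, integral_map (hF n).aemeasurable
      hexp.measurable.aestronglyMeasurable]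
    refine integral_congr_ae (ae_of_all _ fun ω => ?_)
    simp [mul_comm]
  intro ε hε
  set F' : Set ℝ := {x | ε ≤ |x - γ|} with hF'
  have hcl : IsClosed F' := isClosed_le continuous_const (by fun_prop)
  have hlim := ProbabilityMeasure.limsup_measure_closed_le_of_tendsto hT hcl
  simp only [ProbabilityMeasure.coe_mk] at hlim
  have h0 : Measure.dirac γ F' = 0 := by
    rw [Measure.dirac_apply' _ hcl.measurableSet]
    simp [hF', hε]
  rw [h0] at hlim
  have h1 : Tendsto (fun n => μ.map (F n) F') atTop (𝓝 0) :=
    tendsto_of_le_liminf_of_limsup_le zero_le hlim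
  refine tendsto_of_tendsto_of_tendsto_of_le_of_le tendsto_const_nhds h1 (fun _ => zero_le)
    fun n => ?_
  rw [Measure.map_apply (hF n) hcl.measurableSet]
  refine measure_mono fun ω hω => ?_
  simp only [mem_preimage, hF', mem_ofPred_eq] at hω ⊢
  exact hω.le

end IndependentSums

/-! ### The sample as a vector of paths and a vector of marks -/

section PairLaw

variable {Ω E M : Type*} [MeasurableSpace Ω] [MeasurableSpace E] [MeasurableSpace M]
  {μ : Measure Ω} [IsProbabilityMeasure μ] {P : Measure E} [IsProbabilityMeasure P]
  {ν : Measure M} [IsProbabilityMeasure ν] {y : ℕ → Ω → E × M}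

/-- Separates all paths from all marks, so that estimates on the product space, derived
conditionally on the marks, apply to the data. -/
theorem measurePreserving_pairs (hy : iIndepFun y μ)
    (hyP : ∀ i, MeasurePreserving (y i) μ (P.prod ν)) (n : ℕ) :
    MeasurePreserving (fun ω => ((fun i : Fin n => (y i ω).1), fun i : Fin n => (y i ω).2)) μ
      ((Measure.pi fun _ : Fin n => P).prod (Measure.pi fun _ : Fin n => ν)) := by
  have h1 : MeasurePreserving (fun ω (i : Fin n) => y i ω) μ
      (Measure.pi fun _ : Fin n => P.prod ν) := by
    refine ⟨measurable_pi_lambda _ fun i => (hyP i).measurable, ?_⟩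
    have h2 : iIndepFun (fun (i : Fin n) => y i) μ := hy.precomp Fin.val_injective
    rw [iIndepFun.map_fun_eq_pi_map (f := fun i : Fin n => y i)
      (fun i => (hyP i).measurable.aemeasurable) h2]
    congr 1; ext1 i
    exact (hyP i).map_eq
  exact (measurePreserving_arrowProdEquivProdArrow E M (Fin n) (fun _ => P) fun _ => ν).comp h1

theorem lintegral_pairs (hy : iIndepFun y μ)
    (hyP : ∀ i, MeasurePreserving (y i) μ (P.prod ν)) {n : ℕ}
    {F : (Fin n → E) → (Fin n → M) → ENNReal} (hF : Measurable fun z : (Fin n → E) × (Fin n → M) => F z.1 z.2) :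
    ∫⁻ ω, F (fun i => (y i ω).1) (fun i => (y i ω).2) ∂μ
      = ∫⁻ z, F z.1 z.2 ∂((Measure.pi fun _ : Fin n => P).prod (Measure.pi fun _ : Fin n => ν)) :=
  (measurePreserving_pairs hy hyP n).lintegral_comp hF

end PairLaw

/-! ### Perturbation theory of least squares -/

section LeastSquares

open scoped MatrixOrder in
theorem Matrix.PosDef.exists_eq_conjTranspose_mul_self {ι : Type*} [Fintype ι] [DecidableEq ι]
    {A : Matrix ι ι ℝ} (hA : A.PosDef) :
    ∃ B : Matrix ι ι ℝ, IsUnit B ∧ A = B.conjTranspose * B := by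
  obtain ⟨B, hB⟩ := CStarAlgebra.nonneg_iff_eq_star_mul_self.mp hA.posSemidef.nonneg
  rw [Matrix.star_eq_conjTranspose] at hB
  refine ⟨B, ?_, hB⟩
  have h1 := hA.det_pos
  rw [hB, Matrix.det_mul] at h1
  rw [Matrix.isUnit_iff_isUnit_det, isUnit_iff_ne_zero]
  exact right_ne_zero_of_mul h1.ne'

/-- With `A = BᵀB` the form is `|Bv|²`, and `v = B⁻¹(Bv)` gives `|v|² ≤ c |Bv|²` for the squared
Frobenius norm `c` of `B⁻¹`. The `+ 1` keeps `κ` well defined when there are no indices. -/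
theorem Matrix.PosDef.exists_quadratic_ge {ι : Type*} [Fintype ι] [DecidableEq ι]
    {A : Matrix ι ι ℝ} (hA : A.PosDef) :
    ∃ κ : ℝ, 0 < κ ∧ ∀ v : ι → ℝ, κ * ∑ i, v i ^ 2 ≤ ∑ i, ∑ j, v i * A i j * v j := by
  obtain ⟨B, hB, hAB⟩ := hA.exists_eq_conjTranspose_mul_self
  set c := ∑ i, ∑ j, B⁻¹ i j ^ 2 with hc
  have hc0 : 0 ≤ c := Finset.sum_nonneg fun i _ => Finset.sum_nonneg fun j _ => sq_nonneg _
  refine ⟨(c + 1)⁻¹, by positivity, fun v => ?_⟩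
  have hq : ∑ i, ∑ j, v i * A i j * v j = ∑ k, (B.mulVec v) k ^ 2 := by
    have h1 : v ⬝ᵥ A.mulVec v = B.mulVec v ⬝ᵥ B.mulVec v := by
      rw [hAB, ← Matrix.mulVec_mulVec, Matrix.dotProduct_mulVec, Matrix.conjTranspose_eq_transpose_of_trivial,
        Matrix.vecMul_transpose]
    have h2 : ∑ i, ∑ j, v i * A i j * v j = v ⬝ᵥ A.mulVec v := by
      simp [dotProduct, Matrix.mulVec, Finset.mul_sum, mul_assoc]
    rw [h2, h1]
    simp [dotProduct, sq]
  rw [hq]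
  have hv : B⁻¹.mulVec (B.mulVec v) = v := by
    rw [Matrix.mulVec_mulVec, Matrix.nonsing_inv_mul _ ((Matrix.isUnit_iff_isUnit_det _).1 hB),
      Matrix.one_mulVec]
  have h3 : ∑ i, v i ^ 2 ≤ c * ∑ k, (B.mulVec v) k ^ 2 := by
    rw [hc, Finset.sum_mul]
    refine Finset.sum_le_sum fun i _ => ?_
    conv_lhs => rw [← hv]
    exact Finset.sum_mul_sq_le_sq_mul_sq _ _ _
  have h4 : 0 ≤ ∑ k, (B.mulVec v) k ^ 2 := Finset.sum_nonneg fun _ _ => sq_nonneg _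
  rw [inv_mul_le_iff₀ (by positivity)]
  nlinarith

/-- Uniqueness of the minimizer of a weighted least-squares criterion. -/
theorem leastSquares_lt {α ι : Type*} [Fintype ι] (I : (α → ℝ) →ₗ[ℝ] ℝ) (k ρ : α → ℝ)
    (f : ι → α → ℝ) {d : ι → ℝ}
    (hd : ∀ i, ∑ j, I (fun x => k x * f i x * f j x) * d j = I fun x => k x * f i x * ρ x)
    (hpos : ∀ w : ι → ℝ, w ≠ 0 → 0 < ∑ i, ∑ j, w i * I (fun x => k x * f i x * f j x) * w j)
    {v : ι → ℝ} (hv : v ≠ d) :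
    I (fun x => k x * (ρ x - ∑ i, f i x * d i) ^ 2)
      < I fun x => k x * (ρ x - ∑ i, f i x * v i) ^ 2 := by
  set w : ι → ℝ := fun i => v i - d i with hw
  have hw0 : w ≠ 0 := fun h => hv (funext fun i => sub_eq_zero.1 (congrFun h i))
  -- Expansion about `d`: the linear term vanishes by the normal equations, and the quadratic term
  -- is the positive Gram form of `w = v - d`.
  have e1 : (fun x => k x * (ρ x - ∑ i, f i x * v i) ^ 2)
      = (fun x => k x * (ρ x - ∑ i, f i x * d i) ^ 2)
        - (2 : ℝ) • (∑ i, w i • ((fun x => k x * f i x * ρ x)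
          - ∑ j, d j • fun x => k x * f i x * f j x))
        + ∑ i, ∑ j, (w i * w j) • fun x => k x * f i x * f j x := by
    funext x
    simp only [Pi.add_apply, Pi.sub_apply, Pi.smul_apply, Finset.sum_apply, smul_eq_mul]
    have hs : ∑ i, f i x * v i = ∑ i, f i x * d i + ∑ i, f i x * w i := by
      rw [← Finset.sum_add_distrib]
      exact Finset.sum_congr rfl fun i _ => by rw [hw]; ring
    have h1 : ∑ i, w i * (k x * f i x * ρ x - ∑ j, d j * (k x * f i x * f j x))
        = k x * (ρ x - ∑ i, f i x * d i) * ∑ i, f i x * w i := by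
      rw [Finset.mul_sum]
      refine Finset.sum_congr rfl fun i _ => ?_
      have : ∑ j, d j * (k x * f i x * f j x) = k x * f i x * ∑ j, f j x * d j := by
        rw [Finset.mul_sum]
        exact Finset.sum_congr rfl fun j _ => by ring
      rw [this]; ring
    have h2 : ∑ i, ∑ j, w i * w j * (k x * f i x * f j x)
        = k x * (∑ i, f i x * w i) ^ 2 := by
      rw [sq, Finset.sum_mul_sum, Finset.mul_sum]
      refine Finset.sum_congr rfl fun i _ => ?_
      rw [Finset.mul_sum]
      exact Finset.sum_congr rfl fun j _ => by ring
    rw [hs, h1, h2]; ring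
  rw [e1]
  simp only [map_add, map_sub, map_smul, map_sum, smul_eq_mul]
  have h3 : ∑ i, w i * (I (fun x => k x * f i x * ρ x)
      - ∑ j, d j * I fun x => k x * f i x * f j x) = 0 := by
    refine Finset.sum_eq_zero fun i _ => ?_
    rw [← hd i, sub_eq_zero.2, mul_zero]
    exact Finset.sum_congr rfl fun j _ => mul_comm _ _
  rw [h3]
  have h4 := hpos w hw0
  have h5 : ∑ i, ∑ j, w i * w j * I (fun x => k x * f i x * f j x)
      = ∑ i, ∑ j, w i * I (fun x => k x * f i x * f j x) * w j :=
    Finset.sum_congr rfl fun i _ => Finset.sum_congr rfl fun j _ => by ring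
  rw [h5]
  linarith

theorem sum_abs_sq_le_card_mul {ι : Type*} [Fintype ι] (w : ι → ℝ) :
    (∑ i, |w i|) ^ 2 ≤ Fintype.card ι * ∑ i, w i ^ 2 := by
  have := sq_sum_le_card_mul_sum_sq (s := Finset.univ) (f := fun i => |w i|)
  simpa using this

/-- Coercivity gives injectivity, hence solvability in finite dimension. Testing the equation with
`d` yields `κ |d|² ≤ d · τ`; the comparison of the `ℓ¹` and `ℓ²` norms supplies the number of
indices. -/
theorem exists_solution_of_quadratic_ge {ι : Type*} [Fintype ι] {S : ι → ι → ℝ} {κ : ℝ}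
    (hκ : 0 < κ) (hS : ∀ w : ι → ℝ, κ * ∑ i, w i ^ 2 ≤ ∑ i, ∑ j, w i * S i j * w j) (τ : ι → ℝ) :
    ∃ d : ι → ℝ, (∀ i, ∑ j, S i j * d j = τ i)
      ∧ ∑ i, |d i| ≤ Fintype.card ι / κ * ∑ i, |τ i| := by
  classical
  have hinj : Function.Injective (Matrix.mulVecLin (Matrix.of S)) := by
    rw [injective_iff_map_eq_zero]
    intro w hw
    have h1 : ∑ i, ∑ j, w i * S i j * w j = 0 := by
      refine Finset.sum_eq_zero fun i _ => ?_
      have h2 := congrFun hw i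
      simp only [Matrix.mulVecLin_apply, Matrix.mulVec, dotProduct, Matrix.of_apply,
        Pi.zero_apply] at h2
      have h3 : ∑ j, w i * S i j * w j = w i * ∑ j, S i j * w j := by
        rw [Finset.mul_sum]; exact Finset.sum_congr rfl fun j _ => by ring
      rw [h3, h2, mul_zero]
    have h2 := hS w
    rw [h1] at h2
    have h3 : ∑ i, w i ^ 2 = 0 := le_antisymm (by
      by_contra! hc
      have := mul_pos hκ hc
      linarith) (Finset.sum_nonneg fun _ _ => sq_nonneg _)
    funext i
    have h4 := (Finset.sum_eq_zero_iff_of_nonneg fun i _ => sq_nonneg (w i)).1 h3 i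
      (Finset.mem_univ i)
    simpa using h4
  obtain ⟨d, hd⟩ := (LinearMap.injective_iff_surjective.1 hinj) τ
  have hd' : ∀ i, ∑ j, S i j * d j = τ i := fun i => congrFun hd i
  refine ⟨d, hd', ?_⟩
  set D := ∑ i, |d i|
  set T := ∑ i, |τ i|
  have hD : 0 ≤ D := Finset.sum_nonneg fun _ _ => abs_nonneg _
  have hT : 0 ≤ T := Finset.sum_nonneg fun _ _ => abs_nonneg _
  have h1 : ∑ i, ∑ j, d i * S i j * d j ≤ D * T := by
    have h2 : ∑ i, ∑ j, d i * S i j * d j = ∑ i, d i * τ i := by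
      refine Finset.sum_congr rfl fun i _ => ?_
      rw [← hd' i, Finset.mul_sum]
      exact Finset.sum_congr rfl fun j _ => by ring
    rw [h2, Finset.sum_mul]
    refine Finset.sum_le_sum fun i _ => ?_
    calc d i * τ i ≤ |d i| * |τ i| := by rw [← abs_mul]; exact le_abs_self _
      _ ≤ |d i| * T := mul_le_mul_of_nonneg_left
          (Finset.single_le_sum (fun j _ => abs_nonneg (τ j)) (Finset.mem_univ i)) (abs_nonneg _)
  have h2 := sum_abs_sq_le_card_mul d
  have h3 := hS d
  have hc : (0 : ℝ) ≤ Fintype.card ι := Nat.cast_nonneg _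
  rcases hD.eq_or_lt with h0 | h0
  · rw [← h0]; positivity
  · have h4 : D * D * κ ≤ Fintype.card ι * T * D := by
      calc D * D * κ = D ^ 2 * κ := by ring
        _ ≤ Fintype.card ι * (∑ i, d i ^ 2) * κ := mul_le_mul_of_nonneg_right h2 hκ.le
        _ = Fintype.card ι * (κ * ∑ i, d i ^ 2) := by ring
        _ ≤ Fintype.card ι * (D * T) := mul_le_mul_of_nonneg_left (h3.trans h1) hc
        _ = _ := by ring
    rw [div_mul_eq_mul_div, le_div_iff₀ hκ]
    have h5 : D * (D * κ) ≤ D * (Fintype.card ι * T) := by linarith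
    exact le_of_mul_le_mul_left h5 h0

/-- The limit of the local linear Gram matrix: the moments `1, 0, m` of the kernel times `A`. -/
def blockGram {p : ℕ} (A : Matrix (Fin p) (Fin p) ℝ) (m : ℝ) (i j : Fin p × Fin 2) : ℝ :=
  A i.1 j.1 * !![1, 0; 0, m] i.2 j.2

theorem blockGram_quadratic {p : ℕ} (A : Matrix (Fin p) (Fin p) ℝ) (m : ℝ)
    (w : Fin p × Fin 2 → ℝ) :
    ∑ i, ∑ j, w i * blockGram A m i j * w j
      = ∑ a, ∑ b, w (a, 0) * A a b * w (b, 0) + m * ∑ a, ∑ b, w (a, 1) * A a b * w (b, 1) := by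
  simp only [Fintype.sum_prod_type, Fin.sum_univ_two, blockGram]
  simp only [Finset.sum_add_distrib, Finset.mul_sum]
  simp
  congr 1
  funext a
  exact Finset.sum_congr rfl fun b _ => by ring

/-- Perturbation bound for local linear least squares. -/
theorem exists_leastSquares_bound {p : ℕ} {A : Matrix (Fin p) (Fin p) ℝ} (hA : A.PosDef) {m : ℝ}
    (hm : 0 < m) :
    ∃ ε₀ : ℝ, 0 < ε₀ ∧ ∃ C : ℝ, 0 ≤ C ∧ ∀ (S : Fin p × Fin 2 → Fin p × Fin 2 → ℝ)
      (τ Z : Fin p × Fin 2 → ℝ) (r e : ℝ), (∀ i j, |S i j - blockGram A m i j| ≤ e) →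
      e ≤ ε₀ → (∀ i, |τ i - Z i| ≤ r) → 0 ≤ e → 0 ≤ r →
      ∃ d : Fin p × Fin 2 → ℝ, (∀ i, ∑ j, S i j * d j = τ i) ∧
        (∀ w : Fin p × Fin 2 → ℝ, w ≠ 0 → 0 < ∑ i, ∑ j, w i * S i j * w j) ∧
        ∀ a, |d (a, 0) - ∑ b, A⁻¹ a b * Z (b, 0)| ≤ C * (r + e * (r + ∑ i, |Z i|)) := by
  obtain ⟨κ, hκ, hq⟩ := hA.exists_quadratic_ge
  set c : ℝ := ((Fintype.card (Fin p × Fin 2) : ℕ) : ℝ) with hc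
  have hc0 : 0 ≤ c := Nat.cast_nonneg _
  set κ₁ := κ * min 1 m with hκ₁
  have hmin : 0 < min 1 m := lt_min one_pos hm
  have hκ₁0 : 0 < κ₁ := mul_pos hκ hmin
  set a₀ := ∑ a, ∑ b, |A⁻¹ a b| with ha₀
  have ha₀0 : 0 ≤ a₀ := Finset.sum_nonneg fun _ _ => Finset.sum_nonneg fun _ _ => abs_nonneg _
  set D := c / (κ₁ / 2) with hD
  have hD0 : 0 ≤ D := by positivity
  -- An entrywise perturbation `e` changes the form by at most `e (Σ|w|)² ≤ e c Σw²`. The threshold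
  -- keeps this below half of the coercivity constant `κ₁`.
  refine ⟨κ₁ / (2 * (c + 1)), by positivity, a₀ * (1 + D * (1 + c)), by positivity,
    fun S τ Z r e hS he hτ he0 hr0 => ?_⟩
  have hquad : ∀ w : Fin p × Fin 2 → ℝ,
      κ₁ / 2 * ∑ i, w i ^ 2 ≤ ∑ i, ∑ j, w i * S i j * w j := by
    intro w
    have hW : 0 ≤ ∑ i, w i ^ 2 := Finset.sum_nonneg fun _ _ => sq_nonneg _
    have h1 : κ₁ * ∑ i, w i ^ 2 ≤ ∑ i, ∑ j, w i * blockGram A m i j * w j := by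
      rw [blockGram_quadratic]
      have h2 : ∑ i, w i ^ 2 = ∑ a, w (a, 0) ^ 2 + ∑ a, w (a, 1) ^ 2 := by
        simp [Fintype.sum_prod_type, Finset.sum_add_distrib]
      have h3 := hq fun a => w (a, 0)
      have h4 := hq fun a => w (a, 1)
      have p0 : 0 ≤ κ * ∑ a, w (a, 0) ^ 2 :=
        mul_nonneg hκ.le (Finset.sum_nonneg fun _ _ => sq_nonneg _)
      have p1 : 0 ≤ κ * ∑ a, w (a, 1) ^ 2 :=
        mul_nonneg hκ.le (Finset.sum_nonneg fun _ _ => sq_nonneg _)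
      calc κ₁ * ∑ i, w i ^ 2
          = min 1 m * (κ * ∑ a, w (a, 0) ^ 2) + min 1 m * (κ * ∑ a, w (a, 1) ^ 2) := by
            rw [h2, hκ₁]; ring
        _ ≤ 1 * (κ * ∑ a, w (a, 0) ^ 2) + m * (κ * ∑ a, w (a, 1) ^ 2) :=
            add_le_add (mul_le_mul_of_nonneg_right (min_le_left _ _) p0)
              (mul_le_mul_of_nonneg_right (min_le_right _ _) p1)
        _ ≤ _ := by
            rw [one_mul]
            exact add_le_add h3 (mul_le_mul_of_nonneg_left h4 hm.le)
    have h5 : ∑ i, ∑ j, w i * blockGram A m i j * w j - ∑ i, ∑ j, w i * S i j * w j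
        ≤ e * (∑ i, |w i|) ^ 2 := by
      rw [← Finset.sum_sub_distrib, sq, Finset.sum_mul_sum, Finset.mul_sum]
      refine Finset.sum_le_sum fun i _ => ?_
      rw [← Finset.sum_sub_distrib, Finset.mul_sum]
      refine Finset.sum_le_sum fun j _ => ?_
      calc w i * blockGram A m i j * w j - w i * S i j * w j
          = -((S i j - blockGram A m i j) * (w i * w j)) := by ring
        _ ≤ |(S i j - blockGram A m i j) * (w i * w j)| := neg_le_abs _
        _ = |S i j - blockGram A m i j| * (|w i| * |w j|) := by rw [abs_mul, abs_mul]
        _ ≤ e * (|w i| * |w j|) := mul_le_mul_of_nonneg_right (hS i j) (by positivity)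
    have h6 : e * (∑ i, |w i|) ^ 2 ≤ κ₁ / 2 * ∑ i, w i ^ 2 := by
      calc e * (∑ i, |w i|) ^ 2 ≤ κ₁ / (2 * (c + 1)) * (c * ∑ i, w i ^ 2) :=
            mul_le_mul he (sum_abs_sq_le_card_mul w) (sq_nonneg _) (by positivity)
        _ = κ₁ / 2 * (c / (c + 1)) * ∑ i, w i ^ 2 := by field_simp
        _ ≤ κ₁ / 2 * 1 * ∑ i, w i ^ 2 := by
            refine mul_le_mul_of_nonneg_right (mul_le_mul_of_nonneg_left ?_ (by positivity)) hW
            rw [div_le_one (by positivity)]; linarith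
        _ = _ := by ring
    linarith
  obtain ⟨d, hd, hdb⟩ := exists_solution_of_quadratic_ge (half_pos hκ₁0) hquad τ
  refine ⟨d, hd, fun w hw => ?_, fun a => ?_⟩
  · obtain ⟨i, hi⟩ : ∃ i, w i ≠ 0 := by
      by_contra! hcon
      exact hw (funext hcon)
    have h1 : 0 < ∑ i, w i ^ 2 := Finset.sum_pos' (fun _ _ => sq_nonneg _)
      ⟨i, Finset.mem_univ i, by positivity⟩
    exact lt_of_lt_of_le (by positivity) (hquad w)
  · set W := ∑ i, |Z i| with hW
    have hW0 : 0 ≤ W := Finset.sum_nonneg fun _ _ => abs_nonneg _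
    have hT : ∑ i, |τ i| ≤ W + c * r := by
      calc ∑ i, |τ i| ≤ ∑ i, (|Z i| + r) := Finset.sum_le_sum fun i _ => by
            have := abs_sub_abs_le_abs_sub (τ i) (Z i)
            linarith [hτ i]
        _ = W + c * r := by
            rw [Finset.sum_add_distrib, Finset.sum_const, nsmul_eq_mul, Finset.card_univ]
    have hdT : ∑ i, |d i| ≤ D * (W + c * r) := hdb.trans (mul_le_mul_of_nonneg_left hT hD0)
    -- The limit Gram matrix has no coupling between levels and slopes, so the level block solves `A
    -- d₀ = Z₀ + q` with a small defect `q`.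
    set q : Fin p → ℝ := fun b => ∑ a', A b a' * d (a', 0) - Z (b, 0) with hqdef
    have hqb : ∀ b, |q b| ≤ r + e * (D * (W + c * r)) := by
      intro b
      have h1 : ∑ a', A b a' * d (a', 0) = ∑ j, blockGram A m (b, 0) j * d j := by
        simp [Fintype.sum_prod_type, blockGram]
      have h2 : q b = (τ (b, 0) - Z (b, 0))
          - ∑ j, (S (b, 0) j - blockGram A m (b, 0) j) * d j := by
        simp only [hqdef, h1, sub_mul, Finset.sum_sub_distrib, hd]
        ring
      rw [h2]
      refine (abs_sub _ _).trans (add_le_add (hτ _) ?_)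
      calc |∑ j, (S (b, 0) j - blockGram A m (b, 0) j) * d j|
          ≤ ∑ j, |(S (b, 0) j - blockGram A m (b, 0) j) * d j| := Finset.abs_sum_le_sum_abs _ _
        _ ≤ ∑ j, e * |d j| := Finset.sum_le_sum fun j _ => by
            rw [abs_mul]
            exact mul_le_mul_of_nonneg_right (hS _ _) (abs_nonneg _)
        _ = e * ∑ j, |d j| := by rw [Finset.mul_sum]
        _ ≤ _ := mul_le_mul_of_nonneg_left hdT he0
    have hinv : d (a, 0) - ∑ b, A⁻¹ a b * Z (b, 0) = ∑ b, A⁻¹ a b * q b := by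
      have h1 : A⁻¹.mulVec (A.mulVec fun a' => d (a', 0)) = fun a' => d (a', 0) := by
        rw [Matrix.mulVec_mulVec, Matrix.nonsing_inv_mul _ hA.det_pos.ne'.isUnit,
          Matrix.one_mulVec]
      have h2 := congrFun h1 a
      simp only [Matrix.mulVec, dotProduct] at h2
      rw [← h2, ← Finset.sum_sub_distrib]
      exact Finset.sum_congr rfl fun b _ => by rw [hqdef]; ring
    rw [hinv]
    calc |∑ b, A⁻¹ a b * q b| ≤ ∑ b, |A⁻¹ a b| * (r + e * (D * (W + c * r))) := by
          refine (Finset.abs_sum_le_sum_abs _ _).trans (Finset.sum_le_sum fun b _ => ?_)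
          rw [abs_mul]
          exact mul_le_mul_of_nonneg_left (hqb b) (abs_nonneg _)
      _ = (∑ b, |A⁻¹ a b|) * (r + e * (D * (W + c * r))) := by rw [Finset.sum_mul]
      _ ≤ a₀ * (r + e * (D * (W + c * r))) := by
          refine mul_le_mul_of_nonneg_right ?_ (by positivity)
          exact Finset.single_le_sum (f := fun a => ∑ b, |A⁻¹ a b|)
            (fun _ _ => Finset.sum_nonneg fun _ _ => abs_nonneg _) (Finset.mem_univ a)
      _ ≤ a₀ * ((1 + D * (1 + c)) * (r + e * (r + W))) := by
          refine mul_le_mul_of_nonneg_left ?_ ha₀0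
          have p1 : 0 ≤ D * (1 + c) * r := by positivity
          have p2 : 0 ≤ D * (e * r) := by positivity
          have p3 : 0 ≤ D * c * (e * W) := by positivity
          have p4 : 0 ≤ e * (r + W) := by positivity
          nlinarith
      _ = _ := by ring

end LeastSquares

/-! ### Error bounds under a positive linear functional -/

section PositiveFunctional

variable {α : Type*} (I : (α → ℝ) →ₗ[ℝ] ℝ)

theorem abs_map_le_of_abs_le (hI : ∀ f g : α → ℝ, (∀ x, f x ≤ g x) → I f ≤ I g) {f g : α → ℝ}
    (h : ∀ x, |f x| ≤ g x) : |I f| ≤ I g := by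
  rw [abs_le]
  refine ⟨?_, hI _ _ fun x => (le_abs_self _).trans (h x)⟩
  have h1 := hI (-f) g fun x => (neg_le_abs _).trans (h x)
  rw [map_neg] at h1
  linarith

theorem abs_map_mul_mul_le (hI : ∀ f g : α → ℝ, (∀ x, f x ≤ g x) → I f ≤ I g) {w k d d' : α → ℝ}
    {b : ℝ} (hw : ∀ x, |w x| ≤ b * k x) :
    |I fun x => w x * d x * d' x| ≤ b * ((I fun x => k x * d x ^ 2) + I fun x => k x * d' x ^ 2) := by
  have e1 : (I fun x => b * k x * (d x ^ 2 + d' x ^ 2))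
      = b * ((I fun x => k x * d x ^ 2) + I fun x => k x * d' x ^ 2) := by
    rw [← map_add, ← smul_eq_mul b, ← map_smul]
    congr 1; funext x
    simp only [Pi.smul_apply, Pi.add_apply, smul_eq_mul]; ring
  rw [← e1]
  refine abs_map_le_of_abs_le I hI fun x => ?_
  rw [mul_assoc, abs_mul]
  refine mul_le_mul (hw x) ?_ (abs_nonneg _) ((abs_nonneg _).trans (hw x))
  rw [abs_mul, ← sq_abs (d x), ← sq_abs (d' x)]
  nlinarith [sq_nonneg (|d x| - |d' x|), abs_nonneg (d x), abs_nonneg (d' x)]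

/-- Error of a weighted product average when both factors carry an error. -/
theorem abs_map_gram_sub_le (hI : ∀ f g : α → ℝ, (∀ x, f x ≤ g x) → I f ≤ I g)
    {w k u v d d' : α → ℝ} {b : ℝ} (hw : ∀ x, |w x| ≤ b * k x) (γ : ℝ) :
    |(I fun x => w x * ((u x - d x) * (v x - d' x))) - γ|
      ≤ |(I fun x => w x * (u x * v x)) - γ| + |I fun x => w x * u x * d' x|
        + |I fun x => w x * v x * d x|
        + b * ((I fun x => k x * d x ^ 2) + I fun x => k x * d' x ^ 2) := by
  have e1 : (fun x => w x * ((u x - d x) * (v x - d' x))) = (fun x => w x * (u x * v x))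
      - (fun x => w x * u x * d' x) - (fun x => w x * v x * d x) + fun x => w x * d x * d' x := by
    funext x; simp only [Pi.add_apply, Pi.sub_apply]; ring
  rw [e1, map_add, map_sub, map_sub]
  have h1 := abs_map_mul_mul_le I hI (d := d) (d' := d') hw
  set A := I fun x => w x * (u x * v x)
  set B := I fun x => w x * u x * d' x
  set C := I fun x => w x * v x * d x
  set D := I fun x => w x * d x * d' x
  calc |A - B - C + D - γ| = |(A - γ) - B - C + D| := by ring_nf
    _ ≤ |A - γ| + |B| + |C| + |D| := by
        refine (abs_add_le _ _).trans (add_le_add ?_ le_rfl)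
        refine (abs_sub _ _).trans (add_le_add ?_ le_rfl)
        exact abs_sub _ _
    _ ≤ _ := by linarith

/-- Error of the average score when covariates and responses carry errors and the coefficient
function has a remainder. -/
theorem abs_map_score_sub_le {ι : Type*} [Fintype ι]
    (hI : ∀ f g : α → ℝ, (∀ x, f x ≤ g x) → I f ≤ I g)
    {w k u d e dY : α → ℝ} {v dv β rem : ι → α → ℝ} {b B η : ℝ} (hw : ∀ x, |w x| ≤ b * k x)
    (hβ : ∀ i x, |w x * β i x| ≤ b * B * k x) (hrem : ∀ i x, |w x * rem i x| ≤ b * η * k x) :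
    |(I fun x => w x * ((u x - d x) * (e x - dY x + ∑ i, dv i x * β i x
        + ∑ i, (v i x - dv i x) * rem i x))) - I fun x => w x * (u x * e x)|
      ≤ |I fun x => w x * u x * dY x| + |I fun x => w x * e x * d x|
        + b * ((I fun x => k x * d x ^ 2) + I fun x => k x * dY x ^ 2)
        + ∑ i, (|I fun x => w x * β i x * u x * dv i x|
          + b * B * ((I fun x => k x * d x ^ 2) + I fun x => k x * dv i x ^ 2)
          + b * η * (2 * ((I fun x => k x * u x ^ 2) + (I fun x => k x * d x ^ 2)
            + (I fun x => k x * v i x ^ 2) + I fun x => k x * dv i x ^ 2))) := by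
  have e1 : (fun x => w x * ((u x - d x) * (e x - dY x + ∑ i, dv i x * β i x
        + ∑ i, (v i x - dv i x) * rem i x))) = (fun x => w x * (u x * e x))
      - (fun x => w x * u x * dY x) - (fun x => w x * e x * d x) + (fun x => w x * d x * dY x)
      + ∑ i, ((fun x => w x * β i x * u x * dv i x) - (fun x => w x * β i x * d x * dv i x)
        + fun x => w x * rem i x * (u x - d x) * (v i x - dv i x)) := by
    funext x
    simp only [Pi.add_apply, Pi.sub_apply, Finset.sum_apply]
    have h1 : ∑ i, (w x * β i x * u x * dv i x - w x * β i x * d x * dv i x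
        + w x * rem i x * (u x - d x) * (v i x - dv i x))
        = w x * ((u x - d x) * (∑ i, dv i x * β i x + ∑ i, (v i x - dv i x) * rem i x)) := by
      rw [← Finset.sum_add_distrib, Finset.mul_sum, Finset.mul_sum]
      exact Finset.sum_congr rfl fun i _ => by ring
    rw [h1]; ring
  rw [e1, map_add, map_add, map_sub, map_sub, map_sum]
  have h1 := abs_map_mul_mul_le I hI (d := d) (d' := dY) hw
  have h2 : ∀ i, |I ((fun x => w x * β i x * u x * dv i x) - (fun x => w x * β i x * d x * dv i x)
        + fun x => w x * rem i x * (u x - d x) * (v i x - dv i x))|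
      ≤ |I fun x => w x * β i x * u x * dv i x|
          + b * B * ((I fun x => k x * d x ^ 2) + I fun x => k x * dv i x ^ 2)
          + b * η * (2 * ((I fun x => k x * u x ^ 2) + (I fun x => k x * d x ^ 2)
            + (I fun x => k x * v i x ^ 2) + I fun x => k x * dv i x ^ 2)) := by
    intro i
    rw [map_add, map_sub]
    have h3 := abs_map_mul_mul_le I hI (w := fun x => w x * β i x) (d := d) (d' := dv i) (hβ i)
    have h4 := abs_map_le_of_abs_le I hI
      (f := fun x => w x * rem i x * (u x - d x) * (v i x - dv i x))
      (g := fun x => b * η * (2 * (k x * u x ^ 2 + k x * d x ^ 2 + k x * v i x ^ 2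
        + k x * dv i x ^ 2))) fun x => by
      rw [mul_assoc, abs_mul]
      have h5 : |(u x - d x) * (v i x - dv i x)|
          ≤ 2 * (u x ^ 2 + d x ^ 2 + v i x ^ 2 + dv i x ^ 2) := by
        rw [abs_le]
        constructor <;> nlinarith [sq_nonneg (u x + d x), sq_nonneg (v i x + dv i x),
          sq_nonneg (u x - d x), sq_nonneg (v i x - dv i x),
          sq_nonneg (u x - d x - (v i x - dv i x)), sq_nonneg (u x - d x + (v i x - dv i x))]
      calc |w x * rem i x| * |(u x - d x) * (v i x - dv i x)|
          ≤ (b * η * k x) * (2 * (u x ^ 2 + d x ^ 2 + v i x ^ 2 + dv i x ^ 2)) :=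
            mul_le_mul (hrem i x) h5 (abs_nonneg _) ((abs_nonneg _).trans (hrem i x))
        _ = _ := by ring
    have e2 : (I fun x => b * η * (2 * (k x * u x ^ 2 + k x * d x ^ 2 + k x * v i x ^ 2
        + k x * dv i x ^ 2))) = b * η * (2 * ((I fun x => k x * u x ^ 2)
          + (I fun x => k x * d x ^ 2) + (I fun x => k x * v i x ^ 2)
          + I fun x => k x * dv i x ^ 2)) := by
      rw [← map_add, ← map_add, ← map_add, ← smul_eq_mul (b * η), ← smul_eq_mul 2, ← map_smul,
        ← map_smul]
      rfl
    rw [e2] at h4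
    refine (abs_add_le _ _).trans (add_le_add ((abs_sub _ _).trans (add_le_add le_rfl h3)) h4)
  have h3 := (Finset.abs_sum_le_sum_abs (fun i => I ((fun x => w x * β i x * u x * dv i x)
      - (fun x => w x * β i x * d x * dv i x)
      + fun x => w x * rem i x * (u x - d x) * (v i x - dv i x))) Finset.univ).trans
    (Finset.sum_le_sum fun i _ => h2 i)
  set T := ∑ i, I ((fun x => w x * β i x * u x * dv i x)
      - (fun x => w x * β i x * d x * dv i x)
      + fun x => w x * rem i x * (u x - d x) * (v i x - dv i x))
  set A := I fun x => w x * (u x * e x)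
  set C := I fun x => w x * u x * dY x
  set D := I fun x => w x * e x * d x
  set F := I fun x => w x * d x * dY x
  refine le_trans ?_ (add_le_add (add_le_add le_rfl h1) h3)
  calc |A - C - D + F + T - A| = |-C - D + F + T| := by ring_nf
    _ ≤ |C| + |D| + |F| + |T| := by
        refine (abs_add_le _ _).trans (add_le_add ?_ le_rfl)
        refine (abs_add_le _ _).trans (add_le_add ?_ le_rfl)
        refine (abs_sub _ _).trans (add_le_add (abs_neg _).le le_rfl)

end PositiveFunctional

/-! ### The sample average as a positive linear functional -/

section SampleAverage

variable {E M : Type*} [MeasurableSpace E] [MeasurableSpace M] {n : ℕ}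

/-- Average over the sample of the integrals against the observation processes. -/
noncomputable def sampleAvg (N : Kernel M ℝ) (hN : ∀ m, IsPointMeasure (N m)) (m : Fin n → M) :
    (Fin n × ℝ → ℝ) →ₗ[ℝ] ℝ where
  toFun f := (n : ℝ)⁻¹ * ∑ i, ∫ s, f (i, s) ∂(N (m i))
  map_add' f g := by
    simp only [Pi.add_apply]
    rw [← mul_add, ← Finset.sum_add_distrib]
    congr 1
    exact Finset.sum_congr rfl fun i _ =>
      integral_add ((hN (m i)).integrable _) ((hN (m i)).integrable _)
  map_smul' c f := by
    simp only [Pi.smul_apply, smul_eq_mul, RingHom.id_apply, integral_const_mul]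
    rw [← Finset.mul_sum]
    ring

variable {N : Kernel M ℝ} (hN : ∀ m, IsPointMeasure (N m))

theorem sampleAvg_apply (m : Fin n → M) (f : Fin n × ℝ → ℝ) :
    sampleAvg N hN m f = (n : ℝ)⁻¹ * ∑ i, ∫ s, f (i, s) ∂(N (m i)) := rfl

theorem sampleAvg_mono (m : Fin n → M) (f g : Fin n × ℝ → ℝ) (h : ∀ x, f x ≤ g x) :
    sampleAvg N hN m f ≤ sampleAvg N hN m g := by
  rw [sampleAvg_apply, sampleAvg_apply]
  refine mul_le_mul_of_nonneg_left (Finset.sum_le_sum fun i _ => ?_) (by positivity)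
  exact (hN (m i)).integral_mono fun s => h (i, s)

end SampleAverage

/-! ### The abstract local model and statistics bounded at the rate -/

/-- A centered varying-coefficient regression observed at the points of an independent point
process, with the regularity needed for local linear estimation at `t`. The processes `X` and `Y`
are the centered ones, `mX` and `mY` their means. -/
structure LocalModel (E M : Type*) [MeasurableSpace E] [MeasurableSpace M] (p : ℕ) where
  P : Measure E
  ν : Measure M
  N : Kernel M ℝ
  lam : ℝ → ℝ
  K : ℝ → ℝ
  t : ℝ
  X : Fin p → ℝ → E → ℝ
  mX : Fin p → ℝ → ℝ
  Y : ℝ → E → ℝ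
  mY : ℝ → ℝ
  β : Fin p → ℝ → ℝ
  β' : Fin p → ℝ
  (Λ c R κ h₀ C ℓ B L δ : ℝ)
  prob_P : IsProbabilityMeasure P
  prob_ν : IsProbabilityMeasure ν
  h₀_pos : 0 < h₀
  design : ∀ h, 0 < h → h ≤ h₀ → IsDesign N ν lam Λ c K R κ t h
  continuousAt_lam : ContinuousAt lam t
  X_centered : ∀ a, IsCentered P (X a) C
  Y_centered : IsCentered P Y C
  mX_smooth : ∀ a, IsSmoothMean (mX a) ℓ B
  mY_smooth : IsSmoothMean mY ℓ B
  β_measurable : ∀ a, Measurable (β a)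
  β_le : ∀ a s, |β a s| ≤ B
  L_nonneg : 0 ≤ L
  β_taylor : ∀ a s, |s - t| ≤ R * h₀ → |β a s - β a t - β' a * (s - t)| ≤ L * (s - t) ^ 2
  X_tendsto : ∀ a b, Tendsto (fun s => ∫ x, |X a s x * X b s x - X a t x * X b t x| ∂P) (𝓝 t) (𝓝 0)
  resid_centered : IsCentered P (fun s x => Y s x - ∑ b, X b s x * β b s) C
  score_centered : ∀ a, IsCentered P (fun s x => X a s x * (Y s x - ∑ b, X b s x * β b s)) C
  δ_pos : 0 < δ
  δ_le : δ ≤ 1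
  score_moment : ∀ u : Fin p → ℝ, ∃ D : ℝ, ∀ s,
    Integrable (fun x => |∑ a, u a * (X a s x * (Y s x - ∑ b, X b s x * β b s))| ^ (2 + δ)) P ∧
    ∫ x, |∑ a, u a * (X a s x * (Y s x - ∑ b, X b s x * β b s))| ^ (2 + δ) ∂P ≤ D
  score_cov_continuousAt : ∀ a b, ContinuousAt (fun s => ∫ x,
    X a s x * (Y s x - ∑ b, X b s x * β b s) * (X b s x * (Y s x - ∑ b, X b s x * β b s)) ∂P) t

namespace LocalModel

variable {E M : Type*} [MeasurableSpace E] [MeasurableSpace M] {p : ℕ} (D : LocalModel E M p)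

attribute [instance] prob_P prob_ν

/-- Regression residual. -/
def resid (s : ℝ) (x : E) : ℝ := D.Y s x - ∑ b, D.X b s x * D.β b s

theorem point (m : M) : IsPointMeasure (D.N m) := (D.design D.h₀ D.h₀_pos le_rfl).process.point m

theorem process : IsPointProcess D.N D.ν D.lam D.Λ D.c := (D.design D.h₀ D.h₀_pos le_rfl).process

theorem kernel : IsKernel D.K := (D.design D.h₀ D.h₀_pos le_rfl).kernel

theorem R_pos : 0 < D.R := (D.design D.h₀ D.h₀_pos le_rfl).R_pos

instance : IsSFiniteKernel D.N := isSFiniteKernel_of_point D.point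

theorem B_nonneg : 0 ≤ D.B := D.mY_smooth.B_nonneg

/-- Localized weight `K_h(s - t) ((s - t) / h) ^ k`. -/
noncomputable def weight (h : ℝ) (k : ℕ) (s : ℝ) : ℝ :=
  scaledKernel D.K h (s - D.t) * ((s - D.t) / h) ^ k

theorem measurable_weight (h : ℝ) (k : ℕ) : Measurable (D.weight h k) :=
  ((measurable_scaledKernel D.kernel).comp (measurable_id.sub_const _)).mul
    (((measurable_id.sub_const _).div_const _).pow_const _)

/-- Bound for the powers of the rescaled time in the kernel window. -/
def wBound : ℝ := (1 + D.R) ^ 2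

theorem wBound_nonneg : 0 ≤ D.wBound := sq_nonneg _

theorem abs_sub_le_of_ne {h : ℝ} (hh : 0 < h) {s : ℝ} (hs : scaledKernel D.K h (s - D.t) ≠ 0) :
    |s - D.t| ≤ D.R * h := by
  by_contra! hc
  refine hs ?_
  rw [scaledKernel, (D.design D.h₀ D.h₀_pos le_rfl).support, mul_zero]
  rwa [abs_div, abs_of_pos hh, lt_div_iff₀ hh]

theorem abs_weight_le {h : ℝ} (hh : 0 < h) {k : ℕ} (hk : k ≤ 2) (s : ℝ) :
    |D.weight h k s| ≤ D.wBound * scaledKernel D.K h (s - D.t) := by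
  have h0 := scaledKernel_nonneg D.kernel hh (s - D.t)
  rw [weight, abs_mul, abs_of_nonneg h0, mul_comm]
  by_cases hs : scaledKernel D.K h (s - D.t) = 0
  · simp [hs]
  refine mul_le_mul_of_nonneg_right ?_ h0
  have h1 : |(s - D.t) / h| ≤ 1 + D.R := by
    rw [abs_div, abs_of_pos hh, div_le_iff₀ hh]
    have := D.abs_sub_le_of_ne hh hs
    nlinarith
  rw [abs_pow]
  have hR := D.R_pos
  calc |(s - D.t) / h| ^ k ≤ (1 + D.R) ^ k := pow_le_pow_left₀ (abs_nonneg _) h1 k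
    _ ≤ (1 + D.R) ^ 2 := pow_le_pow_right₀ (by linarith) hk

/-- A statistic whose expectation is of the order of `rate n h`. -/
structure RateBounded (f : ∀ n : ℕ, ℝ → (Fin n → E) → (Fin n → M) → ℝ) : Prop where
  nonneg : ∀ n h x m, 0 < h → 0 ≤ f n h x m
  measurable : ∀ n h, Measurable fun z : (Fin n → E) × (Fin n → M) => f n h z.1 z.2
  bound : ∃ A : ℝ, 0 ≤ A ∧ ∀ n h, 2 ≤ n → 0 < h → h ≤ D.h₀ →
    ∫⁻ z, ENNReal.ofReal (f n h z.1 z.2)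
      ∂((Measure.pi fun _ : Fin n => D.P).prod (Measure.pi fun _ : Fin n => D.ν))
      ≤ ENNReal.ofReal (A * rate n h)

variable {D}

theorem RateBounded.add {f g : ∀ n : ℕ, ℝ → (Fin n → E) → (Fin n → M) → ℝ} (hf : D.RateBounded f)
    (hg : D.RateBounded g) : D.RateBounded fun n h x m => f n h x m + g n h x m := by
  refine ⟨fun n h x m hh => add_nonneg (hf.nonneg n h x m hh) (hg.nonneg n h x m hh),
    fun n h => (hf.measurable n h).add (hg.measurable n h), ?_⟩
  obtain ⟨A, hA, h1⟩ := hf.bound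
  obtain ⟨B, hB, h2⟩ := hg.bound
  refine ⟨A + B, by positivity, fun n h hn hh hh0 => ?_⟩
  have hr := rate_pos (by omega : 0 < n) hh
  have e1 : ∀ z : (Fin n → E) × (Fin n → M), ENNReal.ofReal (f n h z.1 z.2 + g n h z.1 z.2)
      = ENNReal.ofReal (f n h z.1 z.2) + ENNReal.ofReal (g n h z.1 z.2) := fun z =>
    ENNReal.ofReal_add (hf.nonneg _ _ _ _ hh) (hg.nonneg _ _ _ _ hh)
  simp_rw [e1]
  rw [lintegral_add_right _ (hg.measurable n h).ennreal_ofReal, add_mul,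
    ENNReal.ofReal_add (by positivity) (by positivity)]
  exact add_le_add (h1 n h hn hh hh0) (h2 n h hn hh hh0)

theorem RateBounded.const_mul {f : ∀ n : ℕ, ℝ → (Fin n → E) → (Fin n → M) → ℝ}
    (hf : D.RateBounded f) {a : ℝ} (ha : 0 ≤ a) : D.RateBounded fun n h x m => a * f n h x m := by
  refine ⟨fun n h x m hh => mul_nonneg ha (hf.nonneg n h x m hh),
    fun n h => (hf.measurable n h).const_mul a, ?_⟩
  obtain ⟨A, hA, h1⟩ := hf.bound
  refine ⟨a * A, by positivity, fun n h hn hh hh0 => ?_⟩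
  have e1 : ∀ z : (Fin n → E) × (Fin n → M), ENNReal.ofReal (a * f n h z.1 z.2)
      = ENNReal.ofReal a * ENNReal.ofReal (f n h z.1 z.2) := fun z => ENNReal.ofReal_mul ha
  simp_rw [e1]
  rw [lintegral_const_mul' _ _ ENNReal.ofReal_ne_top, mul_assoc, ENNReal.ofReal_mul ha]
  exact mul_le_mul' le_rfl (h1 n h hn hh hh0)

theorem RateBounded.zero : D.RateBounded fun _ _ _ _ => 0 :=
  ⟨fun _ _ _ _ _ => le_rfl, fun _ _ => measurable_const, 0, le_rfl, fun _ _ _ _ _ => by simp⟩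

theorem RateBounded.sum {ι : Type*} (s : Finset ι)
    {f : ι → ∀ n : ℕ, ℝ → (Fin n → E) → (Fin n → M) → ℝ} (hf : ∀ i ∈ s, D.RateBounded (f i)) :
    D.RateBounded fun n h x m => ∑ i ∈ s, f i n h x m := by
  classical
  induction s using Finset.induction_on with
  | empty => simpa using RateBounded.zero
  | insert a s ha ih =>
    simp only [Finset.sum_insert ha]
    exact (hf a (Finset.mem_insert_self _ _)).add
      (ih fun i hi => hf i (Finset.mem_insert_of_mem hi))

theorem rateBounded_sqAvg {W : ℝ → E → ℝ} {g : ℝ → ℝ} {C ℓ B : ℝ} (hW : IsCentered D.P W C)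
    (hg : IsSmoothMean g ℓ B) :
    D.RateBounded fun _ h x m => sqAvg D.N D.K h D.t W g x m := by
  refine ⟨fun n h x m hh => ?_, fun n h => measurable_sqAvg D.kernel hW.measurable hg.measurable,
    ?_⟩
  · refine mul_nonneg (by positivity) (Finset.sum_nonneg fun i _ => integral_nonneg fun s => ?_)
    exact mul_nonneg (scaledKernel_nonneg D.kernel hh _) (sq_nonneg _)
  · obtain ⟨A, hA, h1⟩ := exists_lintegral_sqAvg_le D.P D.ν D.N D.lam D.Λ D.c D.K D.R D.κ D.t hW hg
    exact ⟨A, hA, fun n h hn hh hh0 => h1 n h hn (D.design h hh hh0)⟩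

theorem rateBounded_crossAvg {U W : ℝ → E → ℝ} {g : ℝ → ℝ} {C C' ℓ B b : ℝ}
    (hU : IsCentered D.P U C) (hW : IsCentered D.P W C') (hg : IsSmoothMean g ℓ B) (hb : 0 ≤ b)
    {w : ℝ → ℝ → ℝ} (hwm : ∀ h, Measurable (w h))
    (hw : ∀ h s, 0 < h → |w h s| ≤ b * scaledKernel D.K h (s - D.t)) :
    D.RateBounded fun _ h x m => |crossAvg D.N D.K h (w h) U W g x m| := by
  refine ⟨fun n h x m hh => abs_nonneg _, fun n h => ?_, ?_⟩
  · have := measurable_crossAvg (n := n) (h := h) (N := D.N) D.kernel (hwm h) hU.measurable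
      hW.measurable hg.measurable
    exact this.abs
  · obtain ⟨A, hA, h1⟩ := exists_lintegral_crossAvg_le D.P D.ν D.N D.lam D.Λ D.c D.K D.R D.κ D.t
      hU hW hg hb
    exact ⟨A, hA, fun n h hn hh hh0 => h1 n h hn (D.design h hh hh0) (w h) (hwm h)
      fun s => hw h s hh⟩

/-- The kernel average of `W²` has bounded expectation; the factor `h²`, which comes from the Taylor
remainder of the coefficients, brings it to the rate. -/
theorem rateBounded_sq_mul_linAvg {W : ℝ → E → ℝ} {C : ℝ} (hW : IsCentered D.P W C) :
    D.RateBounded fun _ h x m =>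
      h ^ 2 * linAvg D.N (fun s => scaledKernel D.K h (s - D.t)) (fun s y => W s y ^ 2) x m := by
  have hkm : ∀ h, Measurable fun s => scaledKernel D.K h (s - D.t) := fun h =>
    (measurable_scaledKernel D.kernel).comp (measurable_id.sub_const _)
  have hWm : Measurable fun z : ℝ × E => W z.1 z.2 ^ 2 := hW.measurable.pow_const 2
  have hm : ∀ n h, Measurable fun z : (Fin n → E) × (Fin n → M) =>
      linAvg D.N (fun s => scaledKernel D.K h (s - D.t)) (fun s y => W s y ^ 2) z.1 z.2 :=
    fun n h => measurable_linAvg (hkm h) hWm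
  have hC := hW.nonneg
  have hΛ := D.process.Λ_nonneg
  refine ⟨fun n h x m hh => ?_, fun n h => (hm n h).const_mul _, D.Λ * C, by positivity,
    fun n h hn hh hh0 => ?_⟩
  · refine mul_nonneg (sq_nonneg _) (mul_nonneg (by positivity) (Finset.sum_nonneg fun i _ =>
      integral_nonneg fun s => mul_nonneg (scaledKernel_nonneg D.kernel hh _) (sq_nonneg _)))
  · have hn0 : 0 < n := by omega
    have e1 : ∀ z : (Fin n → E) × (Fin n → M), ENNReal.ofReal (h ^ 2 *
        linAvg D.N (fun s => scaledKernel D.K h (s - D.t)) (fun s y => W s y ^ 2) z.1 z.2)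
        = ENNReal.ofReal (h ^ 2) * ENNReal.ofReal
        (linAvg D.N (fun s => scaledKernel D.K h (s - D.t)) (fun s y => W s y ^ 2) z.1 z.2) :=
      fun z => ENNReal.ofReal_mul (sq_nonneg _)
    simp_rw [e1]
    rw [lintegral_const_mul' _ _ ENNReal.ofReal_ne_top]
    have h2 : ∫⁻ z : (Fin n → E) × (Fin n → M), ENNReal.ofReal
        (linAvg D.N (fun s => scaledKernel D.K h (s - D.t)) (fun s y => W s y ^ 2) z.1 z.2)
        ∂((Measure.pi fun _ : Fin n => D.P).prod (Measure.pi fun _ : Fin n => D.ν))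
        ≤ ENNReal.ofReal (D.Λ * C) := by
      have hψ := measurable_integral_marked (N := D.N)
        (f := fun s y => scaledKernel D.K h (s - D.t) * W s y ^ 2)
        (((hkm h).comp measurable_fst).mul hWm)
      refine lintegral_ofReal_average_le hn0 (fun i z => integral_nonneg fun s =>
        mul_nonneg (scaledKernel_nonneg D.kernel hh _) (sq_nonneg _)) (fun i => ?_) fun i => ?_
      · have hz : Measurable fun z : (Fin n → E) × (Fin n → M) => (z.1 i, z.2 i) :=
          ((measurable_pi_apply i).comp measurable_fst).prodMk
            ((measurable_pi_apply i).comp measurable_snd)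
        exact hψ.comp hz
      · have hmp : MeasurePreserving (fun z : (Fin n → E) × (Fin n → M) => (z.1 i, z.2 i))
            ((Measure.pi fun _ : Fin n => D.P).prod (Measure.pi fun _ : Fin n => D.ν))
            (D.P.prod D.ν) :=
          (measurePreserving_eval (fun _ : Fin n => D.P) i).prod
            (measurePreserving_eval (fun _ : Fin n => D.ν) i)
        have h3 := hmp.lintegral_comp hψ.ennreal_ofReal
        refine h3.le.trans ?_
        have h4 : ∀ z : E × M, ENNReal.ofReal
            (∫ s, scaledKernel D.K h (s - D.t) * W s z.1 ^ 2 ∂(D.N z.2))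
            = ∫⁻ s, ENNReal.ofReal (scaledKernel D.K h (s - D.t) * W s z.1 ^ 2) ∂(D.N z.2) :=
          fun z => (D.point z.2).ofReal_integral fun s =>
            mul_nonneg (scaledKernel_nonneg D.kernel hh _) (sq_nonneg _)
        simp_rw [h4]
        rw [D.process.lintegral_marked
          (F := fun s y => ENNReal.ofReal (scaledKernel D.K h (s - D.t) * W s y ^ 2))
          (((hkm h).comp measurable_fst).mul hWm).ennreal_ofReal]
        calc _ ≤ ∫⁻ s, ENNReal.ofReal (D.Λ * C) * ENNReal.ofReal (scaledKernel D.K h (s - D.t)) := by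
              refine lintegral_mono fun s => ?_
              have hk0 := scaledKernel_nonneg D.kernel hh (s - D.t)
              have hi : Integrable (fun y => scaledKernel D.K h (s - D.t) * W s y ^ 2) D.P :=
                (hW.memLp s).integrable_sq.const_mul _
              simp only
              rw [← ofReal_integral_eq_lintegral_ofReal hi
                (ae_of_all _ fun y => mul_nonneg hk0 (sq_nonneg _)), integral_const_mul,
                ← ENNReal.ofReal_mul (mul_nonneg hk0 (integral_nonneg fun _ => sq_nonneg _)),
                ← ENNReal.ofReal_mul (by positivity)]
              refine ENNReal.ofReal_le_ofReal ?_
              have h5 := hW.sq_le s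
              have h6 := D.process.lam_le s
              have h7 := D.process.lam_nonneg s
              calc _ ≤ scaledKernel D.K h (s - D.t) * C * D.Λ := by gcongr
                _ = _ := by ring
          _ = _ := by
              rw [lintegral_const_mul' _ _ ENNReal.ofReal_ne_top,
                lintegral_scaledKernel D.kernel hh, mul_one]
    refine (mul_le_mul' le_rfl h2).trans ?_
    rw [← ENNReal.ofReal_mul (sq_nonneg _)]
    refine ENNReal.ofReal_le_ofReal ?_
    rw [mul_comm]
    refine mul_le_mul_of_nonneg_left ?_ (by positivity)
    have : 0 ≤ 1 / (n * h) := by positivity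
    unfold rate; linarith

end LocalModel

/-! ### Normal equations and errors of the Gram matrix and the score -/

namespace LocalModel

variable {E M : Type*} [MeasurableSpace E] [MeasurableSpace M] {p : ℕ} (D : LocalModel E M p)
  {n : ℕ}

/-- Empirically centered covariate. -/
noncomputable def obsX (h : ℝ) (x : Fin n → E) (m : Fin n → M) (a : Fin p) (z : Fin n × ℝ) : ℝ :=
  D.X a z.2 (x z.1) - nwDev D.N D.K h (D.X a) (D.mX a) z.2 x m

/-- Empirically centered response. -/
noncomputable def obsY (h : ℝ) (x : Fin n → E) (m : Fin n → M) (z : Fin n × ℝ) : ℝ :=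
  D.Y z.2 (x z.1) - nwDev D.N D.K h D.Y D.mY z.2 x m

/-- The local linear least squares criterion. -/
noncomputable def crit (h : ℝ) (x : Fin n → E) (m : Fin n → M) (b₀ b₁ : Fin p → ℝ) : ℝ :=
  sampleAvg D.N D.point m fun z => scaledKernel D.K h (z.2 - D.t) *
    (D.obsY h x m z - ∑ a, D.obsX h x m a z * b₀ a
      - (∑ a, D.obsX h x m a z * b₁ a) * (z.2 - D.t)) ^ 2

/-- Local linear features in the rescaled time. -/
noncomputable def feat (h : ℝ) (x : Fin n → E) (m : Fin n → M) (i : Fin p × Fin 2)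
    (z : Fin n × ℝ) : ℝ :=
  D.obsX h x m i.1 z * ((z.2 - D.t) / h) ^ (i.2 : ℕ)

/-- Residual of the first order expansion of the coefficients at `t`. -/
noncomputable def locResid (h : ℝ) (x : Fin n → E) (m : Fin n → M) (z : Fin n × ℝ) : ℝ :=
  D.obsY h x m z - ∑ a, D.obsX h x m a z * (D.β a D.t + D.β' a * (z.2 - D.t))

/-- Empirical Gram matrix. -/
noncomputable def gram (h : ℝ) (x : Fin n → E) (m : Fin n → M) (i j : Fin p × Fin 2) : ℝ :=
  sampleAvg D.N D.point m fun z =>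
    scaledKernel D.K h (z.2 - D.t) * D.feat h x m i z * D.feat h x m j z

/-- Empirical score. -/
noncomputable def score (h : ℝ) (x : Fin n → E) (m : Fin n → M) (i : Fin p × Fin 2) : ℝ :=
  sampleAvg D.N D.point m fun z =>
    scaledKernel D.K h (z.2 - D.t) * D.feat h x m i z * D.locResid h x m z

/-- Leading term of the score. -/
noncomputable def leading (h : ℝ) (x : Fin n → E) (m : Fin n → M) (i : Fin p × Fin 2) : ℝ :=
  linAvg D.N (D.weight h i.2) (fun s y => D.X i.1 s y * D.resid s y) x m

/-- Coordinates of a parameter relative to the truth, in the rescaled time. -/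
def relCoord (h : ℝ) (b₀ b₁ : Fin p → ℝ) (i : Fin p × Fin 2) : ℝ :=
  if i.2 = 0 then b₀ i.1 - D.β i.1 D.t else h * (b₁ i.1 - D.β' i.1)

/-- Measuring parameters from the truth and multiplying slopes by `h` gives features of order one,
whose Gram matrix has a nondegenerate limit. -/
theorem crit_eq {h : ℝ} (hh : 0 < h) (x : Fin n → E) (m : Fin n → M) (b₀ b₁ : Fin p → ℝ) :
    D.crit h x m b₀ b₁ = sampleAvg D.N D.point m fun z => scaledKernel D.K h (z.2 - D.t) *
      (D.locResid h x m z - ∑ i, D.feat h x m i z * D.relCoord h b₀ b₁ i) ^ 2 := by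
  unfold crit
  congr 1; funext z
  congr 2
  rw [Fintype.sum_prod_type]
  simp only [Fin.sum_univ_two, feat, relCoord, locResid, Fin.isValue, ↓reduceIte, Fin.val_zero,
    pow_zero, mul_one, one_ne_zero, Fin.val_one, pow_one]
  rw [Finset.sum_mul, sub_sub, sub_sub, ← Finset.sum_add_distrib, ← Finset.sum_add_distrib]
  congr 1
  refine Finset.sum_congr rfl fun a _ => ?_
  field_simp
  ring

theorem crit_lt {h : ℝ} (hh : 0 < h) {x : Fin n → E} {m : Fin n → M} {d : Fin p × Fin 2 → ℝ}
    (hd : ∀ i, ∑ j, D.gram h x m i j * d j = D.score h x m i)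
    (hpos : ∀ w : Fin p × Fin 2 → ℝ, w ≠ 0 → 0 < ∑ i, ∑ j, w i * D.gram h x m i j * w j)
    {b₀ b₁ : Fin p → ℝ}
    (hb : b₀ ≠ (fun a => D.β a D.t + d (a, 0)) ∨ b₁ ≠ fun a => D.β' a + d (a, 1) / h) :
    D.crit h x m (fun a => D.β a D.t + d (a, 0)) (fun a => D.β' a + d (a, 1) / h)
      < D.crit h x m b₀ b₁ := by
  rw [crit_eq D hh, crit_eq D hh]
  have h1 : D.relCoord h (fun a => D.β a D.t + d (a, 0)) (fun a => D.β' a + d (a, 1) / h) = d := by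
    funext ⟨a, k⟩
    fin_cases k
    · simp [relCoord]
    · simp only [relCoord, Fin.mk_one, Fin.isValue, one_ne_zero, ↓reduceIte]
      field_simp
      ring
  rw [h1]
  refine leastSquares_lt _ _ _ _ hd hpos fun hv => ?_
  rcases hb with hb | hb
  · refine hb (funext fun a => ?_)
    have := congrFun hv (a, 0)
    simp only [relCoord, ↓reduceIte] at this
    linarith
  · refine hb (funext fun a => ?_)
    have := congrFun hv (a, 1)
    simp only [relCoord, Fin.isValue, one_ne_zero, ↓reduceIte] at this
    rw [← this]
    field_simp
    ring

/-- Bound for the error in the Gram matrix due to empirical centering. -/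
noncomputable def gramErr (i j : Fin p × Fin 2) (n : ℕ) (h : ℝ) (x : Fin n → E) (m : Fin n → M) : ℝ :=
  |crossAvg D.N D.K h (D.weight h (i.2 + j.2)) (D.X i.1) (D.X j.1) (D.mX j.1) x m|
    + |crossAvg D.N D.K h (D.weight h (i.2 + j.2)) (D.X j.1) (D.X i.1) (D.mX i.1) x m|
    + D.wBound * (sqAvg D.N D.K h D.t (D.X i.1) (D.mX i.1) x m
      + sqAvg D.N D.K h D.t (D.X j.1) (D.mX j.1) x m)

theorem abs_gram_sub_le {h : ℝ} (hh : 0 < h) (x : Fin n → E) (m : Fin n → M)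
    (i j : Fin p × Fin 2) (γ : ℝ) :
    |D.gram h x m i j - γ| ≤ |linAvg D.N (D.weight h (i.2 + j.2))
      (fun s y => D.X i.1 s y * D.X j.1 s y) x m - γ| + D.gramErr i j n h x m := by
  have h1 := abs_map_gram_sub_le (sampleAvg D.N D.point m) (sampleAvg_mono D.point m)
    (w := fun z => D.weight h (i.2 + j.2) z.2) (k := fun z => scaledKernel D.K h (z.2 - D.t))
    (u := fun z => D.X i.1 z.2 (x z.1)) (v := fun z => D.X j.1 z.2 (x z.1))
    (d := fun z => nwDev D.N D.K h (D.X i.1) (D.mX i.1) z.2 x m)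
    (d' := fun z => nwDev D.N D.K h (D.X j.1) (D.mX j.1) z.2 x m) (b := D.wBound)
    (fun z => D.abs_weight_le hh (by omega) z.2) γ
  have e1 : D.gram h x m i j = sampleAvg D.N D.point m fun z => D.weight h (i.2 + j.2) z.2
      * ((D.X i.1 z.2 (x z.1) - nwDev D.N D.K h (D.X i.1) (D.mX i.1) z.2 x m)
        * (D.X j.1 z.2 (x z.1) - nwDev D.N D.K h (D.X j.1) (D.mX j.1) z.2 x m)) := by
    unfold gram
    congr 1; funext z
    simp only [feat, obsX, weight, pow_add]; ring
  rw [e1]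
  refine h1.trans (le_of_eq ?_)
  unfold gramErr
  rw [← add_assoc, ← add_assoc]
  rfl

theorem rateBounded_gramErr (i j : Fin p × Fin 2) : D.RateBounded (D.gramErr i j) := by
  have hw : ∀ h s, 0 < h → |D.weight h (i.2 + j.2) s| ≤ D.wBound * scaledKernel D.K h (s - D.t) :=
    fun h s hh => D.abs_weight_le hh (by omega) s
  exact ((rateBounded_crossAvg (D.X_centered _) (D.X_centered _) (D.mX_smooth _) D.wBound_nonneg
    (fun h => D.measurable_weight h _) hw).add
    (rateBounded_crossAvg (D.X_centered _) (D.X_centered _) (D.mX_smooth _) D.wBound_nonneg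
    (fun h => D.measurable_weight h _) hw)).add
    (((rateBounded_sqAvg (D.X_centered _) (D.mX_smooth _)).add
      (rateBounded_sqAvg (D.X_centered _) (D.mX_smooth _))).const_mul D.wBound_nonneg)

/-- Bound for the contribution of the `b`-th covariate to the error in the score. -/
noncomputable def scoreTerm (i : Fin p × Fin 2) (b : Fin p) (n : ℕ) (h : ℝ) (x : Fin n → E)
    (m : Fin n → M) : ℝ :=
  |crossAvg D.N D.K h (fun s => D.weight h i.2 s * D.β b s) (D.X i.1) (D.X b) (D.mX b) x m|
    + D.wBound * D.B * (sqAvg D.N D.K h D.t (D.X i.1) (D.mX i.1) x m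
      + sqAvg D.N D.K h D.t (D.X b) (D.mX b) x m)
    + D.wBound * (D.L * D.R ^ 2) * (2 * (
      h ^ 2 * linAvg D.N (fun s => scaledKernel D.K h (s - D.t)) (fun s y => D.X i.1 s y ^ 2) x m
      + sqAvg D.N D.K h D.t (D.X i.1) (D.mX i.1) x m
      + h ^ 2 * linAvg D.N (fun s => scaledKernel D.K h (s - D.t)) (fun s y => D.X b s y ^ 2) x m
      + sqAvg D.N D.K h D.t (D.X b) (D.mX b) x m))

/-- Bound for the error in the score due to empirical centering and to the local linear
approximation. -/
noncomputable def scoreErr (i : Fin p × Fin 2) (n : ℕ) (h : ℝ) (x : Fin n → E) (m : Fin n → M) : ℝ :=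
  |crossAvg D.N D.K h (D.weight h i.2) (D.X i.1) D.Y D.mY x m|
    + |crossAvg D.N D.K h (D.weight h i.2) D.resid (D.X i.1) (D.mX i.1) x m|
    + D.wBound * (sqAvg D.N D.K h D.t (D.X i.1) (D.mX i.1) x m
      + sqAvg D.N D.K h D.t D.Y D.mY x m)
    + ∑ b, D.scoreTerm i b n h x m

theorem abs_weight_mul_β_le {h : ℝ} (hh : 0 < h) {k : ℕ} (hk : k ≤ 2) (b : Fin p) (s : ℝ) :
    |D.weight h k s * D.β b s| ≤ D.wBound * D.B * scaledKernel D.K h (s - D.t) := by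
  rw [abs_mul]
  calc _ ≤ D.wBound * scaledKernel D.K h (s - D.t) * D.B :=
        mul_le_mul (D.abs_weight_le hh hk s) (D.β_le b s) (abs_nonneg _)
          (mul_nonneg D.wBound_nonneg (scaledKernel_nonneg D.kernel hh _))
    _ = _ := by ring

theorem abs_weight_mul_remainder_le {h : ℝ} (hh : 0 < h) (hh0 : h ≤ D.h₀) {k : ℕ} (hk : k ≤ 2)
    (b : Fin p) (s : ℝ) :
    |D.weight h k s * (D.β b s - D.β b D.t - D.β' b * (s - D.t))|
      ≤ D.wBound * (D.L * D.R ^ 2 * h ^ 2) * scaledKernel D.K h (s - D.t) := by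
  by_cases hs : scaledKernel D.K h (s - D.t) = 0
  · simp [weight, hs]
  have h1 := D.abs_sub_le_of_ne hh hs
  have hR := D.R_pos
  have hL := D.L_nonneg
  have h2 : |D.β b s - D.β b D.t - D.β' b * (s - D.t)| ≤ D.L * D.R ^ 2 * h ^ 2 := by
    refine (D.β_taylor b s (h1.trans (by gcongr))).trans ?_
    rw [mul_assoc, ← mul_pow, ← sq_abs (s - D.t)]
    gcongr
  rw [abs_mul]
  calc _ ≤ D.wBound * scaledKernel D.K h (s - D.t) * (D.L * D.R ^ 2 * h ^ 2) :=
        mul_le_mul (D.abs_weight_le hh hk s) h2 (abs_nonneg _)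
          (mul_nonneg D.wBound_nonneg (scaledKernel_nonneg D.kernel hh _))
    _ = _ := by ring

theorem sqAvg_nonneg {W : ℝ → E → ℝ} {g : ℝ → ℝ} {h : ℝ} (hh : 0 < h) (x : Fin n → E)
    (m : Fin n → M) : 0 ≤ sqAvg D.N D.K h D.t W g x m :=
  mul_nonneg (by positivity) (Finset.sum_nonneg fun _ _ => integral_nonneg fun _ =>
    mul_nonneg (scaledKernel_nonneg D.kernel hh _) (sq_nonneg _))

theorem abs_score_sub_le {h : ℝ} (hh : 0 < h) (hh0 : h ≤ D.h₀) (x : Fin n → E) (m : Fin n → M)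
    (i : Fin p × Fin 2) :
    |D.score h x m i - D.leading h x m i| ≤ D.scoreErr i n h x m := by
  have hk : (i.2 : ℕ) ≤ 2 := by omega
  have h1 := abs_map_score_sub_le (sampleAvg D.N D.point m) (sampleAvg_mono D.point m)
    (w := fun z => D.weight h i.2 z.2) (k := fun z => scaledKernel D.K h (z.2 - D.t))
    (u := fun z => D.X i.1 z.2 (x z.1)) (e := fun z => D.resid z.2 (x z.1))
    (d := fun z => nwDev D.N D.K h (D.X i.1) (D.mX i.1) z.2 x m)
    (dY := fun z => nwDev D.N D.K h D.Y D.mY z.2 x m)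
    (v := fun b z => D.X b z.2 (x z.1))
    (dv := fun b z => nwDev D.N D.K h (D.X b) (D.mX b) z.2 x m)
    (β := fun b z => D.β b z.2)
    (rem := fun b z => D.β b z.2 - D.β b D.t - D.β' b * (z.2 - D.t))
    (b := D.wBound) (B := D.B) (η := D.L * D.R ^ 2 * h ^ 2)
    (fun z => D.abs_weight_le hh hk z.2) (fun b z => D.abs_weight_mul_β_le hh hk b z.2)
    (fun b z => D.abs_weight_mul_remainder_le hh hh0 hk b z.2)
  have e1 : (fun z : Fin n × ℝ => D.weight h i.2 z.2
      * ((D.X i.1 z.2 (x z.1) - nwDev D.N D.K h (D.X i.1) (D.mX i.1) z.2 x m)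
        * (D.resid z.2 (x z.1) - nwDev D.N D.K h D.Y D.mY z.2 x m
          + ∑ b, nwDev D.N D.K h (D.X b) (D.mX b) z.2 x m * D.β b z.2
          + ∑ b, (D.X b z.2 (x z.1) - nwDev D.N D.K h (D.X b) (D.mX b) z.2 x m)
            * (D.β b z.2 - D.β b D.t - D.β' b * (z.2 - D.t)))))
      = fun z => scaledKernel D.K h (z.2 - D.t) * D.feat h x m i z * D.locResid h x m z := by
    funext z
    -- The local residual is the regression residual, corrected by the centering errors of response
    -- and covariates and by the Taylor remainder of the coefficients.
    have e2 : D.locResid h x m z = D.resid z.2 (x z.1) - nwDev D.N D.K h D.Y D.mY z.2 x m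
          + ∑ b, nwDev D.N D.K h (D.X b) (D.mX b) z.2 x m * D.β b z.2
          + ∑ b, (D.X b z.2 (x z.1) - nwDev D.N D.K h (D.X b) (D.mX b) z.2 x m)
            * (D.β b z.2 - D.β b D.t - D.β' b * (z.2 - D.t)) := by
      have e3 : ∑ a, D.obsX h x m a z * (D.β a D.t + D.β' a * (z.2 - D.t))
          = ∑ b, D.X b z.2 (x z.1) * D.β b z.2
            - ∑ b, nwDev D.N D.K h (D.X b) (D.mX b) z.2 x m * D.β b z.2
            - ∑ b, (D.X b z.2 (x z.1) - nwDev D.N D.K h (D.X b) (D.mX b) z.2 x m)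
            * (D.β b z.2 - D.β b D.t - D.β' b * (z.2 - D.t)) := by
        rw [← Finset.sum_sub_distrib, ← Finset.sum_sub_distrib]
        exact Finset.sum_congr rfl fun b _ => by simp only [obsX]; ring
      rw [locResid, e3, resid, obsY]; ring
    rw [e2]
    simp only [feat, obsX, weight]; ring
  rw [e1] at h1
  refine h1.trans ?_
  unfold scoreErr
  refine add_le_add le_rfl (Finset.sum_le_sum fun b _ => ?_)
  unfold scoreTerm
  refine add_le_add le_rfl ?_
  -- The factor `h²` of the Taylor remainder is kept for the averages of `X²`, which do not vanish,
  -- and dropped for the squared errors, which are already of the order of the rate.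
  have hh1 : h ≤ 1 := (D.design h hh hh0).h_le
  have hq : h ^ 2 ≤ 1 := pow_le_one₀ hh.le hh1
  have s1 := D.sqAvg_nonneg (W := D.X i.1) (g := D.mX i.1) hh x m
  have s2 := D.sqAvg_nonneg (W := D.X b) (g := D.mX b) hh x m
  change D.wBound * (D.L * D.R ^ 2 * h ^ 2) * (2 * (
      linAvg D.N (fun s => scaledKernel D.K h (s - D.t)) (fun s y => D.X i.1 s y ^ 2) x m
      + sqAvg D.N D.K h D.t (D.X i.1) (D.mX i.1) x m
      + linAvg D.N (fun s => scaledKernel D.K h (s - D.t)) (fun s y => D.X b s y ^ 2) x m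
      + sqAvg D.N D.K h D.t (D.X b) (D.mX b) x m)) ≤ _
  generalize sqAvg D.N D.K h D.t (D.X i.1) (D.mX i.1) x m = q1 at *
  generalize sqAvg D.N D.K h D.t (D.X b) (D.mX b) x m = q2 at *
  generalize linAvg D.N (fun s => scaledKernel D.K h (s - D.t)) (fun s y => D.X i.1 s y ^ 2) x m = l1
  generalize linAvg D.N (fun s => scaledKernel D.K h (s - D.t)) (fun s y => D.X b s y ^ 2) x m = l2
  have hL := D.L_nonneg
  have hb := D.wBound_nonneg
  calc _ = D.wBound * (D.L * D.R ^ 2) * (2 * (h ^ 2 * l1 + h ^ 2 * q1 + h ^ 2 * l2 + h ^ 2 * q2)) := by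
        ring
    _ ≤ _ := by
        gcongr
        · exact mul_le_of_le_one_left s1 hq
        · exact mul_le_of_le_one_left s2 hq

theorem rateBounded_scoreTerm (i : Fin p × Fin 2) (b : Fin p) : D.RateBounded (D.scoreTerm i b) := by
  have hk : (i.2 : ℕ) ≤ 2 := by omega
  have hb := D.wBound_nonneg
  have hB := D.B_nonneg
  have hL := D.L_nonneg
  have hs : ∀ a, D.RateBounded fun _ h x m => sqAvg D.N D.K h D.t (D.X a) (D.mX a) x m :=
    fun a => rateBounded_sqAvg (D.X_centered a) (D.mX_smooth a)
  have hl : ∀ a, D.RateBounded fun _ h x m => h ^ 2 *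
      linAvg D.N (fun s => scaledKernel D.K h (s - D.t)) (fun s y => D.X a s y ^ 2) x m :=
    fun a => rateBounded_sq_mul_linAvg (D.X_centered a)
  exact ((rateBounded_crossAvg (D.X_centered _) (D.X_centered b) (D.mX_smooth b) (by positivity)
    (fun h => (D.measurable_weight h i.2).mul (D.β_measurable b))
    (fun h s hh => D.abs_weight_mul_β_le hh hk b s)).add
    (((hs i.1).add (hs b)).const_mul (by positivity))).add
    ((((((hl i.1).add (hs i.1)).add (hl b)).add (hs b)).const_mul zero_le_two).const_mul
      (by positivity))

/-- Every centering error of first order is multiplied by a centered process, a covariate or the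
residual, and so appears as a cross average; products of two errors reduce to averages of squares.
-/
theorem rateBounded_scoreErr (i : Fin p × Fin 2) : D.RateBounded (D.scoreErr i) := by
  have hk : (i.2 : ℕ) ≤ 2 := by omega
  have hw : ∀ h s, 0 < h → |D.weight h i.2 s| ≤ D.wBound * scaledKernel D.K h (s - D.t) :=
    fun h s hh => D.abs_weight_le hh hk s
  exact (((rateBounded_crossAvg (D.X_centered _) D.Y_centered D.mY_smooth D.wBound_nonneg
    (fun h => D.measurable_weight h i.2) hw).add
    (rateBounded_crossAvg D.resid_centered (D.X_centered _) (D.mX_smooth _) D.wBound_nonneg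
    (fun h => D.measurable_weight h i.2) hw)).add
    (((rateBounded_sqAvg (D.X_centered _) (D.mX_smooth _)).add
      (rateBounded_sqAvg D.Y_centered D.mY_smooth)).const_mul D.wBound_nonneg)).add
    (RateBounded.sum _ fun b _ => D.rateBounded_scoreTerm i b)

end LocalModel

/-! ### Limits of the Gram matrix and of the leading score -/

namespace LocalModel

variable {E M Ω : Type*} [MeasurableSpace E] [MeasurableSpace M] [MeasurableSpace Ω] {p : ℕ}
  {D : LocalModel E M p} {μ : Measure Ω} [IsProbabilityMeasure μ] {y : ℕ → Ω → E × M}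
  {h : ℕ → ℝ}

/-- Covariate paths of the first `n` subjects. -/
def paths (y : ℕ → Ω → E × M) (n : ℕ) (ω : Ω) (i : Fin n) : E := (y i ω).1

/-- Observation marks of the first `n` subjects. -/
def marks (y : ℕ → Ω → E × M) (n : ℕ) (ω : Ω) (i : Fin n) : M := (y i ω).2

theorem measurable_sample (hyP : ∀ i, MeasurePreserving (y i) μ (D.P.prod D.ν)) (n : ℕ) :
    Measurable fun ω => (paths y n ω, marks y n ω) :=
  Measurable.prodMk (f := paths y n) (g := marks y n)
    (measurable_pi_lambda _ fun i => (hyP i).measurable.fst)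
    (measurable_pi_lambda _ fun i => (hyP i).measurable.snd)

theorem RateBounded.lintegral_le (hy : iIndepFun y μ)
    (hyP : ∀ i, MeasurePreserving (y i) μ (D.P.prod D.ν))
    {f : ∀ n : ℕ, ℝ → (Fin n → E) → (Fin n → M) → ℝ} (hf : D.RateBounded f)
    (h0 : ∀ᶠ n in atTop, 0 < h n) (hh : Tendsto h atTop (𝓝 0)) :
    ∃ A : ℝ, 0 ≤ A ∧ ∀ r : ℕ → ℝ, (∀ n, 0 ≤ r n) → ∀ᶠ n in atTop,
      ∫⁻ ω, ENNReal.ofReal (r n * f n (h n) (paths y n ω) (marks y n ω)) ∂μ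
        ≤ ENNReal.ofReal (A * (r n * rate n (h n))) := by
  obtain ⟨A, hA, h1⟩ := hf.bound
  refine ⟨A, hA, fun r hr => ?_⟩
  filter_upwards [h0, hh.eventually_le_const D.h₀_pos, eventually_ge_atTop 2] with n hn hn' hn2
  have e1 : ∀ ω, ENNReal.ofReal (r n * f n (h n) (paths y n ω) (marks y n ω))
      = ENNReal.ofReal (r n) * ENNReal.ofReal (f n (h n) (paths y n ω) (marks y n ω)) :=
    fun ω => ENNReal.ofReal_mul (hr n)
  simp_rw [e1]
  rw [lintegral_const_mul' _ _ ENNReal.ofReal_ne_top]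
  have h2 := lintegral_pairs (n := n) hy hyP
    (F := fun x m => ENNReal.ofReal (f n (h n) x m)) (hf.measurable n (h n)).ennreal_ofReal
  have h3 := h1 n (h n) hn2 hn hn'
  rw [← h2] at h3
  refine (mul_le_mul' le_rfl h3).trans (le_of_eq ?_)
  rw [← ENNReal.ofReal_mul (hr n)]
  congr 1; ring

theorem RateBounded.measurable_sample (hyP : ∀ i, MeasurePreserving (y i) μ (D.P.prod D.ν))
    {f : ∀ n : ℕ, ℝ → (Fin n → E) → (Fin n → M) → ℝ} (hf : D.RateBounded f) (r : ℕ → ℝ) (n : ℕ) :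
    Measurable fun ω => r n * f n (h n) (paths y n ω) (marks y n ω) :=
  ((hf.measurable n (h n)).comp (LocalModel.measurable_sample hyP n)).const_mul _

theorem RateBounded.smallInProb (hy : iIndepFun y μ)
    (hyP : ∀ i, MeasurePreserving (y i) μ (D.P.prod D.ν))
    {f : ∀ n : ℕ, ℝ → (Fin n → E) → (Fin n → M) → ℝ} (hf : D.RateBounded f)
    (h0 : ∀ᶠ n in atTop, 0 < h n) (hh : Tendsto h atTop (𝓝 0)) {r : ℕ → ℝ} (hr : ∀ n, 0 ≤ r n)
    (hrate : Tendsto (fun n => r n * rate n (h n)) atTop (𝓝 0)) :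
    SmallInProb μ fun n ω => r n * f n (h n) (paths y n ω) (marks y n ω) := by
  obtain ⟨A, hA, h1⟩ := hf.lintegral_le hy hyP h0 hh
  refine smallInProb_of_lintegral (hf.measurable_sample hyP r) ?_ (h1 r hr)
  simpa using hrate.const_mul A

theorem RateBounded.boundedInProb (hy : iIndepFun y μ)
    (hyP : ∀ i, MeasurePreserving (y i) μ (D.P.prod D.ν))
    {f : ∀ n : ℕ, ℝ → (Fin n → E) → (Fin n → M) → ℝ} (hf : D.RateBounded f)
    (h0 : ∀ᶠ n in atTop, 0 < h n) (hh : Tendsto h atTop (𝓝 0)) {r : ℕ → ℝ} (hr : ∀ n, 0 ≤ r n)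
    {C : ℝ} (hrate : ∀ᶠ n in atTop, r n * rate n (h n) ≤ C) :
    BoundedInProb μ fun n ω => r n * f n (h n) (paths y n ω) (marks y n ω) := by
  obtain ⟨A, hA, h1⟩ := hf.lintegral_le hy hyP h0 hh
  refine boundedInProb_of_lintegral (C := A * C) (hf.measurable_sample hyP r) ?_
  filter_upwards [h1 r hr, hrate] with n h2 h3
  exact h2.trans (ENNReal.ofReal_le_ofReal (mul_le_mul_of_nonneg_left h3 hA))

variable (D) in
theorem kernel_eq_zero {z : ℝ} (hz : D.R < |z|) : D.K z = 0 :=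
  (D.design D.h₀ D.h₀_pos le_rfl).support z hz

variable (D) in
theorem integrable_kernel_mul_pow (k : ℕ) : Integrable fun z => D.K z * z ^ k := by
  refine Integrable.mono' (D.kernel.integrable.mul_const (D.R ^ k))
    (D.kernel.measurable.mul (measurable_id.pow_const k)).aestronglyMeasurable
    (ae_of_all _ fun z => ?_)
  rw [norm_mul, Real.norm_eq_abs, abs_of_nonneg (D.kernel.nonneg z), Real.norm_eq_abs, abs_pow]
  by_cases hz : D.R < |z|
  · simp [D.kernel_eq_zero hz]
  · exact mul_le_mul_of_nonneg_left (pow_le_pow_left₀ (abs_nonneg _) (not_lt.mp hz) k)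
      (D.kernel.nonneg z)

variable (D) in
-- If it vanished, `K` would be zero almost everywhere, against total mass one. Positivity makes the
-- slope block of the limit Gram matrix nondegenerate.
theorem secondMoment_pos : 0 < ∫ z, D.K z * z ^ 2 := by
  have h0 : ∀ z, 0 ≤ D.K z * z ^ 2 := fun z => mul_nonneg (D.kernel.nonneg z) (sq_nonneg z)
  refine lt_of_le_of_ne (integral_nonneg h0) fun h1 => ?_
  rw [eq_comm, integral_eq_zero_iff_of_nonneg h0 (D.integrable_kernel_mul_pow 2)] at h1
  have h2 : D.K =ᵐ[volume] 0 := by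
    have h3 : ∀ᵐ z : ℝ, z ≠ 0 := by simp [ae_iff]
    filter_upwards [h1, h3] with z h4 h5
    simpa [h5] using h4
  have h3 := D.kernel.integral_eq_one
  rw [integral_congr_ae h2] at h3
  simp at h3

variable (D) in
theorem integrable_X_mul (a b : Fin p) (s : ℝ) :
    Integrable (fun x => D.X a s x * D.X b s x) D.P :=
  ((D.X_centered a).memLp s).integrable_mul ((D.X_centered b).memLp s)

variable (D) in
theorem integral_abs_X_mul_le (a b : Fin p) (s : ℝ) :
    ∫ x, |D.X a s x * D.X b s x| ∂D.P ≤ D.C := by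
  have ha := ((D.X_centered a).memLp s).integrable_sq
  have hb := ((D.X_centered b).memLp s).integrable_sq
  calc _ ≤ ∫ x, (D.X a s x ^ 2 + D.X b s x ^ 2) / 2 ∂D.P := by
        refine integral_mono (D.integrable_X_mul a b s).abs ((ha.add hb).div_const 2) fun x => ?_
        simp only [abs_mul]
        rw [← sq_abs (D.X a s x), ← sq_abs (D.X b s x)]
        nlinarith [sq_nonneg (|D.X a s x| - |D.X b s x|)]
    _ ≤ D.C := by
        rw [integral_div, integral_add ha hb]
        linarith [(D.X_centered a).sq_le s, (D.X_centered b).sq_le s]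

theorem linAvg_eq_sum {w : ℝ → ℝ} {U : ℝ → E → ℝ} (n : ℕ) (ω : Ω) (q : ℝ) :
    q * linAvg D.N w U (paths y n ω) (marks y n ω)
      = ∑ i ∈ Finset.range n, ∫ s, q * (n : ℝ)⁻¹ * w s * U s (y i ω).1 ∂(D.N (y i ω).2) := by
  unfold linAvg paths marks
  rw [Finset.sum_range fun i => ∫ s, q * (n : ℝ)⁻¹ * w s * U s (y i ω).1 ∂(D.N (y i ω).2),
    ← mul_assoc, Finset.mul_sum]
  refine Finset.sum_congr rfl fun i _ => ?_
  rw [← integral_const_mul]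
  congr 1; funext s; ring

/-- Convergence in probability of local averages. -/
theorem smallInProb_linAvg_sub (hy : iIndepFun y μ)
    (hyP : ∀ i, MeasurePreserving (y i) μ (D.P.prod D.ν))
    (h0 : ∀ᶠ n in atTop, 0 < h n) (hh : Tendsto h atTop (𝓝 0))
    (hnh : Tendsto (fun n : ℕ => n * h n) atTop atTop) (a b : Fin p) (k : ℕ) :
    SmallInProb μ fun n ω => |linAvg D.N (D.weight (h n) k)
      (fun s x => D.X a s x * D.X b s x) (paths y n ω) (marks y n ω)
      - (∫ z, D.K z * z ^ k) * (D.lam D.t * ∫ x, D.X a D.t x * D.X b D.t x ∂D.P)| := by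
  have hΓ : Measurable fun z : ℝ × E => D.X a z.1 z.2 * D.X b z.1 z.2 :=
    (D.X_centered a).measurable.mul (D.X_centered b).measurable
  have hm : ∀ n, Measurable fun ω => linAvg D.N (D.weight (h n) k)
      (fun s x => D.X a s x * D.X b s x) (paths y n ω) (marks y n ω) := fun n =>
    (measurable_linAvg (n := n) (N := D.N) (U := fun s x => D.X a s x * D.X b s x)
      (D.measurable_weight (h n) k) hΓ).comp (LocalModel.measurable_sample hyP n)
  refine smallInProb_abs_sub_of_charFun hm fun u => ?_
  have hJm : Measurable fun z => u * (D.K z * z ^ k) :=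
    (D.kernel.measurable.mul (measurable_id.pow_const k)).const_mul u
  have h1 := D.process.tendsto_charFun_local_average (P := D.P) (t := D.t) hJm
    ((D.integrable_kernel_mul_pow k).const_mul u) D.R_pos
    (fun z hz => by simp [D.kernel_eq_zero hz]) hΓ (D.integrable_X_mul a b)
    (D.integral_abs_X_mul_le a b) (D.X_tendsto a b) D.continuousAt_lam h0 hh hnh
  have hψ : ∀ n : ℕ, Measurable fun z : E × M => ∫ s, (n * h n)⁻¹ *
      (u * (D.K ((s - D.t) / h n) * ((s - D.t) / h n) ^ k)) * (D.X a s z.1 * D.X b s z.1)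
        ∂(D.N z.2) := fun n =>
    measurable_integral_marked (N := D.N) (f := fun s x => (n * h n)⁻¹ *
      (u * (D.K ((s - D.t) / h n) * ((s - D.t) / h n) ^ k)) * (D.X a s x * D.X b s x))
      (measurable_local (Γ := fun s x => D.X a s x * D.X b s x) hJm hΓ (n * h n)⁻¹ D.t (h n))
  have h2 := tendsto_charFun_sum hy hyP hψ h1
  rw [integral_const_mul] at h2
  rw [mul_assoc] at h2
  refine Tendsto.congr (fun n => ?_) h2
  congr 1; funext ω
  rw [linAvg_eq_sum]
  congr 3
  refine Finset.sum_congr rfl fun i _ => ?_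
  congr 1; funext s
  simp only [weight, scaledKernel, mul_inv]; ring

/-- Chebyshev's inequality: the leading score is a centered average with variance `O(1/(nh))`. -/
theorem boundedInProb_leading (hy : iIndepFun y μ)
    (hyP : ∀ i, MeasurePreserving (y i) μ (D.P.prod D.ν))
    (h0 : ∀ᶠ n in atTop, 0 < h n) (hh : Tendsto h atTop (𝓝 0)) (i : Fin p × Fin 2) :
    BoundedInProb μ fun n ω => √(n * h n) * |D.leading (h n) (paths y n ω) (marks y n ω) i| := by
  have hk : (i.2 : ℕ) ≤ 2 := by omega
  have hUm := (D.score_centered i.1).measurable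
  have hlm : ∀ n, Measurable fun z : (Fin n → E) × (Fin n → M) => D.leading (h n) z.1 z.2 i :=
    fun n => measurable_linAvg (D.measurable_weight (h n) i.2) hUm
  have hm : ∀ n, Measurable fun ω =>
      √(n * h n) * D.leading (h n) (paths y n ω) (marks y n ω) i := fun n =>
    ((hlm n).comp (LocalModel.measurable_sample hyP n)).const_mul _
  have h1 := boundedInProb_of_lintegral_sq (μ := μ) hm
    (C := D.C * D.wBound ^ 2 * IsDesign.sqConst D.Λ D.c D.K) ?_
  · refine h1.mono (Eventually.of_forall fun n => ae_of_all _ fun ω => le_of_eq ?_)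
    rw [abs_mul, abs_of_nonneg (Real.sqrt_nonneg _)]
  filter_upwards [h0, hh.eventually_le_const D.h₀_pos, eventually_gt_atTop 0] with n hn hn' hn0
  have hnh : (0 : ℝ) < n * h n := by positivity
  have e1 : ∀ ω, ENNReal.ofReal ((√(n * h n) * D.leading (h n) (paths y n ω) (marks y n ω) i) ^ 2)
      = ENNReal.ofReal (n * h n)
        * ENNReal.ofReal (D.leading (h n) (paths y n ω) (marks y n ω) i ^ 2) := fun ω => by
    rw [mul_pow, Real.sq_sqrt hnh.le, ENNReal.ofReal_mul hnh.le]
  simp_rw [e1]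
  rw [lintegral_const_mul' _ _ ENNReal.ofReal_ne_top]
  have h2 := lintegral_pairs (n := n) hy hyP
    (F := fun x m => ENNReal.ofReal (D.leading (h n) x m i ^ 2))
    ((hlm n).pow_const 2).ennreal_ofReal
  have h3 := (D.design (h n) hn hn').lintegral_linAvg_sq_le (P := D.P) (D.score_centered i.1) hn0
    (D.measurable_weight (h n) i.2) (D.abs_weight_le hn hk)
  have h4 : ∫⁻ ω, ENNReal.ofReal (D.leading (h n) (paths y n ω) (marks y n ω) i ^ 2) ∂μ
      ≤ ENNReal.ofReal (D.C * D.wBound ^ 2 * IsDesign.sqConst D.Λ D.c D.K / (n * h n)) :=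
    h2.le.trans h3
  refine (mul_le_mul' le_rfl h4).trans (le_of_eq ?_)
  rw [← ENNReal.ofReal_mul hnh.le]
  congr 1
  field_simp

variable (D) in
theorem isCentered_sum_score (u : Fin p → ℝ) :
    IsCentered D.P (fun s x => ∑ a, u a * (D.X a s x * D.resid s x))
      (Fintype.card (Fin p) * ∑ a, u a ^ 2 * D.C) := by
  have hc := D.score_centered
  have hL : ∀ s, ∀ a ∈ Finset.univ, MemLp (fun x => u a * (D.X a s x * D.resid s x)) 2 D.P :=
    fun s a _ => ((hc a).memLp s).const_mul (u a)
  refine ⟨Finset.measurable_fun_sum _ fun a _ => (hc a).measurable.const_mul (u a),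
    fun s => memLp_finsetSum _ (hL s), fun s => ?_, fun s => ?_⟩
  · rw [integral_finsetSum _ fun a ha => (hL s a ha).integrable one_le_two]
    refine Finset.sum_eq_zero fun a _ => ?_
    rw [integral_const_mul]
    exact mul_eq_zero_of_right _ ((hc a).mean s)
  · have hi : ∀ a ∈ Finset.univ,
        Integrable (fun x => (u a * (D.X a s x * D.resid s x)) ^ 2) D.P :=
      fun a ha => (hL s a ha).integrable_sq
    calc _ ≤ ∫ x, Fintype.card (Fin p) * ∑ a, (u a * (D.X a s x * D.resid s x)) ^ 2 ∂D.P := by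
          refine integral_mono (memLp_finsetSum _ (hL s)).integrable_sq
            ((integrable_finsetSum _ hi).const_mul _) fun x => ?_
          simp only
          exact sq_sum_le_card_mul_sum_sq
      _ ≤ _ := by
          rw [integral_const_mul, integral_finsetSum _ hi]
          refine mul_le_mul_of_nonneg_left (Finset.sum_le_sum fun a _ => ?_) (by positivity)
          simp_rw [mul_pow (u a)]
          rw [integral_const_mul]
          exact mul_le_mul_of_nonneg_left ((hc a).sq_le s) (sq_nonneg _)

variable (D) in
theorem integral_sum_score_sq (u : Fin p → ℝ) (s : ℝ) :
    ∫ x, (∑ a, u a * (D.X a s x * D.resid s x)) ^ 2 ∂D.P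
      = ∑ a, ∑ b, u a * u b * ∫ x, D.X a s x * D.resid s x * (D.X b s x * D.resid s x) ∂D.P := by
  have hc := D.score_centered
  have hi : ∀ a b, Integrable (fun x => u a * u b *
      (D.X a s x * D.resid s x * (D.X b s x * D.resid s x))) D.P := fun a b =>
    (((hc a).memLp s).integrable_mul ((hc b).memLp s)).const_mul _
  have e1 : ∀ x, (∑ a, u a * (D.X a s x * D.resid s x)) ^ 2
      = ∑ a, ∑ b, u a * u b * (D.X a s x * D.resid s x * (D.X b s x * D.resid s x)) := fun x => by
    rw [sq, Finset.sum_mul_sum]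
    exact Finset.sum_congr rfl fun a _ => Finset.sum_congr rfl fun b _ => by ring
  simp_rw [e1]
  rw [integral_finsetSum _ fun a _ => integrable_finsetSum _ fun b _ => hi a b]
  refine Finset.sum_congr rfl fun a _ => ?_
  rw [integral_finsetSum _ fun b _ => hi a b]
  exact Finset.sum_congr rfl fun b _ => integral_const_mul _ _

/-- Convergence of the characteristic functions of the leading term. -/
theorem tendsto_charFun_leading (hy : iIndepFun y μ)
    (hyP : ∀ i, MeasurePreserving (y i) μ (D.P.prod D.ν))
    (h0 : ∀ᶠ n in atTop, 0 < h n) (hh : Tendsto h atTop (𝓝 0))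
    (hnh : Tendsto (fun n : ℕ => n * h n) atTop atTop) (u : Fin p → ℝ) :
    Tendsto (fun n : ℕ => ∫ ω, Complex.exp (Complex.I * (√(n * h n) *
        ∑ a, u a * D.leading (h n) (paths y n ω) (marks y n ω) (a, 0) : ℝ)) ∂μ) atTop
      (𝓝 (Complex.exp (-((∫ z, D.K z ^ 2) * (D.lam D.t * ∑ a, ∑ b, u a * u b *
        ∫ x, D.X a D.t x * D.resid D.t x * (D.X b D.t x * D.resid D.t x) ∂D.P) / 2 : ℝ)))) := by
  obtain ⟨Cδ, hCδ⟩ := D.score_moment u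
  have hg := D.isCentered_sum_score u
  have hgt : ContinuousAt (fun s => ∫ x, (∑ a, u a * (D.X a s x * D.resid s x)) ^ 2 ∂D.P) D.t := by
    simp_rw [integral_sum_score_sq]
    refine tendsto_finsetSum _ fun a _ => tendsto_finsetSum _ fun b _ => ?_
    exact (D.score_cov_continuousAt a b).const_mul _
  have h1 := D.process.tendsto_charFun_local_score (P := D.P) hg D.kernel.measurable
    D.kernel.integrable D.kernel.integrable_sq D.δ_pos D.δ_le (fun s => (hCδ s).1)
    (fun s => (hCδ s).2) hgt D.continuousAt_lam h0 hh hnh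
  have hψ : ∀ n : ℕ, Measurable fun z : E × M => ∫ s, (√(n * h n))⁻¹ * D.K ((s - D.t) / h n)
      * ∑ a, u a * (D.X a s z.1 * D.resid s z.1) ∂(D.N z.2) := fun n =>
    measurable_integral_marked (N := D.N) (f := fun s x => (√(n * h n))⁻¹ * D.K ((s - D.t) / h n)
      * ∑ a, u a * (D.X a s x * D.resid s x))
      (measurable_local (Γ := fun s x => ∑ a, u a * (D.X a s x * D.resid s x))
        D.kernel.measurable hg.measurable (√(n * h n))⁻¹ D.t (h n))
  have h2 := tendsto_charFun_sum hy hyP hψ h1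
  rw [integral_sum_score_sq] at h2
  refine Tendsto.congr' ?_ h2
  filter_upwards [h0, eventually_gt_atTop 0] with n hn hn0
  congr 1; funext ω
  congr 3
  rw [Finset.mul_sum]
  simp_rw [leading, mul_left_comm (√(n * h n)), linAvg_eq_sum, Finset.mul_sum]
  rw [Finset.sum_comm]
  refine Finset.sum_congr rfl fun i _ => ?_
  simp_rw [← integral_const_mul]
  rw [← integral_finsetSum _ fun a _ => (D.point _).integrable _]
  congr 1; funext s
  refine Finset.sum_congr rfl fun a _ => ?_
  have hs : √(n * h n) * √(n * h n) = n * h n := Real.mul_self_sqrt (by positivity)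
  have hs0 : √(n * h n) ≠ 0 := by positivity
  -- Matches the normalizations: `√(nh)`, the average `n⁻¹` and the factor `h⁻¹` of the scaled
  -- kernel combine to `(√(nh))⁻¹`.
  have e3 : (√(n * h n))⁻¹ = √(n * h n) * (n : ℝ)⁻¹ * (h n)⁻¹ := by
    rw [mul_assoc, ← mul_inv, eq_mul_inv_iff_mul_eq₀ (by positivity),
      inv_mul_eq_iff_eq_mul₀ hs0, hs]
  rw [e3]
  simp only [weight, scaledKernel, Fin.val_zero, pow_zero, mul_one]
  ring

end LocalModel

/-! ### Linearization of the estimator -/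

namespace LocalModel

variable {E M Ω : Type*} [MeasurableSpace E] [MeasurableSpace M] [MeasurableSpace Ω] {p : ℕ}
  {D : LocalModel E M p} {μ : Measure Ω} [IsProbabilityMeasure μ] {y : ℕ → Ω → E × M}
  {h : ℕ → ℝ}

variable (D) in
/-- The limit of the Gram matrix of the covariates. -/
noncomputable def limA : Matrix (Fin p) (Fin p) ℝ :=
  Matrix.of fun a b => D.lam D.t * ∫ x, D.X a D.t x * D.X b D.t x ∂D.P

variable (D) in
/-- Total error in the Gram matrix. -/
noncomputable def gramDev (n : ℕ) (h : ℝ) (x : Fin n → E) (m : Fin n → M) : ℝ :=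
  ∑ i : Fin p × Fin 2, ∑ j : Fin p × Fin 2, (|linAvg D.N (D.weight h (i.2 + j.2))
    (fun s y => D.X i.1 s y * D.X j.1 s y) x m - blockGram D.limA (∫ z, D.K z * z ^ 2) i j|
    + D.gramErr i j n h x m)

variable (D) in
/-- Total error in the score. -/
noncomputable def scoreDev (n : ℕ) (h : ℝ) (x : Fin n → E) (m : Fin n → M) : ℝ :=
  ∑ i, D.scoreErr i n h x m

variable (D) in
theorem rateBounded_scoreDev : D.RateBounded D.scoreDev :=
  RateBounded.sum _ fun i _ => D.rateBounded_scoreErr i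

variable (D) in
theorem gramDev_nonneg {n : ℕ} {h : ℝ} (hh : 0 < h) (x : Fin n → E) (m : Fin n → M) :
    0 ≤ D.gramDev n h x m :=
  Finset.sum_nonneg fun i _ => Finset.sum_nonneg fun j _ =>
    add_nonneg (abs_nonneg _) ((D.rateBounded_gramErr i j).nonneg n h x m hh)

variable (D) in
theorem abs_gram_sub_blockGram_le {n : ℕ} {h : ℝ} (hh : 0 < h) (x : Fin n → E) (m : Fin n → M)
    (i j : Fin p × Fin 2) :
    |D.gram h x m i j - blockGram D.limA (∫ z, D.K z * z ^ 2) i j| ≤ D.gramDev n h x m := by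
  refine (D.abs_gram_sub_le hh x m i j _).trans ?_
  have h0 : ∀ i j, 0 ≤ |linAvg D.N (D.weight h ((i : Fin p × Fin 2).2 + (j : Fin p × Fin 2).2))
    (fun s y => D.X i.1 s y * D.X j.1 s y) x m - blockGram D.limA (∫ z, D.K z * z ^ 2) i j|
    + D.gramErr i j n h x m := fun i j =>
    add_nonneg (abs_nonneg _) ((D.rateBounded_gramErr i j).nonneg n h x m hh)
  exact (Finset.single_le_sum (f := fun j => |linAvg D.N (D.weight h (i.2 + j.2))
    (fun s y => D.X i.1 s y * D.X j.1 s y) x m - blockGram D.limA (∫ z, D.K z * z ^ 2) i j|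
    + D.gramErr i j n h x m) (fun j _ => h0 i j) (Finset.mem_univ j)).trans
    (Finset.single_le_sum (f := fun i => ∑ j : Fin p × Fin 2, (|linAvg D.N (D.weight h (i.2 + j.2))
    (fun s y => D.X i.1 s y * D.X j.1 s y) x m - blockGram D.limA (∫ z, D.K z * z ^ 2) i j|
    + D.gramErr i j n h x m)) (fun i _ => Finset.sum_nonneg fun j _ => h0 i j) (Finset.mem_univ i))

variable (D) in
-- The entries `1`, `0`, `m` are the kernel moments of orders zero, one and two; the first moment
-- vanishes.
theorem blockGram_eq (i j : Fin p × Fin 2) :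
    blockGram D.limA (∫ z, D.K z * z ^ 2) i j = (∫ z, D.K z * z ^ ((i.2 : ℕ) + j.2))
      * (D.lam D.t * ∫ x, D.X i.1 D.t x * D.X j.1 D.t x ∂D.P) := by
  obtain ⟨a, k⟩ := i
  obtain ⟨b, l⟩ := j
  have h0 := D.kernel.integral_eq_one
  have h1 := D.kernel.integral_mul
  unfold blockGram limA
  fin_cases k <;> fin_cases l <;> simp [h0, h1, mul_comm]

theorem tendsto_rate (hh : Tendsto h atTop (𝓝 0))
    (hnh : Tendsto (fun n : ℕ => n * h n) atTop atTop) :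
    Tendsto (fun n => rate n (h n)) atTop (𝓝 0) := by
  have h1 := (tendsto_inv_atTop_zero.comp hnh).add (hh.pow 2)
  simpa [rate, Function.comp_def] using h1

theorem smallInProb_gramDev (hy : iIndepFun y μ)
    (hyP : ∀ i, MeasurePreserving (y i) μ (D.P.prod D.ν))
    (h0 : ∀ᶠ n in atTop, 0 < h n) (hh : Tendsto h atTop (𝓝 0))
    (hnh : Tendsto (fun n : ℕ => n * h n) atTop atTop) :
    SmallInProb μ fun n ω => D.gramDev n (h n) (paths y n ω) (marks y n ω) := by
  refine SmallInProb.sum _ fun i _ => SmallInProb.sum _ fun j _ => ?_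
  rw [blockGram_eq]
  have h1 := (D.rateBounded_gramErr i j).smallInProb hy hyP h0 hh (r := fun _ => 1)
    (fun _ => zero_le_one) (by simpa using tendsto_rate hh hnh)
  simp only [one_mul] at h1
  exact (smallInProb_linAvg_sub hy hyP h0 hh hnh i.1 j.1 (i.2 + j.2)).add h1

/-- First component of the unique minimizer of the criterion, if there is one. -/
def IsEstimate (D : LocalModel E M p) (h : ℝ) {n : ℕ} (x : Fin n → E) (m : Fin n → M)
    (b : Fin p → ℝ) : Prop :=
  ∀ b₀ b₁, (∀ b₀' b₁', (b₀' ≠ b₀ ∨ b₁' ≠ b₁) → D.crit h x m b₀ b₁ < D.crit h x m b₀' b₁') → b = b₀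

variable (D) in
-- Where the Gram matrix is close to its limit it is positive definite, so the minimizer exists and
-- is unique and the estimator must equal it. The convention for other samples never enters.
theorem exists_estimate_bound (hA : D.limA.PosDef) :
    ∃ ε₀ : ℝ, 0 < ε₀ ∧ ∃ C : ℝ, 0 ≤ C ∧ ∀ (n : ℕ) (h : ℝ), 0 < h → h ≤ D.h₀ →
      ∀ (x : Fin n → E) (m : Fin n → M) (b : Fin p → ℝ), D.IsEstimate h x m b →
      D.gramDev n h x m ≤ ε₀ → ∀ a,
      |b a - D.β a D.t - ∑ b, D.limA⁻¹ a b * D.leading h x m (b, 0)|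
        ≤ C * (D.scoreDev n h x m + D.gramDev n h x m
          * (D.scoreDev n h x m + ∑ i, |D.leading h x m i|)) := by
  obtain ⟨ε₀, hε₀, C, hC, h1⟩ := exists_leastSquares_bound hA D.secondMoment_pos
  refine ⟨ε₀, hε₀, C, hC, fun n h hh hh0 x m b hb he a => ?_⟩
  have hs : ∀ i, |D.score h x m i - D.leading h x m i| ≤ D.scoreDev n h x m := fun i =>
    (D.abs_score_sub_le hh hh0 x m i).trans (Finset.single_le_sum
      (f := fun i => D.scoreErr i n h x m)
      (fun i _ => (D.rateBounded_scoreErr i).nonneg n h x m hh) (Finset.mem_univ i))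
  obtain ⟨d, hd, hpos, hbd⟩ := h1 (D.gram h x m) (D.score h x m) (D.leading h x m)
    (D.scoreDev n h x m) (D.gramDev n h x m) (D.abs_gram_sub_blockGram_le hh x m) he hs
    (D.gramDev_nonneg hh x m) (D.rateBounded_scoreDev.nonneg n h x m hh)
  have h2 := hb (fun a => D.β a D.t + d (a, 0)) (fun a => D.β' a + d (a, 1) / h)
    fun b₀' b₁' hne => D.crit_lt hh hd hpos hne
  have h3 : b a - D.β a D.t = d (a, 0) := by rw [h2]; ring
  rw [h3]
  exact hbd a

/-- After multiplication by `√(nh)` the score error vanishes by the rate condition, and the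
remaining term is a vanishing Gram error times a bounded leading score. -/
theorem smallInProb_estimate (hy : iIndepFun y μ)
    (hyP : ∀ i, MeasurePreserving (y i) μ (D.P.prod D.ν)) (hA : D.limA.PosDef)
    (h0 : ∀ᶠ n in atTop, 0 < h n) (hh : Tendsto h atTop (𝓝 0))
    (hnh : Tendsto (fun n : ℕ => n * h n) atTop atTop)
    (hrate : Tendsto (fun n : ℕ => √(n * h n) * rate n (h n)) atTop (𝓝 0))
    {b : ℕ → Ω → Fin p → ℝ}
    (hb : ∀ n, ∀ᵐ ω ∂μ, D.IsEstimate (h n) (paths y n ω) (marks y n ω) (b n ω)) (a : Fin p) :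
    SmallInProb μ fun n ω => √(n * h n) * |b n ω a - D.β a D.t
      - ∑ c, D.limA⁻¹ a c * D.leading (h n) (paths y n ω) (marks y n ω) (c, 0)| := by
  obtain ⟨ε₀, hε₀, C, hC, h1⟩ := D.exists_estimate_bound hA
  have hg := smallInProb_gramDev (D := D) hy hyP h0 hh hnh
  have hs := D.rateBounded_scoreDev.smallInProb hy hyP h0 hh (fun n => Real.sqrt_nonneg _) hrate
  have hl := BoundedInProb.sum Finset.univ fun i _ => boundedInProb_leading (D := D) hy hyP h0 hh i
  have hg' : SmallInProb μ fun n ω => |D.gramDev n (h n) (paths y n ω) (marks y n ω)| := by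
    refine hg.mono ?_
    filter_upwards [h0] with n hn
    exact ae_of_all _ fun ω => (abs_of_nonneg (D.gramDev_nonneg hn _ _)).le
  -- On the event in question the product of the Gram error and the score error is at most `ε₀`
  -- times the score error; hence the factor `1 + ε₀`.
  refine hg.of_le_on (((hs.const_mul (by positivity : 0 ≤ 1 + ε₀)).add
    (hg'.mul_bounded hl fun _ _ => abs_nonneg _)).const_mul hC) hε₀ ?_
  filter_upwards [h0, hh.eventually_le_const D.h₀_pos] with n hn hn'
  filter_upwards [hb n] with ω hω he
  have h2 := h1 n (h n) hn hn' _ _ _ hω he a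
  have hr := D.rateBounded_scoreDev.nonneg n (h n) (paths y n ω) (marks y n ω) hn
  rw [abs_of_nonneg (D.gramDev_nonneg hn _ _)]
  refine (mul_le_mul_of_nonneg_left h2 (Real.sqrt_nonneg _)).trans ?_
  rw [← Finset.mul_sum, mul_left_comm]
  refine mul_le_mul_of_nonneg_left ?_ hC
  have h3 := mul_le_mul_of_nonneg_left (mul_le_mul_of_nonneg_right he hr) (Real.sqrt_nonneg (n * h n))
  nlinarith [h3]

/-- With the scaled rate only bounded, the remainder is bounded instead of small, and so is the
linear part; this suffices for the optimal bandwidth. -/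
theorem boundedInProb_estimate (hy : iIndepFun y μ)
    (hyP : ∀ i, MeasurePreserving (y i) μ (D.P.prod D.ν)) (hA : D.limA.PosDef)
    (h0 : ∀ᶠ n in atTop, 0 < h n) (hh : Tendsto h atTop (𝓝 0))
    (hnh : Tendsto (fun n : ℕ => n * h n) atTop atTop) {C₀ : ℝ}
    (hrate : ∀ᶠ n : ℕ in atTop, √(n * h n) * rate n (h n) ≤ C₀) {b : ℕ → Ω → Fin p → ℝ}
    (hb : ∀ n, ∀ᵐ ω ∂μ, D.IsEstimate (h n) (paths y n ω) (marks y n ω) (b n ω)) (a : Fin p) :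
    BoundedInProb μ fun n ω => √(n * h n) * |b n ω a - D.β a D.t| := by
  obtain ⟨ε₀, hε₀, C, hC, h1⟩ := D.exists_estimate_bound hA
  have hg := smallInProb_gramDev (D := D) hy hyP h0 hh hnh
  have hs := D.rateBounded_scoreDev.boundedInProb hy hyP h0 hh (fun n => Real.sqrt_nonneg _) hrate
  have hl1 := fun i => boundedInProb_leading (D := D) hy hyP h0 hh i
  have hl := BoundedInProb.sum Finset.univ fun i _ => hl1 i
  have hz := BoundedInProb.sum Finset.univ fun c (_ : c ∈ Finset.univ) =>
    (hl1 (c, 0)).const_mul (abs_nonneg (D.limA⁻¹ a c))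
  refine BoundedInProb.of_le_on hg (((hs.const_mul (by positivity : 0 ≤ 1 + ε₀)).add
    (hl.const_mul hε₀.le)).const_mul hC |>.add hz) hε₀ ?_
  filter_upwards [h0, hh.eventually_le_const D.h₀_pos] with n hn hn'
  filter_upwards [hb n] with ω hω he
  have h2 := h1 n (h n) hn hn' _ _ _ hω he a
  have hr := D.rateBounded_scoreDev.nonneg n (h n) (paths y n ω) (marks y n ω) hn
  have hq := Real.sqrt_nonneg (n * h n)
  rw [← Finset.mul_sum]
  have h3 : |∑ c, D.limA⁻¹ a c * D.leading (h n) (paths y n ω) (marks y n ω) (c, 0)|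
      ≤ ∑ c, |D.limA⁻¹ a c| * |D.leading (h n) (paths y n ω) (marks y n ω) (c, 0)| :=
    (Finset.abs_sum_le_sum_abs _ _).trans (Finset.sum_le_sum fun c _ => (abs_mul _ _).le)
  have e3 : ∑ c, |D.limA⁻¹ a c| * (√(n * h n)
      * |D.leading (h n) (paths y n ω) (marks y n ω) (c, 0)|)
      = √(n * h n) * ∑ c, |D.limA⁻¹ a c|
        * |D.leading (h n) (paths y n ω) (marks y n ω) (c, 0)| := by
    rw [Finset.mul_sum]
    exact Finset.sum_congr rfl fun c _ => by ring
  rw [e3]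
  have h4 := abs_sub_abs_le_abs_sub (b n ω a - D.β a D.t)
    (∑ c, D.limA⁻¹ a c * D.leading (h n) (paths y n ω) (marks y n ω) (c, 0))
  have h5 : D.gramDev n (h n) (paths y n ω) (marks y n ω)
      * (D.scoreDev n (h n) (paths y n ω) (marks y n ω)
        + ∑ i, |D.leading (h n) (paths y n ω) (marks y n ω) i|)
      ≤ ε₀ * (D.scoreDev n (h n) (paths y n ω) (marks y n ω)
        + ∑ i, |D.leading (h n) (paths y n ω) (marks y n ω) i|) :=
    mul_le_mul_of_nonneg_right he (add_nonneg hr (Finset.sum_nonneg fun _ _ => abs_nonneg _))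
  have h6 := mul_le_mul_of_nonneg_left h5 hC
  calc _ ≤ √(n * h n) * (C * (D.scoreDev n (h n) (paths y n ω) (marks y n ω)
        + ε₀ * (D.scoreDev n (h n) (paths y n ω) (marks y n ω)
        + ∑ i, |D.leading (h n) (paths y n ω) (marks y n ω) i|))
        + ∑ c, |D.limA⁻¹ a c| * |D.leading (h n) (paths y n ω) (marks y n ω) (c, 0)|) :=
      mul_le_mul_of_nonneg_left (by linarith) hq
    _ = _ := by ring

end LocalModel

theorem EuclideanSpace.norm_le_sum_abs {p : ℕ} (v : EuclideanSpace ℝ (Fin p)) :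
    ‖v‖ ≤ ∑ a, |v a| := by
  rw [EuclideanSpace.norm_eq]
  refine (Real.sqrt_le_left (Finset.sum_nonneg fun _ _ => abs_nonneg _)).2 ?_
  exact Finset.sum_sq_le_sq_sum_of_nonneg fun _ _ => abs_nonneg _

theorem SmallInProb.tendstoInMeasure {Ω : Type*} [MeasurableSpace Ω] {μ : Measure Ω} {p : ℕ}
    {V : ℕ → Ω → EuclideanSpace ℝ (Fin p)}
    (hV : ∀ a, SmallInProb μ fun n ω => |V n ω a|) : TendstoInMeasure μ V atTop 0 := by
  have h1 := SmallInProb.sum Finset.univ fun a _ => hV a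
  rw [tendstoInMeasure_iff_norm]
  intro ε hε
  refine tendsto_of_tendsto_of_tendsto_of_le_of_le tendsto_const_nhds (h1 (ε / 2) (by positivity))
    (fun _ => zero_le) fun n => measure_mono fun ω hω => ?_
  simp only [Pi.zero_apply, sub_zero, mem_ofPred_eq] at hω ⊢
  have h2 : ‖V n ω‖ ≤ ∑ a, |V n ω a| := EuclideanSpace.norm_le_sum_abs _
  linarith

/-! ### Asymptotic normality in the local model -/

namespace LocalModel

variable {E M Ω : Type*} [MeasurableSpace E] [MeasurableSpace M] [MeasurableSpace Ω] {p : ℕ}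
  {D : LocalModel E M p} {μ : Measure Ω} [IsProbabilityMeasure μ] {y : ℕ → Ω → E × M}
  {h : ℕ → ℝ}

variable (D) in
/-- Limiting covariance matrix of the score. -/
noncomputable def limSigma : Matrix (Fin p) (Fin p) ℝ :=
  Matrix.of fun a b => (∫ z, D.K z ^ 2) * D.lam D.t *
    ∫ x, D.X a D.t x * D.resid D.t x * (D.X b D.t x * D.resid D.t x) ∂D.P

variable (D) in
theorem dotProduct_limSigma (u : Fin p → ℝ) :
    dotProduct u (D.limSigma.mulVec u) = (∫ z, D.K z ^ 2) * (D.lam D.t * ∑ a, ∑ b, u a * u b *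
        ∫ x, D.X a D.t x * D.resid D.t x * (D.X b D.t x * D.resid D.t x) ∂D.P) := by
  simp only [dotProduct, Matrix.mulVec, limSigma, Matrix.of_apply, Finset.mul_sum]
  exact Finset.sum_congr rfl fun a _ => Finset.sum_congr rfl fun b _ => by ring

variable (D) in
theorem posSemidef_limSigma : D.limSigma.PosSemidef := by
  refine Matrix.PosSemidef.of_dotProduct_mulVec_nonneg ?_ fun u => ?_
  · ext a b
    simp only [limSigma, Matrix.conjTranspose_apply, Matrix.of_apply, star_trivial]
    congr 2; funext x; ring
  · rw [star_trivial, dotProduct_limSigma, ← integral_sum_score_sq]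
    exact mul_nonneg (integral_nonneg fun _ => sq_nonneg _)
      (mul_nonneg (D.process.lam_nonneg _) (integral_nonneg fun _ => sq_nonneg _))

variable (D) in
/-- The linear statistic that approximates the normalized estimation error. -/
noncomputable def linearPart (y : ℕ → Ω → E × M) (h : ℕ → ℝ) (n : ℕ) (ω : Ω) :
    EuclideanSpace ℝ (Fin p) :=
  WithLp.toLp 2 fun a => √(n * h n) *
    ∑ c, D.limA⁻¹ a c * D.leading (h n) (paths y n ω) (marks y n ω) (c, 0)

theorem measurable_linearPart (hyP : ∀ i, MeasurePreserving (y i) μ (D.P.prod D.ν)) (n : ℕ) :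
    Measurable (D.linearPart y h n) := by
  refine (PiLp.continuous_toLp 2 _).measurable.comp (measurable_pi_lambda _ fun a =>
    (Finset.measurable_fun_sum _ fun c _ => Measurable.const_mul ?_ _).const_mul _)
  have h1 : Measurable fun z : (Fin n → E) × (Fin n → M) => D.leading (h n) z.1 z.2 (c, 0) :=
    measurable_linAvg (D.measurable_weight (h n) _) (D.score_centered c).measurable
  exact h1.comp (LocalModel.measurable_sample hyP n)

/-- By Lévy's continuity theorem it is enough to test against each `u`. As `A⁻¹` is symmetric, this
means testing the leading score against `A⁻¹ u`, where its characteristic function is known. -/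
theorem tendstoInDistribution_linearPart (hy : iIndepFun y μ)
    (hyP : ∀ i, MeasurePreserving (y i) μ (D.P.prod D.ν)) (hA : D.limA.PosDef)
    (h0 : ∀ᶠ n in atTop, 0 < h n) (hh : Tendsto h atTop (𝓝 0))
    (hnh : Tendsto (fun n : ℕ => n * h n) atTop atTop) :
    TendstoInDistribution (D.linearPart y h) atTop id (fun _ => μ)
      (multivariateGaussian 0 (D.limA⁻¹ * D.limSigma * D.limA⁻¹)) := by
  have hm : ∀ n, Measurable (D.linearPart y h n) := measurable_linearPart hyP
  refine ⟨fun n => (hm n).aemeasurable, aemeasurable_id, ?_⟩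
  refine ProbabilityMeasure.tendsto_iff_tendsto_charFun.2 fun u => ?_
  have hAi : (D.limA⁻¹).transpose = D.limA⁻¹ := by
    have := hA.1.inv
    rwa [Matrix.IsHermitian, Matrix.conjTranspose_eq_transpose_of_trivial] at this
  have hps : (D.limA⁻¹ * D.limSigma * D.limA⁻¹).PosSemidef := by
    have := D.posSemidef_limSigma.mul_mul_conjTranspose_same D.limA⁻¹
    rwa [hA.1.inv.eq] at this
  have h1 := tendsto_charFun_leading (D := D) hy hyP h0 hh hnh (fun c => ∑ a, u a * D.limA⁻¹ a c)
  have e1 : ∀ n : ℕ, charFun (μ.map (D.linearPart y h n)) u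
      = ∫ ω, Complex.exp (Complex.I * (√(n * h n) * ∑ c, (∑ a, u a * D.limA⁻¹ a c)
        * D.leading (h n) (paths y n ω) (marks y n ω) (c, 0) : ℝ)) ∂μ := by
    intro n
    rw [charFun_apply, integral_map (hm n).aemeasurable (by fun_prop)]
    congr 1; funext ω
    rw [mul_comm]
    congr 3
    rw [real_inner_comm]
    simp only [PiLp.inner_apply, linearPart, conj_trivial, RCLike.inner_apply]
    simp_rw [Finset.mul_sum, Finset.sum_mul]
    rw [Finset.sum_comm]
    simp_rw [Finset.mul_sum]
    exact Finset.sum_congr rfl fun c _ => Finset.sum_congr rfl fun a _ => by ring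
  have e2 : charFun ((multivariateGaussian 0 (D.limA⁻¹ * D.limSigma * D.limA⁻¹)).map id) u
      = Complex.exp (-((∫ z, D.K z ^ 2) * (D.lam D.t * ∑ a, ∑ b,
        (∑ d, u d * D.limA⁻¹ d a) * (∑ d, u d * D.limA⁻¹ d b) *
        ∫ x, D.X a D.t x * D.resid D.t x * (D.X b D.t x * D.resid D.t x) ∂D.P) / 2 : ℝ)) := by
    rw [Measure.map_id, charFun_multivariateGaussian hps, inner_zero_right,
      ← D.dotProduct_limSigma fun c => ∑ a, u a * D.limA⁻¹ a c]
    have e3 : (fun c => ∑ a, u a * D.limA⁻¹ a c) = Matrix.vecMul u.ofLp D.limA⁻¹ := rfl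
    have e4 : Matrix.vecMul u.ofLp D.limA⁻¹ = D.limA⁻¹.mulVec u.ofLp := by
      rw [← Matrix.mulVec_transpose, hAi]
    have e5 : dotProduct u.ofLp ((D.limA⁻¹ * D.limSigma * D.limA⁻¹).mulVec u.ofLp)
        = dotProduct (Matrix.vecMul u.ofLp D.limA⁻¹)
          (D.limSigma.mulVec (Matrix.vecMul u.ofLp D.limA⁻¹)) := by
      rw [← Matrix.dotProduct_mulVec, e4, Matrix.mulVec_mulVec, Matrix.mulVec_mulVec,
        Matrix.mul_assoc]
    rw [e3, ← e5]
    push_cast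
    congr 1
    simp
  have h2 : Tendsto (fun n => charFun (μ.map (D.linearPart y h n)) u) atTop
      (𝓝 (charFun ((multivariateGaussian 0 (D.limA⁻¹ * D.limSigma * D.limA⁻¹)).map id) u)) := by
    rw [e2]
    simp_rw [e1]
    exact h1
  exact h2

/-- Asymptotic normality of the local linear estimator. -/
theorem tendstoInDistribution_estimate (hy : iIndepFun y μ)
    (hyP : ∀ i, MeasurePreserving (y i) μ (D.P.prod D.ν)) (hA : D.limA.PosDef)
    (h0 : ∀ᶠ n in atTop, 0 < h n) (hh : Tendsto h atTop (𝓝 0))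
    (hnh : Tendsto (fun n : ℕ => n * h n) atTop atTop)
    (hrate : Tendsto (fun n : ℕ => √(n * h n) * rate n (h n)) atTop (𝓝 0))
    {b : ℕ → Ω → EuclideanSpace ℝ (Fin p)} (hbm : ∀ n, AEMeasurable (b n) μ)
    (hb : ∀ n, ∀ᵐ ω ∂μ, D.IsEstimate (h n) (paths y n ω) (marks y n ω) (b n ω))
    {β₀ : EuclideanSpace ℝ (Fin p)} (hβ : ∀ a, β₀ a = D.β a D.t) :
    TendstoInDistribution (fun n ω => √(n * h n) • (b n ω - β₀)) atTop id (fun _ => μ)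
      (multivariateGaussian 0 (D.limA⁻¹ * D.limSigma * D.limA⁻¹)) := by
  -- Slutsky: the estimator differs from its linear part by a term that vanishes in probability.
  refine tendstoInDistribution_of_tendstoInMeasure_sub _ _
    (tendstoInDistribution_linearPart hy hyP hA h0 hh hnh) ?_
    fun n => by have := hbm n; fun_prop
  refine SmallInProb.tendstoInMeasure fun a => ?_
  refine (smallInProb_estimate hy hyP hA h0 hh hnh hrate
    (b := fun n ω => (b n ω).ofLp) hb a).mono (Eventually.of_forall fun n => ae_of_all _ fun ω =>
      le_of_eq ?_)
  simp only [Pi.sub_apply, PiLp.sub_apply, PiLp.smul_apply, smul_eq_mul, hβ, linearPart]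
  rw [← mul_sub, abs_mul, abs_of_nonneg (Real.sqrt_nonneg _)]

theorem boundedInProb_norm_estimate (hy : iIndepFun y μ)
    (hyP : ∀ i, MeasurePreserving (y i) μ (D.P.prod D.ν)) (hA : D.limA.PosDef)
    (h0 : ∀ᶠ n in atTop, 0 < h n) (hh : Tendsto h atTop (𝓝 0))
    (hnh : Tendsto (fun n : ℕ => n * h n) atTop atTop) {C₀ : ℝ}
    (hrate : ∀ᶠ n : ℕ in atTop, √(n * h n) * rate n (h n) ≤ C₀)
    {b : ℕ → Ω → EuclideanSpace ℝ (Fin p)}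
    (hb : ∀ n, ∀ᵐ ω ∂μ, D.IsEstimate (h n) (paths y n ω) (marks y n ω) (b n ω))
    {β₀ : EuclideanSpace ℝ (Fin p)} (hβ : ∀ a, β₀ a = D.β a D.t) :
    BoundedInProb μ fun n ω => √(n * h n) * ‖b n ω - β₀‖ := by
  have h1 := BoundedInProb.sum Finset.univ fun a _ => boundedInProb_estimate hy hyP hA h0 hh hnh
    hrate (b := fun n ω => (b n ω).ofLp) hb a
  refine h1.mono (Eventually.of_forall fun n => ae_of_all _ fun ω => ?_)
  rw [← Finset.mul_sum]
  refine mul_le_mul_of_nonneg_left ?_ (Real.sqrt_nonneg _)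
  simpa [hβ] using EuclideanSpace.norm_le_sum_abs (b n ω - β₀)

end LocalModel

/-! ### Extension from the unit interval to the line by clamping time -/

section UnitInterval

/-- The nearest point of `[0, 1]`. -/
noncomputable def clamp (s : ℝ) : ℝ := max 0 (min s 1)

theorem clamp_mem (s : ℝ) : clamp s ∈ Icc (0 : ℝ) 1 :=
  ⟨le_max_left _ _, max_le zero_le_one (min_le_right _ _)⟩

theorem clamp_of_mem {s : ℝ} (hs : s ∈ Icc (0 : ℝ) 1) : clamp s = s := by
  rw [clamp, min_eq_left hs.2, max_eq_right hs.1]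

theorem continuous_clamp : Continuous clamp := by unfold clamp; fun_prop

theorem abs_clamp_sub_le (u s : ℝ) : |clamp u - clamp s| ≤ |u - s| := by
  have h1 : |max 0 (min u 1) - max 0 (min s 1)| ≤ |min u 1 - min s 1| := by
    simpa using abs_max_sub_max_le_max (0 : ℝ) (min u 1) 0 (min s 1)
  have h2 : |min u 1 - min s 1| ≤ |u - s| := by
    simpa using abs_min_sub_min_le_max u 1 s 1
  exact h1.trans h2

theorem _root_.ContinuousOn.comp_clamp {F : Type*} [TopologicalSpace F] {f : ℝ → F}
    (hf : ContinuousOn f (Icc 0 1)) : Continuous fun s => f (clamp s) :=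
  hf.comp_continuous continuous_clamp clamp_mem

theorem exists_abs_le_on_unitInterval {f : ℝ → ℝ} (hf : ContinuousOn f (Icc 0 1)) :
    ∃ B : ℝ, 0 ≤ B ∧ ∀ s ∈ Icc (0 : ℝ) 1, |f s| ≤ B := by
  obtain ⟨B, hB⟩ := isCompact_Icc.exists_bound_of_continuousOn hf
  exact ⟨|B|, abs_nonneg _, fun s hs => (hB s hs).trans (le_abs_self _)⟩

theorem exists_lipschitz_on_unitInterval {f : ℝ → ℝ} (hf : ContDiffOn ℝ 1 f (Icc 0 1)) :
    ∃ ℓ : ℝ, 0 ≤ ℓ ∧ ∀ u ∈ Icc (0 : ℝ) 1, ∀ s ∈ Icc (0 : ℝ) 1, |f u - f s| ≤ ℓ * |u - s| := by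
  have hu : UniqueDiffOn ℝ (Icc (0 : ℝ) 1) := uniqueDiffOn_Icc zero_lt_one
  obtain ⟨ℓ, hℓ, h1⟩ := exists_abs_le_on_unitInterval
    (hf.continuousOn_derivWithin hu le_rfl)
  refine ⟨ℓ, hℓ, fun u hu' s hs => ?_⟩
  exact (convex_Icc (0 : ℝ) 1).norm_image_sub_le_of_norm_derivWithin_le
    (hf.differentiableOn one_ne_zero) (fun x hx => h1 x hx) hs hu'

/-- The mean value inequality is applied to `f` minus its tangent slope, whose derivative is at most
`L |s - t|` between `t` and `s` because `f'` is Lipschitz. -/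
theorem exists_taylor_on_unitInterval {f : ℝ → ℝ} (hf : ContDiffOn ℝ 2 f (Icc 0 1)) {t : ℝ}
    (ht : t ∈ Icc (0 : ℝ) 1) :
    ∃ f' L : ℝ, 0 ≤ L ∧ ∀ s ∈ Icc (0 : ℝ) 1, |f s - f t - f' * (s - t)| ≤ L * (s - t) ^ 2 := by
  have hu : UniqueDiffOn ℝ (Icc (0 : ℝ) 1) := uniqueDiffOn_Icc zero_lt_one
  obtain ⟨L, hL, h1⟩ := exists_lipschitz_on_unitInterval
    (hf.derivWithin hu (m := 1) (by norm_num))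
  refine ⟨derivWithin f (Icc 0 1) t, L, hL, fun s hs => ?_⟩
  have hsub : uIcc t s ⊆ Icc (0 : ℝ) 1 := ordConnected_Icc.uIcc_subset ht hs
  have h2 := (convex_uIcc t s).norm_image_sub_le_of_norm_hasDerivWithin_le
    (f := fun v => f v - derivWithin f (Icc 0 1) t * v)
    (f' := fun v => derivWithin f (Icc 0 1) v - derivWithin f (Icc 0 1) t) (C := L * |s - t|)
    (fun v hv => by
      have h3 := ((hf.differentiableOn two_ne_zero v (hsub hv)).hasDerivWithinAt).mono hsub
      have h4 := (hasDerivWithinAt_id v (uIcc t s)).const_mul (derivWithin f (Icc 0 1) t)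
      rw [mul_one] at h4
      exact h3.sub h4)
    (fun v hv => (h1 v (hsub hv) t ht).trans
      (mul_le_mul_of_nonneg_left (abs_sub_left_of_mem_uIcc hv) hL))
    left_mem_uIcc right_mem_uIcc
  rw [Real.norm_eq_abs, Real.norm_eq_abs, mul_assoc, ← sq, sq_abs] at h2
  refine le_trans (le_of_eq ?_) h2
  congr 1; ring

theorem isSmoothMean_comp_clamp {f : ℝ → ℝ} {ℓ B : ℝ}
    (hf : ContinuousOn f (Icc 0 1)) (hB : ∀ s ∈ Icc (0 : ℝ) 1, |f s| ≤ B)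
    (hℓ0 : 0 ≤ ℓ) (hℓ : ∀ u ∈ Icc (0 : ℝ) 1, ∀ s ∈ Icc (0 : ℝ) 1, |f u - f s| ≤ ℓ * |u - s|) :
    IsSmoothMean (fun s => f (clamp s)) ℓ B :=
  ⟨hf.comp_clamp.measurable, fun s => hB _ (clamp_mem s), fun u s =>
    (hℓ _ (clamp_mem u) _ (clamp_mem s)).trans
      (mul_le_mul_of_nonneg_left (abs_clamp_sub_le u s) hℓ0)⟩

/-- Any two constants above `A` are admissible, so that finitely many functions can share the same
pair. -/
theorem exists_isSmoothMean {f : ℝ → ℝ} (hf : ContDiffOn ℝ 2 f (Icc 0 1)) :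
    ∃ A : ℝ, 0 ≤ A ∧ ∀ ℓ B, A ≤ ℓ → A ≤ B → IsSmoothMean (fun s => f (clamp s)) ℓ B := by
  obtain ⟨ℓ, hℓ0, hℓ⟩ := exists_lipschitz_on_unitInterval (hf.of_le one_le_two)
  obtain ⟨B, hB0, hB⟩ := exists_abs_le_on_unitInterval hf.continuousOn
  refine ⟨ℓ + B, by positivity, fun ℓ' B' h1 h2 => isSmoothMean_comp_clamp hf.continuousOn
    (fun s hs => (hB s hs).trans (by linarith)) (by linarith) fun u hu s hs =>
    (hℓ u hu s hs).trans (mul_le_mul_of_nonneg_right (by linarith) (abs_nonneg _))⟩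

end UnitInterval

/-! ### Centered processes under image measures -/

section Transfer

theorem IsCentered.map {S E : Type*} [MeasurableSpace S] [MeasurableSpace E] {P : Measure S}
    {π : S → E} (hπ : Measurable π) {W : ℝ → E → ℝ} {C : ℝ}
    (hW : Measurable fun z : ℝ × E => W z.1 z.2) (hL : ∀ s, MemLp (fun ω => W s (π ω)) 2 P)
    (h0 : ∀ s, ∫ ω, W s (π ω) ∂P = 0) (hC : ∀ s, ∫ ω, W s (π ω) ^ 2 ∂P ≤ C) :
    IsCentered (P.map π) W C := by
  have hs : ∀ s, Measurable (W s) := fun s => hW.comp measurable_prodMk_left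
  refine ⟨hW, fun s => ?_, fun s => ?_, fun s => ?_⟩
  · rw [memLp_map_measure_iff (hs s).aestronglyMeasurable hπ.aemeasurable]
    exact hL s
  · rw [integral_map hπ.aemeasurable (hs s).aestronglyMeasurable, h0]
  · rw [integral_map hπ.aemeasurable ((hs s).pow_const 2).aestronglyMeasurable]
    exact hC s

end Transfer

/-! ### Pairs of distinct observation times -/

namespace Subject

variable {S : Type*} {p q : ℕ} [MeasurableSpace S] {D : Subject S p q} {P : Measure S}

/-- Campbell's formula for the ordered pairs of distinct observation times, as an inequality. -/
theorem lintegral_pair_le (hL : Measurable D.L) (hT : ∀ j, Measurable (D.T j)) {c : NNReal}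
    (hc : ∀ B : Set (ℝ × ℝ), MeasurableSet B → ∫⁻ ω, D.pairCount ω B ∂P ≤ c * volume B)
    {f : ℝ × ℝ → ENNReal} (hf : Measurable f) :
    ∫⁻ ω, ∑ j ∈ Finset.range (D.L ω), ∑ k ∈ (Finset.range (D.L ω)).erase j,
      f (D.T j ω, D.T k ω) ∂P ≤ c * ∫⁻ z, f z := by
  classical
  let A : ℕ × ℕ → Set S := fun i => {ω | i.1 < D.L ω ∧ i.2 < D.L ω ∧ i.2 ≠ i.1}
  have hA : ∀ i, MeasurableSet (A i) := fun i =>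
    (measurableSet_lt measurable_const hL).inter
      ((measurableSet_lt measurable_const hL).inter (MeasurableSet.const _))
  -- The random index range becomes a countable sum over all index pairs. The resulting measure is
  -- at most `c` times Lebesgue measure on sets, hence also on nonnegative functions.
  let ρ : Measure (ℝ × ℝ) :=
    Measure.sum fun i : ℕ × ℕ => (P.restrict (A i)).map fun ω => (D.T i.1 ω, D.T i.2 ω)
  have hTT : ∀ i : ℕ × ℕ, Measurable fun ω => (D.T i.1 ω, D.T i.2 ω) := fun i =>
    (hT i.1).prodMk (hT i.2)
  have key : ∀ g : ℝ × ℝ → ENNReal, Measurable g →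
      ∫⁻ ω, ∑ j ∈ Finset.range (D.L ω), ∑ k ∈ (Finset.range (D.L ω)).erase j,
        g (D.T j ω, D.T k ω) ∂P = ∫⁻ z, g z ∂ρ := by
    intro g hg
    have e1 : ∀ ω, ∑ j ∈ Finset.range (D.L ω), ∑ k ∈ (Finset.range (D.L ω)).erase j,
        g (D.T j ω, D.T k ω)
        = ∑' i : ℕ × ℕ, (A i).indicator (fun ω => g (D.T i.1 ω, D.T i.2 ω)) ω := fun ω => by
      rw [ENNReal.tsum_prod', tsum_eq_sum (s := Finset.range (D.L ω))]
      · refine Finset.sum_congr rfl fun j hj => ?_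
        rw [tsum_eq_sum (s := (Finset.range (D.L ω)).erase j)]
        · refine Finset.sum_congr rfl fun k hk => ?_
          rw [Finset.mem_erase, Finset.mem_range] at hk
          rw [indicator_of_mem]
          exact ⟨Finset.mem_range.1 hj, hk.2, hk.1⟩
        · intro k hk
          refine indicator_of_notMem (fun h => hk ?_) _
          exact Finset.mem_erase.2 ⟨h.2.2, Finset.mem_range.2 h.2.1⟩
      · intro j hj
        rw [ENNReal.tsum_eq_zero]
        exact fun k => indicator_of_notMem (fun h => hj (Finset.mem_range.2 h.1)) _
    simp_rw [e1]
    have hm : ∀ i : ℕ × ℕ, Measurable fun ω => g (D.T i.1 ω, D.T i.2 ω) := fun i =>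
      hg.comp (hTT i)
    rw [lintegral_tsum fun i => ((hm i).indicator (hA i)).aemeasurable, lintegral_sum_measure]
    refine tsum_congr fun i => ?_
    rw [lintegral_indicator (hA i), lintegral_map hg (hTT i)]
  have hρ : ρ ≤ c • volume := by
    refine Measure.le_iff.2 fun B hB => ?_
    have h1 := key (B.indicator 1) (measurable_one.indicator hB)
    rw [lintegral_indicator_one hB] at h1
    rw [← h1]
    exact hc B hB
  rw [key f hf]
  refine (lintegral_mono' hρ le_rfl).trans (le_of_eq ?_)
  rw [lintegral_smul_measure]
  rfl

end Subject

/-! ### The observation process as a point process -/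

namespace Subject

section Observation

variable {S M : Type*} {p q : ℕ} [MeasurableSpace S] [MeasurableSpace M] {D : Subject S p q}
  {P : Measure S} {lam : ℝ → ℝ}

/-- The intensity, extended by zero outside of `[0, 1]`. -/
noncomputable def extIntensity (lam : ℝ → ℝ) : ℝ → ℝ := (Icc 0 1).indicator fun s => lam (clamp s)

theorem extIntensity_of_mem {s : ℝ} (hs : s ∈ Icc (0 : ℝ) 1) : extIntensity lam s = lam s := by
  rw [extIntensity, indicator_of_mem hs, clamp_of_mem hs]

theorem isPointMeasure_N (ω : S) : IsPointMeasure (D.N ω) := ⟨D.L ω, fun j => D.T j ω, rfl⟩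

theorem lintegral_N (ω : S) (f : ℝ → ENNReal) (hf : Measurable f) :
    ∫⁻ s, f s ∂(D.N ω) = ∑ j ∈ Finset.range (D.L ω), f (D.T j ω) := by
  rw [N, lintegral_finsetSum_measure]
  exact Finset.sum_congr rfl fun j _ => lintegral_dirac' _ hf

theorem intN_eq_integral (ω : S) (f : ℝ → ℝ) : D.intN ω f = ∫ s, f s ∂(D.N ω) := by
  rw [N, integral_range_dirac]; rfl

theorem isPointProcess (hL : Measurable D.L) (hT : ∀ j, Measurable (D.T j))
    (hobs : D.ObservationCond P lam) {τ : S → M} (hτ : Measurable τ) {N : Kernel M ℝ}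
    (hpt : ∀ m, IsPointMeasure (N m)) (hN : ∀ ω, N (τ ω) = D.N ω)
    (hl0 : ∀ s ∈ Icc (0 : ℝ) 1, 0 ≤ lam s) {Λ : ℝ} (hΛ : ∀ s ∈ Icc (0 : ℝ) 1, lam s ≤ Λ) :
    ∃ c, IsPointProcess N (P.map τ) (extIntensity lam) Λ c := by
  have hsf : IsSFiniteKernel N := isSFiniteKernel_of_point hpt
  have hlm : Measurable (extIntensity lam) :=
    hobs.contDiff_lam.continuousOn.comp_clamp.measurable.indicator measurableSet_Icc
  have hint : ∀ B, MeasurableSet B →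
      ∫⁻ m, N m B ∂(P.map τ) = ∫⁻ s in B, ENNReal.ofReal (extIntensity lam s) := by
    intro B hB
    rw [lintegral_map (N.measurable_coe hB) hτ]
    simp_rw [hN]
    rw [hobs.intensity B hB, inter_comm, ← Measure.restrict_restrict measurableSet_Icc,
      ← lintegral_indicator measurableSet_Icc]
    congr 1; funext s
    by_cases hs : s ∈ Icc (0 : ℝ) 1
    · rw [indicator_of_mem hs, extIntensity_of_mem hs]
    · rw [indicator_of_notMem hs, extIntensity, indicator_of_notMem hs, ENNReal.ofReal_zero]
  obtain ⟨c, hc⟩ := hobs.pair_intensity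
  refine ⟨c, hpt, hlm, fun s => ?_, fun s => ?_, c.2, hint, fun f hf => ?_⟩
  · exact indicator_nonneg (fun s hs => hl0 _ (clamp_mem s)) s
  · exact indicator_le_self' (fun x _ => hl0 _ (clamp_mem x)) s |>.trans (hΛ _ (clamp_mem s))
  · have hf2 : ∀ s, Measurable (f s) := fun s => hf.comp measurable_prodMk_left
    have hfd : Measurable fun s => f s s := hf.comp (measurable_id.prodMk measurable_id)
    have hdd : Measurable fun m => ∫⁻ s, f s s ∂(N m) :=
      Measurable.lintegral_kernel_prod_right (hfd.comp measurable_snd)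
    have hin : Measurable fun z : M × ℝ => ∫⁻ u, f z.2 u ∂(N z.1) :=
      measurable_lintegral_kernel N (f := fun z : M × ℝ => f z.2)
        (hf.comp ((measurable_snd.comp measurable_fst).prodMk measurable_snd)) measurable_fst
    have hout : Measurable fun m => ∫⁻ s, ∫⁻ u, f s u ∂(N m) ∂(N m) :=
      Measurable.lintegral_kernel_prod_right hin
    rw [← lintegral_lintegral_of_intensity hlm hint hfd, lintegral_map hout hτ,
      lintegral_map hdd hτ]
    simp_rw [hN]
    -- The double sum is divided by index, not by location, so coinciding observation times are
    -- counted among the distinct pairs.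
    have e1 : ∀ ω, ∫⁻ s, ∫⁻ u, f s u ∂(D.N ω) ∂(D.N ω)
        = ∫⁻ s, f s s ∂(D.N ω) + ∑ j ∈ Finset.range (D.L ω),
          ∑ k ∈ (Finset.range (D.L ω)).erase j, Function.uncurry f (D.T j ω, D.T k ω) := by
      intro ω
      have hm1 : Measurable fun s => ∫⁻ u, f s u ∂(D.N ω) := by
        simp_rw [fun s => lintegral_N (D := D) ω (f s) (hf2 s)]
        exact Finset.measurable_fun_sum _ fun j _ => hf.comp (measurable_id.prodMk measurable_const)
      rw [lintegral_N ω _ hm1, lintegral_N ω _ hfd, ← Finset.sum_add_distrib]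
      refine Finset.sum_congr rfl fun j hj => ?_
      rw [lintegral_N ω _ (hf2 _), ← Finset.add_sum_erase _ _ hj]
      rfl
    simp_rw [e1]
    have hdd' : Measurable fun ω => ∫⁻ s, f s s ∂(D.N ω) := by
      have := hdd.comp hτ
      simpa only [Function.comp_def, hN] using this
    rw [lintegral_add_left hdd']
    refine add_le_add le_rfl ?_
    refine (lintegral_pair_le hL hT hc hf).trans (le_of_eq ?_)
    rw [ENNReal.ofReal_coe_nnreal, Measure.volume_eq_prod, lintegral_prod _ hf.aemeasurable]
    rfl

/-- The expected number of points outside `[0, 1]` is zero. Outside a null set, time can therefore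
be clamped without changing any sample statistic. -/
theorem ae_T_mem (hobs : D.ObservationCond P lam) {τ : S → M} (hτ : Measurable τ) {N : Kernel M ℝ}
    (hN : ∀ ω, N (τ ω) = D.N ω) :
    ∀ᵐ ω ∂P, ∀ j < D.L ω, D.T j ω ∈ Icc (0 : ℝ) 1 := by
  have hB : MeasurableSet (Icc (0 : ℝ) 1)ᶜ := measurableSet_Icc.compl
  have h1 := hobs.intensity _ hB
  rw [compl_inter_self, Measure.restrict_empty, lintegral_zero_measure,
    lintegral_eq_zero_iff (by
      have := (N.measurable_coe hB).comp hτ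
      simpa only [Function.comp_def, hN] using this)] at h1
  filter_upwards [h1] with ω hω j hj
  by_contra hc
  rw [Subject.N, Measure.finsetSum_apply, Pi.zero_apply, Finset.sum_eq_zero_iff] at hω
  have h2 := hω j (Finset.mem_range.2 hj)
  rw [Measure.dirac_apply' _ hB, indicator_of_mem hc] at h2
  exact one_ne_zero h2

end Observation

/-! ### The centered regression model -/

section Model

variable {S : Type*} {p q : ℕ} [mS : MeasurableSpace S] {D : Subject S p q}
  {P : Measure S} [IsProbabilityMeasure P] {β : ℝ → EuclideanSpace ℝ (Fin p)}
  {γ : ℝ → EuclideanSpace ℝ (Fin q)} {s : ℝ}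

/-- Regression error of the centered model. -/
noncomputable def err (D : Subject S p q) (P : Measure S) (β : ℝ → EuclideanSpace ℝ (Fin p))
    (s : ℝ) (ω : S) : ℝ :=
  D.Yc P s ω - inner ℝ (D.Xc P s ω) (β s)

/-- Translation is a measurable equivalence, so conditioning on `X̃(s)` and on `X(s)` is the same.
-/
theorem comap_Xc (s : ℝ) :
    MeasurableSpace.comap (D.Xc P s) inferInstance = MeasurableSpace.comap (D.X s) inferInstance := by
  have e1 : D.Xc P s = (fun v => v - D.meanX P s) ∘ D.X s := rfl
  rw [e1, ← MeasurableSpace.comap_comp]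
  congr 1
  exact (MeasurableEquiv.subRight (D.meanX P s)).measurableEmbedding.comap_eq

theorem Regular.measurable_Xs (hreg : D.Regular P) (s : ℝ) : Measurable (D.X s) :=
  hreg.measurable_X.comp measurable_prodMk_left

theorem Regular.measurable_Xc (hreg : D.Regular P) (s : ℝ) : Measurable (D.Xc P s) :=
  (hreg.measurable_Xs s).sub_const _

theorem Regular.memLp_Xc (hreg : D.Regular P) (hs : s ∈ Icc (0 : ℝ) 1) : MemLp (D.Xc P s) 2 P :=
  (hreg.memLp_X s hs).sub (memLp_const _)

theorem Regular.memLp_Yc (hreg : D.Regular P) (hs : s ∈ Icc (0 : ℝ) 1) : MemLp (D.Yc P s) 2 P :=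
  (hreg.memLp_Y s hs).sub (memLp_const _)

theorem Regular.memLp_Xc_apply (hreg : D.Regular P) (hs : s ∈ Icc (0 : ℝ) 1) (a : Fin p) :
    MemLp (fun ω => D.Xc P s ω a) 2 P :=
  (EuclideanSpace.proj (𝕜 := ℝ) a).comp_memLp' (hreg.memLp_Xc hs)

theorem Regular.memLp_inner (hreg : D.Regular P) (hs : s ∈ Icc (0 : ℝ) 1)
    (v : EuclideanSpace ℝ (Fin p)) : MemLp (fun ω => inner ℝ (D.Xc P s ω) v) 2 P := by
  have := (innerSL ℝ v).comp_memLp' (hreg.memLp_Xc hs)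
  simpa only [Function.comp_def, innerSL_apply_apply, real_inner_comm] using this

theorem Regular.memLp_err (hreg : D.Regular P) (hs : s ∈ Icc (0 : ℝ) 1) :
    MemLp (D.err P β s) 2 P :=
  (hreg.memLp_Yc hs).sub (hreg.memLp_inner hs (β s))

theorem Regular.integral_Xc (hreg : D.Regular P) (hs : s ∈ Icc (0 : ℝ) 1) :
    ∫ ω, D.Xc P s ω ∂P = 0 := by
  have hX := (hreg.memLp_X s hs).integrable one_le_two
  simp only [Xc]
  rw [integral_sub hX (integrable_const _)]
  simp [meanX]

theorem Regular.integral_Xc_apply (hreg : D.Regular P) (hs : s ∈ Icc (0 : ℝ) 1) (a : Fin p) :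
    ∫ ω, D.Xc P s ω a ∂P = 0 := by
  have h1 := (EuclideanSpace.proj (𝕜 := ℝ) a).integral_comp_comm
    ((hreg.memLp_Xc hs).integrable one_le_two)
  rw [hreg.integral_Xc hs] at h1
  simpa using h1

theorem Regular.integral_Yc (hreg : D.Regular P) (hs : s ∈ Icc (0 : ℝ) 1) :
    ∫ ω, D.Yc P s ω ∂P = 0 := by
  have hY := (hreg.memLp_Y s hs).integrable one_le_two
  simp only [Yc]
  rw [integral_sub hY (integrable_const _)]
  simp [meanY]

theorem Regular.integral_inner_Xc (hreg : D.Regular P) (hs : s ∈ Icc (0 : ℝ) 1)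
    (v : EuclideanSpace ℝ (Fin p)) : ∫ ω, inner ℝ (D.Xc P s ω) v ∂P = 0 := by
  have h1 := (innerSL ℝ v).integral_comp_comm ((hreg.memLp_Xc hs).integrable one_le_two)
  rw [hreg.integral_Xc hs] at h1
  simpa [real_inner_comm] using h1

theorem Regular.integral_err (hreg : D.Regular P) (hs : s ∈ Icc (0 : ℝ) 1) :
    ∫ ω, D.err P β s ω ∂P = 0 := by
  unfold err
  rw [integral_sub ((hreg.memLp_Yc hs).integrable one_le_two)
    ((hreg.memLp_inner hs _).integrable one_le_two), hreg.integral_Yc hs,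
    hreg.integral_inner_Xc hs, sub_zero]

end Model

end Subject

namespace Subject

/-! ### Conditional mean and conditional variance of the response -/

section Model

variable {S : Type*} {p q : ℕ} [mS : MeasurableSpace S] {D : Subject S p q}
  {P : Measure S} [IsProbabilityMeasure P] {β : ℝ → EuclideanSpace ℝ (Fin p)}
  {γ : ℝ → EuclideanSpace ℝ (Fin q)} {s : ℝ}

theorem stronglyMeasurable_Xc_apply (s : ℝ) (a : Fin p) :
    StronglyMeasurable[MeasurableSpace.comap (D.Xc P s) inferInstance] fun ω => D.Xc P s ω a := by
  have h1 : Measurable fun v : EuclideanSpace ℝ (Fin p) => v a := by fun_prop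
  exact (h1.comp (comap_measurable (D.Xc P s))).stronglyMeasurable

/-- The conditional mean of the response given the covariates is, up to a constant, the regression
function. -/
theorem condExp_Y (hreg : D.Regular P) (hmodel : D.VaryingCoefficient P β γ)
    (horth : D.Orthogonal P) (hs : s ∈ Icc (0 : ℝ) 1) :
    P[D.Y s | MeasurableSpace.comap (D.X s) inferInstance] =ᵐ[P] fun ω =>
      inner ℝ (D.X s ω) (β s) + inner ℝ (∫ ω, D.Z s ω ∂P) (γ s) := by
  have hX := hreg.measurable_Xs s
  have hXZ : Measurable fun ω => (D.X s ω, D.Z s ω) := hX.prodMk (hreg.measurable_Z s)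
  have hm2 := hXZ.comap_le
  have hm1 : MeasurableSpace.comap (D.X s) inferInstance
      ≤ MeasurableSpace.comap (fun ω => (D.X s ω, D.Z s ω)) inferInstance := by
    have h1 : D.X s = Prod.fst ∘ fun ω => (D.X s ω, D.Z s ω) := rfl
    rw [h1, ← MeasurableSpace.comap_comp]
    exact MeasurableSpace.comap_mono measurable_fst.comap_le
  have hXi : Integrable (fun ω => inner ℝ (D.X s ω) (β s)) P :=
    ((hreg.memLp_X s hs).integrable one_le_two).inner_const (β s)
  have hZi : Integrable (fun ω => inner ℝ (D.Z s ω) (γ s)) P :=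
    (hreg.integrable_Z s hs).inner_const (γ s)
  have h1 := (condExp_condExp_of_le (μ := P) (f := D.Y s) hm1 hm2).symm
  have h2 := condExp_congr_ae (m := MeasurableSpace.comap (D.X s) inferInstance) (hmodel s hs)
  have h3 := condExp_add hXi hZi (MeasurableSpace.comap (D.X s) inferInstance)
  have hXm : StronglyMeasurable[MeasurableSpace.comap (D.X s) inferInstance]
      fun ω => inner ℝ (D.X s ω) (β s) := by
    have h4 : Measurable fun v : EuclideanSpace ℝ (Fin p) => (inner ℝ v (β s) : ℝ) := by fun_prop
    exact (h4.comp (comap_measurable (D.X s))).stronglyMeasurable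
  have h4 := condExp_of_stronglyMeasurable hX.comap_le hXm hXi
  have h5 := (innerSL ℝ (γ s)).comp_condExp_comm
    (m := MeasurableSpace.comap (D.X s) inferInstance) (hreg.integrable_Z s hs)
  have e5 : (innerSL ℝ (γ s) ∘ D.Z s) = fun ω => inner ℝ (D.Z s ω) (γ s) := by
    funext ω; simp [real_inner_comm]
  rw [e5] at h5
  refine (h1.trans (h2.trans h3)).trans ?_
  rw [h4]
  filter_upwards [h5, horth s hs] with ω h6 h7
  simp only [Pi.add_apply]
  rw [← h6]
  simp only [Function.comp_apply, h7, innerSL_apply_apply, real_inner_comm]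

/-- Taking expectations identifies the constant left over from `Z`, and centering cancels it. From
here on `Z` and its coefficient play no role. -/
theorem condExp_Yc (hreg : D.Regular P) (hmodel : D.VaryingCoefficient P β γ)
    (horth : D.Orthogonal P) (hs : s ∈ Icc (0 : ℝ) 1) :
    P[D.Yc P s | MeasurableSpace.comap (D.Xc P s) inferInstance] =ᵐ[P] fun ω =>
      inner ℝ (D.Xc P s ω) (β s) := by
  rw [comap_Xc]
  have hle := (hreg.measurable_Xs s).comap_le
  have hXint := (hreg.memLp_X s hs).integrable one_le_two
  have hXi : Integrable (fun ω => inner ℝ (D.X s ω) (β s)) P := hXint.inner_const (β s)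
  have hY := (hreg.memLp_Y s hs).integrable one_le_two
  have h1 := condExp_Y hreg hmodel horth hs
  have h2 := condExp_sub hY (integrable_const (D.meanY P s))
    (MeasurableSpace.comap (D.X s) inferInstance)
  rw [condExp_const hle] at h2
  have h3 : D.meanY P s = inner ℝ (D.meanX P s) (β s) + inner ℝ (∫ ω, D.Z s ω ∂P) (γ s) := by
    rw [meanY, ← integral_condExp hle, integral_congr_ae h1,
      integral_add hXi (integrable_const _), integral_const, probReal_univ, one_smul]
    congr 1
    have h4 := (innerSL ℝ (β s)).integral_comp_comm hXint
    simpa [real_inner_comm, meanX] using h4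
  refine EventuallyEq.trans (h2 : P[D.Yc P s | _] =ᵐ[P] _) ?_
  filter_upwards [h1] with ω h4
  simp only [Pi.sub_apply]
  rw [h4, h3, Xc, inner_sub_left]
  ring

/-- The covariate is measurable for the conditioning σ-algebra, so the tower property replaces `Ỹ`
by its conditional mean. -/
theorem integral_Xc_mul_err (hreg : D.Regular P) (hmodel : D.VaryingCoefficient P β γ)
    (horth : D.Orthogonal P) (hs : s ∈ Icc (0 : ℝ) 1) (a : Fin p) :
    ∫ ω, D.Xc P s ω a * D.err P β s ω ∂P = 0 := by
  have hle := (hreg.measurable_Xc s).comap_le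
  have hXa := hreg.memLp_Xc_apply hs a
  have hY := hreg.memLp_Yc hs
  have hin := hreg.memLp_inner hs (β s)
  have h1 := condExp_mul_of_stronglyMeasurable_left (stronglyMeasurable_Xc_apply (D := D) (P := P) s a)
    (hXa.integrable_mul hY) (hY.integrable one_le_two)
  have h2 : ∫ ω, D.Xc P s ω a * D.Yc P s ω ∂P
      = ∫ ω, D.Xc P s ω a * inner ℝ (D.Xc P s ω) (β s) ∂P := by
    rw [← integral_condExp hle]
    refine integral_congr_ae (EventuallyEq.trans h1 ?_)
    filter_upwards [condExp_Yc hreg hmodel horth hs] with ω hω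
    simp only [Pi.mul_apply, hω]
  unfold err
  simp_rw [mul_sub]
  have i1 : Integrable (fun ω => D.Xc P s ω a * D.Yc P s ω) P := hXa.integrable_mul hY
  have i2 : Integrable (fun ω => D.Xc P s ω a * inner ℝ (D.Xc P s ω) (β s)) P :=
    hXa.integrable_mul hin
  rw [integral_sub i1 i2, h2, sub_self]

theorem sigmaSq_ae_eq (hreg : D.Regular P) (hmodel : D.VaryingCoefficient P β γ)
    (horth : D.Orthogonal P) (hs : s ∈ Icc (0 : ℝ) 1) :
    D.sigmaSq P s =ᵐ[P]
      P[fun ω => D.err P β s ω ^ 2 | MeasurableSpace.comap (D.Xc P s) inferInstance] := by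
  unfold sigmaSq condVar
  refine condExp_congr_ae ?_
  filter_upwards [condExp_Yc hreg hmodel horth hs] with ω hω
  simp only [Pi.pow_apply, Pi.sub_apply, hω, err]

/-- The conditional variance is the conditional second moment of the error, and the covariates can
be pulled out; square integrability of the scores justifies the tower property. -/
theorem covXSigma_eq (hreg : D.Regular P) (hmodel : D.VaryingCoefficient P β γ)
    (horth : D.Orthogonal P) (hs : s ∈ Icc (0 : ℝ) 1)
    (hsc : ∀ a, MemLp (fun ω => D.Xc P s ω a * D.err P β s ω) 2 P) (a b : Fin p) :
    D.covXSigma P s a b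
      = ∫ ω, D.Xc P s ω a * D.err P β s ω * (D.Xc P s ω b * D.err P β s ω) ∂P := by
  have hle := (hreg.measurable_Xc s).comap_le
  have e1 : (fun ω => D.Xc P s ω a * D.err P β s ω * (D.Xc P s ω b * D.err P β s ω))
      = (fun ω => D.Xc P s ω a * D.Xc P s ω b) * fun ω => D.err P β s ω ^ 2 := by
    funext ω; simp only [Pi.mul_apply]; ring
  have hi : Integrable ((fun ω => D.Xc P s ω a * D.Xc P s ω b) * fun ω => D.err P β s ω ^ 2) P := by
    rw [← e1]; exact (hsc a).integrable_mul (hsc b)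
  have h1 := condExp_mul_of_stronglyMeasurable_left
    ((stronglyMeasurable_Xc_apply (D := D) (P := P) s a).mul (stronglyMeasurable_Xc_apply s b))
    hi (hreg.memLp_err hs).integrable_sq
  rw [e1, ← integral_condExp hle]
  refine integral_congr_ae ?_
  filter_upwards [h1, sigmaSq_ae_eq hreg hmodel horth hs] with ω h2 h3
  rw [h3]
  exact h2.symm

end Model

/-! ### Moments of the scores and continuity of the covariates -/

section Moments

variable {S : Type*} {p q : ℕ} [mS : MeasurableSpace S] {D : Subject S p q}
  {P : Measure S} [IsProbabilityMeasure P] {β : ℝ → EuclideanSpace ℝ (Fin p)} {lam : ℝ → ℝ}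

/-- The regression score. -/
noncomputable def scoreVec (D : Subject S p q) (P : Measure S) (β : ℝ → EuclideanSpace ℝ (Fin p))
    (s : ℝ) (ω : S) : EuclideanSpace ℝ (Fin p) :=
  D.err P β s ω • D.Xc P s ω

theorem rpow_le_one_add_rpow {x r r' : ℝ} (hx : 0 ≤ x) (hr : 0 ≤ r) (hrr : r ≤ r') :
    x ^ r ≤ 1 + x ^ r' := by
  rcases le_total x 1 with h1 | h1
  · have := Real.rpow_le_one hx h1 hr
    have := Real.rpow_nonneg hx r'
    linarith
  · have := Real.rpow_le_rpow_of_exponent_le h1 hrr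
    linarith

/-- Uniform moments of the scores, of some order in `(2, 3]`. -/
theorem exists_score_moment (hreg : D.Regular P) (hsm : D.SmoothnessCond P β lam) :
    ∃ δ : ℝ, 0 < δ ∧ δ ≤ 1 ∧ ∃ C : ℝ, 0 ≤ C ∧ ∀ r : ℝ, 0 ≤ r → r ≤ 2 + δ → ∀ s ∈ Icc (0 : ℝ) 1,
      Integrable (fun ω => ‖D.scoreVec P β s ω‖ ^ r) P
        ∧ ∫ ω, ‖D.scoreVec P β s ω‖ ^ r ∂P ≤ C := by
  obtain ⟨δ, hδ, C, hC⟩ := hsm.lyapunov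
  -- The order is lowered to at most three to suit the second-order expansion of the exponential.
  -- The constant `1 + C` comes from `x^r ≤ 1 + x^(2+δ)`.
  refine ⟨min δ 1, by positivity, min_le_right _ _, 1 + C, by positivity, fun r hr0 hr s hs => ?_⟩
  have hm : AEStronglyMeasurable (D.scoreVec P β s) P :=
    (hreg.memLp_err hs).1.smul (hreg.memLp_Xc hs).1
  have hm' : ∀ r : ℝ, 0 ≤ r → AEStronglyMeasurable (fun ω => ‖D.scoreVec P β s ω‖ ^ r) P :=
    fun r hr => (hm.norm.aemeasurable.pow_const r).aestronglyMeasurable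
  have h0 : ∀ r : ℝ, ∀ ω, 0 ≤ ‖D.scoreVec P β s ω‖ ^ r := fun r ω =>
    Real.rpow_nonneg (norm_nonneg _) r
  have hr' : r ≤ 2 + δ := hr.trans (by linarith [min_le_left δ 1])
  have h1 : ∫⁻ ω, ENNReal.ofReal (‖D.scoreVec P β s ω‖ ^ (2 + δ)) ∂P ≤ ENNReal.ofReal C := by
    rw [ENNReal.ofReal_coe_nnreal]
    refine le_trans (le_of_eq ?_) (hC s hs)
    refine lintegral_congr fun ω => ?_
    rw [← ENNReal.ofReal_rpow_of_nonneg (norm_nonneg _) (by positivity), ofReal_norm]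
    rfl
  have h2 : Integrable (fun ω => ‖D.scoreVec P β s ω‖ ^ (2 + δ)) P :=
    ⟨hm' _ (by positivity), by
      rw [hasFiniteIntegral_iff_ofReal (ae_of_all _ (h0 _))]
      exact h1.trans_lt ENNReal.ofReal_lt_top⟩
  have h3 : ∫ ω, ‖D.scoreVec P β s ω‖ ^ (2 + δ) ∂P ≤ C := by
    rw [integral_eq_lintegral_of_nonneg_ae (ae_of_all _ (h0 _)) (hm' _ (by positivity))]
    exact ENNReal.toReal_le_of_le_ofReal C.2 h1
  have h4 : ∀ ω, ‖D.scoreVec P β s ω‖ ^ r ≤ 1 + ‖D.scoreVec P β s ω‖ ^ (2 + δ) := fun ω =>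
    rpow_le_one_add_rpow (norm_nonneg _) hr0 hr'
  have h5 : Integrable (fun ω => 1 + ‖D.scoreVec P β s ω‖ ^ (2 + δ)) P :=
    (integrable_const 1).add h2
  have h6 : Integrable (fun ω => ‖D.scoreVec P β s ω‖ ^ r) P :=
    h5.mono' (hm' r hr0) (ae_of_all _ fun ω => by
      rw [Real.norm_of_nonneg (h0 r ω)]; exact h4 ω)
  refine ⟨h6, (integral_mono h6 h5 h4).trans ?_⟩
  rw [integral_add (integrable_const 1) h2]
  simpa using h3

theorem abs_Xc_mul_err_le (s : ℝ) (ω : S) (a : Fin p) :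
    |D.Xc P s ω a * D.err P β s ω| ≤ ‖D.scoreVec P β s ω‖ := by
  have h1 := PiLp.norm_apply_le (D.scoreVec P β s ω) a
  have e1 : D.scoreVec P β s ω a = D.Xc P s ω a * D.err P β s ω := by
    simp [scoreVec, mul_comm]
  rwa [e1, Real.norm_eq_abs] at h1

theorem abs_sum_Xc_mul_err_le (u : Fin p → ℝ) (s : ℝ) (ω : S) :
    |∑ a, u a * (D.Xc P s ω a * D.err P β s ω)| ≤ (∑ a, |u a|) * ‖D.scoreVec P β s ω‖ := by
  rw [Finset.sum_mul]
  refine (Finset.abs_sum_le_sum_abs _ _).trans (Finset.sum_le_sum fun a _ => ?_)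
  rw [abs_mul]
  exact mul_le_mul_of_nonneg_left (abs_Xc_mul_err_le s ω a) (abs_nonneg _)

theorem integral_sq_Xc_sub (hreg : D.Regular P) {s t : ℝ} (hs : s ∈ Icc (0 : ℝ) 1)
    (ht : t ∈ Icc (0 : ℝ) 1) (a : Fin p) :
    ∫ ω, (D.Xc P s ω a - D.Xc P t ω a) ^ 2 ∂P
      = D.covX P s s a a - 2 * D.covX P s t a a + D.covX P t t a a := by
  have h1 := hreg.memLp_Xc_apply hs a
  have h2 := hreg.memLp_Xc_apply ht a
  have e1 : ∀ ω, (D.Xc P s ω a - D.Xc P t ω a) ^ 2 = D.Xc P s ω a * D.Xc P s ω a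
      - 2 * (D.Xc P s ω a * D.Xc P t ω a) + D.Xc P t ω a * D.Xc P t ω a := fun ω => by ring
  simp_rw [e1]
  have i1 : Integrable (fun ω => D.Xc P s ω a * D.Xc P s ω a) P := h1.integrable_mul h1
  have i2 : Integrable (fun ω => 2 * (D.Xc P s ω a * D.Xc P t ω a)) P :=
    (h1.integrable_mul h2).const_mul 2
  have i3 : Integrable (fun ω => D.Xc P t ω a * D.Xc P t ω a) P := h2.integrable_mul h2
  have i4 : Integrable (fun ω => D.Xc P s ω a * D.Xc P s ω a
      - 2 * (D.Xc P s ω a * D.Xc P t ω a)) P := i1.sub i2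
  rw [integral_add i4 i3, integral_sub i1 i2, integral_const_mul]
  rfl

/-- A weighted arithmetic-geometric mean in place of Cauchy–Schwarz: `η` is fixed first to make `η
C` small, and then `s` tends to `t`. -/
theorem tendsto_zero_of_le_weighted {f g : ℝ → ℝ} {t C : ℝ} (hf : ∀ s, 0 ≤ f s)
    (h : ∀ η : ℝ, 0 < η → ∀ s, f s ≤ η * C + η⁻¹ * g s) (hg : Tendsto g (𝓝 t) (𝓝 0)) :
    Tendsto f (𝓝 t) (𝓝 0) := by
  rw [Metric.tendsto_nhds]
  intro ε hε
  have hη : 0 < ε / (2 * (|C| + 1)) := by positivity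
  have h1 := (hg.const_mul (ε / (2 * (|C| + 1)))⁻¹).eventually_lt_const
    (by simpa using half_pos hε : _ < ε / 2)
  filter_upwards [h1] with s hs
  rw [Real.dist_eq, sub_zero, abs_of_nonneg (hf s)]
  have h2 := h _ hη s
  have h3 : ε / (2 * (|C| + 1)) * C ≤ ε / 2 := by
    rw [div_mul_eq_mul_div, div_le_div_iff₀ (by positivity) two_pos]
    nlinarith [le_abs_self C, abs_nonneg C]
  linarith

/-- The covariates are continuous in mean square, hence their products in mean. -/
theorem tendsto_integral_abs_Xc_mul_sub (hreg : D.Regular P) (hsm : D.SmoothnessCond P β lam)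
    {t : ℝ} (ht : t ∈ Icc (0 : ℝ) 1) {C : ℝ}
    (hC : ∀ s ∈ Icc (0 : ℝ) 1, ∀ a, ∫ ω, D.Xc P s ω a ^ 2 ∂P ≤ C) (a b : Fin p) :
    Tendsto (fun s => ∫ ω, |D.Xc P (clamp s) ω a * D.Xc P (clamp s) ω b
      - D.Xc P t ω a * D.Xc P t ω b| ∂P) (𝓝 t) (𝓝 0) := by
  -- The mean-square increment is a combination of three values of the covariance function, so joint
  -- continuity of the latter gives continuity in mean square.
  have hcov : ∀ c, Tendsto (fun s => ∫ ω, (D.Xc P (clamp s) ω c - D.Xc P t ω c) ^ 2 ∂P) (𝓝 t)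
      (𝓝 0) := by
    intro c
    simp_rw [fun s => integral_sq_Xc_sub hreg (clamp_mem s) ht c]
    have hc := (hsm.contDiff_covX c c).continuousOn
    have h1 : Continuous fun s => D.covX P (clamp s) (clamp s) c c :=
      hc.comp_continuous (continuous_clamp.prodMk continuous_clamp)
        fun s => ⟨clamp_mem s, clamp_mem s⟩
    have h2 : Continuous fun s => D.covX P (clamp s) t c c :=
      hc.comp_continuous (continuous_clamp.prodMk continuous_const) fun s => ⟨clamp_mem s, ht⟩
    have h3 : Continuous fun s => D.covX P (clamp s) (clamp s) c c
        - 2 * D.covX P (clamp s) t c c + D.covX P t t c c := by fun_prop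
    have h4 := h3.tendsto t
    rw [clamp_of_mem ht] at h4
    have e : D.covX P t t c c - 2 * D.covX P t t c c + D.covX P t t c c = 0 := by ring
    rwa [e] at h4
  refine tendsto_zero_of_le_weighted (C := C)
    (g := fun s => (∫ ω, (D.Xc P (clamp s) ω a - D.Xc P t ω a) ^ 2 ∂P)
      + ∫ ω, (D.Xc P (clamp s) ω b - D.Xc P t ω b) ^ 2 ∂P)
    (fun s => integral_nonneg fun _ => abs_nonneg _) (fun η hη s => ?_)
    (by simpa using (hcov a).add (hcov b))
  have hs := clamp_mem s
  have m1 := hreg.memLp_Xc_apply hs a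
  have m2 := hreg.memLp_Xc_apply hs b
  have m3 := hreg.memLp_Xc_apply ht a
  have m4 := hreg.memLp_Xc_apply ht b
  have i1 := m1.integrable_sq
  have i2 := m4.integrable_sq
  have i3 : Integrable (fun ω => (D.Xc P (clamp s) ω a - D.Xc P t ω a) ^ 2) P :=
    (m1.sub m3).integrable_sq
  have i4 : Integrable (fun ω => (D.Xc P (clamp s) ω b - D.Xc P t ω b) ^ 2) P :=
    (m2.sub m4).integrable_sq
  have i5 : Integrable (fun ω => η / 2 * (D.Xc P (clamp s) ω a ^ 2 + D.Xc P t ω b ^ 2)) P :=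
    (i1.add i2).const_mul _
  have i6 : Integrable (fun ω => η⁻¹ * ((D.Xc P (clamp s) ω a - D.Xc P t ω a) ^ 2
      + (D.Xc P (clamp s) ω b - D.Xc P t ω b) ^ 2)) P := (i3.add i4).const_mul _
  calc _ ≤ ∫ ω, (η / 2 * (D.Xc P (clamp s) ω a ^ 2 + D.Xc P t ω b ^ 2)
        + η⁻¹ * ((D.Xc P (clamp s) ω a - D.Xc P t ω a) ^ 2
          + (D.Xc P (clamp s) ω b - D.Xc P t ω b) ^ 2)) ∂P := by
        refine integral_mono ((m1.integrable_mul m2).sub (m3.integrable_mul m4)).abs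
          (i5.add i6) fun ω => ?_
        simp only
        have key : ∀ x d : ℝ, |x * d| ≤ η / 2 * x ^ 2 + η⁻¹ * d ^ 2 := fun x d => by
          have e : η⁻¹ * d ^ 2 = η * (η⁻¹ * d) ^ 2 := by field_simp
          have e' : x * d = η * (x * (η⁻¹ * d)) := by field_simp
          rw [e, e', abs_mul, abs_of_pos hη, mul_comm (η / 2), mul_div_assoc', mul_comm _ η,
            mul_div_assoc, ← mul_add]
          refine mul_le_mul_of_nonneg_left ?_ hη.le
          rw [abs_le]
          constructor <;> nlinarith [sq_nonneg (x - η⁻¹ * d), sq_nonneg (x + η⁻¹ * d),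
            sq_nonneg (η⁻¹ * d)]
        have k1 := key (D.Xc P (clamp s) ω a) (D.Xc P (clamp s) ω b - D.Xc P t ω b)
        have k2 := key (D.Xc P t ω b) (D.Xc P (clamp s) ω a - D.Xc P t ω a)
        have e3 : D.Xc P (clamp s) ω a * D.Xc P (clamp s) ω b - D.Xc P t ω a * D.Xc P t ω b
            = D.Xc P (clamp s) ω a * (D.Xc P (clamp s) ω b - D.Xc P t ω b)
              + D.Xc P t ω b * (D.Xc P (clamp s) ω a - D.Xc P t ω a) := by ring
        rw [e3]
        refine (abs_add_le _ _).trans ((add_le_add k1 k2).trans (le_of_eq ?_))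
        ring
    _ ≤ _ := by
        rw [integral_add i5 i6, integral_const_mul,
          integral_const_mul, integral_add i1 i2, integral_add i3 i4]
        refine add_le_add ?_ le_rfl
        have c1 := hC _ hs a
        have c2 := hC _ ht b
        nlinarith

end Moments

end Subject

/-! ### Uniform moments and the kernel design around an interior point -/

namespace Subject

variable {S E M : Type*} {p q : ℕ} [MeasurableSpace S] [MeasurableSpace E] [MeasurableSpace M]
  {D : Subject S p q} {P : Measure S} [IsProbabilityMeasure P]
  {β : ℝ → EuclideanSpace ℝ (Fin p)} {γ : ℝ → EuclideanSpace ℝ (Fin q)} {lam : ℝ → ℝ}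

theorem inner_eq_sum (x y : EuclideanSpace ℝ (Fin p)) : inner ℝ x y = ∑ a, x a * y a := by
  simp [PiLp.inner_apply, mul_comm]

theorem err_eq (s : ℝ) (ω : S) :
    D.err P β s ω = D.Yc P s ω - ∑ b, D.Xc P s ω b * β s b := by
  rw [err, inner_eq_sum]

theorem memLp_Xc_mul_err (hreg : D.Regular P) (hsm : D.SmoothnessCond P β lam) {s : ℝ}
    (hs : s ∈ Icc (0 : ℝ) 1) (a : Fin p) :
    MemLp (fun ω => D.Xc P s ω a * D.err P β s ω) 2 P := by
  obtain ⟨δ, hδ, -, C, -, h1⟩ := exists_score_moment hreg hsm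
  have hm : AEStronglyMeasurable (fun ω => D.Xc P s ω a * D.err P β s ω) P :=
    (hreg.memLp_Xc_apply hs a).1.mul (hreg.memLp_err hs).1
  rw [memLp_two_iff_integrable_sq hm]
  refine (h1 2 zero_le_two (by linarith) s hs).1.mono' (hm.pow 2) (ae_of_all _ fun ω => ?_)
  rw [Real.rpow_two, norm_pow, Real.norm_eq_abs]
  exact pow_le_pow_left₀ (abs_nonneg _) (abs_Xc_mul_err_le s ω a) 2

/-- Uniform second moments. -/
theorem exists_second_moments (hreg : D.Regular P) (hsm : D.SmoothnessCond P β lam) :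
    ∃ C : ℝ, ∀ s ∈ Icc (0 : ℝ) 1, (∀ a, ∫ ω, D.Xc P s ω a ^ 2 ∂P ≤ C)
      ∧ ∫ ω, D.Yc P s ω ^ 2 ∂P ≤ C ∧ ∫ ω, D.err P β s ω ^ 2 ∂P ≤ C
      ∧ ∀ a, ∫ ω, (D.Xc P s ω a * D.err P β s ω) ^ 2 ∂P ≤ C := by
  have hX : ∀ a, ∃ B : ℝ, 0 ≤ B ∧ ∀ s ∈ Icc (0 : ℝ) 1, |D.covX P s s a a| ≤ B := fun a =>
    exists_abs_le_on_unitInterval ((hsm.contDiff_covX a a).continuousOn.comp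
      (continuousOn_id.prodMk continuousOn_id) fun s hs => ⟨hs, hs⟩)
  choose BX hBX0 hBX using hX
  obtain ⟨CY, hCY⟩ := hsm.second_moment_Y
  obtain ⟨BY, hBY0, hBY⟩ := exists_abs_le_on_unitInterval hsm.contDiff_meanY.continuousOn
  obtain ⟨Bβ, hBβ0, hBβ⟩ := exists_abs_le_on_unitInterval hsm.contDiff_β.continuousOn.norm
  obtain ⟨δ, hδ, -, Cs, hCs0, hCs⟩ := exists_score_moment hreg hsm
  have hCY0 : 0 ≤ CY := (integral_nonneg fun _ => sq_nonneg _).trans (hCY 0 (by simp))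
  have hS0 : 0 ≤ ∑ a, BX a := Finset.sum_nonneg fun a _ => hBX0 a
  have eX : ∀ s a, ∫ ω, D.Xc P s ω a ^ 2 ∂P = D.covX P s s a a := fun s a => by
    simp only [covX, Matrix.of_apply, sq]
  have bX : ∀ s ∈ Icc (0 : ℝ) 1, ∀ a, ∫ ω, D.Xc P s ω a ^ 2 ∂P ≤ BX a := fun s hs a => by
    rw [eX]; exact (le_abs_self _).trans (hBX a s hs)
  have bY : ∀ s ∈ Icc (0 : ℝ) 1, ∫ ω, D.Yc P s ω ^ 2 ∂P ≤ 2 * CY + 2 * BY ^ 2 := fun s hs => by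
    have i1 := (hreg.memLp_Y s hs).integrable_sq
    calc _ ≤ ∫ ω, (2 * D.Y s ω ^ 2 + 2 * BY ^ 2) ∂P := by
          refine integral_mono (hreg.memLp_Yc hs).integrable_sq
            ((i1.const_mul 2).add (integrable_const _)) fun ω => ?_
          have h1 := sq_le_sq' (abs_le.1 (hBY s hs)).1 (abs_le.1 (hBY s hs)).2
          simp only [Yc]
          nlinarith [sq_nonneg (D.Y s ω + D.meanY P s)]
      _ ≤ _ := by
          rw [integral_add (i1.const_mul 2) (integrable_const _), integral_const_mul]
          have := hCY s hs
          simp only [integral_const, probReal_univ, smul_eq_mul, one_mul]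
          linarith
  have be : ∀ s ∈ Icc (0 : ℝ) 1, ∫ ω, D.err P β s ω ^ 2 ∂P
      ≤ 2 * (2 * CY + 2 * BY ^ 2) + 2 * (Bβ ^ 2 * ∑ a, BX a) := fun s hs => by
    have i1 := (hreg.memLp_Yc hs).integrable_sq
    have i2 : Integrable (fun ω => ∑ a, D.Xc P s ω a ^ 2) P :=
      integrable_finsetSum _ fun a _ => (hreg.memLp_Xc_apply hs a).integrable_sq
    have i3 : Integrable (fun ω => 2 * (Bβ ^ 2 * ∑ a, D.Xc P s ω a ^ 2)) P :=
      (i2.const_mul _).const_mul 2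
    calc _ ≤ ∫ ω, (2 * D.Yc P s ω ^ 2 + 2 * (Bβ ^ 2 * ∑ a, D.Xc P s ω a ^ 2)) ∂P := by
          refine integral_mono (hreg.memLp_err hs).integrable_sq ((i1.const_mul 2).add i3)
            fun ω => ?_
          have h1 : (inner ℝ (D.Xc P s ω) (β s)) ^ 2 ≤ Bβ ^ 2 * ∑ a, D.Xc P s ω a ^ 2 := by
            rw [← EuclideanSpace.real_norm_sq_eq, ← mul_pow, ← sq_abs]
            refine pow_le_pow_left₀ (abs_nonneg _) ((abs_real_inner_le_norm _ _).trans ?_) 2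
            rw [mul_comm]
            exact mul_le_mul_of_nonneg_right ((le_abs_self _).trans (hBβ s hs)) (norm_nonneg _)
          simp only [err]
          nlinarith [sq_nonneg (D.Yc P s ω + inner ℝ (D.Xc P s ω) (β s))]
      _ ≤ _ := by
          rw [integral_add (i1.const_mul 2) i3, integral_const_mul, integral_const_mul,
            integral_const_mul,
            integral_finsetSum _ fun a _ => (hreg.memLp_Xc_apply hs a).integrable_sq]
          have h1 := bY s hs
          have h2 := Finset.sum_le_sum fun a (_ : a ∈ Finset.univ) => bX s hs a
          have h3 := mul_le_mul_of_nonneg_left h2 (sq_nonneg Bβ)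
          linarith
  have bs : ∀ s ∈ Icc (0 : ℝ) 1, ∀ a, ∫ ω, (D.Xc P s ω a * D.err P β s ω) ^ 2 ∂P ≤ Cs :=
    fun s hs a => by
      obtain ⟨h1, h2⟩ := hCs 2 zero_le_two (by linarith) s hs
      refine (integral_mono (memLp_Xc_mul_err hreg hsm hs a).integrable_sq h1 fun ω => ?_).trans h2
      simp only [Real.rpow_two]
      rw [← sq_abs]
      exact pow_le_pow_left₀ (abs_nonneg _) (abs_Xc_mul_err_le s ω a) 2
  have n1 : 0 ≤ Bβ ^ 2 * ∑ a, BX a := by positivity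
  have n2 := sq_nonneg BY
  refine ⟨∑ a, BX a + (2 * (2 * CY + 2 * BY ^ 2) + 2 * (Bβ ^ 2 * ∑ a, BX a)) + Cs,
    fun s hs => ⟨fun a => ?_, ?_, ?_, fun a => ?_⟩⟩
  · have h1 := bX s hs a
    have h2 := Finset.single_le_sum (fun a _ => hBX0 a) (Finset.mem_univ a)
    linarith
  · have := bY s hs
    linarith
  · have := be s hs
    linarith
  · have := bs s hs a
    linarith

/-- A diagonal entry of the positive definite `lam s • covX` is `lam s` times a nonnegative moment.
An index `a` must exist, so this requires `p > 0`. -/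
theorem lam_pos (hsm : D.SmoothnessCond P β lam) (a : Fin p) {s : ℝ} (hs : s ∈ Icc (0 : ℝ) 1) :
    0 < lam s := by
  have h1 := (hsm.posDef s hs).diag_pos (i := a)
  simp only [Matrix.smul_apply, covX, Matrix.of_apply, smul_eq_mul] at h1
  exact pos_of_mul_pos_left h1 (integral_nonneg fun ω => mul_self_nonneg _)

theorem exists_isDesign (hreg : D.Regular P) (hobs : D.ObservationCond P lam) {τ : S → M}
    (hτ : Measurable τ) {N : Kernel M ℝ} (hpt : ∀ m, IsPointMeasure (N m))
    (hN : ∀ ω, N (τ ω) = D.N ω) (hl : ∀ s ∈ Icc (0 : ℝ) 1, 0 < lam s) {K : ℝ → ℝ} (hK : IsKernel K)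
    {t : ℝ} (ht : t ∈ Ioo (0 : ℝ) 1) :
    ∃ Λ c R κ h₀ : ℝ, 0 < h₀ ∧ (∀ s, |s - t| ≤ R * h₀ → s ∈ Icc (0 : ℝ) 1) ∧
      ∀ h, 0 < h → h ≤ h₀ → IsDesign N (P.map τ) (extIntensity lam) Λ c K R κ t h := by
  have hlc := hobs.contDiff_lam.continuousOn
  obtain ⟨Λ, -, hΛ⟩ := exists_abs_le_on_unitInterval hlc
  obtain ⟨s₀, hs₀, hmin⟩ := isCompact_Icc.exists_isMinOn (nonempty_Icc.2 zero_le_one) hlc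
  obtain ⟨R, hR, hRK⟩ := hK.exists_support
  obtain ⟨c, hc⟩ := isPointProcess hreg.measurable_L hreg.measurable_T hobs hτ hpt hN
    (fun s hs => (hl s hs).le) (fun s hs => (le_abs_self _).trans (hΛ s hs))
  have ht0 := ht.1
  have ht1 : 0 < 1 - t := by linarith [ht.2]
  have hmem : ∀ h s, h ≤ min t (1 - t) / (2 * R) → |s - t| ≤ 2 * (R * h) → s ∈ Icc (0 : ℝ) 1 := by
    intro h s h1 h2
    rw [le_div_iff₀ (by positivity)] at h1
    have h3 := min_le_left t (1 - t)
    have h4 := min_le_right t (1 - t)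
    rw [abs_le] at h2
    constructor <;> nlinarith
  -- The bandwidth is limited so that windows of radius `2 R h` around `t` remain in `[0, 1]`, where
  -- the intensity is at least its minimum `lam s₀`.
  refine ⟨Λ, c, R, lam s₀, min 1 (min t (1 - t) / (2 * R)), by positivity, fun s hs => ?_,
    fun h hh hh0 => ⟨hc, hK, hR, hRK, hl s₀ hs₀, hh, hh0.trans (min_le_left _ _), fun u hu => ?_⟩⟩
  · refine hmem (min 1 (min t (1 - t) / (2 * R))) s (min_le_right _ _) (hs.trans ?_)
    have : 0 < R * min 1 (min t (1 - t) / (2 * R)) := by positivity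
    linarith
  · have h1 := hmem h u (hh0.trans (min_le_right _ _)) hu
    rw [extIntensity_of_mem h1]
    exact hmin h1

theorem continuousAt_extIntensity (hlc : ContinuousOn lam (Icc 0 1)) {t : ℝ}
    (ht : t ∈ Ioo (0 : ℝ) 1) : ContinuousAt (extIntensity lam) t := by
  refine hlc.comp_clamp.continuousAt.congr ?_
  filter_upwards [Icc_mem_nhds ht.1 ht.2] with s hs
  rw [extIntensity_of_mem hs, clamp_of_mem hs]

end Subject

/-! ### From a subject to a local model -/

namespace Subject

variable {S E M : Type*} {p q : ℕ} [MeasurableSpace S] [MeasurableSpace E] [MeasurableSpace M]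

/-- A factorization of a subject through a space `E` of paths of `(X, Y)` and a space `M` that
carries the observation process. -/
structure Carrier (D : Subject S p q) (E M : Type*) [MeasurableSpace E] [MeasurableSpace M] where
  path : S → E
  mark : S → M
  X : ℝ → E → EuclideanSpace ℝ (Fin p)
  Y : ℝ → E → ℝ
  N : Kernel M ℝ
  measurable_path : Measurable path
  measurable_mark : Measurable mark
  measurable_X : Measurable fun z : ℝ × E => X z.1 z.2
  measurable_Y : Measurable fun z : ℝ × E => Y z.1 z.2
  X_path : ∀ s ω, X s (path ω) = D.X s ω
  Y_path : ∀ s ω, Y s (path ω) = D.Y s ω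
  point : ∀ m, IsPointMeasure (N m)
  N_mark : ∀ ω, N (mark ω) = D.N ω

namespace Carrier

variable {D : Subject S p q} (F : D.Carrier E M) (P : Measure S)

/-- Coordinates of the centered covariates, with time clamped to `[0, 1]`. -/
noncomputable def Xc (a : Fin p) (s : ℝ) (x : E) : ℝ := F.X (clamp s) x a - D.meanX P (clamp s) a

/-- The centered response, with time clamped to `[0, 1]`. -/
noncomputable def Yc (s : ℝ) (x : E) : ℝ := F.Y (clamp s) x - D.meanY P (clamp s)

theorem Xc_path (a : Fin p) (s : ℝ) (ω : S) : F.Xc P a s (F.path ω) = D.Xc P (clamp s) ω a := by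
  rw [Xc, F.X_path]; rfl

theorem Yc_path (s : ℝ) (ω : S) : F.Yc P s (F.path ω) = D.Yc P (clamp s) ω := by
  rw [Yc, F.Y_path]; rfl

/-- Residuals of the centered regression. -/
noncomputable def resid (β : ℝ → EuclideanSpace ℝ (Fin p)) (s : ℝ) (x : E) : ℝ :=
  F.Yc P s x - ∑ b, F.Xc P b s x * β (clamp s) b

variable {P} [IsProbabilityMeasure P] {β : ℝ → EuclideanSpace ℝ (Fin p)}
  {γ : ℝ → EuclideanSpace ℝ (Fin q)} {lam : ℝ → ℝ}

theorem resid_path (P : Measure S) [IsProbabilityMeasure P] (β : ℝ → EuclideanSpace ℝ (Fin p)) (s : ℝ) (ω : S) :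
    F.resid P β s (F.path ω) = D.err P β (clamp s) ω := by
  rw [resid, Yc_path, err_eq]
  simp_rw [Xc_path]

theorem measurable_clamp_fst : Measurable fun z : ℝ × E => (clamp z.1, z.2) :=
  (continuous_clamp.measurable.comp measurable_fst).prodMk measurable_snd

theorem measurable_Xc (hsm : D.SmoothnessCond P β lam) (a : Fin p) :
    Measurable fun z : ℝ × E => F.Xc P a z.1 z.2 := by
  have h1 : Measurable fun z : ℝ × E => F.X (clamp z.1) z.2 :=
    F.measurable_X.comp measurable_clamp_fst
  have h2 : Measurable fun z : ℝ × E => D.meanX P (clamp z.1) :=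
    hsm.contDiff_meanX.continuousOn.comp_clamp.measurable.comp measurable_fst
  have h3 : Measurable fun v : EuclideanSpace ℝ (Fin p) => v a := by fun_prop
  exact (h3.comp h1).sub (h3.comp h2)

theorem measurable_Yc (hsm : D.SmoothnessCond P β lam) :
    Measurable fun z : ℝ × E => F.Yc P z.1 z.2 := by
  have h1 : Measurable fun z : ℝ × E => F.Y (clamp z.1) z.2 :=
    F.measurable_Y.comp measurable_clamp_fst
  exact h1.sub (hsm.contDiff_meanY.continuousOn.comp_clamp.measurable.comp measurable_fst)

theorem contDiffOn_apply {f : ℝ → EuclideanSpace ℝ (Fin p)} (hf : ContDiffOn ℝ 2 f (Icc 0 1))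
    (a : Fin p) : ContDiffOn ℝ 2 (fun s => f s a) (Icc 0 1) :=
  (EuclideanSpace.proj (𝕜 := ℝ) a).contDiff.comp_contDiffOn hf

theorem measurable_β (hsm : D.SmoothnessCond P β lam) (a : Fin p) :
    Measurable fun s => β (clamp s) a :=
  (contDiffOn_apply hsm.contDiff_β a).continuousOn.comp_clamp.measurable

theorem measurable_resid (hsm : D.SmoothnessCond P β lam) :
    Measurable fun z : ℝ × E => F.resid P β z.1 z.2 :=
  (F.measurable_Yc hsm).sub (Finset.measurable_fun_sum _ fun b _ =>
    (F.measurable_Xc hsm b).mul ((measurable_β hsm b).comp measurable_fst))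

theorem integral_path {f : ℝ → E → ℝ} (hf : Measurable fun z : ℝ × E => f z.1 z.2) (s : ℝ) :
    ∫ x, f s x ∂(P.map F.path) = ∫ ω, f s (F.path ω) ∂P :=
  integral_map F.measurable_path.aemeasurable
    (hf.comp measurable_prodMk_left : Measurable (f s)).aestronglyMeasurable

theorem score_moment (hreg : D.Regular P) (hsm : D.SmoothnessCond P β lam) :
    ∃ δ : ℝ, 0 < δ ∧ δ ≤ 1 ∧ ∀ u : Fin p → ℝ, ∃ C : ℝ, ∀ s,
      Integrable (fun x => |∑ a, u a * (F.Xc P a s x * F.resid P β s x)| ^ (2 + δ)) (P.map F.path)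
      ∧ ∫ x, |∑ a, u a * (F.Xc P a s x * F.resid P β s x)| ^ (2 + δ) ∂(P.map F.path) ≤ C := by
  obtain ⟨δ, hδ, hδ1, C, hC0, hC⟩ := exists_score_moment hreg hsm
  refine ⟨δ, hδ, hδ1, fun u => ⟨(∑ a, |u a|) ^ (2 + δ) * C, fun s => ?_⟩⟩
  have hm0 : Measurable fun z : ℝ × E =>
      ∑ a, u a * (F.Xc P a z.1 z.2 * F.resid P β z.1 z.2) :=
    Finset.measurable_fun_sum _ fun a _ =>
      ((F.measurable_Xc hsm a).mul (F.measurable_resid hsm)).const_mul (u a)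
  have hm : Measurable fun z : ℝ × E =>
      |∑ a, u a * (F.Xc P a z.1 z.2 * F.resid P β z.1 z.2)| ^ (2 + δ) :=
    hm0.abs.pow_const _
  have hms : Measurable fun x => |∑ a, u a * (F.Xc P a s x * F.resid P β s x)| ^ (2 + δ) := by
    have h3 : Measurable fun x : E => (s, x) := measurable_prodMk_left
    have h4 : ∀ a, Measurable (F.Xc P a s) := fun a => (F.measurable_Xc hsm a).comp h3
    have h5 : Measurable (F.resid P β s) := (F.measurable_resid hsm).comp h3
    have h6 : Measurable fun x => ∑ a, u a * (F.Xc P a s x * F.resid P β s x) :=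
      Finset.measurable_fun_sum _ fun a _ => ((h4 a).mul h5).const_mul (u a)
    exact h6.abs.pow_const _
  obtain ⟨h1, h2⟩ := hC (2 + δ) (by positivity) le_rfl _ (clamp_mem s)
  have hu : 0 ≤ ∑ a, |u a| := Finset.sum_nonneg fun _ _ => abs_nonneg _
  have hle : ∀ ω, |∑ a, u a * (F.Xc P a s (F.path ω) * F.resid P β s (F.path ω))| ^ (2 + δ)
      ≤ (∑ a, |u a|) ^ (2 + δ) * ‖D.scoreVec P β (clamp s) ω‖ ^ (2 + δ) := fun ω => by
    simp_rw [Xc_path, resid_path]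
    rw [← Real.mul_rpow hu (norm_nonneg _)]
    exact Real.rpow_le_rpow (abs_nonneg _) (abs_sum_Xc_mul_err_le u _ ω) (by positivity)
  have hmc : Measurable fun ω =>
      |∑ a, u a * (F.Xc P a s (F.path ω) * F.resid P β s (F.path ω))| ^ (2 + δ) :=
    hms.comp F.measurable_path
  have hi : Integrable (fun ω =>
      |∑ a, u a * (F.Xc P a s (F.path ω) * F.resid P β s (F.path ω))| ^ (2 + δ)) P :=
    (h1.const_mul ((∑ a, |u a|) ^ (2 + δ))).mono' hmc.aestronglyMeasurable (ae_of_all _ fun ω => by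
      rw [Real.norm_of_nonneg (Real.rpow_nonneg (abs_nonneg _) _)]; exact hle ω)
  refine ⟨(integrable_map_measure hms.aestronglyMeasurable F.measurable_path.aemeasurable).2 hi, ?_⟩
  rw [F.integral_path
    (f := fun s x => |∑ a, u a * (F.Xc P a s x * F.resid P β s x)| ^ (2 + δ)) hm s]
  refine (integral_mono hi (h1.const_mul _) hle).trans ?_
  rw [integral_const_mul]
  exact mul_le_mul_of_nonneg_left h2 (by positivity)

/-- The local model attached to a subject has the limits of the centering estimator. -/
theorem exists_localModel (hreg : D.Regular P) (hmodel : D.VaryingCoefficient P β γ)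
    (horth : D.Orthogonal P) (hobs : D.ObservationCond P lam) (hsm : D.SmoothnessCond P β lam)
    (hl : ∀ s ∈ Icc (0 : ℝ) 1, 0 < lam s) {K : ℝ → ℝ} (hK : IsKernel K) {t : ℝ}
    (ht : t ∈ Ioo (0 : ℝ) 1) :
    ∃ Q : LocalModel E M p, Q.P = P.map F.path ∧ Q.ν = P.map F.mark ∧ Q.N = F.N
      ∧ Q.lam = extIntensity lam ∧ Q.K = K ∧ Q.t = t ∧ Q.X = F.Xc P ∧ Q.Y = F.Yc P
      ∧ (Q.mX = fun a s => D.meanX P (clamp s) a) ∧ (Q.mY = fun s => D.meanY P (clamp s))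
      ∧ Q.β = fun a s => β (clamp s) a := by
  have ht' : t ∈ Icc (0 : ℝ) 1 := Ioo_subset_Icc_self ht
  obtain ⟨C, hC⟩ := exists_second_moments hreg hsm
  obtain ⟨Λ, c, R, κ, h₀, hh₀, hmem, hdes⟩ :=
    exists_isDesign hreg hobs F.measurable_mark F.point F.N_mark hl hK ht
  obtain ⟨δ, hδ, hδ1, hmom⟩ := F.score_moment hreg hsm
  have hmX : ∀ a, ContDiffOn ℝ 2 (fun s => D.meanX P s a) (Icc 0 1) :=
    contDiffOn_apply hsm.contDiff_meanX
  have hβ2 : ∀ a, ContDiffOn ℝ 2 (fun s => β s a) (Icc 0 1) := contDiffOn_apply hsm.contDiff_β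
  choose AX hAX0 hAX using fun a => exists_isSmoothMean (hmX a)
  choose Aβ hAβ0 hAβ using fun a => exists_isSmoothMean (hβ2 a)
  obtain ⟨AY, hAY0, hAY⟩ := exists_isSmoothMean hsm.contDiff_meanY
  choose β' L hL0 hL using fun a => exists_taylor_on_unitInterval (hβ2 a) ht'
  have sX : ∀ a, AX a ≤ ∑ a, AX a := fun a =>
    Finset.single_le_sum (fun a _ => hAX0 a) (Finset.mem_univ a)
  have sβ : ∀ a, Aβ a ≤ ∑ a, Aβ a := fun a =>
    Finset.single_le_sum (fun a _ => hAβ0 a) (Finset.mem_univ a)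
  have sL : ∀ a, L a ≤ ∑ a, L a := fun a =>
    Finset.single_le_sum (fun a _ => hL0 a) (Finset.mem_univ a)
  have pX : 0 ≤ ∑ a, AX a := Finset.sum_nonneg fun a _ => hAX0 a
  have pβ : 0 ≤ ∑ a, Aβ a := Finset.sum_nonneg fun a _ => hAβ0 a
  let B := ∑ a, AX a + ∑ a, Aβ a + AY
  have hXB : ∀ a, IsSmoothMean (fun s => D.meanX P (clamp s) a) B B := fun a =>
    hAX a B B (by have := sX a; simp only [B]; linarith) (by have := sX a; simp only [B]; linarith)
  have hβB : ∀ a, IsSmoothMean (fun s => β (clamp s) a) B B := fun a =>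
    hAβ a B B (by have := sβ a; simp only [B]; linarith) (by have := sβ a; simp only [B]; linarith)
  have hYB : IsSmoothMean (fun s => D.meanY P (clamp s)) B B :=
    hAY B B (by simp only [B]; linarith) (by simp only [B]; linarith)
  have hsc : ∀ s ∈ Icc (0 : ℝ) 1, ∀ a, MemLp (fun ω => D.Xc P s ω a * D.err P β s ω) 2 P :=
    fun s hs a => memLp_Xc_mul_err hreg hsm hs a
  have hsm2 : ∀ a, Measurable fun z : ℝ × E => F.Xc P a z.1 z.2 * F.resid P β z.1 z.2 :=
    fun a => (F.measurable_Xc hsm a).mul (F.measurable_resid hsm)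
  let Q : LocalModel E M p :=
    { P := P.map F.path
      ν := P.map F.mark
      N := F.N
      lam := extIntensity lam
      K := K
      t := t
      X := F.Xc P
      mX := fun a s => D.meanX P (clamp s) a
      Y := F.Yc P
      mY := fun s => D.meanY P (clamp s)
      β := fun a s => β (clamp s) a
      β' := β'
      Λ := Λ, c := c, R := R, κ := κ, h₀ := h₀, C := C, ℓ := B, B := B, L := ∑ a, L a, δ := δ
      prob_P := Measure.isProbabilityMeasure_map F.measurable_path.aemeasurable
      prob_ν := Measure.isProbabilityMeasure_map F.measurable_mark.aemeasurable
      h₀_pos := hh₀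
      design := hdes
      continuousAt_lam := continuousAt_extIntensity hobs.contDiff_lam.continuousOn ht
      X_centered := fun a => IsCentered.map F.measurable_path (F.measurable_Xc hsm a)
        (fun s => by simp_rw [Xc_path]; exact hreg.memLp_Xc_apply (clamp_mem s) a)
        (fun s => by simp_rw [Xc_path]; exact hreg.integral_Xc_apply (clamp_mem s) a)
        (fun s => by simp_rw [Xc_path]; exact (hC _ (clamp_mem s)).1 a)
      Y_centered := IsCentered.map F.measurable_path (F.measurable_Yc hsm)
        (fun s => by simp_rw [Yc_path]; exact hreg.memLp_Yc (clamp_mem s))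
        (fun s => by simp_rw [Yc_path]; exact hreg.integral_Yc (clamp_mem s))
        (fun s => by simp_rw [Yc_path]; exact (hC _ (clamp_mem s)).2.1)
      mX_smooth := hXB
      mY_smooth := hYB
      β_measurable := measurable_β hsm
      β_le := fun a s => (hβB a).abs_le s
      L_nonneg := Finset.sum_nonneg fun a _ => hL0 a
      β_taylor := fun a s hs => by
        rw [clamp_of_mem (hmem s hs), clamp_of_mem ht']
        exact (hL a s (hmem s hs)).trans (mul_le_mul_of_nonneg_right (sL a) (sq_nonneg _))
      X_tendsto := fun a b => by
        have hd : Measurable fun z : ℝ × E =>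
            |F.Xc P a z.1 z.2 * F.Xc P b z.1 z.2 - F.Xc P a t z.2 * F.Xc P b t z.2| := by
          have h1 := F.measurable_Xc hsm a
          have h2 := F.measurable_Xc hsm b
          have h3 : Measurable fun z : ℝ × E => (t, z.2) := measurable_const.prodMk measurable_snd
          exact ((h1.mul h2).sub ((h1.comp h3).mul (h2.comp h3))).abs
        have e1 := F.integral_path (P := P) (f := fun s x =>
          |F.Xc P a s x * F.Xc P b s x - F.Xc P a t x * F.Xc P b t x|) hd
        simp_rw [e1, Xc_path, clamp_of_mem ht']
        exact tendsto_integral_abs_Xc_mul_sub hreg hsm ht' (fun s hs => (hC s hs).1) a b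
      resid_centered := IsCentered.map (W := F.resid P β) F.measurable_path (F.measurable_resid hsm)
        (fun s => by simp_rw [resid_path]; exact hreg.memLp_err (clamp_mem s))
        (fun s => by simp_rw [resid_path]; exact hreg.integral_err (clamp_mem s))
        (fun s => by simp_rw [resid_path]; exact (hC _ (clamp_mem s)).2.2.1)
      score_centered := fun a => IsCentered.map
        (W := fun s x => F.Xc P a s x * F.resid P β s x) F.measurable_path (hsm2 a)
        (fun s => by simp_rw [resid_path, Xc_path]; exact hsc _ (clamp_mem s) a)
        (fun s => by
          simp_rw [resid_path, Xc_path]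
          exact integral_Xc_mul_err hreg hmodel horth (clamp_mem s) a)
        (fun s => by simp_rw [resid_path, Xc_path]; exact (hC _ (clamp_mem s)).2.2.2 a)
      δ_pos := hδ
      δ_le := hδ1
      score_moment := hmom
      score_cov_continuousAt := fun a b => by
        have e1 := F.integral_path (P := P) (f := fun s x => F.Xc P a s x * F.resid P β s x
          * (F.Xc P b s x * F.resid P β s x)) ((hsm2 a).mul (hsm2 b))
        have h1 : Continuous fun s => D.covXSigma P (clamp s) a b :=
          (hsm.continuous_sigma a b).comp_clamp
        have e2 : (fun s => ∫ x, F.Xc P a s x * F.resid P β s x * (F.Xc P b s x * F.resid P β s x)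
            ∂(P.map F.path)) = fun s => D.covXSigma P (clamp s) a b := by
          funext s
          rw [covXSigma_eq hreg hmodel horth (clamp_mem s) (hsc _ (clamp_mem s)) a b]
          refine (e1 s).trans ?_
          simp_rw [Xc_path, resid_path]
        exact (e2 ▸ h1.continuousAt :) }
  exact ⟨Q, rfl, rfl, rfl, rfl, rfl, rfl, rfl, rfl, rfl, rfl, rfl⟩

end Carrier

end Subject

/-! ### Agreement of the two forms of the criterion -/

namespace Subject.Carrier

variable {S E M : Type*} {p q : ℕ} [MeasurableSpace S] [MeasurableSpace E] [MeasurableSpace M]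
  {D : Subject S p q} (F : D.Carrier E M) {P : Measure S} {n : ℕ} {ω : ℕ → S} {K : ℝ → ℝ} {h : ℝ}

theorem sum_integral_mark (f : ℕ → ℝ → ℝ) :
    ∑ i : Fin n, ∫ s, f i s ∂(F.N (F.mark (ω i)))
      = ∑ i ∈ Finset.range n, D.intN (ω i) (f i) := by
  rw [Finset.sum_range fun i => D.intN (ω i) (f i)]
  refine Finset.sum_congr rfl fun i _ => ?_
  rw [F.N_mark, intN_eq_integral]

theorem intN_congr {f g : ℝ → ℝ} {x : S} (hT : ∀ j < D.L x, D.T j x ∈ Icc (0 : ℝ) 1)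
    (hfg : ∀ u ∈ Icc (0 : ℝ) 1, f u = g u) : D.intN x f = D.intN x g :=
  Finset.sum_congr rfl fun j hj => hfg _ (hT j (Finset.mem_range.1 hj))

theorem nwDev_eq (hT : ∀ i < n, ∀ j < D.L (ω i), D.T j (ω i) ∈ Icc (0 : ℝ) 1)
    {W : ℝ → E → ℝ} {g : ℝ → ℝ} {V : ℝ → S → ℝ}
    (hV : ∀ u ∈ Icc (0 : ℝ) 1, ∀ x, W u (F.path x) + g u = V u x) (s : ℝ) :
    nwDev F.N K h W g s (fun i : Fin n => F.path (ω i)) (fun i : Fin n => F.mark (ω i))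
      = (∑ i ∈ Finset.range n, D.intN (ω i) fun u => scaledKernel K h (u - s))⁻¹
        * (∑ i ∈ Finset.range n, D.intN (ω i) fun u => scaledKernel K h (u - s) * V u (ω i))
        - g s := by
  unfold nwDev localMass
  rw [F.sum_integral_mark (fun _ u => scaledKernel K h (u - s)),
    F.sum_integral_mark fun i u => scaledKernel K h (u - s) * (W u (F.path (ω i)) + g u)]
  congr 2
  refine Finset.sum_congr rfl fun i hi => intN_congr (hT i (Finset.mem_range.1 hi)) fun u hu => ?_
  rw [hV u hu]

theorem mhatX_apply (s : ℝ) (a : Fin p) :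
    mhatX D K h n ω s a
      = (∑ i ∈ Finset.range n, D.intN (ω i) fun u => scaledKernel K h (u - s))⁻¹
        * ∑ i ∈ Finset.range n, D.intN (ω i) fun u => scaledKernel K h (u - s) * D.X u (ω i) a := by
  simp [mhatX, intN]

/-- `nwDev` is `m̂ - m`, so the true mean cancels: `(X - m) - (m̂ - m) = X - m̂`. The identity
persists for empty windows, where `m̂` is zero in both forms. -/
theorem Xc_sub_nwDev (hT : ∀ i < n, ∀ j < D.L (ω i), D.T j (ω i) ∈ Icc (0 : ℝ) 1) {s : ℝ}
    (hs : s ∈ Icc (0 : ℝ) 1) (x : S) (a : Fin p) :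
    F.Xc P a s (F.path x) - nwDev F.N K h (F.Xc P a) (fun s => D.meanX P (clamp s) a) s
        (fun i : Fin n => F.path (ω i)) (fun i : Fin n => F.mark (ω i))
      = (D.X s x - mhatX D K h n ω s) a := by
  rw [F.nwDev_eq hT (V := fun u x => D.X u x a) fun u hu x => by
      rw [Xc_path, clamp_of_mem hu]; simp [Subject.Xc],
    Xc_path, clamp_of_mem hs, PiLp.sub_apply, mhatX_apply]
  simp [Subject.Xc]

theorem Yc_sub_nwDev (hT : ∀ i < n, ∀ j < D.L (ω i), D.T j (ω i) ∈ Icc (0 : ℝ) 1) {s : ℝ}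
    (hs : s ∈ Icc (0 : ℝ) 1) (x : S) :
    F.Yc P s (F.path x) - nwDev F.N K h (F.Yc P) (fun s => D.meanY P (clamp s)) s
        (fun i : Fin n => F.path (ω i)) (fun i : Fin n => F.mark (ω i))
      = D.Y s x - mhatY D K h n ω s := by
  rw [F.nwDev_eq hT (V := fun u x => D.Y u x) fun u hu x => by
      rw [Yc_path, clamp_of_mem hu]; simp [Subject.Yc],
    Yc_path, clamp_of_mem hs, mhatY]
  simp [Subject.Yc]

/-- On samples observed in `[0, 1]` the two forms of the criterion agree. -/
theorem crit_eq_centeredCriterion {Q : LocalModel E M p} (hN : Q.N = F.N) (hK : Q.K = K)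
    (hX : Q.X = F.Xc P) (hY : Q.Y = F.Yc P) (hmX : Q.mX = fun a s => D.meanX P (clamp s) a)
    (hmY : Q.mY = fun s => D.meanY P (clamp s))
    (hT : ∀ i < n, ∀ j < D.L (ω i), D.T j (ω i) ∈ Icc (0 : ℝ) 1)
    (b : EuclideanSpace ℝ (Fin p) × EuclideanSpace ℝ (Fin p)) :
    Q.crit h (fun i : Fin n => F.path (ω i)) (fun i : Fin n => F.mark (ω i)) b.1 b.2
      = centeredCriterion D K h n ω Q.t b := by
  unfold LocalModel.crit centeredCriterion LocalModel.obsX LocalModel.obsY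
  rw [sampleAvg_apply]
  simp only [hN, hK, hX, hY, hmX, hmY]
  congr 1
  rw [F.sum_integral_mark fun i s => scaledKernel K h (s - Q.t) *
    (F.Yc P s (F.path (ω i)) - nwDev F.N K h (F.Yc P) (fun s => D.meanY P (clamp s)) s
        (fun i : Fin n => F.path (ω i)) (fun i : Fin n => F.mark (ω i))
      - ∑ a, (F.Xc P a s (F.path (ω i))
        - nwDev F.N K h (F.Xc P a) (fun s => D.meanX P (clamp s) a) s
        (fun i : Fin n => F.path (ω i)) (fun i : Fin n => F.mark (ω i))) * b.1 a
      - (∑ a, (F.Xc P a s (F.path (ω i))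
        - nwDev F.N K h (F.Xc P a) (fun s => D.meanX P (clamp s) a) s
        (fun i : Fin n => F.path (ω i)) (fun i : Fin n => F.mark (ω i))) * b.2 a)
        * (s - Q.t)) ^ 2]
  refine Finset.sum_congr rfl fun i hi => intN_congr (hT i (Finset.mem_range.1 hi)) fun s hs => ?_
  simp_rw [F.Yc_sub_nwDev hT hs, F.Xc_sub_nwDev hT hs, inner_eq_sum]

theorem isEstimate_of_isCenteringEstimate {Q : LocalModel E M p} (hN : Q.N = F.N) (hK : Q.K = K)
    (hX : Q.X = F.Xc P) (hY : Q.Y = F.Yc P) (hmX : Q.mX = fun a s => D.meanX P (clamp s) a)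
    (hmY : Q.mY = fun s => D.meanY P (clamp s))
    (hT : ∀ i < n, ∀ j < D.L (ω i), D.T j (ω i) ∈ Icc (0 : ℝ) 1) {b : EuclideanSpace ℝ (Fin p)}
    (hb : IsCenteringEstimate D K h n ω Q.t b) :
    Q.IsEstimate h (fun i : Fin n => F.path (ω i)) (fun i : Fin n => F.mark (ω i)) b := by
  intro b₀ b₁ hmin
  have h1 := hb (WithLp.toLp 2 b₀, WithLp.toLp 2 b₁) fun b' hne => ?_
  · rw [h1]
  · rw [← F.crit_eq_centeredCriterion hN hK hX hY hmX hmY hT,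
      ← F.crit_eq_centeredCriterion hN hK hX hY hmX hmY hT]
    refine hmin _ _ ?_
    by_contra! hc
    refine hne (Prod.ext ?_ ?_)
    · exact WithLp.ofLp_injective 2 hc.1
    · exact WithLp.ofLp_injective 2 hc.2

end Subject.Carrier

/-! ### Bandwidth conditions -/

section Bandwidth

/-- The first term vanishes when `nh → ∞`; the second is the scaled smoothing bias `√(nh) h²`. -/
theorem sqrt_mul_rate_eq {n : ℕ} {h : ℝ} (hn : 0 < n) (hh : 0 < h) :
    √(n * h) * rate n h = (√(n * h))⁻¹ + √(n * h ^ 5) := by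
  have h1 : (0 : ℝ) < n * h := by positivity
  have h2 : √((n : ℝ) * h ^ 5) = √(n * h) * h ^ 2 := by
    rw [show (n : ℝ) * h ^ 5 = n * h * (h ^ 2) ^ 2 by ring, Real.sqrt_mul h1.le,
      Real.sqrt_sq (sq_nonneg h)]
  have h3 : √(n * h) * (1 / (n * h)) = (√(n * h))⁻¹ := by
    rw [one_div, mul_inv_eq_iff_eq_mul₀ h1.ne', eq_inv_mul_iff_mul_eq₀ (by positivity),
      Real.mul_self_sqrt h1.le]
  rw [h2, rate, mul_add, h3]

/-- `h⁴` is the quotient of `n h⁵ → 0` by `n h → ∞`. -/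
theorem tendsto_bandwidth_zero {h : ℕ → ℝ} (h0 : ∀ᶠ n in atTop, 0 < h n)
    (hnh : Tendsto (fun n : ℕ => n * h n) atTop atTop)
    (hnh5 : Tendsto (fun n : ℕ => n * h n ^ 5) atTop (𝓝 0)) : Tendsto h atTop (𝓝 0) := by
  have h1 := hnh5.div_atTop hnh
  have h2 := (Real.continuous_sqrt.tendsto _).comp ((Real.continuous_sqrt.tendsto _).comp h1)
  simp only [Real.sqrt_zero] at h2
  refine h2.congr' ?_
  filter_upwards [h0, eventually_gt_atTop 0] with n hn hn0
  have e1 : (n : ℝ) * h n ^ 5 / (n * h n) = (h n ^ 2) ^ 2 := by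
    field_simp
  simp only [Function.comp_apply, e1]
  rw [Real.sqrt_sq (sq_nonneg _), Real.sqrt_sq hn.le]

theorem tendsto_inv_sqrt {h : ℕ → ℝ} (hnh : Tendsto (fun n : ℕ => n * h n) atTop atTop) :
    Tendsto (fun n : ℕ => (√(n * h n))⁻¹) atTop (𝓝 0) :=
  tendsto_inv_atTop_zero.comp (Real.tendsto_sqrt_atTop.comp hnh)

theorem tendsto_sqrt_mul_rate {h : ℕ → ℝ} (h0 : ∀ᶠ n in atTop, 0 < h n)
    (hnh : Tendsto (fun n : ℕ => n * h n) atTop atTop)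
    (hnh5 : Tendsto (fun n : ℕ => n * h n ^ 5) atTop (𝓝 0)) :
    Tendsto (fun n : ℕ => √(n * h n) * rate n (h n)) atTop (𝓝 0) := by
  have h1 := (tendsto_inv_sqrt hnh).add ((Real.continuous_sqrt.tendsto _).comp hnh5)
  simp only [Real.sqrt_zero, add_zero] at h1
  refine h1.congr' ?_
  filter_upwards [h0, eventually_gt_atTop 0] with n hn hn0
  exact (sqrt_mul_rate_eq hn0 hn).symm

/-- Properties of bandwidths of the order `n ^ (-1 / 5)`. -/
theorem optimal_bandwidth {c : ℝ} (hc : 0 < c) :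
    (∀ᶠ n : ℕ in atTop, 0 < c * (n : ℝ) ^ (-(1 / 5) : ℝ))
      ∧ Tendsto (fun n : ℕ => c * (n : ℝ) ^ (-(1 / 5) : ℝ)) atTop (𝓝 0)
      ∧ Tendsto (fun n : ℕ => n * (c * (n : ℝ) ^ (-(1 / 5) : ℝ))) atTop atTop
      ∧ (∀ᶠ n : ℕ in atTop, √(n * (c * (n : ℝ) ^ (-(1 / 5) : ℝ))) = √c * (n : ℝ) ^ (2 / 5 : ℝ))
      ∧ ∀ᶠ n : ℕ in atTop, √(n * (c * (n : ℝ) ^ (-(1 / 5) : ℝ)))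
        * rate n (c * (n : ℝ) ^ (-(1 / 5) : ℝ)) ≤ 1 + √(c ^ 5) := by
  have e1 : ∀ n : ℕ, 0 < n → (n : ℝ) * (c * (n : ℝ) ^ (-(1 / 5) : ℝ)) = c * (n : ℝ) ^ (4 / 5 : ℝ) := by
    intro n hn
    have hn' : (0 : ℝ) < n := by exact_mod_cast hn
    have : (n : ℝ) ^ (4 / 5 : ℝ) = n * (n : ℝ) ^ (-(1 / 5) : ℝ) := by
      rw [show (4 / 5 : ℝ) = 1 + -(1 / 5) by norm_num, Real.rpow_add hn', Real.rpow_one]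
    rw [this]; ring
  have p0 : ∀ᶠ n : ℕ in atTop, 0 < c * (n : ℝ) ^ (-(1 / 5) : ℝ) := by
    filter_upwards [eventually_gt_atTop 0] with n hn
    have hn' : (0 : ℝ) < n := by exact_mod_cast hn
    positivity
  have p1 : Tendsto (fun n : ℕ => n * (c * (n : ℝ) ^ (-(1 / 5) : ℝ))) atTop atTop := by
    have h1 : Tendsto (fun n : ℕ => c * (n : ℝ) ^ (4 / 5 : ℝ)) atTop atTop :=
      ((tendsto_rpow_atTop (by norm_num)).comp tendsto_natCast_atTop_atTop).const_mul_atTop hc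
    refine h1.congr' ?_
    filter_upwards [eventually_gt_atTop 0] with n hn
    exact (e1 n hn).symm
  refine ⟨p0, ?_, p1, ?_, ?_⟩
  · have h1 := ((tendsto_rpow_neg_atTop (by norm_num : (0 : ℝ) < 1 / 5)).comp
      tendsto_natCast_atTop_atTop).const_mul c
    simpa using h1
  · filter_upwards [eventually_gt_atTop 0] with n hn
    have hn' : (0 : ℝ) ≤ n := by positivity
    rw [e1 n hn, Real.sqrt_mul hc.le, Real.sqrt_eq_rpow, Real.sqrt_eq_rpow, ← Real.rpow_mul hn']
    norm_num
  · filter_upwards [p0, eventually_gt_atTop 0,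
      (tendsto_inv_sqrt p1).eventually_le_const one_pos] with n hn hn0 h1
    have hn' : (0 : ℝ) < n := by exact_mod_cast hn0
    rw [sqrt_mul_rate_eq hn0 hn]
    -- For this bandwidth `n h⁵` equals `c⁵` exactly.
    refine add_le_add h1 (le_of_eq ?_)
    congr 1
    rw [mul_pow, ← Real.rpow_natCast ((n : ℝ) ^ (-(1 / 5) : ℝ)), ← Real.rpow_mul hn'.le]
    norm_num
    rw [Real.rpow_neg_one]
    field_simp

end Bandwidth

/-! ### Limits of the centering estimator for a factorized subject -/

namespace Subject.Carrier

variable {S E M Ω : Type*} {p q : ℕ} [MeasurableSpace S] [MeasurableSpace E] [MeasurableSpace M]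
  [MeasurableSpace Ω] {D : Subject S p q} (F : D.Carrier E M) {P : Measure S}
  [IsProbabilityMeasure P] {μ : Measure Ω} [IsProbabilityMeasure μ]
  {β₀ : ℝ → EuclideanSpace ℝ (Fin p)} {γ₀ : ℝ → EuclideanSpace ℝ (Fin q)} {lam K : ℝ → ℝ}
  {ξ : ℕ → Ω → S} {t : ℝ}

theorem measurePreserving_path_mark (hind : IndepFun F.path F.mark P) :
    MeasurePreserving (fun x => (F.path x, F.mark x)) P ((P.map F.path).prod (P.map F.mark)) :=
  ⟨F.measurable_path.prodMk F.measurable_mark,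
    (indepFun_iff_map_prod_eq_prod_map_map F.measurable_path.aemeasurable
      F.measurable_mark.aemeasurable).1 hind⟩

/-- A local model that describes the centering estimator. -/
theorem exists_localModel_estimate (hξ : ∀ i, MeasurePreserving (ξ i) μ P)
    (hind : IndepFun F.path F.mark P) (hreg : D.Regular P)
    (hmodel : D.VaryingCoefficient P β₀ γ₀) (horth : D.Orthogonal P)
    (hobs : D.ObservationCond P lam) (hsm : D.SmoothnessCond P β₀ lam)
    (hl : ∀ s ∈ Icc (0 : ℝ) 1, 0 < lam s) (hK : IsKernel K) (ht : t ∈ Ioo (0 : ℝ) 1) :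
    ∃ Q : LocalModel E M p,
      (∀ i, MeasurePreserving (fun ω => (F.path (ξ i ω), F.mark (ξ i ω))) μ (Q.P.prod Q.ν))
      ∧ Q.limA = asympA D P lam t ∧ Q.limSigma = asympSigma D P lam K t
      ∧ (∀ a, β₀ t a = Q.β a Q.t)
      ∧ ∀ (h : ℕ → ℝ) (b : ℕ → Ω → EuclideanSpace ℝ (Fin p)),
        (∀ n, ∀ᵐ ω ∂μ, IsCenteringEstimate D K (h n) n (fun i => ξ i ω) t (b n ω)) →
        ∀ n, ∀ᵐ ω ∂μ, Q.IsEstimate (h n)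
          (LocalModel.paths (fun i ω => (F.path (ξ i ω), F.mark (ξ i ω))) n ω)
          (LocalModel.marks (fun i ω => (F.path (ξ i ω), F.mark (ξ i ω))) n ω) (b n ω) := by
  obtain ⟨Q, hP, hν, hN, hlam, hQK, rfl, hX, hY, hmX, hmY, hβ⟩ :=
    F.exists_localModel hreg hmodel horth hobs hsm hl hK ht
  have ht' : Q.t ∈ Icc (0 : ℝ) 1 := Ioo_subset_Icc_self ht
  refine ⟨Q, fun i => ?_, ?_, ?_, fun a => ?_, fun h b hb n => ?_⟩
  · rw [hP, hν]
    exact (F.measurePreserving_path_mark hind).comp (hξ i)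
  · ext a b
    have h1 := F.integral_path (P := P) (f := fun s x => F.Xc P a s x * F.Xc P b s x)
      ((F.measurable_Xc hsm a).mul (F.measurable_Xc hsm b)) Q.t
    simp only [LocalModel.limA, asympA, Matrix.of_apply, Matrix.smul_apply, smul_eq_mul, covX,
      hlam, hX, hP, extIntensity_of_mem ht', h1, Xc_path, clamp_of_mem ht']
  · ext a b
    have hm : ∀ a, Measurable fun z : ℝ × E => F.Xc P a z.1 z.2 * F.resid P β₀ z.1 z.2 :=
      fun a => (F.measurable_Xc hsm a).mul (F.measurable_resid hsm)
    have h1 := F.integral_path (P := P) (f := fun s x => F.Xc P a s x * F.resid P β₀ s x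
      * (F.Xc P b s x * F.resid P β₀ s x)) ((hm a).mul (hm b)) Q.t
    have h2 : Q.resid Q.t = F.resid P β₀ Q.t := by
      funext x
      simp only [LocalModel.resid, resid, hX, hY, hβ]
    simp only [LocalModel.limSigma, asympSigma, Matrix.of_apply, Matrix.smul_apply, smul_eq_mul,
      hlam, hX, hP, hQK, extIntensity_of_mem ht', h2, h1, Xc_path, resid_path, clamp_of_mem ht']
    rw [covXSigma_eq hreg hmodel horth ht' (fun a => memLp_Xc_mul_err hreg hsm ht' a)]
  · simp only [hβ, clamp_of_mem ht']
  · have hT : ∀ᵐ ω ∂μ, ∀ i, ∀ j < D.L (ξ i ω), D.T j (ξ i ω) ∈ Icc (0 : ℝ) 1 :=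
      ae_all_iff.2 fun i => (hξ i).quasiMeasurePreserving.ae
        (ae_T_mem hobs F.measurable_mark F.N_mark)
    filter_upwards [hb n, hT] with ω h1 h2
    exact F.isEstimate_of_isCenteringEstimate (ω := fun i => ξ i ω) hN hQK hX hY hmX hmY
      (fun i _ => h2 i) h1

/-- Asymptotic normality and rate of the centering estimator. -/
theorem centeringEstimate_limits (hξ_indep : iIndepFun ξ μ)
    (hξ : ∀ i, MeasurePreserving (ξ i) μ P)
    (hind : IndepFun F.path F.mark P) (hreg : D.Regular P)
    (hmodel : D.VaryingCoefficient P β₀ γ₀) (horth : D.Orthogonal P)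
    (hobs : D.ObservationCond P lam) (hsm : D.SmoothnessCond P β₀ lam)
    (hl : ∀ s ∈ Icc (0 : ℝ) 1, 0 < lam s) (hK : IsKernel K) (ht : t ∈ Ioo (0 : ℝ) 1) :
    (∀ h : ℕ → ℝ, (∀ᶠ n in atTop, 0 < h n) →
      Tendsto (fun n : ℕ => n * h n) atTop atTop →
      Tendsto (fun n : ℕ => n * h n ^ 5) atTop (𝓝 0) →
      ∀ βhat : ℕ → Ω → EuclideanSpace ℝ (Fin p), (∀ n, AEMeasurable (βhat n) μ) →
      (∀ n, ∀ᵐ ω ∂μ, IsCenteringEstimate D K (h n) n (fun i => ξ i ω) t (βhat n ω)) →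
      TendstoInDistribution (fun n ω => √(n * h n) • (βhat n ω - β₀ t)) atTop id (fun _ => μ)
        (multivariateGaussian 0
          ((asympA D P lam t)⁻¹ * asympSigma D P lam K t * (asympA D P lam t)⁻¹))) ∧
    (∀ c : ℝ, 0 < c →
      ∀ βhat : ℕ → Ω → EuclideanSpace ℝ (Fin p),
      (∀ n : ℕ, ∀ᵐ ω ∂μ,
        IsCenteringEstimate D K (c * (n : ℝ) ^ (-(1 / 5) : ℝ)) n (fun i => ξ i ω) t
          (βhat n ω)) →
      BoundedInProb μ fun n ω => (n : ℝ) ^ (2 / 5 : ℝ) * ‖βhat n ω - β₀ t‖) := by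
  obtain ⟨Q, hyP, hA, hSig, hβ, hest⟩ :=
    F.exists_localModel_estimate hξ hind hreg hmodel horth hobs hsm hl hK ht
  have hy : iIndepFun (fun i ω => (F.path (ξ i ω), F.mark (ξ i ω))) μ :=
    hξ_indep.comp (fun _ x => (F.path x, F.mark x)) fun _ =>
      F.measurable_path.prodMk F.measurable_mark
  have hpd : Q.limA.PosDef := by
    rw [hA]
    exact hsm.posDef t (Ioo_subset_Icc_self ht)
  refine ⟨fun h h0 hnh hnh5 βhat hm hb => ?_, fun c hc βhat hb => ?_⟩
  · have h1 := LocalModel.tendstoInDistribution_estimate hy hyP hpd h0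
      (tendsto_bandwidth_zero h0 hnh hnh5) hnh (tendsto_sqrt_mul_rate h0 hnh hnh5) hm
      (hest h βhat hb) hβ
    rwa [hA, hSig] at h1
  · obtain ⟨h0, hh, hnh, hsq, hrate⟩ := optimal_bandwidth hc
    have h1 := LocalModel.boundedInProb_norm_estimate hy hyP hpd h0 hh hnh hrate
      (hest _ βhat hb) hβ
    have hc' : 0 < √c := Real.sqrt_pos.2 hc
    refine (h1.const_mul (inv_nonneg.2 hc'.le)).mono ?_
    filter_upwards [hsq] with n hn
    refine ae_of_all _ fun ω => le_of_eq ?_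
    rw [hn]
    field_simp

end Subject.Carrier

/-! ### Construction of the factorization and conclusion -/

namespace Subject

universe u

variable {S : Type u} {p q : ℕ} [mS : MeasurableSpace S] {D : Subject S p q} {P : Measure S}

theorem Regular.measurable_N (hreg : D.Regular P) : Measurable D.N := by
  refine Measure.measurable_of_measurable_coe _ fun B hB => ?_
  have h1 : (fun ω => D.N ω B)
      = fun ω => ∑' j, {ω | j < D.L ω}.indicator (fun ω => B.indicator 1 (D.T j ω)) ω := by
    funext ω
    rw [N, Measure.finsetSum_apply, tsum_eq_sum (s := Finset.range (D.L ω))]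
    · refine Finset.sum_congr rfl fun j hj => ?_
      have hj' : ω ∈ {ω | j < D.L ω} := Finset.mem_range.1 hj
      rw [Measure.dirac_apply' _ hB, indicator_of_mem hj']
    · intro j hj
      have hj' : ω ∉ {ω | j < D.L ω} := fun h => hj (Finset.mem_range.2 h)
      exact indicator_of_notMem hj' _
  rw [h1]
  exact Measurable.tsum fun j =>
    ((measurable_one.indicator hB).comp (hreg.measurable_T j)).indicator
      (measurableSet_lt measurable_const hreg.measurable_L)

/-- Both spaces are `S` itself, once with `𝒢` and once with the σ-algebra generated by the
observation process, and both maps are the identity. Independence of the σ-algebras thus becomes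
independence of two maps. -/
theorem IndepPaths.exists_carrier (h : D.IndepPaths P) (hreg : D.Regular P) :
    ∃ (E M : Type u) (_ : MeasurableSpace E) (_ : MeasurableSpace M) (F : D.Carrier E M),
      IndepFun F.path F.mark P := by
  have hN := hreg.measurable_N
  have hpt := D.isPointMeasure_N
  obtain ⟨𝒢, hX, hY, hle, hind⟩ := h
  refine ⟨S, S, 𝒢, MeasurableSpace.comap D.N inferInstance,
    @Carrier.mk S p q mS D S S 𝒢 (MeasurableSpace.comap D.N inferInstance) id id D.X D.Y
      (@Kernel.mk S ℝ (MeasurableSpace.comap D.N inferInstance) _ D.N (comap_measurable D.N))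
      (measurable_id'' hle) (measurable_id'' hN.comap_le) hX hY (fun _ _ => rfl) (fun _ _ => rfl)
      hpt fun _ => rfl, ?_⟩
  rw [@IndepFun_iff_Indep]
  simpa only [MeasurableSpace.comap_id] using hind

end Subject

/-- Settles convergence in distribution for `p = 0`, where all laws live on a one-point space. -/
theorem MeasureTheory.ProbabilityMeasure.eq_of_subsingleton {X : Type*} [MeasurableSpace X]
    [Subsingleton X] (ρ ρ' : ProbabilityMeasure X) : ρ = ρ' := by
  refine Subtype.ext (Measure.ext fun s _ => ?_)
  rcases Subsingleton.set_cases (p := fun s => s = ∅ ∨ s = univ) (Or.inl rfl) (Or.inr rfl) s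
    with rfl | rfl
  · simp
  · exact (measure_univ (μ := (ρ : Measure X))).trans (measure_univ (μ := (ρ' : Measure X))).symm

theorem theorem2 {S Ω : Type*} [MeasurableSpace S] [MeasurableSpace Ω] {p q : ℕ}
    (P : Measure S) [IsProbabilityMeasure P] (μ : Measure Ω) [IsProbabilityMeasure μ]
    (D : Subject S p q)
    (β₀ : ℝ → EuclideanSpace ℝ (Fin p)) (γ₀ : ℝ → EuclideanSpace ℝ (Fin q))
    (lam : ℝ → ℝ) (K : ℝ → ℝ)
    -- the subjects are independent copies of the generic subject
    (ξ : ℕ → Ω → S) (hξ_indep : iIndepFun ξ μ) (hξ_law : ∀ i, MeasurePreserving (ξ i) μ P)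
    (hreg : D.Regular P)
    (hmodel : D.VaryingCoefficient P β₀ γ₀)
    (horth : D.Orthogonal P)
    (hobs : D.ObservationCond P lam)
    (hsmooth : D.SmoothnessCond P β₀ lam)
    (hK : IsKernel K)
    (t : ℝ) (ht : t ∈ Ioo (0 : ℝ) 1) :
    -- asymptotic normality
    (∀ h : ℕ → ℝ, (∀ᶠ n in atTop, 0 < h n) →
      Tendsto (fun n : ℕ => n * h n) atTop atTop →
      Tendsto (fun n : ℕ => n * h n ^ 5) atTop (𝓝 0) →
      ∀ βhat : ℕ → Ω → EuclideanSpace ℝ (Fin p), (∀ n, AEMeasurable (βhat n) μ) →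
      (∀ n, ∀ᵐ ω ∂μ, IsCenteringEstimate D K (h n) n (fun i => ξ i ω) t (βhat n ω)) →
      TendstoInDistribution (fun n ω => √(n * h n) • (βhat n ω - β₀ t)) atTop id (fun _ => μ)
        (multivariateGaussian 0
          ((asympA D P lam t)⁻¹ * asympSigma D P lam K t * (asympA D P lam t)⁻¹))) ∧
    -- the rate `n ^ (2 / 5)`, for bandwidths of the order `n ^ (-1 / 5)`
    (∀ c : ℝ, 0 < c →
      ∀ βhat : ℕ → Ω → EuclideanSpace ℝ (Fin p), (∀ n, AEMeasurable (βhat n) μ) →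
      (∀ n : ℕ, ∀ᵐ ω ∂μ,
        IsCenteringEstimate D K (c * (n : ℝ) ^ (-(1 / 5) : ℝ)) n (fun i => ξ i ω) t
          (βhat n ω)) →
      ∀ ε : ℝ, 0 < ε → ∃ M : ℝ, ∀ᶠ n : ℕ in atTop,
        μ {ω | M < (n : ℝ) ^ (2 / 5 : ℝ) * ‖βhat n ω - β₀ t‖} ≤ ENNReal.ofReal ε) := by
  -- For `p = 0` positive definiteness says nothing about `lam`, so positivity of the intensity is
  -- unavailable; the claims are then trivial.
  rcases Nat.eq_zero_or_pos p with rfl | hp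
  · refine ⟨fun h _ _ _ βhat hm _ => ⟨fun n => ?_, aemeasurable_id, ?_⟩,
      fun c _ βhat _ _ ε _ => ⟨0, Eventually.of_forall fun n => ?_⟩⟩
    · exact (measurable_of_subsingleton_codomain _).aemeasurable
    · exact tendsto_const_nhds.congr fun n => ProbabilityMeasure.eq_of_subsingleton _ _
    · simp [Subsingleton.elim (βhat n _ - β₀ t) 0]
  have hl : ∀ s ∈ Icc (0 : ℝ) 1, 0 < lam s := fun s hs => D.lam_pos hsmooth ⟨0, hp⟩ hs
  obtain ⟨E, M, _, _, F, hind⟩ := hobs.indep.exists_carrier hreg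
  obtain ⟨h1, h2⟩ := F.centeringEstimate_limits hξ_indep hξ_law hind hreg hmodel horth hobs
    hsmooth hl hK ht
  exact ⟨h1, fun c hc βhat _ hb => h2 c hc βhat hb⟩
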